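/- Let $d\ge 1$, let $\Omega\subset\mathbb R^d$ be a bounded open set with Lipschitz boundary $\Gamma=\partial\Omega$, and let $\omega\subset\Omega$ be open and of class $C^2$, with outward unit normal $\bm n$ on $\partial\omega$. Let $\alpha>0$, $\lambda,\beta,\gamma_0\in\mathbb R$, $f\in L^2(\Omega)$, $u_d,u_n\in L^2(\Gamma)$. Let $\bm V$ be a Lipschitz vector field on $\overline\Omega$ with $\bm V=0$ on $\Gamma$ that is of class $C^1$ in a neighbourhood of $\partial\omega$ (that is, $\bm V\in\bm W^{1,\infty}(\Omega)$, $\bm V|_\Gamma=0$, with the regularity that gives $D\bm V$ a meaning on $\partial\omega$). Put $T_t=\mathrm{Id}+t\bm V$, $\Omega_t=T_t(\Omega)$, $\omega_t=T_t(\omega)$. All boundary values are traces, $\mathrm ds$ is the $(d-1)$-dimensional Hausdorff measure, and $a(u,v)=\int_\Omega(\nabla u\cdot\nabla v+uv)\,\mathrm dx$. For measurable $A\subset\Omega$ the state system: find $u,p\in H^1(\Omega)$ such that, for all $v,w\in H^1(\Omega)$, $$a(u,v)+\tfrac1\alpha\int_A pv\,\mathrm dx=\int_\Omega fv\,\mathrm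 dx+\int_\Gamma u_nv\,\mathrm ds,\qquad a(p,w)=\int_\Gamma(u-u_d)w\,\mathrm ds,$$ has exactly one solution. Let $$J(\Omega,\omega)=\tfrac12\|u-u_d\|^2_{L^2(\Gamma)}+\tfrac1{2\alpha}\|p\|^2_{L^2(\omega)}+\lambda\int_{\partial\omega}\mathrm ds+\beta\,(|\omega|-\gamma_0)$$ at the solution $(u,p)$ for $A=\omega$, define $J(\Omega_t,\omega_t)$ in the same way on $\Omega_t$, and let $dJ(\Omega;\bm V)=\lim_{t\to0^+}\frac{J(\Omega_t,\omega_t)-J(\Omega,\omega)}t$. Let $(u,p)$ be the state for $\omega$. Then: 1. The adjoint system: find $v,w\in H^1(\Omega)$ with $$a(v,r)=\int_\Gamma(w-u+u_d)\,r\,\mathrm ds,\qquad a(w,s)=-\tfrac1\alpha\int_\omega(v+p)\,s\,\mathrm dx\qquad\forall r,s\in H^1(\Omega),$$ has exactly one solution, namely $v=-p$, $w=0$. 2. (Surface form.) The limit $dJ(\Omega;\bm V)$ exists and, with the traces of $p$ and $v$ on $\partial\omega$, $$dJ(\Omega;\bm V)=\frac1{2\alpha}\int_{\partial\omega}(p^2+2pv)(\bm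 V\cdot\bm n)\,\mathrm ds+\lambda\int_{\partial\omega}(\operatorname{div}\bm V-D\bm V\bm n\cdot\bm n)\,\mathrm ds+\beta\int_{\partial\omega}\bm V\cdot\bm n\,\mathrm ds.$$ 3. (Distributed form.) If moreover $f\in H^1(\Omega)$, then, with $A'=(\operatorname{div}\bm V)I-D\bm V^{T}-D\bm V$, $$\begin{aligned}dJ(\Omega;\bm V)={}&\frac1{2\alpha}\int_\omega\operatorname{div}\bm V\,p^2\,\mathrm dx+\int_\Omega A'\nabla u\cdot\nabla v\,\mathrm dx+\int_\Omega\operatorname{div}\bm V\,(uv-vf)\,\mathrm dx-\int_\Omega v\,(\nabla f\cdot\bm V)\,\mathrm dx+\frac1\alpha\int_\omega\operatorname{div}\bm V\,pv\,\mathrm dx\\&+\int_\Omega A'\nabla p\cdot\nabla w\,\mathrm dx+\int_\Omega\operatorname{div}\bm V\,pw\,\mathrm dx+\lambda\int_{\partial\omega}(\operatorname{div}\bm V-D\bm V\bm n\cdot\bm n)\,\mathrm ds+\beta\int_\omega\operatorname{div}\bm V\,\mathrm dx.\end{aligned}$$ 4. (Shape derivatives.) Let $(u_t,p_t)$ be the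 states on $(\Omega_t,\omega_t)$. As $t\to0^+$ the quotients $(u_t\circ T_t-u)/t$ and $(p_t\circ T_t-p)/t$ converge weakly in $H^1(\Omega)$ to material derivatives $\dot u,\dot p$; the shape derivatives $u'=\dot u-\nabla u\cdot\bm V$ and $p'=\dot p-\nabla p\cdot\bm V$ lie in $H^1(\Omega)$; and $(u',p')$ is the unique weak solution of the transmission problem $$-\Delta u'+u'+\tfrac1\alpha\chi_\omega p'=0,\quad -\Delta p'+p'=0\ \text{ in }\Omega,\qquad [\![\partial_nu']\!]=-\tfrac1\alpha p\,(\bm V\cdot\bm n)\ \text{ on }\partial\omega,\qquad \partial_nu'=0,\quad\partial_np'=u'\ \text{ on }\Gamma,$$ that is, the only pair in $H^1(\Omega)^2$ with $a(u',v)+\frac1\alpha\int_\omega p'v\,\mathrm dx+\frac1\alpha\int_{\partial\omega}pv\,(\bm V\cdot\bm n)\,\mathrm ds=0$ and $a(p',w)-\int_\Gamma u'w\,\mathrm ds=0$ for all $v,w\in H^1(\Omega)$. Here $[\![\partial_nu']\!]$ is the inner minus the outer derivative of $u'$ in the direction $\bm n$. -/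

import Mathlib

open MeasureTheory Filter Topology Set
open scoped NNReal ENNReal

noncomputable section

namespace ShapeSource

/-- `d`-dimensional Euclidean space. -/
abbrev Eucl (d : ℕ) : Type := EuclideanSpace ℝ (Fin d)

variable {d : ℕ}

/-! ### Domains, surface measure, normal -/

/-- The surface measure `ds` on a set `S`: the `(d-1)`-dimensional Hausdorff measure, normalised so
that it is Lebesgue measure on `(d-1)`-dimensional planes, restricted to `S`. -/
def surf (S : Set (Eucl d)) : Measure (Eucl d) :=
  (Measure.euclideanHausdorffMeasure (d - 1)).restrict S

/-- Bounded open sets that, near each boundary point, are the region below the graph of a Lipschitz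
function `g` over the hyperplane orthogonal to some unit vector `e`. -/
structure IsLipschitzDomain (Ω : Set (Eucl d)) : Prop where
  isOpen : IsOpen Ω
  isBounded : Bornology.IsBounded Ω
  chart : ∀ x ∈ frontier Ω, ∃ (e : Eucl d) (g : Eucl d → ℝ) (L : ℝ≥0),
    ‖e‖ = 1 ∧ LipschitzWith L g ∧
    ∀ᶠ y in 𝓝 x, (y ∈ Ω ↔ inner ℝ y e < g (y - (inner ℝ y e) • e))

/-- `ρ` is a defining function of class `C^k` of `ω` near `x`: close to `x`, `ω = {ρ < 0}`, and
`∇ρ(x) ≠ 0`. -/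
structure IsDefiningFunction (k : ℕ) (ω : Set (Eucl d)) (x : Eucl d) (ρ : Eucl d → ℝ) :
    Prop where
  contDiffAt : ContDiffAt ℝ k ρ x
  gradient_ne_zero : gradient ρ x ≠ 0
  mem_iff : ∀ᶠ y in 𝓝 x, (y ∈ ω ↔ ρ y < 0)

/-- Open sets of class `C²`: near each boundary point there is a `C²` defining function. -/
structure IsC2Domain (ω : Set (Eucl d)) : Prop where
  isOpen : IsOpen ω
  chart : ∀ x ∈ frontier ω, ∃ ρ, IsDefiningFunction 2 ω x ρ

/-- `ν` is the outward unit normal of `ω` at `x`: the normalised gradient of a `C¹` defining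
function. There is at most one such `ν` at a boundary point. -/
def IsOuterNormal (ω : Set (Eucl d)) (x ν : Eucl d) : Prop :=
  ∃ ρ, IsDefiningFunction 1 ω x ρ ∧ ν = ‖gradient ρ x‖⁻¹ • gradient ρ x

open Classical in
/-- The outward unit normal field `n` on the boundary of a `C²` domain. -/
def outerNormal (ω : Set (Eucl d)) (x : Eucl d) : Eucl d :=
  if h : ∃ ν, IsOuterNormal ω x ν then h.choose else 0

/-! ### The space `H¹` and traces -/

/-- `Du` is the weak gradient of `u` in `Ω`. -/
def HasWeakGradient (Ω : Set (Eucl d)) (u : Eucl d → ℝ) (Du : Eucl d → Eucl d) : Prop :=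
  ∀ φ : Eucl d → ℝ, ContDiff ℝ ((⊤ : ℕ∞) : WithTop ℕ∞) φ →
    HasCompactSupport φ → tsupport φ ⊆ Ω →
    ∫ x in Ω, u x • gradient φ x = - ∫ x in Ω, φ x • Du x

/-- A function together with a candidate for its weak gradient. -/
abbrev SobPair (d : ℕ) : Type := (Eucl d → ℝ) × (Eucl d → Eucl d)

/-- `g ∈ L²(∂D)` is the trace on `∂D` of `u = (u.1, ∇u = u.2)`: there are `C¹` functions on the
whole space that converge to `u` in `H¹(D)` and to `g` in `L²(∂D)`. -/
def HasTrace (D : Set (Eucl d)) (u : SobPair d) (g : Eucl d → ℝ) : Prop :=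
  MemLp g 2 (surf (frontier D)) ∧
  ∃ φ : ℕ → Eucl d → ℝ, (∀ n, ContDiff ℝ 1 (φ n)) ∧
    Tendsto (fun n => eLpNorm (fun x => φ n x - u.1 x) 2 (volume.restrict D)) atTop (𝓝 0) ∧
    Tendsto (fun n => eLpNorm (fun x => gradient (φ n) x - u.2 x) 2 (volume.restrict D))
      atTop (𝓝 0) ∧
    Tendsto (fun n => eLpNorm (fun x => φ n x - g x) 2 (surf (frontier D))) atTop (𝓝 0)

open Classical in
/-- The trace of `u` on `∂D` (a representative; the trace is unique up to surface null sets
when `D` is a Lipschitz domain). -/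
def traceOn (D : Set (Eucl d)) (u : SobPair d) : Eucl d → ℝ :=
  if h : ∃ g, HasTrace D u g then h.choose else 0

/-- `u.1 ∈ H¹(Ω)` with weak gradient `u.2`, for a bounded Lipschitz domain `Ω`. The last field
holds for every `H¹` function on such a domain, by the density of `C¹(Ω̄)` in `H¹(Ω)` and the
trace theorem. -/
structure IsH1 (Ω : Set (Eucl d)) (u : SobPair d) : Prop where
  memLp : MemLp u.1 2 (volume.restrict Ω)
  memLp_grad : MemLp u.2 2 (volume.restrict Ω)
  weakGradient : HasWeakGradient Ω u.1 u.2
  exists_trace : ∃ g, HasTrace Ω u g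

/-- The bilinear form `a(u,v) = ∫_Ω (∇u·∇v + uv) dx`, the inner product of `H¹(Ω)`. -/
def aForm (Ω : Set (Eucl d)) (u v : SobPair d) : ℝ :=
  ∫ x in Ω, (inner ℝ (u.2 x) (v.2 x) + u.1 x * v.1 x)

/-! ### State system, adjoint system, cost functional -/

/-- `(u,p) ∈ H¹(Ω)²` is the weak solution of
`-Δu + u = f - α⁻¹ p χ_ω`, `-Δp + p = 0` in `Ω`, `∂ₙu = uₙ`, `∂ₙp = u - u_d` on `∂Ω`. -/
structure IsState (α : ℝ) (f ud un : Eucl d → ℝ) (Ω ω : Set (Eucl d)) (u p : SobPair d) :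
    Prop where
  memU : IsH1 Ω u
  memP : IsH1 Ω p
  eqU : ∀ v, IsH1 Ω v → aForm Ω u v + 1 / α * ∫ x in ω, p.1 x * v.1 x
    = (∫ x in Ω, f x * v.1 x) + ∫ x, un x * traceOn Ω v x ∂(surf (frontier Ω))
  eqP : ∀ w, IsH1 Ω w → aForm Ω p w
    = ∫ x, (traceOn Ω u x - ud x) * traceOn Ω w x ∂(surf (frontier Ω))

/-- `(v,w) ∈ H¹(Ω)²` solves the coupled adjoint system belonging to `(u,p)`:
`a(v,r) = (w - u + u_d, r)_{∂Ω}` and `a(w,s) = -α⁻¹ (v + p, s)_ω` for all `r, s ∈ H¹(Ω)`. -/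
structure IsAdjoint (α : ℝ) (ud : Eucl d → ℝ) (Ω ω : Set (Eucl d)) (u p v w : SobPair d) :
    Prop where
  memV : IsH1 Ω v
  memW : IsH1 Ω w
  eqV : ∀ r, IsH1 Ω r → aForm Ω v r
    = ∫ x, (traceOn Ω w x - traceOn Ω u x + ud x) * traceOn Ω r x ∂(surf (frontier Ω))
  eqW : ∀ s, IsH1 Ω s → aForm Ω w s = - (1 / α) * ∫ x in ω, (v.1 x + p.1 x) * s.1 x

/-- `½‖u - u_d‖²_{∂Ω} + (2α)⁻¹‖p‖²_ω + λ Per(ω) + β(|ω| - γ₀)`, with `Per(ω) = ∫_{∂ω} ds`. -/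
def cost (α lam β γ₀ : ℝ) (ud : Eucl d → ℝ) (Ω ω : Set (Eucl d)) (u p : SobPair d) : ℝ :=
  1 / 2 * (∫ x, (traceOn Ω u x - ud x) ^ 2 ∂(surf (frontier Ω)))
    + 1 / (2 * α) * (∫ x in ω, (p.1 x) ^ 2)
    + lam * (surf (frontier ω)).real univ
    + β * ((volume : Measure (Eucl d)).real ω - γ₀)

open Classical in
/-- The shape functional `J(Ω, ω)`: the cost at the solution `(u,p)` of the state system. -/
def shapeFunctional (α lam β γ₀ : ℝ) (f ud un : Eucl d → ℝ) (Ω ω : Set (Eucl d)) : ℝ :=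
  if h : ∃ s : SobPair d × SobPair d, IsState α f ud un Ω ω s.1 s.2 then
    cost α lam β γ₀ ud Ω ω h.choose.1 h.choose.2
  else 0

/-! ### Shape calculus -/

/-- The perturbation of the identity `T_t = Id + tV`. -/
def flow (V : Eucl d → Eucl d) (t : ℝ) (x : Eucl d) : Eucl d := x + t • V x

/-- `div V`. -/
def divergence (V : Eucl d → Eucl d) (x : Eucl d) : ℝ :=
  LinearMap.trace ℝ (Eucl d) (fderiv ℝ V x : Eucl d →ₗ[ℝ] Eucl d)

/-- `((div V) I - DVᵀ - DV) a · b` at the point `x`. -/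
def aPrime (V : Eucl d → Eucl d) (x a b : Eucl d) : ℝ :=
  divergence V x * inner ℝ a b - inner ℝ a (fderiv ℝ V x b) - inner ℝ (fderiv ℝ V x a) b

/-- `∫_{∂ω} (div V - DV n · n) ds`. -/
def tangentialDivIntegral (ω : Set (Eucl d)) (V : Eucl d → Eucl d) : ℝ :=
  ∫ x, (divergence V x - inner ℝ (fderiv ℝ V x (outerNormal ω x)) (outerNormal ω x))
    ∂(surf (frontier ω))

/-- `L` is the Eulerian derivative of the functional `J` at `(Ω, ω)` in the direction `V`:
`L = lim_{t → 0⁺} (J(Ω_t, ω_t) - J(Ω, ω)) / t` with `Ω_t = T_t(Ω)`, `ω_t = T_t(ω)`. -/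
def HasEulerianDerivative (J : Set (Eucl d) → Set (Eucl d) → ℝ) (Ω ω : Set (Eucl d))
    (V : Eucl d → Eucl d) (L : ℝ) : Prop :=
  Tendsto (fun t : ℝ => (J (flow V t '' Ω) (flow V t '' ω) - J Ω ω) / t) (𝓝[>] 0) (𝓝 L)

/-- `udot ∈ H¹(Ω)` is the weak material derivative of the family `ut t ∈ H¹(Ω_t)` at `u ∈ H¹(Ω)`:
the quotients `(u_t ∘ T_t - u) / t` lie in `H¹(Ω)` for small `t > 0` and converge weakly in `H¹(Ω)`
to `udot` as `t → 0⁺`. -/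
def IsWeakMaterialDerivative (Ω : Set (Eucl d)) (V : Eucl d → Eucl d) (ut : ℝ → SobPair d)
    (u udot : SobPair d) : Prop :=
  IsH1 Ω udot ∧ ∃ z : ℝ → SobPair d,
    (∀ᶠ t in 𝓝[>] (0 : ℝ), IsH1 Ω (z t) ∧
      ∀ᵐ x ∂(volume.restrict Ω), (z t).1 x = ((ut t).1 (flow V t x) - u.1 x) / t) ∧
    ∀ v, IsH1 Ω v → Tendsto (fun t => aForm Ω (z t) v) (𝓝[>] 0) (𝓝 (aForm Ω udot v))

/-- `(u',p') ∈ H¹(Ω)²` is a weak solution of the coupled transmission problem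
`-Δu' + u' + α⁻¹ χ_ω p' = 0`, `-Δp' + p' = 0` in `Ω`, `⟦∂ₙu'⟧ = -α⁻¹ p (V·n)` on `∂ω`,
`∂ₙu' = 0`, `∂ₙp' = u'` on `∂Ω`; the jump is the inner minus the outer normal derivative. -/
structure IsTransmissionSolution (α : ℝ) (Ω ω : Set (Eucl d)) (V : Eucl d → Eucl d)
    (p u' p' : SobPair d) : Prop where
  memU : IsH1 Ω u'
  memP : IsH1 Ω p'
  eqU : ∀ v, IsH1 Ω v → aForm Ω u' v + 1 / α * (∫ x in ω, p'.1 x * v.1 x)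
    + 1 / α * (∫ x, traceOn ω p x * traceOn ω v x * inner ℝ (V x) (outerNormal ω x)
        ∂(surf (frontier ω))) = 0
  eqP : ∀ w, IsH1 Ω w → aForm Ω p' w
    - ∫ x, traceOn Ω u' x * traceOn Ω w x ∂(surf (frontier Ω)) = 0

end ShapeSource

end

open ShapeSource

noncomputable section

namespace ShapeSource

section

/-! ### Hausdorff measure: comparison and the area formula -/

/-! Since the field vanishes on `∂Ω`, its restriction to the closure of `Ω` extends by zero to a
global Lipschitz field `W`, and for small `t` the map `id + tW` is a bi-Lipschitz bijection of `Ω`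
onto itself. Only `ω` moves, so all states live in the one Hilbert space `H¹(Ω)`, whose inner
product is `a`.

In this space the state system reads `u + C p = F`, `p = B u - g`, where `B` represents the trace
form on `∂Ω` and `C = S ω` represents `α⁻¹ (·,·)_ω`. Both operators are symmetric and positive
semidefinite, and for such operators `1 + C B` is invertible with an explicit bound
(`SymPSD.norm_le_of_add_comp`, `SymPSD.surjective_add_comp`). This settles existence and uniqueness
of the state. The adjoint system becomes `v + p = B w`, `w + C (v + p) = 0`, hence `w + C B w = 0`,
so `w = 0` and `v = -p`.

An `H¹` function composed with `id + tW` changes by `O(t)` in `L²`. Therefore `C_t = S (ω_t)` is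
within `O(t)` of `C` in norm, and its weak derivative `C'` is the operator of `α⁻¹ ∫_ω div (u v W)`.
It follows that `(u_t - u)/t` converges weakly in `H¹(Ω)` to the solution of `u' + C B u' + C' p =
0`, which is the shape derivative (`perturbed_system_weak_deriv`). The state equations turn the
quadratic part of the cost into `½ (⟨F, p⟩ - ⟨g, u⟩)` plus a constant (`system_energy_eq`). Being
affine in the state, it is differentiated by weak convergence alone, and pairing the derivative
equation with `p` gives `-½ ⟨C' p, p⟩ = -(2α)⁻¹ ∫_ω div (p² W)` (`system_derivative_eq`).

The surface form is the divergence theorem for this integral, together with `p² + 2pv = -p²`. The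
perimeter term comes from the area formula: the Jacobian of `1 + t DV` on the tangent plane has
derivative `div V - DV n · n`. The distributed form needs an identity for `∫ A'∇u·∇p + div V u p`.
It follows by transporting the equations of `u` and `p` along the flow: the difference of a function
and its transport has zero trace and is an admissible test function, so no second derivatives enter
(`SolvesInside.energyForm_eq`). The same device shows that transport changes `u` and `p` by `O(t)`
in `H¹`. The material quotients are then bounded in `H¹`, and their weak limits in `L²`, namely `u'
+ ∇u·V` and `p' + ∇p·V`, are also their weak limits in `H¹`.

The geometric tools rest on local graph representations of the boundaries: an area formula for
bi-Lipschitz maps with the Euclidean Hausdorff measure, the trace inequality, and the Gauss-Green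
formula on `C²` domains. Every statement about `H¹` functions is obtained by density from compactly
supported `C¹` functions and uniform bounds. -/

theorem euclideanHausdorffMeasure_image_le_of_edist_le {α X Y : Type*}
    [EMetricSpace X] [MeasurableSpace X] [BorelSpace X]
    [EMetricSpace Y] [MeasurableSpace Y] [BorelSpace Y]
    {f : α → X} {g : α → Y} {s : Set α} {K : ℝ≥0}
    (h : ∀ x ∈ s, ∀ y ∈ s, edist (f x) (f y) ≤ K * edist (g x) (g y)) (m : ℕ) :
    μHE[m] (f '' s) ≤ (K : ℝ≥0∞) ^ m * μHE[m] (g '' s) := by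
  rcases s.eq_empty_or_nonempty with rfl | ⟨x₀, hx₀⟩
  · simp
  have : Nonempty α := ⟨x₀⟩
  -- The hypothesis makes `f` factor through `g`: with `i` choosing a preimage in `s`, the map `f ∘
  -- i` is `K`-Lipschitz on `g '' s`.
  set i := Function.invFunOn g s
  have hi : ∀ x ∈ s, i (g x) ∈ s ∧ g (i (g x)) = g x := fun x hx =>
    ⟨Function.invFunOn_mem ⟨x, hx, rfl⟩, Function.invFunOn_eq ⟨x, hx, rfl⟩⟩
  have hfi : ∀ x ∈ s, f (i (g x)) = f x := fun x hx => by
    have := h _ (hi x hx).1 x hx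
    rw [(hi x hx).2, edist_self, mul_zero, nonpos_iff_eq_zero, edist_eq_zero] at this
    exact this
  have himg : f '' s = (f ∘ i) '' (g '' s) := by
    rw [image_image]
    exact image_congr fun x hx => (hfi x hx).symm
  have hL : LipschitzOnWith K (f ∘ i) (g '' s) := by
    rintro _ ⟨x, hx, rfl⟩ _ ⟨y, hy, rfl⟩
    simp only [Function.comp_apply, hfi x hx, hfi y hy]
    exact h x hx y hy
  rw [himg, Measure.euclideanHausdorffMeasure_def, Measure.euclideanHausdorffMeasure_def,
    Measure.smul_apply, Measure.smul_apply]
  have := hL.hausdorffMeasure_image_le (d := m) (by positivity)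
  rw [ENNReal.rpow_natCast] at this
  simp only [ENNReal.smul_def, smul_eq_mul]
  calc _ ≤ _ := mul_le_mul_right this _
    _ = _ := by ring

/-- Let `κ → 1`. The area formula is first proved up to a factor `κ ^ (m + 1)` in both directions.
-/
theorem ennreal_le_of_forall_one_lt {a b : ℝ≥0∞} (n : ℕ)
    (h : ∀ κ : ℝ≥0, 1 < κ → a ≤ (κ : ℝ≥0∞) ^ n * b) : a ≤ b := by
  have ht : Tendsto (fun κ : ℝ≥0 => (κ : ℝ≥0∞) ^ n * b) (𝓝[>] 1) (𝓝 (1 * b)) := by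
    refine ENNReal.Tendsto.mul_const ?_ (Or.inl one_ne_zero)
    have : Tendsto (fun κ : ℝ≥0 => ((κ ^ n : ℝ≥0) : ℝ≥0∞)) (𝓝[>] 1) (𝓝 ((1 ^ n : ℝ≥0) : ℝ≥0∞)) :=
      ENNReal.tendsto_coe.2 (((continuous_pow n).tendsto 1).mono_left nhdsWithin_le_nhds)
    simpa using this
  rw [one_mul] at ht
  exact ge_of_tendsto ht (eventually_mem_nhdsWithin.mono fun κ hκ => h κ hκ)

section AreaFormula

variable {m : ℕ} {E : Type*} [NormedAddCommGroup E] [InnerProductSpace ℝ E] [FiniteDimensional ℝ E]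

theorem continuous_normDet :
    Continuous fun L : Eucl m →L[ℝ] E => L.toLinearMap.normDet := by
  have h : (fun L : Eucl m →L[ℝ] E => L.toLinearMap.normDet)
      = fun L => Real.sqrt ((L.adjoint ∘L L).det) := by
    funext L
    have := L.normDet_sq
    rw [← Real.sqrt_sq L.toLinearMap.normDet_nonneg]
    exact congrArg Real.sqrt this
  rw [h]
  refine Real.continuous_sqrt.comp (ContinuousLinearMap.continuous_det.comp ?_)
  exact (ContinuousLinearMap.adjoint.continuous).clm_comp continuous_id

omit [FiniteDimensional ℝ E] in
theorem normDet_pos {L : Eucl m →L[ℝ] E} (hL : Function.Injective L) :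
    0 < L.toLinearMap.normDet := by
  refine lt_of_le_of_ne L.toLinearMap.normDet_nonneg (Ne.symm fun h => ?_)
  rw [LinearMap.normDet_eq_zero_iff_ker_ne_bot] at h
  exact h (LinearMap.ker_eq_bot.2 hL)

variable [MeasurableSpace E] [BorelSpace E]

/-- Both sides of the area formula agree on `s` up to the factor `c`. -/
def AreaComparable (ψ : Eucl m → E) (c : ℝ≥0∞) (s : Set (Eucl m)) : Prop :=
  μHE[m] (ψ '' s) ≤ c * ∫⁻ x in s, ENNReal.ofReal (fderiv ℝ ψ x).toLinearMap.normDet ∧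
  ∫⁻ x in s, ENNReal.ofReal (fderiv ℝ ψ x).toLinearMap.normDet ≤ c * μHE[m] (ψ '' s)

/-- If `ψ` is close enough to the injective map `A`, then `‖ψ x - ψ y‖` and `‖A (x - y)‖` agree up
to the factor `κ`. The measures of the images then agree up to `κ ^ m`, and by continuity the
Jacobians agree up to one more `κ`. For `A` itself the formula is linear algebra. -/
theorem exists_pos_areaComparable (A : Eucl m →L[ℝ] E) (hA : Function.Injective A) {κ : ℝ≥0}
    (hκ : 1 < κ) : ∃ δ : ℝ≥0, 0 < δ ∧ ∀ (ψ : Eucl m → E) (s : Set (Eucl m)), MeasurableSet s →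
      ApproximatesLinearOn ψ A s δ → (∀ x ∈ s, ‖fderiv ℝ ψ x - A‖ < δ) →
      AreaComparable ψ ((κ : ℝ≥0∞) ^ (m + 1)) s := by
  obtain ⟨K, hK, hAK⟩ := A.toLinearMap.exists_antilipschitzWith (LinearMap.ker_eq_bot.2 hA)
  have hJ := normDet_pos hA
  have hκ' : (1 : ℝ) < κ := hκ
  have hκ0 : (0 : ℝ) < κ := by linarith
  have hc : ∀ᶠ L in 𝓝 A, L.toLinearMap.normDet < κ * A.toLinearMap.normDet ∧
      A.toLinearMap.normDet < κ * L.toLinearMap.normDet := by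
    have h1 := (continuous_normDet (m := m) (E := E)).tendsto A
    refine (h1.eventually_lt_const (by nlinarith)).and ?_
    exact (tendsto_const_nhds.mul h1).eventually_const_lt (by nlinarith)
  obtain ⟨ρ, hρ, hball⟩ := Metric.eventually_nhds_iff.1 hc
  -- The first entry keeps the Jacobians within the factor `κ`. The second, with the antilipschitz
  -- constant `K` of `A`, makes the error at most the fraction `1 - κ⁻¹` of `‖A (x - y)‖`.
  have hmin : 0 < min ρ ((1 - (κ : ℝ)⁻¹) / K) := by
    refine lt_min hρ (div_pos ?_ (by exact_mod_cast hK))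
    have := inv_lt_one_of_one_lt₀ hκ'
    linarith
  refine ⟨⟨min ρ ((1 - (κ : ℝ)⁻¹) / K), hmin.le⟩, hmin, fun ψ s hs hψ hd => ?_⟩
  set δ : ℝ≥0 := ⟨min ρ ((1 - (κ : ℝ)⁻¹) / K), hmin.le⟩
  have hKr : (0 : ℝ) < K := by exact_mod_cast hK
  have hδK : (δ : ℝ) * K ≤ 1 - (κ : ℝ)⁻¹ := by
    rw [← le_div_iff₀ hKr]; exact min_le_right _ _
  have hAn : ∀ v, ‖v‖ ≤ K * ‖A v‖ := fun v => by
    simpa [dist_eq_norm] using hAK.le_mul_dist v 0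
  have happ : ∀ x ∈ s, ∀ y ∈ s, ‖ψ x - ψ y - A (x - y)‖ ≤ (1 - (κ : ℝ)⁻¹) * ‖A (x - y)‖ :=
    fun x hx y hy => by
      calc _ ≤ δ * ‖x - y‖ := hψ x hx y hy
        _ ≤ δ * (K * ‖A (x - y)‖) := by gcongr; exact hAn _
        _ = δ * K * ‖A (x - y)‖ := by ring
        _ ≤ _ := by gcongr
  have hinv : (κ : ℝ) * (κ : ℝ)⁻¹ = 1 := mul_inv_cancel₀ hκ0.ne'
  have hi0 : 0 < (κ : ℝ)⁻¹ := inv_pos.2 hκ0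
  have up : μHE[m] (ψ '' s) ≤ (κ : ℝ≥0∞) ^ m * μHE[m] (A '' s) := by
    refine euclideanHausdorffMeasure_image_le_of_edist_le (fun x hx y hy => ?_) m
    rw [edist_dist, edist_dist, dist_eq_norm, dist_eq_norm, ← map_sub,
      ← ENNReal.ofReal_coe_nnreal, ← ENNReal.ofReal_mul (by positivity)]
    refine ENNReal.ofReal_le_ofReal ?_
    have h1 := happ x hx y hy
    have h2 : ‖ψ x - ψ y‖ ≤ ‖ψ x - ψ y - A (x - y)‖ + ‖A (x - y)‖ := by
      simpa using norm_add_le (ψ x - ψ y - A (x - y)) (A (x - y))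
    have h3 : 0 ≤ ‖A (x - y)‖ := norm_nonneg _
    -- The upper factor is `1 + (1 - κ⁻¹)`, and `κ + κ⁻¹ ≥ 2`.
    have h4 : 2 - (κ : ℝ)⁻¹ ≤ κ := by nlinarith [sq_nonneg ((κ : ℝ) - 1)]
    nlinarith
  have lo : μHE[m] (A '' s) ≤ (κ : ℝ≥0∞) ^ m * μHE[m] (ψ '' s) := by
    refine euclideanHausdorffMeasure_image_le_of_edist_le (fun x hx y hy => ?_) m
    rw [edist_dist, edist_dist, dist_eq_norm, dist_eq_norm, ← map_sub,
      ← ENNReal.ofReal_coe_nnreal, ← ENNReal.ofReal_mul (by positivity)]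
    refine ENNReal.ofReal_le_ofReal ?_
    have h1 := happ x hx y hy
    have h2 : ‖A (x - y)‖ ≤ ‖ψ x - ψ y‖ + ‖ψ x - ψ y - A (x - y)‖ := by
      simpa using norm_sub_le (ψ x - ψ y) (ψ x - ψ y - A (x - y))
    have h3 : (κ : ℝ)⁻¹ * ‖A (x - y)‖ ≤ ‖ψ x - ψ y‖ := by nlinarith
    calc ‖A (x - y)‖ = κ * ((κ : ℝ)⁻¹ * ‖A (x - y)‖) := by rw [← mul_assoc, hinv, one_mul]
      _ ≤ _ := by gcongr
  have hlin : μHE[m] (A '' s) = ENNReal.ofReal A.toLinearMap.normDet * volume s := by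
    have := A.toLinearMap.euclideanHausdorffMeasure_image_eq_normDet_mul_volume s
    rwa [finrank_euclideanSpace_fin] at this
  have hint : ∫⁻ _ in s, ENNReal.ofReal A.toLinearMap.normDet
      = ENNReal.ofReal A.toLinearMap.normDet * volume s := by
    rw [setLIntegral_const]
  have hnear : ∀ x ∈ s, (fderiv ℝ ψ x).toLinearMap.normDet < κ * A.toLinearMap.normDet ∧
      A.toLinearMap.normDet < κ * (fderiv ℝ ψ x).toLinearMap.normDet := fun x hx => by
    refine hball ?_
    rw [dist_eq_norm]
    exact (hd x hx).trans_le (min_le_left _ _)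
  have i1 : ENNReal.ofReal A.toLinearMap.normDet * volume s
      ≤ κ * ∫⁻ x in s, ENNReal.ofReal (fderiv ℝ ψ x).toLinearMap.normDet := by
    rw [← hint, ← lintegral_const_mul' _ _ ENNReal.coe_ne_top]
    refine setLIntegral_mono' hs fun x hx => ?_
    rw [← ENNReal.ofReal_coe_nnreal, ← ENNReal.ofReal_mul (by positivity)]
    exact ENNReal.ofReal_le_ofReal (hnear x hx).2.le
  have i2 : ∫⁻ x in s, ENNReal.ofReal (fderiv ℝ ψ x).toLinearMap.normDet
      ≤ κ * (ENNReal.ofReal A.toLinearMap.normDet * volume s) := by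
    rw [← hint, ← lintegral_const_mul' _ _ ENNReal.coe_ne_top]
    refine setLIntegral_mono' hs fun x hx => ?_
    rw [← ENNReal.ofReal_coe_nnreal, ← ENNReal.ofReal_mul (by positivity)]
    exact ENNReal.ofReal_le_ofReal (hnear x hx).1.le
  constructor
  · calc _ ≤ _ := up
      _ ≤ (κ : ℝ≥0∞) ^ m * (κ * ∫⁻ x in s, ENNReal.ofReal (fderiv ℝ ψ x).toLinearMap.normDet) := by
        rw [hlin]; gcongr
      _ = _ := by ring
  · calc _ ≤ _ := i2
      _ ≤ κ * ((κ : ℝ≥0∞) ^ m * μHE[m] (ψ '' s)) := by rw [← hlin]; gcongr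
      _ = _ := by ring

/-- Both sides are countably additive: injectivity and continuity keep the images of the pieces
disjoint and measurable. -/
theorem AreaComparable.of_partition {ψ : Eucl m → E} {c : ℝ≥0∞} {s : Set (Eucl m)}
    (hs : MeasurableSet s) (hc : ContinuousOn ψ s) (hinj : InjOn ψ s) {t : ℕ → Set (Eucl m)}
    (ht : ∀ n, MeasurableSet (t n)) (hdisj : Pairwise (Function.onFun Disjoint t))
    (hcov : s ⊆ ⋃ n, t n) (h : ∀ n, AreaComparable ψ c (s ∩ t n)) : AreaComparable ψ c s := by
  have hsU : s = ⋃ n, s ∩ t n := by rw [← inter_iUnion, inter_eq_self_of_subset_left hcov]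
  have hm : ∀ n, MeasurableSet (s ∩ t n) := fun n => hs.inter (ht n)
  have hd : Pairwise (Function.onFun Disjoint fun n => s ∩ t n) :=
    pairwise_disjoint_mono hdisj fun n => inter_subset_right
  have hI : ∫⁻ x in s, ENNReal.ofReal (fderiv ℝ ψ x).toLinearMap.normDet
      = ∑' n, ∫⁻ x in s ∩ t n, ENNReal.ofReal (fderiv ℝ ψ x).toLinearMap.normDet := by
    conv_lhs => rw [hsU]
    rw [lintegral_iUnion hm hd]
  have hM : μHE[m] (ψ '' s) = ∑' n, μHE[m] (ψ '' (s ∩ t n)) := by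
    conv_lhs => rw [hsU, image_iUnion]
    refine measure_iUnion (fun i j hij => ?_) fun n =>
      (hm n).image_of_continuousOn_injOn (hc.mono inter_subset_left) (hinj.mono inter_subset_left)
    exact (hd hij).image hinj inter_subset_left inter_subset_left
  rw [AreaComparable, hI, hM, ← ENNReal.tsum_mul_left, ← ENNReal.tsum_mul_left]
  exact ⟨ENNReal.tsum_le_tsum fun n => (h n).1, ENNReal.tsum_le_tsum fun n => (h n).2⟩

/-- The area formula for injective immersions, with the Euclidean Hausdorff measure. -/
theorem euclideanHausdorffMeasure_image_eq_lintegral {ψ : Eucl m → E} {s : Set (Eucl m)}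
    (hs : MeasurableSet s) (hd : ∀ x ∈ s, DifferentiableAt ℝ ψ x)
    (hi : ∀ x ∈ s, Function.Injective (fderiv ℝ ψ x)) (hinj : InjOn ψ s) :
    μHE[m] (ψ '' s) = ∫⁻ x in s, ENNReal.ofReal (fderiv ℝ ψ x).toLinearMap.normDet := by
  have hcont : ContinuousOn ψ s := fun x hx => (hd x hx).continuousAt.continuousWithinAt
  have key : ∀ κ : ℝ≥0, 1 < κ → AreaComparable ψ ((κ : ℝ≥0∞) ^ (m + 1)) s := by
    intro κ hκ
    choose! δ hδ0 hδ using fun A : Eucl m →L[ℝ] E => fun hA : Function.Injective A =>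
      exists_pos_areaComparable A hA hκ
    set I : Set (Eucl m →L[ℝ] E) := {A | Function.Injective A}
    -- Countably many balls of radius `δ A / 2` cover all injective maps, so `s` splits into
    -- countably many pieces on each of which the derivative stays within `δ / 2` of a fixed
    -- injective map `a n`.
    obtain ⟨T, hTI, hTc, hTU⟩ := TopologicalSpace.countable_cover_nhdsWithin (s := I)
      (f := fun A => Metric.ball A (δ A / 2)) fun A hA =>
        mem_nhdsWithin_of_mem_nhds (Metric.ball_mem_nhds A (half_pos (hδ0 A hA)))
    rcases s.eq_empty_or_nonempty with rfl | ⟨x₀, hx₀⟩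
    · simp [AreaComparable]
    have hTne : T.Nonempty := by
      by_contra hne
      rw [not_nonempty_iff_eq_empty] at hne
      have := hTU (hi x₀ hx₀)
      simp [hne] at this
    obtain ⟨a, ha⟩ := hTc.exists_eq_range hTne
    have haI : ∀ n, Function.Injective (a n) := fun n => hTI (ha ▸ mem_range_self n)
    set u : ℕ → Set (Eucl m) := fun n => fderiv ℝ ψ ⁻¹' Metric.ball (a n) (δ (a n) / 2)
    have hu : ∀ n, MeasurableSet (u n) := fun n =>
      measurable_fderiv ℝ ψ Metric.isOpen_ball.measurableSet
    refine AreaComparable.of_partition hs hcont hinj (t := disjointed u)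
      (fun n => MeasurableSet.disjointed hu n) (disjoint_disjointed u) ?_ fun n => ?_
    · rw [iUnion_disjointed]
      intro x hx
      have := hTU (hi x hx)
      rw [ha, biUnion_range] at this
      obtain ⟨n, hn⟩ := mem_iUnion.1 this
      exact mem_iUnion.2 ⟨n, hn⟩
    · set s' := s ∩ disjointed u n
      have hs' : MeasurableSet s' := hs.inter (MeasurableSet.disjointed hu n)
      have hs's : s' ⊆ s := inter_subset_left
      have hs'u : ∀ x ∈ s', ‖fderiv ℝ ψ x - a n‖ < δ (a n) / 2 := fun x hx => by
        have : x ∈ u n := disjointed_subset u n hx.2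
        simpa [u, dist_eq_norm] using this
      have hδn := hδ0 _ (haI n)
      -- A second partition makes `ψ` close to a linear map `A k` at tolerance `δ / 2`. As `A k` is
      -- a value of the derivative, it is within `δ / 2` of `a n`, and the two errors add up to `δ`.
      obtain ⟨t, A, htd, htm, htc, hta, htA⟩ :=
        exists_partition_approximatesLinearOn_of_hasFDerivWithinAt ψ s' (fderiv ℝ ψ)
          (fun x hx => (hd x (hs's hx)).hasFDerivAt.hasFDerivWithinAt) (fun _ => δ (a n) / 2)
          (fun _ => (half_pos hδn).ne')
      refine AreaComparable.of_partition hs' (hcont.mono hs's) (hinj.mono hs's) htm htd htc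
        fun k => hδ _ (haI n) ψ _ (hs'.inter (htm k)) ?_ fun x hx =>
          (hs'u x hx.1).trans (half_lt_self (by exact_mod_cast hδn))
      rcases s'.eq_empty_or_nonempty with he | hne
      · rw [he, empty_inter]; intro x hx; exact absurd hx (notMem_empty x)
      obtain ⟨y, hy, hyA⟩ := htA hne k
      intro x hx z hz
      have h1 := hta k x hx z hz
      have h2 : ‖A k - a n‖ ≤ δ (a n) / 2 := by rw [hyA]; exact (hs'u y hy).le
      have h3 : ψ x - ψ z - a n (x - z) = (ψ x - ψ z - A k (x - z)) + (A k - a n) (x - z) := by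
        simp
      rw [h3]
      refine (norm_add_le _ _).trans ?_
      have h4 : ‖(A k - a n) (x - z)‖ ≤ δ (a n) / 2 * ‖x - z‖ :=
        (A k - a n).le_of_opNorm_le h2 (x - z)
      push_cast at h1
      linarith
  refine le_antisymm (ennreal_le_of_forall_one_lt (m + 1) fun κ hκ => (key κ hκ).1)
    (ennreal_le_of_forall_one_lt (m + 1) fun κ hκ => (key κ hκ).2)

end AreaFormula

end

section

/-! ### Operator systems in a Hilbert space -/

section Abstract

open scoped RealInnerProductSpace

variable {H : Type*} [NormedAddCommGroup H] [InnerProductSpace ℝ H]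

/-- Symmetric positive semidefinite bounded operators. -/
structure SymPSD (B : H →L[ℝ] H) : Prop where
  symm : ∀ u v, ⟪B u, v⟫ = ⟪u, B v⟫
  nonneg : ∀ u, 0 ≤ ⟪B u, u⟫

/-- Nonnegativity of the form of `B` at the vector `u - ‖B‖⁻¹ • B u`. -/
theorem SymPSD.norm_sq_le {B : H →L[ℝ] H} (hB : SymPSD B) (u : H) :
    ‖B u‖ ^ 2 ≤ ‖B‖ * ⟪B u, u⟫ := by
  rcases eq_or_lt_of_le (norm_nonneg B) with h0 | hpos
  · have : B = 0 := norm_eq_zero.1 h0.symm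
    simp [this]
  have h := hB.nonneg (u - (‖B‖⁻¹) • B u)
  have e : ⟪B (u - (‖B‖⁻¹) • B u), u - (‖B‖⁻¹) • B u⟫
      = ⟪B u, u⟫ - 2 * ‖B‖⁻¹ * ‖B u‖ ^ 2 + ‖B‖⁻¹ ^ 2 * ⟪B (B u), B u⟫ := by
    rw [map_sub, map_smul, inner_sub_left, inner_sub_right, inner_sub_right, real_inner_smul_left,
      real_inner_smul_left, real_inner_smul_right, real_inner_smul_right, hB.symm (B u) u,
      real_inner_self_eq_norm_sq]
    ring
  have h2 : ⟪B (B u), B u⟫ ≤ ‖B‖ * ‖B u‖ ^ 2 := by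
    calc _ ≤ ‖B (B u)‖ * ‖B u‖ := real_inner_le_norm _ _
      _ ≤ ‖B‖ * ‖B u‖ * ‖B u‖ := by gcongr; exact B.le_opNorm _
      _ = _ := by ring
  rw [e] at h
  have h3 : ‖B‖⁻¹ ^ 2 * ⟪B (B u), B u⟫ ≤ ‖B‖⁻¹ * ‖B u‖ ^ 2 := by
    calc _ ≤ ‖B‖⁻¹ ^ 2 * (‖B‖ * ‖B u‖ ^ 2) := by gcongr
      _ = _ := by field_simp
  have h4 : ‖B‖⁻¹ * ‖B u‖ ^ 2 ≤ ⟪B u, u⟫ := by linarith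
  calc ‖B u‖ ^ 2 = ‖B‖ * (‖B‖⁻¹ * ‖B u‖ ^ 2) := by field_simp
    _ ≤ _ := by gcongr

/-- Pairing `z = u + C B u` with `B u` and dropping the nonnegative term of `C` gives `⟪B u, u⟫ ≤
‖z‖ ‖B u‖`. With `SymPSD.norm_sq_le` this bounds `B u`, and then `u = z - C B u`. No smallness is
needed, and the bound is uniform when `C` is perturbed. -/
theorem SymPSD.norm_le_of_add_comp {B C : H →L[ℝ] H} (hB : SymPSD B) (hC : SymPSD C) (u : H) :
    ‖u‖ ≤ (1 + ‖C‖ * ‖B‖) * ‖u + C (B u)‖ := by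
  set z := u + C (B u)
  have h1 : ⟪B u, u⟫ ≤ ‖z‖ * ‖B u‖ := by
    have e : ⟪z, B u⟫ = ⟪B u, u⟫ + ⟪C (B u), B u⟫ := by
      rw [inner_add_left, real_inner_comm u]
    have := hC.nonneg (B u)
    have := real_inner_le_norm z (B u)
    linarith
  have h2 : ‖B u‖ ≤ ‖B‖ * ‖z‖ := by
    have h3 : ‖B u‖ ^ 2 ≤ ‖B‖ * (‖z‖ * ‖B u‖) :=
      (hB.norm_sq_le u).trans (by gcongr)
    rcases eq_or_lt_of_le (norm_nonneg (B u)) with h0 | hpos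
    · rw [← h0]; positivity
    · nlinarith
  have h4 : u = z - C (B u) := by simp [z]
  calc ‖u‖ ≤ ‖z‖ + ‖C (B u)‖ := by
        conv_lhs => rw [h4]
        exact norm_sub_le _ _
    _ ≤ ‖z‖ + ‖C‖ * ‖B u‖ := by gcongr; exact C.le_opNorm _
    _ ≤ ‖z‖ + ‖C‖ * (‖B‖ * ‖z‖) := by gcongr
    _ = _ := by ring

/-- The a priori bound makes the range closed. A vector orthogonal to it lies in the kernel of the
adjoint `1 + B C`, which is trivial by the same bound with `B` and `C` exchanged. -/
theorem SymPSD.surjective_add_comp [CompleteSpace H] {B C : H →L[ℝ] H} (hB : SymPSD B)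
    (hC : SymPSD C) (z : H) : ∃ u, u + C (B u) = z := by
  set D : H →L[ℝ] H := ContinuousLinearMap.id ℝ H + C ∘L B
  have hD : ∀ u, D u = u + C (B u) := fun u => rfl
  have hanti : AntilipschitzWith (Real.toNNReal (1 + ‖C‖ * ‖B‖)) D := by
    refine ContinuousLinearMap.antilipschitz_of_bound D fun u => ?_
    rw [Real.coe_toNNReal _ (by positivity), hD]
    exact hB.norm_le_of_add_comp hC u
  have hcl : IsClosed (D.range : Set H) := hanti.isClosed_range D.uniformContinuous
  have := hcl.completeSpace_coe
  have htop : D.range = ⊤ := by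
    rw [← D.range.orthogonal_orthogonal, Submodule.eq_top_iff']
    intro v w hw
    have hw0 : w + B (C w) = 0 := by
      refine ext_inner_left ℝ fun x => ?_
      have h1 : ⟪D x, w⟫ = 0 := hw _ ⟨x, rfl⟩
      rw [hD, inner_add_left, hC.symm, hB.symm, ← inner_add_right] at h1
      rw [h1, inner_zero_right]
    have h2 := hC.norm_le_of_add_comp hB w
    rw [hw0, norm_zero, mul_zero] at h2
    rw [norm_le_zero_iff.1 h2, inner_zero_left]
  obtain ⟨u, hu⟩ : z ∈ D.range := htop ▸ Submodule.mem_top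
  exact ⟨u, by rw [← hD]; exact hu⟩

/-- Weak limits of bounded families whose images under an injective operator converge weakly. -/
theorem exists_weak_limit_of_injective {Y ι : Type*} [NormedAddCommGroup Y] [InnerProductSpace ℝ Y]
    [CompleteSpace Y] [CompleteSpace H] {l : Filter ι} [l.NeBot] (j : H →L[ℝ] Y)
    (hj : Function.Injective j) {z : ι → H} {M : ℝ} (hM : ∀ᶠ t in l, ‖z t‖ ≤ M) {ζ : Y}
    (hζ : ∀ y, Tendsto (fun t => ⟪j (z t), y⟫) l (𝓝 ⟪ζ, y⟫)) :
    ∃ z₀, j z₀ = ζ ∧ ∀ h, Tendsto (fun t => ⟪z t, h⟫) l (𝓝 ⟪z₀, h⟫) := by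
  -- Injectivity of `j` is density of the range of its adjoint. On vectors `j.adjoint y` the
  -- pairings converge by hypothesis, and the bound `M` extends this to all vectors.
  have hdense : j.adjoint.range.topologicalClosure = ⊤ := by
    rw [← Submodule.orthogonal_orthogonal_eq_closure, Submodule.eq_top_iff']
    intro v w hw
    have : w = 0 := by
      refine hj ?_
      rw [map_zero]
      refine ext_inner_right ℝ fun y => ?_
      have := hw (j.adjoint y) ⟨y, rfl⟩
      rw [ContinuousLinearMap.adjoint_inner_left, real_inner_comm] at this
      rw [this, inner_zero_left]
    rw [this, inner_zero_left]
  have hM0 : 0 ≤ M := by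
    obtain ⟨t, ht⟩ := hM.exists
    exact (norm_nonneg _).trans ht
  have hex : ∀ h, ∃ L, Tendsto (fun t => ⟪z t, h⟫) l (𝓝 L) := by
    intro h
    refine cauchy_map_iff_exists_tendsto.1 ?_
    rw [Metric.cauchy_iff]
    refine ⟨inferInstance, fun ε hε => ?_⟩
    have hh : h ∈ closure (j.adjoint.range : Set H) := by
      have : h ∈ j.adjoint.range.topologicalClosure := hdense ▸ Submodule.mem_top
      exact this
    obtain ⟨s, ⟨y, rfl⟩, hs⟩ := Metric.mem_closure_iff.1 hh (ε / (4 * (M + 1))) (by positivity)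
    have hlim := hζ y
    have hev := Metric.tendsto_nhds.1 hlim (ε / 4) (by positivity)
    refine ⟨_, image_mem_map (hM.and hev), ?_⟩
    have key : ∀ t, ‖z t‖ ≤ M → dist ⟪j (z t), y⟫ ⟪ζ, y⟫ < ε / 4 →
        dist ⟪z t, h⟫ ⟪ζ, y⟫ < ε / 2 := by
      intro t h1 h2
      have h3 : ⟪z t, h⟫ = ⟪z t, h - j.adjoint y⟫ + ⟪j (z t), y⟫ := by
        rw [inner_sub_right, ContinuousLinearMap.adjoint_inner_right]; ring
      have h4 : |⟪z t, h - j.adjoint y⟫| ≤ ε / 4 := by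
        have h5 : ‖h - j.adjoint y‖ ≤ ε / (4 * (M + 1)) := by
          rw [← dist_eq_norm]; exact hs.le
        calc _ ≤ ‖z t‖ * ‖h - j.adjoint y‖ := abs_real_inner_le_norm _ _
          _ ≤ (M + 1) * (ε / (4 * (M + 1))) := by gcongr; linarith
          _ = ε / 4 := by field_simp
      rw [h3, Real.dist_eq] at *
      have := abs_add_le ⟪z t, h - j.adjoint y⟫ (⟪j (z t), y⟫ - ⟪ζ, y⟫)
      rw [add_sub_assoc]
      linarith
    rintro _ ⟨t, ⟨h1, h2⟩, rfl⟩ _ ⟨t', ⟨h1', h2'⟩, rfl⟩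
    have a := key t h1 h2
    have b := key t' h1' h2'
    calc dist ⟪z t, h⟫ ⟪z t', h⟫ ≤ _ := dist_triangle_right _ _ ⟪ζ, y⟫
      _ < ε := by linarith
  choose Λ hΛ using hex
  let Λ' : H →ₗ[ℝ] ℝ :=
    { toFun := Λ
      map_add' := fun a b => tendsto_nhds_unique (hΛ (a + b))
        (by simpa only [inner_add_right] using (hΛ a).add (hΛ b))
      map_smul' := fun c a => tendsto_nhds_unique (hΛ (c • a))
        (by simpa only [inner_smul_right, smul_eq_mul, RingHom.id_apply] using (hΛ a).const_mul c) }
  let Λc : H →L[ℝ] ℝ := Λ'.mkContinuous M fun h => by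
    refine le_of_tendsto (hΛ h).norm (hM.mono fun t ht => ?_)
    calc ‖⟪z t, h⟫‖ ≤ ‖z t‖ * ‖h‖ := norm_inner_le_norm _ _
      _ ≤ _ := by gcongr
  refine ⟨(InnerProductSpace.toDual ℝ H).symm Λc, ?_, fun h => ?_⟩
  · refine ext_inner_right ℝ fun y => ?_
    rw [← ContinuousLinearMap.adjoint_inner_right, InnerProductSpace.toDual_symm_apply]
    refine tendsto_nhds_unique (hΛ (j.adjoint y)) ?_
    simpa only [ContinuousLinearMap.adjoint_inner_right] using hζ y
  · rw [InnerProductSpace.toDual_symm_apply]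
    exact hΛ h

/-- Solutions of the system `u + C_t p = F`, `p = B u - g` under a perturbation `C_t` of `C`. -/
theorem perturbed_system_bound {ι : Type*} {l : Filter ι} {B C : H →L[ℝ] H} {Ct : ι → H →L[ℝ] H}
    {ε : ι → ℝ} {K : ℝ} (hB : SymPSD B) (hC : ∀ᶠ t in l, SymPSD (Ct t))
    (hK : ∀ᶠ t in l, 0 < ε t ∧ ‖Ct t - C‖ ≤ K * ε t) (hε : Tendsto ε l (𝓝 0))
    {F g u p : H} {ut pt : ι → H} (hu : u + C p = F) (hp : p = B u - g)
    (hut : ∀ᶠ t in l, ut t + Ct t (pt t) = F ∧ pt t = B (ut t) - g) :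
    ∃ M, 0 ≤ M ∧ ∀ᶠ t in l, ‖ut t - u‖ ≤ M * ε t ∧ ‖pt t - p‖ ≤ M * ε t := by
  set N := (1 + (‖C‖ + |K|) * ‖B‖) * (|K| * ‖p‖)
  have hN : 0 ≤ N := by positivity
  refine ⟨N * (1 + ‖B‖), by positivity, ?_⟩
  have hε1 : ∀ᶠ t in l, ε t < 1 := hε.eventually_lt_const one_pos
  filter_upwards [hC, hK, hut, hε1] with t h1 ⟨h0, h2⟩ ⟨h3, h4⟩ h5
  have hK2 : ‖Ct t - C‖ ≤ |K| * ε t := h2.trans (by gcongr; exact le_abs_self K)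
  have hCn : ‖Ct t‖ ≤ ‖C‖ + |K| := by
    calc ‖Ct t‖ = ‖C + (Ct t - C)‖ := by rw [add_sub_cancel]
      _ ≤ ‖C‖ + ‖Ct t - C‖ := norm_add_le _ _
      _ ≤ _ := by gcongr; nlinarith [abs_nonneg K]
  have hpt : pt t - p = B (ut t - u) := by rw [h4, map_sub]; conv_lhs => rw [hp]
                                           abel
  -- The difference of the states solves the perturbed system with a right-hand side of order `ε t`,
  -- to which the a priori bound for `Ct t` applies.
  have hD : (ut t - u) + Ct t (B (ut t - u)) = -((Ct t - C) p) := by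
    rw [← hpt, map_sub, _root_.sub_apply]
    have : ut t + Ct t (pt t) - (u + C p) = 0 := by rw [h3, hu, sub_self]
    rw [← sub_eq_zero, ← this]; abel
  have hb := hB.norm_le_of_add_comp h1 (ut t - u)
  rw [hD, norm_neg] at hb
  have h6 : ‖ut t - u‖ ≤ N * ε t := by
    calc _ ≤ (1 + ‖Ct t‖ * ‖B‖) * ‖(Ct t - C) p‖ := hb
      _ ≤ (1 + (‖C‖ + |K|) * ‖B‖) * (|K| * ε t * ‖p‖) := by
        gcongr
        exact (Ct t - C).le_of_opNorm_le hK2 p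
      _ = _ := by ring
  have h7 : 0 ≤ N * ε t := by positivity
  refine ⟨h6.trans (by nlinarith [norm_nonneg B]), ?_⟩
  rw [hpt]
  calc _ ≤ ‖B‖ * ‖ut t - u‖ := B.le_opNorm _
    _ ≤ ‖B‖ * (N * ε t) := by gcongr
    _ ≤ _ := by nlinarith [norm_nonneg B]

/-- The operators `Ct` are differentiable only weakly, but they are Lipschitz in norm. In the
equation for the difference, `(Ct - C) B (ut - u)` is therefore of second order and only `(Ct - C)
p` contributes. The quotients converge weakly because the adjoint of `1 + C B` is surjective. -/
theorem perturbed_system_weak_deriv [CompleteSpace H] {ι : Type*} {l : Filter ι}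
    {B C C' : H →L[ℝ] H} {Ct : ι → H →L[ℝ] H}
    {ε : ι → ℝ} {K : ℝ} (hB : SymPSD B) (hC0 : SymPSD C) (hC : ∀ᶠ t in l, SymPSD (Ct t))
    (hK : ∀ᶠ t in l, 0 < ε t ∧ ‖Ct t - C‖ ≤ K * ε t) (hε : Tendsto ε l (𝓝 0))
    (hC' : ∀ x y, Tendsto (fun t => (⟪Ct t x, y⟫ - ⟪C x, y⟫) / ε t) l (𝓝 ⟪C' x, y⟫))
    {F g u p : H} {ut pt : ι → H} (hu : u + C p = F) (hp : p = B u - g)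
    (hut : ∀ᶠ t in l, ut t + Ct t (pt t) = F ∧ pt t = B (ut t) - g) :
    ∃ u', u' + C (B u') + C' p = 0 ∧
      (∀ z, Tendsto (fun t => ⟪(ε t)⁻¹ • (ut t - u), z⟫) l (𝓝 ⟪u', z⟫)) ∧
      ∀ z, Tendsto (fun t => ⟪(ε t)⁻¹ • (pt t - p), z⟫) l (𝓝 ⟪B u', z⟫) := by
  obtain ⟨M, hM0, hM⟩ := perturbed_system_bound hB hC hK hε hu hp hut
  obtain ⟨u', hu'⟩ := hB.surjective_add_comp hC0 (-(C' p))
  have hweak : ∀ z, Tendsto (fun t => ⟪(ε t)⁻¹ • (ut t - u), z⟫) l (𝓝 ⟪u', z⟫) := by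
    intro z
    -- Writing the test vector as `w + B (C w)` moves `1 + C B` onto the quotient, where the
    -- equation of the difference can be inserted.
    obtain ⟨w, rfl⟩ := hC0.surjective_add_comp hB z
    have e0 : ∀ x : H, ⟪x, w + B (C w)⟫ = ⟪x + C (B x), w⟫ := fun x => by
      rw [inner_add_right, inner_add_left, ← hB.symm, ← hC0.symm]
    rw [e0, hu', inner_neg_left]
    have hdif : Tendsto (fun t => -((⟪Ct t p, w⟫ - ⟪C p, w⟫) / ε t)
        - ⟪(Ct t - C) ((ε t)⁻¹ • B (ut t - u)), w⟫) l (𝓝 (-⟪C' p, w⟫ - 0)) := by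
      refine (hC' p w).neg.sub ?_
      refine squeeze_zero_norm' (a := fun t => |K| * ε t * (‖B‖ * M) * ‖w‖) ?_ ?_
      · filter_upwards [hK, hM] with t ⟨h0, h1⟩ ⟨h2, _⟩
        calc _ ≤ ‖(Ct t - C) ((ε t)⁻¹ • B (ut t - u))‖ * ‖w‖ := norm_inner_le_norm _ _
          _ ≤ |K| * ε t * (‖B‖ * M) * ‖w‖ := by
            gcongr
            refine (ContinuousLinearMap.le_opNorm _ _).trans ?_
            gcongr
            · exact h1.trans (by gcongr; exact le_abs_self K)
            · rw [norm_smul, norm_inv, Real.norm_of_nonneg h0.le]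
              calc (ε t)⁻¹ * ‖B (ut t - u)‖ ≤ (ε t)⁻¹ * (‖B‖ * (M * ε t)) := by
                    gcongr
                    exact (B.le_opNorm _).trans (by gcongr)
                _ = ‖B‖ * M := by field_simp
      · have : Tendsto (fun t => |K| * ε t * (‖B‖ * M) * ‖w‖) l
            (𝓝 (|K| * 0 * (‖B‖ * M) * ‖w‖)) :=
          ((hε.const_mul _).mul_const _).mul_const _
        simpa using this
    rw [sub_zero] at hdif
    refine hdif.congr' ?_
    filter_upwards [hK, hut] with t ⟨h0, _⟩ ⟨h3, h4⟩
    have hpt : pt t - p = B (ut t - u) := by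
      rw [h4, map_sub]; conv_lhs => rw [hp]
      abel
    have hD : (ut t - u) + C (B (ut t - u)) = -((Ct t - C) p) - (Ct t - C) (B (ut t - u)) := by
      rw [← hpt, map_sub, map_sub, _root_.sub_apply, _root_.sub_apply]
      have : ut t + Ct t (pt t) - (u + C p) = 0 := by rw [h3, hu, sub_self]
      rw [← sub_eq_zero, ← this]; abel
    rw [e0, map_smul B, map_smul C, ← smul_add, hD, map_smul (Ct t - C), smul_sub, inner_sub_left,
      smul_neg, inner_neg_left]
    simp only [real_inner_smul_left, _root_.sub_apply, inner_sub_left]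
    ring
  refine ⟨u', ?_, hweak, fun z => ?_⟩
  · rw [hu']; simp
  · have := hweak (B z)
    rw [← hB.symm] at this
    refine this.congr' ?_
    filter_upwards [hut] with t ⟨_, h4⟩
    have hpt : pt t - p = B (ut t - u) := by
      rw [h4, map_sub]; conv_lhs => rw [hp]
      abel
    rw [hpt, ← map_smul, hB.symm]

end Abstract

end

section

variable {d : ℕ}

/-! ### Jets of Sobolev pairs -/

/-- The space of values and gradients. -/
abbrev Jet (d : ℕ) : Type := WithLp 2 (ℝ × Eucl d)

/-- The pointwise value and gradient of a Sobolev pair. -/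
def jet (u : SobPair d) (x : Eucl d) : Jet d := WithLp.toLp 2 (u.1 x, u.2 x)

/-- A function paired with its pointwise gradient. -/
def withGrad (φ : Eucl d → ℝ) : SobPair d := (φ, gradient φ)

@[simp] theorem withGrad_fst (φ : Eucl d → ℝ) : (withGrad φ).1 = φ := rfl
@[simp] theorem withGrad_snd (φ : Eucl d → ℝ) : (withGrad φ).2 = gradient φ := rfl

/-- Compactly supported functions of class `C¹`. -/
def IsCore (φ : Eucl d → ℝ) : Prop := ContDiff ℝ 1 φ ∧ HasCompactSupport φ

theorem inner_gradient (φ : Eucl d → ℝ) (x v : Eucl d) : inner ℝ (gradient φ x) v = fderiv ℝ φ x v := by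
  rw [gradient, InnerProductSpace.toDual_symm_apply]

theorem norm_gradient (φ : Eucl d → ℝ) (x : Eucl d) : ‖gradient φ x‖ = ‖fderiv ℝ φ x‖ := by
  rw [gradient, LinearIsometryEquiv.norm_map]

theorem gradient_add' {φ ψ : Eucl d → ℝ} {x : Eucl d} (h : DifferentiableAt ℝ φ x)
    (h' : DifferentiableAt ℝ ψ x) : gradient (φ + ψ) x = gradient φ x + gradient ψ x := by
  rw [gradient, fderiv_add h h', map_add]; rfl

theorem gradient_sub' {φ ψ : Eucl d → ℝ} {x : Eucl d} (h : DifferentiableAt ℝ φ x)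
    (h' : DifferentiableAt ℝ ψ x) : gradient (φ - ψ) x = gradient φ x - gradient ψ x := by
  rw [gradient, fderiv_sub h h', map_sub]; rfl

theorem gradient_const_smul' {φ : Eucl d → ℝ} {x : Eucl d} (c : ℝ) (h : DifferentiableAt ℝ φ x) :
    gradient (c • φ) x = c • gradient φ x := by
  rw [gradient, fderiv_const_smul h, map_smul]; rfl

theorem continuous_gradient {φ : Eucl d → ℝ} (h : ContDiff ℝ 1 φ) : Continuous (gradient φ) :=
  (LinearIsometryEquiv.continuous _).comp (h.continuous_fderiv one_ne_zero)

theorem measurable_gradient (φ : Eucl d → ℝ) : Measurable (gradient φ) :=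
  (LinearIsometryEquiv.continuous _).measurable.comp (measurable_fderiv ℝ φ)

theorem jet_add (u v : SobPair d) (x : Eucl d) : jet (u + v) x = jet u x + jet v x := rfl
theorem jet_sub (u v : SobPair d) (x : Eucl d) : jet (u - v) x = jet u x - jet v x := rfl

theorem jet_eq_iff {u v : SobPair d} {x : Eucl d} :
    jet u x = jet v x ↔ u.1 x = v.1 x ∧ u.2 x = v.2 x := by
  simp [jet]

theorem inner_jet (u v : SobPair d) (x : Eucl d) :
    inner ℝ (jet u x) (jet v x) = inner ℝ (u.2 x) (v.2 x) + u.1 x * v.1 x := by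
  rw [WithLp.prod_inner_apply]
  simp [jet, mul_comm, add_comm]

theorem norm_jet_sq (u : SobPair d) (x : Eucl d) : ‖jet u x‖ ^ 2 = ‖u.1 x‖ ^ 2 + ‖u.2 x‖ ^ 2 :=
  WithLp.prod_norm_sq_eq_of_L2 _

theorem norm_fst_le_jet (u : SobPair d) (x : Eucl d) : ‖u.1 x‖ ≤ ‖jet u x‖ :=
  abs_le_of_sq_le_sq' (by rw [norm_jet_sq]; nlinarith [norm_nonneg (u.2 x)]) (norm_nonneg _) |>.2

theorem norm_snd_le_jet (u : SobPair d) (x : Eucl d) : ‖u.2 x‖ ≤ ‖jet u x‖ :=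
  abs_le_of_sq_le_sq' (by rw [norm_jet_sq]; nlinarith [norm_nonneg (u.1 x)]) (norm_nonneg _) |>.2

theorem norm_jet_le (u : SobPair d) (x : Eucl d) : ‖jet u x‖ ≤ ‖u.1 x‖ + ‖u.2 x‖ :=
  abs_le_of_sq_le_sq' (by rw [norm_jet_sq]; nlinarith [norm_nonneg (u.1 x), norm_nonneg (u.2 x)])
    (by positivity) |>.2

section Measure

variable {μ : Measure (Eucl d)}

theorem aestronglyMeasurable_jet {u : SobPair d} (h1 : AEStronglyMeasurable u.1 μ)
    (h2 : AEStronglyMeasurable u.2 μ) : AEStronglyMeasurable (jet u) μ :=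
  (WithLp.prod_continuous_toLp 2 ℝ (Eucl d)).comp_aestronglyMeasurable (h1.prodMk h2)

theorem aestronglyMeasurable_fst {u : SobPair d} (h : AEStronglyMeasurable (jet u) μ) :
    AEStronglyMeasurable u.1 μ :=
  (continuous_fst.comp (WithLp.prod_continuous_ofLp 2 ℝ (Eucl d))).comp_aestronglyMeasurable h

theorem aestronglyMeasurable_snd {u : SobPair d} (h : AEStronglyMeasurable (jet u) μ) :
    AEStronglyMeasurable u.2 μ :=
  (continuous_snd.comp (WithLp.prod_continuous_ofLp 2 ℝ (Eucl d))).comp_aestronglyMeasurable h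

theorem memLp_jet {u : SobPair d} (h1 : MemLp u.1 2 μ) (h2 : MemLp u.2 2 μ) :
    MemLp (jet u) 2 μ := by
  refine (h1.norm.add h2.norm).mono' (aestronglyMeasurable_jet h1.1 h2.1)
    (Eventually.of_forall fun x => norm_jet_le u x)

theorem memLp_fst {u : SobPair d} (h : MemLp (jet u) 2 μ) : MemLp u.1 2 μ :=
  h.mono (aestronglyMeasurable_fst h.1) (Eventually.of_forall fun x => norm_fst_le_jet u x)

theorem memLp_snd {u : SobPair d} (h : MemLp (jet u) 2 μ) : MemLp u.2 2 μ :=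
  h.mono (aestronglyMeasurable_snd h.1) (Eventually.of_forall fun x => norm_snd_le_jet u x)

theorem memLp_jet_sub {u v : SobPair d} (hu : MemLp (jet u) 2 μ) (hv : MemLp (jet v) 2 μ) :
    MemLp (jet (u - v)) 2 μ := hu.sub hv

theorem memLp_jet_smul {u : SobPair d} (c : ℝ) (hu : MemLp (jet u) 2 μ) :
    MemLp (jet (c • u)) 2 μ := hu.const_smul c

theorem eLpNorm_fst_le_jet (u : SobPair d) : eLpNorm u.1 2 μ ≤ eLpNorm (jet u) 2 μ :=
  eLpNorm_mono fun x => norm_fst_le_jet u x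

theorem eLpNorm_snd_le_jet (u : SobPair d) : eLpNorm u.2 2 μ ≤ eLpNorm (jet u) 2 μ :=
  eLpNorm_mono fun x => norm_snd_le_jet u x

theorem eLpNorm_jet_le {u : SobPair d} (h1 : AEStronglyMeasurable u.1 μ)
    (h2 : AEStronglyMeasurable u.2 μ) :
    eLpNorm (jet u) 2 μ ≤ eLpNorm u.1 2 μ + eLpNorm u.2 2 μ := by
  calc eLpNorm (jet u) 2 μ ≤ eLpNorm (fun x => ‖u.1 x‖ + ‖u.2 x‖) 2 μ :=
        eLpNorm_mono_real fun x => norm_jet_le u x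
    _ ≤ eLpNorm (fun x => ‖u.1 x‖) 2 μ + eLpNorm (fun x => ‖u.2 x‖) 2 μ :=
        eLpNorm_add_le h1.norm h2.norm one_le_two
    _ = _ := by rw [eLpNorm_norm, eLpNorm_norm]

theorem inner_toLp {E : Type*} [NormedAddCommGroup E] [InnerProductSpace ℝ E] {f g : Eucl d → E}
    (hf : MemLp f 2 μ) (hg : MemLp g 2 μ) :
    inner ℝ (hf.toLp f) (hg.toLp g) = ∫ x, inner ℝ (f x) (g x) ∂μ := by
  rw [L2.inner_def]
  refine integral_congr_ae ?_
  filter_upwards [hf.coeFn_toLp, hg.coeFn_toLp] with x h1 h2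
  rw [h1, h2]

theorem integrable_mul_of_memLp {f g : Eucl d → ℝ} (hf : MemLp f 2 μ) (hg : MemLp g 2 μ) :
    Integrable (fun x => f x * g x) μ := hf.integrable_mul hg

theorem abs_integral_mul_le {f g : Eucl d → ℝ} (hf : MemLp f 2 μ) (hg : MemLp g 2 μ) :
    |∫ x, f x * g x ∂μ| ≤ (eLpNorm f 2 μ).toReal * (eLpNorm g 2 μ).toReal := by
  have h := abs_real_inner_le_norm (hg.toLp g) (hf.toLp f)
  rw [inner_toLp] at h
  simpa [Lp.norm_toLp, mul_comm] using h

end Measure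

/-- The `H¹` norm. -/
def hNorm (Ω : Set (Eucl d)) (u : SobPair d) : ℝ :=
  (eLpNorm (jet u) 2 (volume.restrict Ω)).toReal

/-- The pairs whose jets lie in the closure of the compactly supported `C¹` functions in `H¹`. -/
structure InH (Ω : Set (Eucl d)) (u : SobPair d) : Prop where
  memLp : MemLp (jet u) 2 (volume.restrict Ω)
  approx : ∀ ε : ℝ≥0∞, 0 < ε → ∃ φ, IsCore φ ∧
    eLpNorm (jet (u - withGrad φ)) 2 (volume.restrict Ω) ≤ ε

section Basic

variable {Ω : Set (Eucl d)} {u v w : SobPair d}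

theorem hNorm_nonneg : 0 ≤ hNorm Ω u := ENNReal.toReal_nonneg

theorem aForm_eq_inner (hu : MemLp (jet u) 2 (volume.restrict Ω))
    (hv : MemLp (jet v) 2 (volume.restrict Ω)) :
    aForm Ω u v = inner ℝ (hu.toLp (jet u)) (hv.toLp (jet v)) := by
  rw [inner_toLp, aForm]
  simp only [inner_jet]

theorem abs_aForm_le (hu : MemLp (jet u) 2 (volume.restrict Ω))
    (hv : MemLp (jet v) 2 (volume.restrict Ω)) : |aForm Ω u v| ≤ hNorm Ω u * hNorm Ω v := by
  rw [aForm_eq_inner hu hv]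
  refine (abs_real_inner_le_norm _ _).trans ?_
  rw [Lp.norm_toLp, Lp.norm_toLp]; rfl

theorem aForm_sub_left (hu : MemLp (jet u) 2 (volume.restrict Ω))
    (hv : MemLp (jet v) 2 (volume.restrict Ω)) (hw : MemLp (jet w) 2 (volume.restrict Ω)) :
    aForm Ω (u - v) w = aForm Ω u w - aForm Ω v w := by
  have h : jet (u - v) = jet u - jet v := rfl
  rw [aForm_eq_inner hu hw, aForm_eq_inner hv hw, ← inner_sub_left, ← MemLp.toLp_sub,
    aForm_eq_inner (h ▸ hu.sub hv) hw]
  rfl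

theorem aForm_comm : aForm Ω u v = aForm Ω v u := by
  unfold aForm
  refine integral_congr_ae (Eventually.of_forall fun x => ?_)
  simp only [real_inner_comm (v.2 x), mul_comm]

theorem aForm_congr {u' v' : SobPair d} (hu : jet u =ᵐ[volume.restrict Ω] jet u')
    (hv : jet v =ᵐ[volume.restrict Ω] jet v') : aForm Ω u v = aForm Ω u' v' := by
  unfold aForm
  refine integral_congr_ae ?_
  filter_upwards [hu, hv] with x h1 h2
  rw [← inner_jet, ← inner_jet, h1, h2]

theorem IsCore.memLp_jet {φ : Eucl d → ℝ} (h : IsCore φ) {μ : Measure (Eucl d)}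
    [IsFiniteMeasureOnCompacts μ] : MemLp (jet (withGrad φ)) 2 μ := by
  refine ShapeSource.memLp_jet (h.1.continuous.memLp_of_hasCompactSupport h.2)
    ((continuous_gradient h.1).memLp_of_hasCompactSupport ?_)
  exact h.2.fderiv (𝕜 := ℝ) |>.comp_left (map_zero _)

theorem IsCore.add {φ ψ : Eucl d → ℝ} (h : IsCore φ) (h' : IsCore ψ) : IsCore (φ + ψ) :=
  ⟨h.1.add h'.1, h.2.add h'.2⟩

theorem IsCore.smul {φ : Eucl d → ℝ} (c : ℝ) (h : IsCore φ) : IsCore (c • φ) :=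
  ⟨contDiff_const.smul h.1, h.2.smul_left (f := fun _ => c)⟩

theorem withGrad_add {φ ψ : Eucl d → ℝ} (h : ContDiff ℝ 1 φ) (h' : ContDiff ℝ 1 ψ) :
    withGrad (φ + ψ) = withGrad φ + withGrad ψ :=
  Prod.ext rfl (funext fun x => gradient_add' (h.differentiable one_ne_zero x)
    (h'.differentiable one_ne_zero x))

theorem withGrad_sub {φ ψ : Eucl d → ℝ} (h : ContDiff ℝ 1 φ) (h' : ContDiff ℝ 1 ψ) :
    withGrad (φ - ψ) = withGrad φ - withGrad ψ :=
  Prod.ext rfl (funext fun x => gradient_sub' (h.differentiable one_ne_zero x)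
    (h'.differentiable one_ne_zero x))

theorem withGrad_smul {φ : Eucl d → ℝ} (c : ℝ) (h : ContDiff ℝ 1 φ) :
    withGrad (c • φ) = c • withGrad φ :=
  Prod.ext rfl (funext fun x => gradient_const_smul' c (h.differentiable one_ne_zero x))

theorem IsCore.inH {φ : Eucl d → ℝ} (h : IsCore φ) : InH Ω (withGrad φ) :=
  ⟨h.memLp_jet, fun ε _ => ⟨φ, h, by
    rw [sub_self]
    have : jet (0 : SobPair d) = 0 := rfl
    rw [this, eLpNorm_zero]; exact zero_le⟩⟩

theorem InH.add (hu : InH Ω u) (hv : InH Ω v) : InH Ω (u + v) := by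
  refine ⟨hu.memLp.add hv.memLp, fun ε hε => ?_⟩
  obtain ⟨φ, hφ, h1⟩ := hu.approx (ε / 2) (ENNReal.half_pos hε.ne')
  obtain ⟨ψ, hψ, h2⟩ := hv.approx (ε / 2) (ENNReal.half_pos hε.ne')
  refine ⟨φ + ψ, hφ.add hψ, ?_⟩
  have e : jet (u + v - withGrad (φ + ψ)) = jet (u - withGrad φ) + jet (v - withGrad ψ) := by
    rw [withGrad_add hφ.1 hψ.1]
    funext x
    simp only [jet_add, jet_sub, Pi.add_apply]
    abel
  rw [e]
  refine (eLpNorm_add_le (hu.memLp.sub hφ.memLp_jet).1 (hv.memLp.sub hψ.memLp_jet).1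
    one_le_two).trans ?_
  exact (add_le_add h1 h2).trans_eq (ENNReal.add_halves ε)

theorem InH.smul (c : ℝ) (hu : InH Ω u) : InH Ω (c • u) := by
  refine ⟨hu.memLp.const_smul c, fun ε hε => ?_⟩
  obtain ⟨φ, hφ, h1⟩ := hu.approx (ε / (‖c‖ₑ + 1)) (ENNReal.div_pos hε.ne' (by simp))
  refine ⟨c • φ, hφ.smul c, ?_⟩
  have e : jet (c • u - withGrad (c • φ)) = c • jet (u - withGrad φ) := by
    rw [withGrad_smul c hφ.1, ← smul_sub]; rfl
  rw [e]
  refine (eLpNorm_const_smul_le).trans ?_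
  calc ‖c‖ₑ * eLpNorm (jet (u - withGrad φ)) 2 (volume.restrict Ω)
      ≤ (‖c‖ₑ + 1) * (ε / (‖c‖ₑ + 1)) := by gcongr; exact le_self_add
    _ ≤ ε := ENNReal.mul_div_le

theorem InH.neg (hu : InH Ω u) : InH Ω (-u) := by
  have := hu.smul (-1); rwa [neg_one_smul] at this

theorem InH.sub (hu : InH Ω u) (hv : InH Ω v) : InH Ω (u - v) := by
  rw [sub_eq_add_neg]; exact hu.add hv.neg

theorem InH.zero : InH Ω (0 : SobPair d) := by
  refine ⟨MemLp.zero', fun ε _ => ⟨0, ⟨contDiff_const, HasCompactSupport.zero⟩, ?_⟩⟩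
  have : jet ((0 : SobPair d) - withGrad 0) = 0 := by
    funext x
    simp [jet, withGrad, gradient]
  rw [this, eLpNorm_zero]; exact zero_le

theorem InH.congr (hu : InH Ω u) (h : jet u =ᵐ[volume.restrict Ω] jet v) : InH Ω v := by
  refine ⟨hu.memLp.ae_eq h, fun ε hε => ?_⟩
  obtain ⟨φ, hφ, h1⟩ := hu.approx ε hε
  refine ⟨φ, hφ, le_of_eq_of_le (eLpNorm_congr_ae ?_) h1⟩
  filter_upwards [h] with x hx
  rw [jet_sub, jet_sub, hx]

theorem InH.mono {D : Set (Eucl d)} (hu : InH Ω u) (hD : D ⊆ Ω) : InH D u :=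
  ⟨hu.memLp.mono_measure (Measure.restrict_mono hD le_rfl), fun ε hε => by
    obtain ⟨φ, hφ, h1⟩ := hu.approx ε hε
    exact ⟨φ, hφ, (eLpNorm_mono_measure _ (Measure.restrict_mono hD le_rfl)).trans h1⟩⟩

theorem InH.of_approx (hu : MemLp (jet u) 2 (volume.restrict Ω))
    (h : ∀ ε : ℝ≥0∞, 0 < ε → ∃ v, InH Ω v ∧ eLpNorm (jet (u - v)) 2 (volume.restrict Ω) ≤ ε) :
    InH Ω u := by
  refine ⟨hu, fun ε hε => ?_⟩
  obtain ⟨v, hv, h1⟩ := h (ε / 2) (ENNReal.half_pos hε.ne')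
  obtain ⟨φ, hφ, h2⟩ := hv.approx (ε / 2) (ENNReal.half_pos hε.ne')
  refine ⟨φ, hφ, ?_⟩
  have e : jet (u - withGrad φ) = jet (u - v) + jet (v - withGrad φ) := by
    funext x
    simp only [jet_sub, Pi.add_apply]
    abel
  rw [e]
  refine (eLpNorm_add_le (hu.sub hv.memLp).1 (hv.memLp.sub hφ.memLp_jet).1 one_le_two).trans ?_
  exact (add_le_add h1 h2).trans_eq (ENNReal.add_halves ε)

theorem InH.exists_seq (hu : InH Ω u) : ∃ φ : ℕ → Eucl d → ℝ, (∀ n, IsCore (φ n)) ∧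
    Tendsto (fun n => eLpNorm (jet (u - withGrad (φ n))) 2 (volume.restrict Ω)) atTop (𝓝 0) := by
  choose φ hφ h using fun n : ℕ => hu.approx ((n : ℝ≥0∞) + 1)⁻¹ (by simp)
  refine ⟨φ, hφ, tendsto_of_tendsto_of_tendsto_of_le_of_le tendsto_const_nhds ?_
    (fun n => zero_le) h⟩
  have := (ENNReal.tendsto_inv_nat_nhds_zero).comp (tendsto_add_atTop_nat 1)
  refine this.congr fun n => ?_
  simp

/-- Every `C¹` function agrees near a bounded set with a compactly supported one. -/
theorem exists_isCore_eqOn {φ : Eucl d → ℝ} (hφ : ContDiff ℝ 1 φ) {s : Set (Eucl d)}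
    (hs : Bornology.IsBounded s) : ∃ ψ, IsCore ψ ∧ ∀ x ∈ closure s,
      ψ x = φ x ∧ gradient ψ x = gradient φ x := by
  obtain ⟨R, hR0, hR⟩ := hs.subset_closedBall_lt 0 (0 : Eucl d)
  let b : ContDiffBump (0 : Eucl d) := ⟨R + 1, R + 2, by linarith, by linarith⟩
  refine ⟨fun x => b x * φ x, ⟨b.contDiff.mul hφ, b.hasCompactSupport.mul_right⟩, fun x hx => ?_⟩
  have hx' : x ∈ Metric.ball (0 : Eucl d) (R + 1) := by
    have : x ∈ Metric.closedBall (0 : Eucl d) R :=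
      closure_minimal hR Metric.isClosed_closedBall hx
    exact Metric.closedBall_subset_ball (by linarith) this
  have he : (fun x => b x * φ x) =ᶠ[𝓝 x] φ := by
    filter_upwards [Metric.isOpen_ball.mem_nhds hx'] with y hy
    rw [b.one_of_mem_closedBall (Metric.ball_subset_closedBall hy), one_mul]
  exact ⟨he.eq_of_nhds, he.gradient_eq⟩

end Basic

end

section

variable {d : ℕ}

/-! ### Traces -/

/-- Bounded open sets with a trace inequality for `C¹` functions. -/
structure TraceDomain (D : Set (Eucl d)) (C : ℝ≥0) : Prop where
  isOpen : IsOpen D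
  isBounded : Bornology.IsBounded D
  trace_le : ∀ φ : Eucl d → ℝ, ContDiff ℝ 1 φ →
    eLpNorm φ 2 (surf (frontier D)) ≤ C * eLpNorm (jet (withGrad φ)) 2 (volume.restrict D)

section Trace

variable {D : Set (Eucl d)} {C : ℝ≥0} {u v : SobPair d} {g h : Eucl d → ℝ}

theorem TraceDomain.isFiniteMeasure_vol (hD : TraceDomain D C) :
    IsFiniteMeasure ((volume : Measure (Eucl d)).restrict D) :=
  ⟨by rw [Measure.restrict_apply_univ]; exact hD.isBounded.measure_lt_top⟩

/-- The trace inequality for the constant `1`, whose `H¹` norm is finite on a bounded set. -/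
theorem TraceDomain.isFiniteMeasure_surf (hD : TraceDomain D C) :
    IsFiniteMeasure (surf (frontier D)) := by
  have := hD.isFiniteMeasure_vol
  have h1 := hD.trace_le (fun _ => 1) contDiff_const
  have h2 : eLpNorm (jet (withGrad fun _ : Eucl d => (1 : ℝ))) 2 (volume.restrict D) < ∞ := by
    refine (memLp_jet (u := withGrad fun _ => 1) (memLp_const 1) ?_).2
    have : (withGrad fun _ : Eucl d => (1 : ℝ)).2 = fun _ => 0 := by
      funext x; simp [gradient]
    rw [this]
    exact memLp_const 0
  have h3 := h1.trans_lt (ENNReal.mul_lt_top ENNReal.coe_lt_top h2)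
  constructor
  rw [eLpNorm_const' _ two_ne_zero ENNReal.ofNat_ne_top] at h3
  by_contra hinf
  rw [not_lt, top_le_iff] at hinf
  rw [hinf] at h3
  simp at h3

theorem TraceDomain.memLp_surf (hD : TraceDomain D C) {φ : Eucl d → ℝ} (hφ : ContDiff ℝ 1 φ) :
    MemLp φ 2 (surf (frontier D)) := by
  have := hD.isFiniteMeasure_surf
  obtain ⟨ψ, hψ, he⟩ := exists_isCore_eqOn hφ hD.isBounded
  have h1 : MemLp ψ 2 (surf (frontier D)) := hψ.1.continuous.memLp_of_hasCompactSupport hψ.2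
  refine h1.ae_eq ?_
  refine (ae_restrict_iff' isClosed_frontier.measurableSet).2 (Eventually.of_forall fun x hx => ?_)
  exact (he x (frontier_subset_closure hx)).1

/-- The approximating sequence in `HasTrace` in terms of jets. -/
theorem hasTrace_iff (hD : TraceDomain D C) (hu : MemLp (jet u) 2 (volume.restrict D)) :
    HasTrace D u g ↔ MemLp g 2 (surf (frontier D)) ∧ ∃ φ : ℕ → Eucl d → ℝ, (∀ n, IsCore (φ n)) ∧
      Tendsto (fun n => eLpNorm (jet (u - withGrad (φ n))) 2 (volume.restrict D)) atTop (𝓝 0) ∧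
      Tendsto (fun n => eLpNorm (g - φ n) 2 (surf (frontier D))) atTop (𝓝 0) := by
  have hbase : ∀ φ : ℕ → Eucl d → ℝ, (∀ n, ContDiff ℝ 1 (φ n)) →
      ((Tendsto (fun n => eLpNorm (fun x => φ n x - u.1 x) 2 (volume.restrict D)) atTop (𝓝 0) ∧
        Tendsto (fun n => eLpNorm (fun x => gradient (φ n) x - u.2 x) 2 (volume.restrict D))
          atTop (𝓝 0)) ↔
      Tendsto (fun n => eLpNorm (jet (u - withGrad (φ n))) 2 (volume.restrict D)) atTop (𝓝 0)) := by
    intro φ hφ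
    have e1 : ∀ n, eLpNorm (fun x => φ n x - u.1 x) 2 (volume.restrict D)
        = eLpNorm (u - withGrad (φ n)).1 2 (volume.restrict D) := fun n => eLpNorm_sub_comm _ _ _ _
    have e2 : ∀ n, eLpNorm (fun x => gradient (φ n) x - u.2 x) 2 (volume.restrict D)
        = eLpNorm (u - withGrad (φ n)).2 2 (volume.restrict D) := fun n => eLpNorm_sub_comm _ _ _ _
    simp only [e1, e2]
    constructor
    · rintro ⟨h1, h2⟩
      have h3 := h1.add h2
      rw [add_zero] at h3
      refine tendsto_of_tendsto_of_tendsto_of_le_of_le tendsto_const_nhds h3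
        (fun n => zero_le) fun n => eLpNorm_jet_le ?_ ?_
      · exact (memLp_fst hu).1.sub (hφ n).continuous.aestronglyMeasurable
      · exact (memLp_snd hu).1.sub (continuous_gradient (hφ n)).aestronglyMeasurable
    · intro h
      exact ⟨tendsto_of_tendsto_of_tendsto_of_le_of_le tendsto_const_nhds h
        (fun n => zero_le) fun n => eLpNorm_fst_le_jet _,
        tendsto_of_tendsto_of_tendsto_of_le_of_le tendsto_const_nhds h
        (fun n => zero_le) fun n => eLpNorm_snd_le_jet _⟩
  constructor
  · rintro ⟨hg, φ, hφ, h1, h2, h3⟩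
    have h12 := (hbase φ hφ).1 ⟨h1, h2⟩
    choose ψ hψ he using fun n => exists_isCore_eqOn (hφ n) hD.isBounded
    refine ⟨hg, ψ, hψ, h12.congr fun n => eLpNorm_congr_ae ?_, h3.congr fun n => ?_⟩
    · refine (ae_restrict_iff' hD.isOpen.measurableSet).2 (Eventually.of_forall fun x hx => ?_)
      have := he n x (subset_closure hx)
      exact jet_eq_iff.2 (by simp [this.1, this.2])
    · rw [show (fun x => φ n x - g x) = φ n - g from rfl, eLpNorm_sub_comm]
      refine eLpNorm_congr_ae ?_
      refine (ae_restrict_iff' isClosed_frontier.measurableSet).2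
        (Eventually.of_forall fun x hx => ?_)
      simp [(he n x (frontier_subset_closure hx)).1]
  · rintro ⟨hg, φ, hφ, h1, h2⟩
    obtain ⟨a, b⟩ := (hbase φ fun n => (hφ n).1).2 h1
    exact ⟨hg, φ, fun n => (hφ n).1, a, b, h2.congr fun n =>
      eLpNorm_sub_comm g (φ n) 2 (surf (frontier D))⟩

/-- By the trace inequality the boundary values of an approximating sequence form a Cauchy sequence
in `L²` of the boundary. -/
theorem InH.exists_hasTrace (hD : TraceDomain D C) (hu : InH D u) : ∃ g, HasTrace D u g := by
  obtain ⟨φ, hφ, hlim⟩ := hu.exists_seq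
  have hmem : ∀ n, MemLp (φ n) 2 (surf (frontier D)) := fun n => hD.memLp_surf (hφ n).1
  have hdist : ∀ n k, eLpNorm (φ n - φ k) 2 (surf (frontier D)) ≤
      C * (eLpNorm (jet (u - withGrad (φ n))) 2 (volume.restrict D)
        + eLpNorm (jet (u - withGrad (φ k))) 2 (volume.restrict D)) := by
    intro n k
    refine (hD.trace_le (φ n - φ k) ((hφ n).1.sub (hφ k).1)).trans ?_
    gcongr
    have e : jet (withGrad (φ n - φ k)) = jet (u - withGrad (φ k)) - jet (u - withGrad (φ n)) := by
      rw [withGrad_sub (hφ n).1 (hφ k).1]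
      funext x
      simp only [jet_sub, Pi.sub_apply]
      abel
    rw [e, add_comm]
    exact eLpNorm_sub_le (hu.memLp.sub (hφ k).memLp_jet).1 (hu.memLp.sub (hφ n).memLp_jet).1
      one_le_two
  have hcau : CauchySeq fun n => (hmem n).toLp (φ n) := by
    rw [EMetric.cauchySeq_iff]
    intro ε hε
    have h0 : Tendsto (fun n => (C : ℝ≥0∞) *
        eLpNorm (jet (u - withGrad (φ n))) 2 (volume.restrict D)) atTop (𝓝 0) := by
      have := ENNReal.Tendsto.const_mul (a := (C : ℝ≥0∞)) hlim (Or.inr ENNReal.coe_ne_top)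
      simpa using this
    obtain ⟨N, hN⟩ := (h0.eventually_lt_const (ENNReal.half_pos hε.ne')).exists_forall_of_atTop
    refine ⟨N, fun n hn k hk => ?_⟩
    rw [Lp.edist_toLp_toLp]
    calc _ ≤ _ := hdist n k
      _ < ε / 2 + ε / 2 := by
        rw [mul_add]
        exact ENNReal.add_lt_add (hN n hn) (hN k hk)
      _ = ε := ENNReal.add_halves ε
  obtain ⟨g, hg⟩ := cauchySeq_tendsto_of_complete hcau
  refine ⟨g, (hasTrace_iff hD hu.memLp).2 ⟨Lp.memLp g, φ, hφ, hlim, ?_⟩⟩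
  have := tendsto_iff_edist_tendsto_0.1 hg
  refine this.congr fun n => ?_
  rw [edist_comm, Lp.edist_def]
  refine eLpNorm_congr_ae ?_
  filter_upwards [(hmem n).coeFn_toLp] with x hx
  simp [hx]

theorem HasTrace.eLpNorm_le (hD : TraceDomain D C) (hu : MemLp (jet u) 2 (volume.restrict D))
    (hg : HasTrace D u g) :
    eLpNorm g 2 (surf (frontier D)) ≤ C * eLpNorm (jet u) 2 (volume.restrict D) := by
  obtain ⟨hgm, φ, hφ, h1, h2⟩ := (hasTrace_iff hD hu).1 hg
  have hlim : Tendsto (fun n => eLpNorm (g - φ n) 2 (surf (frontier D)) +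
      C * (eLpNorm (jet (u - withGrad (φ n))) 2 (volume.restrict D)
        + eLpNorm (jet u) 2 (volume.restrict D))) atTop
      (𝓝 (0 + C * (0 + eLpNorm (jet u) 2 (volume.restrict D)))) :=
    h2.add (ENNReal.Tendsto.const_mul (h1.add_const _) (Or.inr ENNReal.coe_ne_top))
  rw [zero_add, zero_add] at hlim
  refine ge_of_tendsto' hlim fun n => ?_
  have hm := hD.memLp_surf (hφ n).1
  calc eLpNorm g 2 (surf (frontier D)) = eLpNorm ((g - φ n) + φ n) 2 (surf (frontier D)) := by
        rw [sub_add_cancel]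
    _ ≤ eLpNorm (g - φ n) 2 (surf (frontier D)) + eLpNorm (φ n) 2 (surf (frontier D)) :=
        eLpNorm_add_le (hgm.sub hm).1 hm.1 one_le_two
    _ ≤ _ := by
        gcongr
        refine (hD.trace_le _ (hφ n).1).trans ?_
        gcongr
        have e : jet (withGrad (φ n)) = jet u - jet (u - withGrad (φ n)) := by
          funext x
          simp only [jet_sub, Pi.sub_apply]
          abel
        rw [e, add_comm]
        exact eLpNorm_sub_le hu.1 (hu.sub (hφ n).memLp_jet).1 one_le_two

theorem HasTrace.sub (hD : TraceDomain D C) (hu : MemLp (jet u) 2 (volume.restrict D))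
    (hv : MemLp (jet v) 2 (volume.restrict D)) (hg : HasTrace D u g) (hh : HasTrace D v h) :
    HasTrace D (u - v) (g - h) := by
  obtain ⟨hgm, φ, hφ, h1, h2⟩ := (hasTrace_iff hD hu).1 hg
  obtain ⟨hhm, ψ, hψ, h3, h4⟩ := (hasTrace_iff hD hv).1 hh
  have hc : ∀ n, IsCore (φ n - ψ n) := fun n => by
    have := (hφ n).add ((hψ n).smul (-1))
    rwa [neg_one_smul, ← sub_eq_add_neg] at this
  refine (hasTrace_iff hD (memLp_jet_sub hu hv)).2 ⟨hgm.sub hhm, fun n => φ n - ψ n, hc, ?_, ?_⟩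
  · have h13 := h1.add h3
    rw [add_zero] at h13
    refine tendsto_of_tendsto_of_tendsto_of_le_of_le tendsto_const_nhds h13
      (fun n => zero_le) fun n => ?_
    have e : jet (u - v - withGrad (φ n - ψ n))
        = jet (u - withGrad (φ n)) - jet (v - withGrad (ψ n)) := by
      rw [withGrad_sub (hφ n).1 (hψ n).1]
      funext x
      simp only [jet_sub, Pi.sub_apply]
      abel
    simp only [e]
    exact eLpNorm_sub_le (hu.sub (hφ n).memLp_jet).1 (hv.sub (hψ n).memLp_jet).1 one_le_two
  · have h24 := h2.add h4
    rw [add_zero] at h24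
    refine tendsto_of_tendsto_of_tendsto_of_le_of_le tendsto_const_nhds h24
      (fun n => zero_le) fun n => ?_
    have e : g - h - (φ n - ψ n) = (g - φ n) - (h - ψ n) := by abel
    simp only [e]
    exact eLpNorm_sub_le (hgm.sub (hD.memLp_surf (hφ n).1)).1
      (hhm.sub (hD.memLp_surf (hψ n).1)).1 one_le_two

theorem HasTrace.const_smul (hD : TraceDomain D C) (hu : MemLp (jet u) 2 (volume.restrict D))
    (hg : HasTrace D u g) (c : ℝ) : HasTrace D (c • u) (c • g) := by
  obtain ⟨hgm, φ, hφ, h1, h2⟩ := (hasTrace_iff hD hu).1 hg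
  have hmul : ∀ a : ℕ → ℝ≥0∞, Tendsto a atTop (𝓝 0) →
      Tendsto (fun n => ‖c‖ₑ * a n) atTop (𝓝 0) := fun a ha => by
    have := ENNReal.Tendsto.const_mul (a := ‖c‖ₑ) ha (Or.inr enorm_ne_top)
    simpa using this
  refine (hasTrace_iff hD (memLp_jet_smul c hu)).2
    ⟨hgm.const_smul c, fun n => c • φ n, fun n => (hφ n).smul c, ?_, ?_⟩
  · refine (hmul _ h1).congr fun n => ?_
    rw [← eLpNorm_const_smul, withGrad_smul c (hφ n).1, ← smul_sub]; rfl
  · refine (hmul _ h2).congr fun n => ?_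
    rw [← eLpNorm_const_smul, ← smul_sub]

/-- The trace bound for the difference, whose jet vanishes. This makes the chosen representative
`traceOn` linear and independent of null sets, up to surface null sets. -/
theorem HasTrace.unique (hD : TraceDomain D C) (hu : MemLp (jet u) 2 (volume.restrict D))
    (hv : MemLp (jet v) 2 (volume.restrict D)) (hg : HasTrace D u g) (hh : HasTrace D v h)
    (he : jet u =ᵐ[volume.restrict D] jet v) : g =ᵐ[surf (frontier D)] h := by
  have h1 := (hg.sub hD hu hv hh).eLpNorm_le hD (memLp_jet_sub hu hv)
  have h2 : jet (u - v) =ᵐ[volume.restrict D] 0 := by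
    filter_upwards [he] with x hx
    rw [jet_sub, hx, sub_self]; rfl
  rw [eLpNorm_congr_ae h2, eLpNorm_zero, mul_zero, nonpos_iff_eq_zero,
    eLpNorm_eq_zero_iff (hg.1.sub hh.1).1 two_ne_zero] at h1
  filter_upwards [h1] with x hx
  exact sub_eq_zero.1 hx

theorem InH.hasTrace_traceOn (hD : TraceDomain D C) (hu : InH D u) :
    HasTrace D u (traceOn D u) := by
  have h := hu.exists_hasTrace hD
  rw [traceOn, dif_pos h]
  exact h.choose_spec

theorem InH.memLp_traceOn (hD : TraceDomain D C) (hu : InH D u) :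
    MemLp (traceOn D u) 2 (surf (frontier D)) := (hu.hasTrace_traceOn hD).1

theorem traceOn_congr (hD : TraceDomain D C) (hu : InH D u) (hv : InH D v)
    (he : jet u =ᵐ[volume.restrict D] jet v) :
    traceOn D u =ᵐ[surf (frontier D)] traceOn D v :=
  (hu.hasTrace_traceOn hD).unique hD hu.memLp hv.memLp (hv.hasTrace_traceOn hD) he

theorem traceOn_sub (hD : TraceDomain D C) (hu : InH D u) (hv : InH D v) :
    traceOn D (u - v) =ᵐ[surf (frontier D)] traceOn D u - traceOn D v :=
  ((hu.sub hv).hasTrace_traceOn hD).unique hD (hu.sub hv).memLp (hu.sub hv).memLp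
    ((hu.hasTrace_traceOn hD).sub hD hu.memLp hv.memLp (hv.hasTrace_traceOn hD)) (ae_eq_refl _)

theorem traceOn_smul (hD : TraceDomain D C) (hu : InH D u) (c : ℝ) :
    traceOn D (c • u) =ᵐ[surf (frontier D)] c • traceOn D u :=
  ((hu.smul c).hasTrace_traceOn hD).unique hD (hu.smul c).memLp (hu.smul c).memLp
    ((hu.hasTrace_traceOn hD).const_smul hD hu.memLp c) (ae_eq_refl _)

theorem traceOn_neg (hD : TraceDomain D C) (hu : InH D u) :
    traceOn D (-u) =ᵐ[surf (frontier D)] -traceOn D u := by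
  have := traceOn_smul hD hu (-1)
  rwa [neg_one_smul, neg_one_smul] at this

theorem traceOn_add (hD : TraceDomain D C) (hu : InH D u) (hv : InH D v) :
    traceOn D (u + v) =ᵐ[surf (frontier D)] traceOn D u + traceOn D v := by
  have h1 := traceOn_sub hD hu hv.neg
  rw [sub_neg_eq_add] at h1
  filter_upwards [h1, traceOn_neg hD hv] with x h2 h3
  rw [h2, Pi.sub_apply, h3]; simp

theorem traceOn_zero (hD : TraceDomain D C) :
    traceOn D (0 : SobPair d) =ᵐ[surf (frontier D)] 0 := by
  have := traceOn_smul hD (InH.zero (Ω := D)) 0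
  rwa [zero_smul, zero_smul] at this

theorem HasTrace.of_isCore (hD : TraceDomain D C) {φ : Eucl d → ℝ} (hφ : IsCore φ) :
    HasTrace D (withGrad φ) φ := by
  refine (hasTrace_iff hD hφ.memLp_jet).2 ⟨hD.memLp_surf hφ.1, fun _ => φ, fun _ => hφ, ?_, ?_⟩
  · have : jet (withGrad φ - withGrad φ) = 0 := by rw [sub_self]; rfl
    simp only [this, eLpNorm_zero, tendsto_const_nhds]
  · simp only [sub_self, eLpNorm_zero, tendsto_const_nhds]

theorem traceOn_withGrad (hD : TraceDomain D C) {φ : Eucl d → ℝ} (hφ : IsCore φ) :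
    traceOn D (withGrad φ) =ᵐ[surf (frontier D)] φ :=
  (hφ.inH.hasTrace_traceOn hD).unique hD hφ.memLp_jet hφ.memLp_jet (.of_isCore hD hφ)
    (ae_eq_refl _)

/-! ### Weak gradients and the characterisation of `H¹` -/

/-- Integration by parts in the direction `v`. The identity defining the weak gradient is written as
vanishing of the form `a` against a fixed square integrable pair, so that it passes to limits in
`H¹`. -/
theorem IsCore.aForm_test {φ η : Eucl d → ℝ} (hφ : IsCore φ)
    (hη : ContDiff ℝ ((⊤ : ℕ∞) : WithTop ℕ∞) η) (hc : HasCompactSupport η)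
    (hsub : tsupport η ⊆ D) (v : Eucl d) :
    aForm D (withGrad φ) (fun x => inner ℝ (gradient η x) v, fun x => η x • v) = 0 := by
  have hη1 : ContDiff ℝ 1 η := hη.of_le (by exact_mod_cast le_top)
  have hdφ := hφ.1.continuous_fderiv one_ne_zero
  have hdη := hη1.continuous_fderiv one_ne_zero
  have hsupp : ∀ x, x ∉ D → η x = 0 ∧ fderiv ℝ η x = 0 := fun x hx => by
    have : x ∉ tsupport η := fun h => hx (hsub h)
    exact ⟨image_eq_zero_of_notMem_tsupport this, fderiv_of_notMem_tsupport (𝕜 := ℝ) this⟩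
  have hφc := hφ.1.continuous
  have h1 : Continuous fun x => fderiv ℝ φ x v * η x := by fun_prop
  have h2 : Continuous fun x => φ x * fderiv ℝ η x v := by fun_prop
  have i1 : Integrable fun x => fderiv ℝ φ x v * η x :=
    h1.integrable_of_hasCompactSupport hc.mul_left
  have i2 : Integrable fun x => φ x * fderiv ℝ η x v :=
    h2.integrable_of_hasCompactSupport hφ.2.mul_right
  have i3 : Integrable fun x => φ x * η x :=
    (hφ.1.continuous.mul hη1.continuous).integrable_of_hasCompactSupport hφ.2.mul_right
  have ibp := integral_mul_fderiv_eq_neg_fderiv_mul_of_integrable i1 i2 i3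
    (fun x _ => hφ.1.differentiable one_ne_zero x) (fun x _ => hη1.differentiable one_ne_zero x)
  have e : aForm D (withGrad φ) (fun x => inner ℝ (gradient η x) v, fun x => η x • v)
      = ∫ x, (fderiv ℝ φ x v * η x + φ x * fderiv ℝ η x v) := by
    rw [aForm, setIntegral_eq_integral_of_forall_compl_eq_zero]
    · refine integral_congr_ae (Eventually.of_forall fun x => ?_)
      simp only [withGrad_fst, withGrad_snd, inner_smul_right, inner_gradient]
      ring
    · intro x hx
      simp only [inner_gradient, (hsupp x hx).1, (hsupp x hx).2]
      simp
  rw [e, integral_add i1 i2, ibp]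
  ring

theorem memLp_test {η : Eucl d → ℝ}
    (hη : ContDiff ℝ ((⊤ : ℕ∞) : WithTop ℕ∞) η) (hc : HasCompactSupport η) (v : Eucl d) :
    MemLp (jet (fun x => inner ℝ (gradient η x) v, fun x => η x • v)) 2
      ((volume : Measure (Eucl d)).restrict D) := by
  have hη1 : ContDiff ℝ 1 η := hη.of_le (by exact_mod_cast le_top)
  have hdη := hη1.continuous_fderiv one_ne_zero
  refine memLp_jet ?_ ?_
  · simp only [inner_gradient]
    refine Continuous.memLp_of_hasCompactSupport (by fun_prop) ?_
    exact (hc.fderiv (𝕜 := ℝ)).comp_left (g := fun L : Eucl d →L[ℝ] ℝ => L v) rfl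
  · exact Continuous.memLp_of_hasCompactSupport
      (hη1.continuous.smul continuous_const) hc.smul_right

theorem InH.aForm_test (hu : InH D u) {η : Eucl d → ℝ}
    (hη : ContDiff ℝ ((⊤ : ℕ∞) : WithTop ℕ∞) η) (hc : HasCompactSupport η)
    (hsub : tsupport η ⊆ D) (v : Eucl d) :
    aForm D u (fun x => inner ℝ (gradient η x) v, fun x => η x • v) = 0 := by
  set w : SobPair d := (fun x => inner ℝ (gradient η x) v, fun x => η x • v)
  have hw : MemLp (jet w) 2 (volume.restrict D) := memLp_test hη hc v
  obtain ⟨φ, hφ, hlim⟩ := hu.exists_seq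
  have h1 : ∀ n, |aForm D u w| ≤ hNorm D (u - withGrad (φ n)) * hNorm D w := fun n => by
    have := abs_aForm_le (memLp_jet_sub hu.memLp (hφ n).memLp_jet) hw
    rwa [aForm_sub_left hu.memLp (hφ n).memLp_jet hw, (hφ n).aForm_test hη hc hsub v,
      sub_zero] at this
  have h2 : Tendsto (fun n => hNorm D (u - withGrad (φ n)) * hNorm D w) atTop (𝓝 (0 * hNorm D w)) :=
    ((ENNReal.tendsto_toReal ENNReal.zero_ne_top).comp hlim).mul_const _
  rw [zero_mul] at h2
  exact abs_eq_zero.1 (le_antisymm (ge_of_tendsto' h2 h1) (abs_nonneg _))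

theorem InH.hasWeakGradient (hu : InH D u) :
    HasWeakGradient D u.1 u.2 := by
  intro η hη hc hsub
  have hη1 : ContDiff ℝ 1 η := hη.of_le (by exact_mod_cast le_top)
  have i1 : Integrable (fun x => u.1 x • gradient η x) (volume.restrict D) := by
    refine memLp_one_iff_integrable.1 (MemLp.smul (p := 2) (q := 2) ?_ (memLp_fst hu.memLp))
    exact (continuous_gradient hη1).memLp_of_hasCompactSupport
      (hc.fderiv (𝕜 := ℝ) |>.comp_left (map_zero _))
  have i2 : Integrable (fun x => η x • u.2 x) (volume.restrict D) :=
    memLp_one_iff_integrable.1 (MemLp.smul (p := 2) (q := 2) (memLp_snd hu.memLp)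
      (hη1.continuous.memLp_of_hasCompactSupport hc))
  rw [eq_neg_iff_add_eq_zero, ← integral_add i1 i2]
  refine integral_eq_zero_of_forall_integral_inner_eq_zero ℝ _ (i1.add i2) fun v => ?_
  have := hu.aForm_test hη hc hsub v
  rw [aForm] at this
  rw [← this]
  refine integral_congr_ae (Eventually.of_forall fun x => ?_)
  simp only [inner_add_right, inner_smul_right, real_inner_comm v]
  ring

theorem ae_eq_zero_of_hasWeakGradient_zero (hD : IsOpen D) {G : Eucl d → Eucl d}
    (hG : MemLp G 2 (volume.restrict D)) {f : Eucl d → ℝ} (hf : f =ᵐ[volume.restrict D] 0)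
    (h : HasWeakGradient D f G) : G =ᵐ[volume.restrict D] 0 := by
  have hloc : LocallyIntegrableOn G D volume := by
    intro x hx
    obtain ⟨r, hr, hb⟩ := Metric.nhds_basis_closedBall.mem_iff.1 (hD.mem_nhds hx)
    refine ⟨Metric.closedBall x r, mem_nhdsWithin_of_mem_nhds (Metric.closedBall_mem_nhds x hr), ?_⟩
    have h1 : MemLp G 2 (volume.restrict (Metric.closedBall x r)) :=
      hG.mono_measure (Measure.restrict_mono hb le_rfl)
    have : IsFiniteMeasure ((volume : Measure (Eucl d)).restrict (Metric.closedBall x r)) :=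
      ⟨by rw [Measure.restrict_apply_univ]; exact measure_closedBall_lt_top⟩
    exact h1.integrable one_le_two
  have := hD.ae_eq_zero_of_integral_contDiff_smul_eq_zero hloc fun η hη hc hsub => by
    have h1 := h η hη hc hsub
    have h2 : ∫ x in D, f x • gradient η x = 0 := by
      rw [integral_congr_ae (g := fun _ => 0), integral_zero]
      filter_upwards [hf] with x hx
      rw [hx]; simp
    rw [h2, eq_comm, neg_eq_zero, setIntegral_eq_integral_of_forall_compl_eq_zero] at h1
    · exact h1
    · intro x hx
      rw [image_eq_zero_of_notMem_tsupport fun h => hx (hsub h), zero_smul]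
  exact (ae_restrict_iff' hD.measurableSet).2 this

/-- The weak gradient is determined by the function. -/
theorem InH.jet_ae_eq (hD : IsOpen D) (hu : InH D u) (hv : InH D v)
    (h : u.1 =ᵐ[volume.restrict D] v.1) : jet u =ᵐ[volume.restrict D] jet v := by
  have h1 := (hu.sub hv).hasWeakGradient
  have h2 := ae_eq_zero_of_hasWeakGradient_zero hD (memLp_snd (hu.sub hv).memLp)
    (h.mono fun x hx => by simp [hx]) h1
  filter_upwards [h, h2] with x h3 h4
  exact jet_eq_iff.2 ⟨h3, sub_eq_zero.1 h4⟩

/-- The approximating functions of a trace can be cut off outside the bounded set `D`. Conversely,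
weak gradients and traces pass to limits. The arguments below work with the density description
only. -/
theorem isH1_iff (hD : TraceDomain D C) : IsH1 D u ↔ InH D u := by
  constructor
  · rintro ⟨h1, h2, -, g, hg⟩
    have hm := memLp_jet h1 h2
    obtain ⟨-, φ, hφ, hlim, -⟩ := (hasTrace_iff hD hm).1 hg
    refine ⟨hm, fun ε hε => ?_⟩
    obtain ⟨n, hn⟩ := (hlim.eventually_lt_const hε).exists
    exact ⟨φ n, hφ n, hn.le⟩
  · exact fun hu => ⟨memLp_fst hu.memLp, memLp_snd hu.memLp, hu.hasWeakGradient,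
      hu.exists_hasTrace hD⟩

end Trace

end

section

variable {d : ℕ}

/-! ### The Hilbert space `H¹(Ω)` -/

/-- The jets of compactly supported `C¹` functions in `L²(Ω)`. -/
def coreSpace (Ω : Set (Eucl d)) : Submodule ℝ (Lp (Jet d) 2 (volume.restrict Ω)) where
  carrier := {F | ∃ (φ : Eucl d → ℝ) (h : IsCore φ),
    F = (h.memLp_jet (μ := volume.restrict Ω)).toLp (jet (withGrad φ))}
  zero_mem' := by
    refine ⟨0, ⟨contDiff_const, HasCompactSupport.zero⟩, ?_⟩
    refine (Lp.ext ?_)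
    refine (Lp.coeFn_zero _ _ _).trans (EventuallyEq.trans ?_ (MemLp.coeFn_toLp _).symm)
    refine Eventually.of_forall fun x => ?_
    simp [jet, withGrad, gradient]
    rfl
  add_mem' := by
    rintro _ _ ⟨φ, hφ, rfl⟩ ⟨ψ, hψ, rfl⟩
    refine ⟨φ + ψ, hφ.add hψ, ?_⟩
    rw [← MemLp.toLp_add]
    refine MemLp.toLp_congr _ _ (Eventually.of_forall fun x => ?_)
    rw [withGrad_add hφ.1 hψ.1]; rfl
  smul_mem' := by
    rintro c _ ⟨φ, hφ, rfl⟩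
    refine ⟨c • φ, hφ.smul c, ?_⟩
    rw [← MemLp.toLp_const_smul]
    refine MemLp.toLp_congr _ _ (Eventually.of_forall fun x => ?_)
    rw [withGrad_smul c hφ.1]; rfl

/-- The space `H¹(Ω)` as a closed subspace of `L²`. -/
def HSpace (Ω : Set (Eucl d)) : Submodule ℝ (Lp (Jet d) 2 (volume.restrict Ω)) :=
  (coreSpace Ω).topologicalClosure

instance (Ω : Set (Eucl d)) : CompleteSpace (HSpace Ω) :=
  (coreSpace Ω).isClosed_topologicalClosure.completeSpace_coe

/-- The pair of components of a jet. -/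
def ofJet (F : Eucl d → Jet d) : SobPair d := (fun x => (F x).fst, fun x => (F x).snd)

section HSpace

variable {Ω : Set (Eucl d)} {u v w : SobPair d}

theorem toLp_mem_HSpace_iff (hu : MemLp (jet u) 2 (volume.restrict Ω)) :
    hu.toLp (jet u) ∈ HSpace Ω ↔ InH Ω u := by
  have e : ∀ (φ : Eucl d → ℝ) (hφ : IsCore φ), edist (hu.toLp (jet u))
      (hφ.memLp_jet.toLp (jet (withGrad φ)))
      = eLpNorm (jet (u - withGrad φ)) 2 (volume.restrict Ω) := fun φ hφ => by
    rw [Lp.edist_toLp_toLp]; rfl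
  constructor
  · intro h
    refine ⟨hu, fun ε hε => ?_⟩
    have h' : hu.toLp (jet u) ∈ closure (coreSpace Ω : Set (Lp (Jet d) 2 (volume.restrict Ω))) := h
    obtain ⟨_, ⟨φ, hφ, rfl⟩, hd⟩ := EMetric.mem_closure_iff.1 h' ε hε
    exact ⟨φ, hφ, ((e φ hφ).symm.trans_lt hd).le⟩
  · intro h
    change hu.toLp (jet u) ∈ closure (coreSpace Ω : Set (Lp (Jet d) 2 (volume.restrict Ω)))
    refine EMetric.mem_closure_iff.2 fun ε hε => ?_
    obtain ⟨δ, hδ0, hδ⟩ := exists_between hε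
    obtain ⟨φ, hφ, hd⟩ := h.approx δ hδ0
    exact ⟨_, ⟨φ, hφ, rfl⟩, ((e φ hφ).trans_le hd).trans_lt hδ⟩

open Classical in
/-- The class of a pair in `H¹(Ω)`. -/
def cls (Ω : Set (Eucl d)) (u : SobPair d) : HSpace Ω :=
  if h : InH Ω u then ⟨h.memLp.toLp (jet u), (toLp_mem_HSpace_iff h.memLp).2 h⟩ else 0

theorem coe_cls (hu : InH Ω u) :
    (cls Ω u : Lp (Jet d) 2 (volume.restrict Ω)) = hu.memLp.toLp (jet u) := by
  rw [cls, dif_pos hu]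

/-- The way back from vectors of the Hilbert space to pairs of functions. -/
theorem exists_cls_eq (h : HSpace Ω) : ∃ u, InH Ω u ∧ cls Ω u = h := by
  have hm : MemLp (jet (ofJet (h : Lp (Jet d) 2 (volume.restrict Ω)))) 2 (volume.restrict Ω) :=
    Lp.memLp (h : Lp (Jet d) 2 (volume.restrict Ω))
  have e : hm.toLp _ = (h : Lp (Jet d) 2 (volume.restrict Ω)) := Lp.toLp_coeFn _ hm
  have hin : InH Ω (ofJet (h : Lp (Jet d) 2 (volume.restrict Ω))) :=
    (toLp_mem_HSpace_iff hm).1 (by rw [e]; exact h.2)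
  exact ⟨_, hin, Subtype.ext ((coe_cls hin).trans e)⟩

theorem inner_cls (hu : InH Ω u) (hv : InH Ω v) : inner ℝ (cls Ω u) (cls Ω v) = aForm Ω u v := by
  rw [Submodule.coe_inner, coe_cls hu, coe_cls hv, aForm_eq_inner]

theorem norm_cls (hu : InH Ω u) : ‖cls Ω u‖ = hNorm Ω u := by
  rw [Submodule.coe_norm, coe_cls hu, Lp.norm_toLp]; rfl

theorem cls_add (hu : InH Ω u) (hv : InH Ω v) : cls Ω (u + v) = cls Ω u + cls Ω v := by
  refine Subtype.ext ?_
  rw [Submodule.coe_add, coe_cls hu, coe_cls hv, coe_cls (hu.add hv), ← MemLp.toLp_add]; rfl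

theorem cls_smul (c : ℝ) (hu : InH Ω u) : cls Ω (c • u) = c • cls Ω u := by
  refine Subtype.ext ?_
  rw [Submodule.coe_smul, coe_cls hu, coe_cls (hu.smul c), ← MemLp.toLp_const_smul]; rfl

theorem cls_neg (hu : InH Ω u) : cls Ω (-u) = -cls Ω u := by
  have := cls_smul (-1) hu
  rwa [neg_one_smul, neg_one_smul] at this

theorem cls_sub (hu : InH Ω u) (hv : InH Ω v) : cls Ω (u - v) = cls Ω u - cls Ω v := by
  rw [sub_eq_add_neg, cls_add hu hv.neg, cls_neg hv, sub_eq_add_neg]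

theorem cls_eq_iff (hu : InH Ω u) (hv : InH Ω v) :
    cls Ω u = cls Ω v ↔ jet u =ᵐ[volume.restrict Ω] jet v := by
  rw [← Subtype.coe_inj, coe_cls hu, coe_cls hv, MemLp.toLp_eq_toLp_iff]

theorem hNorm_add_le (hu : InH Ω u) (hv : InH Ω v) : hNorm Ω (u + v) ≤ hNorm Ω u + hNorm Ω v := by
  rw [← norm_cls hu, ← norm_cls hv, ← norm_cls (hu.add hv), cls_add hu hv]
  exact norm_add_le _ _

theorem hNorm_sub_le (hu : InH Ω u) (hv : InH Ω v) : hNorm Ω (u - v) ≤ hNorm Ω u + hNorm Ω v := by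
  rw [← norm_cls hu, ← norm_cls hv, ← norm_cls (hu.sub hv), cls_sub hu hv]
  exact norm_sub_le _ _

theorem InH.exists_hNorm_lt (hu : InH Ω u) {ε : ℝ} (hε : 0 < ε) :
    ∃ φ, IsCore φ ∧ hNorm Ω (u - withGrad φ) < ε := by
  obtain ⟨φ, hφ, h⟩ := hu.approx (ENNReal.ofReal (ε / 2)) (by simpa using hε)
  refine ⟨φ, hφ, ?_⟩
  calc hNorm Ω (u - withGrad φ) ≤ ε / 2 := by
        refine (ENNReal.toReal_mono ENNReal.ofReal_ne_top h).trans_eq ?_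
        exact ENNReal.toReal_ofReal (by linarith)
    _ < ε := half_lt_self hε

/-! ### Bounded forms and functionals -/

/-- Bounded symmetric bilinear forms on `H¹(Ω)`. -/
structure IsBddForm (Ω : Set (Eucl d)) (β : SobPair d → SobPair d → ℝ) (K : ℝ) : Prop where
  symm : ∀ u v, InH Ω u → InH Ω v → β u v = β v u
  add : ∀ u v w, InH Ω u → InH Ω v → InH Ω w → β (u + v) w = β u w + β v w
  smul : ∀ (c : ℝ) u v, InH Ω u → InH Ω v → β (c • u) v = c * β u v
  bound : ∀ u v, InH Ω u → InH Ω v → |β u v| ≤ K * hNorm Ω u * hNorm Ω v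

/-- Bounded linear functionals on `H¹(Ω)`. -/
structure IsBddFunctional (Ω : Set (Eucl d)) (ℓ : SobPair d → ℝ) (K : ℝ) : Prop where
  add : ∀ u v, InH Ω u → InH Ω v → ℓ (u + v) = ℓ u + ℓ v
  smul : ∀ (c : ℝ) u, InH Ω u → ℓ (c • u) = c * ℓ u
  bound : ∀ u, InH Ω u → |ℓ u| ≤ K * hNorm Ω u

theorem IsBddFunctional.sub {ℓ : SobPair d → ℝ} {K : ℝ} (h : IsBddFunctional Ω ℓ K)
    (hu : InH Ω u) (hv : InH Ω v) : ℓ (u - v) = ℓ u - ℓ v := by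
  have := h.smul (-1) v hv
  rw [neg_one_smul] at this
  rw [sub_eq_add_neg, h.add u (-v) hu hv.neg, this]; ring

theorem hNorm_eq_zero (h : jet u =ᵐ[volume.restrict Ω] 0) : hNorm Ω u = 0 := by
  rw [hNorm, eLpNorm_congr_ae h, eLpNorm_zero, ENNReal.toReal_zero]

theorem jet_sub_ae_eq_zero (h : jet u =ᵐ[volume.restrict Ω] jet v) :
    jet (u - v) =ᵐ[volume.restrict Ω] 0 := by
  filter_upwards [h] with x hx
  rw [jet_sub, hx, sub_self]; rfl

theorem IsBddFunctional.congr {ℓ : SobPair d → ℝ} {K : ℝ} (h : IsBddFunctional Ω ℓ K)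
    (hu : InH Ω u) (hv : InH Ω v) (he : jet u =ᵐ[volume.restrict Ω] jet v) : ℓ u = ℓ v := by
  have h1 := h.bound _ (hu.sub hv)
  rw [hNorm_eq_zero (jet_sub_ae_eq_zero he), mul_zero, h.sub hu hv] at h1
  exact sub_eq_zero.1 (abs_eq_zero.1 (le_antisymm h1 (abs_nonneg _)))

theorem IsBddForm.functional {β : SobPair d → SobPair d → ℝ} {K : ℝ} (h : IsBddForm Ω β K)
    (hv : InH Ω v) : IsBddFunctional Ω (fun u => β u v) (K * hNorm Ω v) :=
  ⟨fun u w hu hw => h.add u w v hu hw hv, fun c u hu => h.smul c u v hu hv, fun u hu =>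
    (h.bound u v hu hv).trans_eq (by ring)⟩

theorem IsBddForm.functional_right {β : SobPair d → SobPair d → ℝ} {K : ℝ} (h : IsBddForm Ω β K)
    (hu : InH Ω u) : IsBddFunctional Ω (fun v => β u v) (K * hNorm Ω u) :=
  ⟨fun v w hv hw => by
    rw [h.symm u _ hu (hv.add hw), h.add v w u hv hw hu, h.symm v u hv hu, h.symm w u hw hu],
  fun c v hv => by rw [h.symm u _ hu (hv.smul c), h.smul c v u hv hu, h.symm v u hv hu],
  fun v hv => h.bound u v hu hv⟩

/-- A bounded functional does not see changes on null sets, so it descends to classes, where the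
Riesz representation applies. -/
theorem IsBddFunctional.exists_riesz {ℓ : SobPair d → ℝ} {K : ℝ} (h : IsBddFunctional Ω ℓ K) :
    ∃ F : HSpace Ω, ∀ u, InH Ω u → inner ℝ F (cls Ω u) = ℓ u := by
  choose r hr hr' using exists_cls_eq (Ω := Ω)
  have hrep : ∀ u, InH Ω u → ∀ k, cls Ω u = k → ℓ (r k) = ℓ u := fun u hu k hk =>
    h.congr (hr k) hu ((cls_eq_iff (hr k) hu).1 ((hr' k).trans hk.symm))
  let L : HSpace Ω →ₗ[ℝ] ℝ :=
    { toFun := fun k => ℓ (r k)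
      map_add' := fun a b => by
        rw [hrep _ ((hr a).add (hr b)) _ (by rw [cls_add (hr a) (hr b), hr', hr']),
          h.add _ _ (hr a) (hr b)]
      map_smul' := fun c a => by
        rw [hrep _ ((hr a).smul c) _ (by rw [cls_smul c (hr a), hr']), h.smul c _ (hr a)]; rfl }
  let Lc := L.mkContinuous K fun k => by
    refine (h.bound _ (hr k)).trans_eq ?_
    rw [← norm_cls (hr k), hr']
  refine ⟨(InnerProductSpace.toDual ℝ (HSpace Ω)).symm Lc, fun u hu => ?_⟩
  rw [InnerProductSpace.toDual_symm_apply]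
  exact hrep u hu _ rfl

theorem exists_op_of_bilin {H : Type*} [NormedAddCommGroup H] [InnerProductSpace ℝ H]
    [CompleteSpace H] {b : H → H → ℝ} {K : ℝ} (hK : 0 ≤ K) (hsymm : ∀ x y, b x y = b y x)
    (hadd : ∀ x y z, b (x + y) z = b x z + b y z) (hsmul : ∀ (c : ℝ) x y, b (c • x) y = c * b x y)
    (hb : ∀ x y, |b x y| ≤ K * ‖x‖ * ‖y‖) : ∃ B : H →L[ℝ] H, ‖B‖ ≤ K ∧
      (∀ x y, inner ℝ (B x) y = inner ℝ x (B y)) ∧ ∀ x y, inner ℝ (B x) y = b x y := by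
  let L : H →ₗ[ℝ] H →ₗ[ℝ] ℝ := LinearMap.mk₂ ℝ b hadd hsmul
    (fun x y z => by rw [hsymm, hadd, hsymm y, hsymm z])
    (fun c x y => by rw [hsymm, hsmul, hsymm y]; rfl)
  let Lc : H →L[ℝ] H →L[ℝ] ℝ := L.mkContinuous₂ K hb
  let B : H →L[ℝ] H := InnerProductSpace.continuousLinearMapOfBilin (𝕜 := ℝ) Lc
  have hB : ∀ x y, inner ℝ (B x) y = b x y := fun x y =>
    InnerProductSpace.continuousLinearMapOfBilin_apply Lc x y
  refine ⟨B, B.opNorm_le_bound hK fun x => ?_, fun x y => ?_, hB⟩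
  · have h1 := (le_abs_self _).trans (hb x (B x))
    rw [← hB, real_inner_self_eq_norm_sq] at h1
    rcases eq_or_lt_of_le (norm_nonneg (B x)) with h0 | h0
    · rw [← h0]; positivity
    · nlinarith
  · rw [hB, real_inner_comm, hB, hsymm]

theorem IsBddForm.exists_op {β : SobPair d → SobPair d → ℝ} {K : ℝ} (hK : 0 ≤ K)
    (h : IsBddForm Ω β K) : ∃ B : HSpace Ω →L[ℝ] HSpace Ω, ‖B‖ ≤ K ∧
      (∀ x y, inner ℝ (B x) y = inner ℝ x (B y)) ∧
      ∀ u v, InH Ω u → InH Ω v → inner ℝ (B (cls Ω u)) (cls Ω v) = β u v := by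
  choose r hr hr' using exists_cls_eq (Ω := Ω)
  have hrep : ∀ u v, InH Ω u → InH Ω v → ∀ x, cls Ω u = x → ∀ y, cls Ω v = y →
      β (r x) (r y) = β u v := by
    intro u v hu hv x hx y hy
    rw [(h.functional (hr y)).congr (hr x) hu ((cls_eq_iff (hr x) hu).1 ((hr' x).trans hx.symm))]
    exact (h.functional_right hu).congr (hr y) hv
      ((cls_eq_iff (hr y) hv).1 ((hr' y).trans hy.symm))
  obtain ⟨B, hB1, hB2, hB3⟩ := exists_op_of_bilin (b := fun x y => β (r x) (r y)) hK
    (fun x y => h.symm _ _ (hr x) (hr y))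
    (fun x y z => by
      rw [hrep _ (r z) ((hr x).add (hr y)) (hr z) (x + y) (by rw [cls_add (hr x) (hr y), hr', hr'])
        z (hr' z), h.add _ _ _ (hr x) (hr y) (hr z)])
    (fun c x y => by
      rw [hrep _ (r y) ((hr x).smul c) (hr y) (c • x) (by rw [cls_smul c (hr x), hr'])
        y (hr' y), h.smul c _ _ (hr x) (hr y)])
    (fun x y => by
      have := h.bound _ _ (hr x) (hr y)
      rwa [← norm_cls (hr x), ← norm_cls (hr y), hr', hr'] at this)
  exact ⟨B, hB1, hB2, fun u v hu hv => (hB3 _ _).trans (hrep u v hu hv _ rfl _ rfl)⟩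

theorem IsBddFunctional.mono {ℓ : SobPair d → ℝ} {c c' : ℝ} (h : IsBddFunctional Ω ℓ c)
    (hc : c ≤ c') : IsBddFunctional Ω ℓ c' :=
  ⟨h.add, h.smul, fun u hu => (h.bound u hu).trans (mul_le_mul_of_nonneg_right hc hNorm_nonneg)⟩

/-- An `ε/3` argument. Derivatives in `t` of bounded forms and functionals are computed on `C¹`
functions, where dominated convergence applies, and extended to `H¹` by a bound uniform in `t`. -/
theorem tendsto_functional_of_core {ι : Type*} {l : Filter ι} {ℓt : ι → SobPair d → ℝ}
    {ℓ : SobPair d → ℝ} {K : ℝ} (hK : 0 ≤ K) (ht : ∀ᶠ t in l, IsBddFunctional Ω (ℓt t) K)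
    (h0 : IsBddFunctional Ω ℓ K)
    (hc : ∀ φ, IsCore φ → Tendsto (fun t => ℓt t (withGrad φ)) l (𝓝 (ℓ (withGrad φ))))
    (hu : InH Ω u) : Tendsto (fun t => ℓt t u) l (𝓝 (ℓ u)) := by
  refine Metric.tendsto_nhds.2 fun ε hε => ?_
  obtain ⟨φ, hφ, hlt⟩ := hu.exists_hNorm_lt (ε := ε / (3 * (K + 1))) (by positivity)
  have hsm : K * hNorm Ω (u - withGrad φ) < ε / 3 := by
    calc _ ≤ K * (ε / (3 * (K + 1))) := by gcongr
      _ < (K + 1) * (ε / (3 * (K + 1))) := by gcongr; linarith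
      _ = ε / 3 := by field_simp
  have hsub := hu.sub (hφ.inH (Ω := Ω))
  filter_upwards [ht, Metric.tendsto_nhds.1 (hc φ hφ) (ε / 3) (by positivity)] with t h1 h2
  have a1 := h1.bound _ hsub
  have a2 := h0.bound _ hsub
  rw [h1.sub hu hφ.inH] at a1
  rw [h0.sub hu hφ.inH] at a2
  rw [Real.dist_eq, abs_lt] at *
  rw [abs_le] at a1 a2
  constructor <;> linarith [a1.1, a1.2, a2.1, a2.2, h2.1, h2.2]

/-- Density is used in one argument at a time. -/
theorem tendsto_form_of_core {ι : Type*} {l : Filter ι} {βt : ι → SobPair d → SobPair d → ℝ}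
    {β : SobPair d → SobPair d → ℝ} {K : ℝ} (hK : 0 ≤ K) (ht : ∀ᶠ t in l, IsBddForm Ω (βt t) K)
    (h0 : IsBddForm Ω β K)
    (hc : ∀ φ ψ, IsCore φ → IsCore ψ → Tendsto (fun t => βt t (withGrad φ) (withGrad ψ)) l
      (𝓝 (β (withGrad φ) (withGrad ψ))))
    (hu : InH Ω u) (hv : InH Ω v) : Tendsto (fun t => βt t u v) l (𝓝 (β u v)) := by
  have step : ∀ φ, IsCore φ → Tendsto (fun t => βt t (withGrad φ) v) l (𝓝 (β (withGrad φ) v)) :=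
    fun φ hφ => tendsto_functional_of_core (K := K * hNorm Ω (withGrad φ))
      (mul_nonneg hK hNorm_nonneg) (ht.mono fun t h => h.functional_right hφ.inH)
      (h0.functional_right hφ.inH) (fun ψ hψ => hc φ ψ hφ hψ) hv
  exact tendsto_functional_of_core (ℓt := fun t w => βt t w v) (ℓ := fun w => β w v)
    (K := K * hNorm Ω v)
    (mul_nonneg hK hNorm_nonneg) (ht.mono fun t h => h.functional hv)
    (h0.functional hv) step hu

theorem IsBddForm.smul_left' {β : SobPair d → SobPair d → ℝ} {K : ℝ} (h : IsBddForm Ω β K)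
    (c : ℝ) : IsBddForm Ω (fun u v => c * β u v) (|c| * K) :=
  ⟨fun u v hu hv => by rw [h.symm u v hu hv], fun u v w hu hv hw => by rw [h.add u v w hu hv hw]; ring,
    fun a u v hu hv => by rw [h.smul a u v hu hv]; ring, fun u v hu hv => by
      rw [abs_mul, mul_assoc, mul_assoc, ← mul_assoc K]
      gcongr
      exact h.bound u v hu hv⟩

/-! ### Concrete forms -/

theorem abs_integral_mul_mul_le {μ : Measure (Eucl d)} {f g θ : Eucl d → ℝ} {M : ℝ}
    (hf : MemLp f 2 μ) (hg : MemLp g 2 μ) (hM : ∀ᵐ x ∂μ, |θ x| ≤ M) :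
    |∫ x, f x * g x * θ x ∂μ| ≤ |M| * ((eLpNorm f 2 μ).toReal * (eLpNorm g 2 μ).toReal) := by
  have h1 := abs_integral_mul_le (f := fun x => ‖f x‖) (g := fun x => ‖g x‖) hf.norm hg.norm
  rw [eLpNorm_norm, eLpNorm_norm] at h1
  have h2 : ‖∫ x, f x * g x * θ x ∂μ‖ ≤ ∫ x, |M| * (‖f x‖ * ‖g x‖) ∂μ := by
    refine norm_integral_le_of_norm_le ((integrable_mul_of_memLp (f := fun x => ‖f x‖)
      (g := fun x => ‖g x‖) hf.norm hg.norm).const_mul _) ?_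
    filter_upwards [hM] with x hx
    rw [norm_mul, norm_mul, mul_comm]
    gcongr
    exact hx.trans (le_abs_self M)
  refine h2.trans ?_
  rw [integral_const_mul]
  gcongr
  exact (le_abs_self _).trans h1

theorem integrable_mul_mul {μ : Measure (Eucl d)} {f g θ : Eucl d → ℝ} {M : ℝ}
    (hf : MemLp f 2 μ) (hg : MemLp g 2 μ) (hθ : AEStronglyMeasurable θ μ)
    (hM : ∀ᵐ x ∂μ, |θ x| ≤ M) : Integrable (fun x => f x * g x * θ x) μ :=
  (integrable_mul_of_memLp hf hg).mul_bdd hθ hM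

/-- The form `∫_{∂D} u v θ ds`. -/
def traceForm (D : Set (Eucl d)) (θ : Eucl d → ℝ) (u v : SobPair d) : ℝ :=
  ∫ x, traceOn D u x * traceOn D v x * θ x ∂(surf (frontier D))

/-- The form `∫_A u v θ dx`. -/
def massForm (A : Set (Eucl d)) (θ : Eucl d → ℝ) (u v : SobPair d) : ℝ :=
  ∫ x in A, u.1 x * v.1 x * θ x

theorem toReal_traceOn_le {D : Set (Eucl d)} {C : ℝ≥0} (hD : TraceDomain D C) (hu : InH D u) :
    (eLpNorm (traceOn D u) 2 (surf (frontier D))).toReal ≤ C * hNorm D u := by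
  have h := (hu.hasTrace_traceOn hD).eLpNorm_le hD hu.memLp
  have := ENNReal.toReal_mono (ENNReal.mul_ne_top ENNReal.coe_ne_top hu.memLp.2.ne) h
  rwa [ENNReal.toReal_mul, ENNReal.coe_toReal] at this

theorem hNorm_mono {D : Set (Eucl d)} (hu : InH Ω u) (hD : D ⊆ Ω) : hNorm D u ≤ hNorm Ω u :=
  ENNReal.toReal_mono hu.memLp.2.ne (eLpNorm_mono_measure _ (Measure.restrict_mono hD le_rfl))

theorem toReal_fst_le {A : Set (Eucl d)} (hA : A ⊆ Ω) (hu : InH Ω u) :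
    (eLpNorm u.1 2 (volume.restrict A)).toReal ≤ hNorm Ω u :=
  (ENNReal.toReal_mono (hu.mono hA).memLp.2.ne (eLpNorm_fst_le_jet u)).trans (hNorm_mono hu hA)

/-- With `D ⊆ Ω` this covers both the form on `∂Ω` and the form on `∂ω`, each as a form on `H¹(Ω)`.
-/
theorem isBddForm_traceForm {D : Set (Eucl d)} {C : ℝ≥0} (hD : TraceDomain D C) (hDΩ : D ⊆ Ω)
    {θ : Eucl d → ℝ} {M : ℝ} (hθ : AEStronglyMeasurable θ (surf (frontier D)))
    (hM : ∀ᵐ x ∂(surf (frontier D)), |θ x| ≤ M) :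
    IsBddForm Ω (traceForm D θ) (|M| * (C * C)) where
  symm u v _ _ := integral_congr_ae (Eventually.of_forall fun x => by ring)
  add u v w hu hv hw := by
    have hu := hu.mono hDΩ
    have hv := hv.mono hDΩ
    have hw := hw.mono hDΩ
    rw [traceForm, traceForm, traceForm, ← integral_add
      (integrable_mul_mul (hu.memLp_traceOn hD) (hw.memLp_traceOn hD) hθ hM)
      (integrable_mul_mul (hv.memLp_traceOn hD) (hw.memLp_traceOn hD) hθ hM)]
    refine integral_congr_ae ?_
    filter_upwards [traceOn_add hD hu hv] with x hx
    rw [hx, Pi.add_apply]; ring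
  smul c u v hu hv := by
    rw [traceForm, traceForm, ← integral_const_mul]
    refine integral_congr_ae ?_
    filter_upwards [traceOn_smul hD (hu.mono hDΩ) c] with x hx
    rw [hx, Pi.smul_apply, smul_eq_mul]; ring
  bound u v hu hv := by
    refine (abs_integral_mul_mul_le ((hu.mono hDΩ).memLp_traceOn hD)
      ((hv.mono hDΩ).memLp_traceOn hD) hM).trans ?_
    calc _ ≤ |M| * ((C * hNorm Ω u) * (C * hNorm Ω v)) := by
          have := hNorm_nonneg (Ω := Ω) (u := u)
          gcongr
          · exact (toReal_traceOn_le hD (hu.mono hDΩ)).trans (mul_le_mul_of_nonneg_left (hNorm_mono hu hDΩ) C.2)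
          · exact (toReal_traceOn_le hD (hv.mono hDΩ)).trans (mul_le_mul_of_nonneg_left (hNorm_mono hv hDΩ) C.2)
      _ = _ := by ring

theorem isBddForm_massForm {A : Set (Eucl d)} (hA : A ⊆ Ω)
    {θ : Eucl d → ℝ} {M : ℝ} (hθ : AEStronglyMeasurable θ (volume.restrict A))
    (hM : ∀ᵐ x ∂(volume.restrict A), |θ x| ≤ M) :
    IsBddForm Ω (massForm A θ) |M| where
  symm u v _ _ := integral_congr_ae (Eventually.of_forall fun x => by ring)
  add u v w hu hv hw := by
    have hu := memLp_fst (hu.mono hA).memLp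
    have hv := memLp_fst (hv.mono hA).memLp
    have hw := memLp_fst (hw.mono hA).memLp
    rw [massForm, massForm, massForm, ← integral_add
      (integrable_mul_mul hu hw hθ hM) (integrable_mul_mul hv hw hθ hM)]
    refine integral_congr_ae (Eventually.of_forall fun x => ?_)
    simp only [Prod.fst_add, Pi.add_apply]; ring
  smul c u v hu hv := by
    rw [massForm, massForm, ← integral_const_mul]
    refine integral_congr_ae (Eventually.of_forall fun x => ?_)
    simp only [Prod.smul_fst, Pi.smul_apply, smul_eq_mul]; ring
  bound u v hu hv := by
    refine (abs_integral_mul_mul_le (memLp_fst (hu.mono hA).memLp)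
      (memLp_fst (hv.mono hA).memLp) hM).trans ?_
    rw [mul_assoc]
    gcongr
    · exact hNorm_nonneg
    · exact toReal_fst_le hA hu
    · exact toReal_fst_le hA hv

end HSpace

end

section

variable {d : ℕ}

/-! ### Smooth approximation of Lipschitz functions -/

theorem norm_fderiv_le_of_lipschitzWith {F : Type*} [NormedAddCommGroup F] [NormedSpace ℝ F]
    {ψ : Eucl d → F} {L : ℝ≥0} (h : LipschitzWith L ψ) (x : Eucl d) : ‖fderiv ℝ ψ x‖ ≤ L :=
  norm_fderiv_le_of_lipschitz ℝ h

/-- Lipschitz functions are uniform limits of smooth functions with bounded gradients that converge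
almost everywhere, supported near the support of the given function. -/
theorem lipschitz_exists_smooth_approx {ψ : Eucl d → ℝ} {L : ℝ≥0} (h : LipschitzWith L ψ) :
    ∃ φ : ℕ → Eucl d → ℝ, (∀ n, ContDiff ℝ ((⊤ : ℕ∞) : WithTop ℕ∞) (φ n)) ∧
      (∀ n x, |φ n x - ψ x| ≤ L * (1 / ((n : ℝ) + 1)))
      ∧ (∀ n x, ‖gradient (φ n) x‖ ≤ L) ∧
      (∀ᵐ x, Tendsto (fun n => gradient (φ n) x) atTop (𝓝 (gradient ψ x))) ∧
      ∀ n x, φ n x ≠ 0 → ∃ y ∈ Metric.ball x (1 / ((n : ℝ) + 1)), ψ y ≠ 0 := by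
  -- The ratio of the two radii is `2`; a fixed bound on it is what the almost everywhere
  -- convergence of the convolutions needs.
  let b : ℕ → ContDiffBump (0 : Eucl d) := fun n =>
    ⟨1 / (2 * ((n : ℝ) + 1)), 1 / ((n : ℝ) + 1), by positivity, by
      apply one_div_lt_one_div_of_lt <;> [positivity; skip]
      have : (0 : ℝ) < (n : ℝ) + 1 := by positivity
      linarith⟩
  have hloc : LocallyIntegrable ψ volume := h.continuous.locallyIntegrable
  have hnn : ∀ n y, 0 ≤ (b n).normed volume y := fun n y => (b n).nonneg_normed y
  have hcont : ∀ n, Continuous ((b n).normed volume) := fun n => (b n).continuous_normed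
  have hint : ∀ n, Integrable ((b n).normed volume) volume := fun n => (b n).integrable_normed
  let φ : ℕ → Eucl d → ℝ := fun n =>
    convolution ((b n).normed volume) ψ (ContinuousLinearMap.lsmul ℝ ℝ) volume
  have hψd : ∀ x, ∀ᵐ y : Eucl d, DifferentiableAt ℝ ψ (x - y) := fun x =>
    (quasiMeasurePreserving_sub_left (volume : Measure (Eucl d)) x).ae
      h.ae_differentiableAt
  have hmf : Measurable (fderiv ℝ ψ) := measurable_fderiv ℝ ψ
  -- The derivative is put on `ψ`, which is differentiable almost everywhere by Rademacher's
  -- theorem, and not on the kernel. Hence the gradients of the convolutions are averages of the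
  -- gradient of `ψ`, bounded by `L`.
  have hder : ∀ n x, HasFDerivAt (φ n)
      (convolution ((b n).normed volume) (fderiv ℝ ψ) (ContinuousLinearMap.lsmul ℝ ℝ) volume x) x := by
    intro n x
    have := hasFDerivAt_integral_of_dominated_loc_of_lip (μ := (volume : Measure (Eucl d)))
      (F := fun x y => (b n).normed volume y • ψ (x - y)) (x₀ := x)
      (F' := fun y => (b n).normed volume y • fderiv ℝ ψ (x - y))
      (bound := fun y => (b n).normed volume y * L) (s := univ) univ_mem
      (Eventually.of_forall fun z => ((hcont n).smul
        (h.continuous.comp (continuous_const.sub continuous_id))).aestronglyMeasurable)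
      (((hcont n).smul (h.continuous.comp (continuous_const.sub continuous_id))
        ).integrable_of_hasCompactSupport (b n).hasCompactSupport_normed.smul_right)
      (((hcont n).measurable.smul (hmf.comp (measurable_const.sub measurable_id))
        ).aestronglyMeasurable)
      (Eventually.of_forall fun y => by
        refine LipschitzOnWith.of_dist_le_mul fun z _ z' _ => ?_
        rw [dist_eq_norm, ← smul_sub, norm_smul, Real.norm_of_nonneg (hnn n y),
          Real.coe_nnabs, abs_of_nonneg (mul_nonneg (hnn n y) L.coe_nonneg), mul_assoc]
        refine mul_le_mul_of_nonneg_left ?_ (hnn n y)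
        · have := h.dist_le_mul (z - y) (z' - y)
          rwa [dist_sub_right, dist_eq_norm] at this)
      ((hint n).mul_const _)
      ((hψd x).mono fun y hy => by
        have h1 : HasFDerivAt (fun z => ψ (z - y)) (fderiv ℝ ψ (x - y)) x := by
          have := hy.hasFDerivAt.comp x (hasFDerivAt_sub_const (x := x) y)
          rwa [ContinuousLinearMap.comp_id] at this
        exact h1.fun_const_smul _)
    exact this.2
  have hgb : ∀ n x, ‖fderiv ℝ (φ n) x‖ ≤ L := by
    intro n x
    rw [(hder n x).fderiv, convolution_def]
    refine (norm_integral_le_of_norm_le ((hint n).mul_const (L : ℝ))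
      (Eventually.of_forall fun y => ?_)).trans ?_
    · rw [ContinuousLinearMap.lsmul_apply, norm_smul, Real.norm_of_nonneg (hnn n y)]
      gcongr
      · exact hnn n y
      · exact norm_fderiv_le_of_lipschitzWith h _
    · rw [integral_mul_const, (b n).integral_normed, one_mul]
  refine ⟨φ, fun n => ?_, fun n x => ?_, fun n x => ?_, ?_, fun n x hx => ?_⟩
  · exact (b n).hasCompactSupport_normed.contDiff_convolution_left _ (b n).contDiff_normed hloc
  · rw [← Real.dist_eq]
    refine (b n).dist_normed_convolution_le h.continuous.aestronglyMeasurable fun y hy => ?_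
    refine (h.dist_le_mul y x).trans ?_
    gcongr
    exact (Metric.mem_ball.1 hy).le
  · rw [norm_gradient]; exact hgb n x
  · have hli : LocallyIntegrable (fderiv ℝ ψ) volume :=
      (memLp_top_of_bound hmf.aestronglyMeasurable (L : ℝ) (Eventually.of_forall fun x =>
        norm_fderiv_le_of_lipschitzWith h x)).locallyIntegrable le_top
    have hto : Tendsto (fun n => (b n).rOut) atTop (𝓝 0) := tendsto_one_div_add_atTop_nhds_zero_nat
    have := ContDiffBump.ae_convolution_tendsto_right_of_locallyIntegrable (K := 2)
      (φ := b) (μ := (volume : Measure (Eucl d))) hto (Eventually.of_forall fun n => by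
        change 1 / ((n : ℝ) + 1) ≤ 2 * (1 / (2 * ((n : ℝ) + 1)))
        rw [one_div, one_div, mul_inv]; linarith) hli
    filter_upwards [this] with x hx
    have h2 := ((InnerProductSpace.toDual ℝ (Eucl d)).symm.continuous.tendsto _).comp hx
    refine h2.congr fun n => ?_
    rw [Function.comp_apply, gradient, (hder n x).fderiv]
  · by_contra hc
    push Not at hc
    have h0 : ψ x = 0 := hc x (Metric.mem_ball_self (by positivity))
    have := (b n).dist_normed_convolution_le (μ := (volume : Measure (Eucl d))) (ε := 0)
      h.continuous.aestronglyMeasurable (x₀ := x) fun y hy => by rw [hc y hy, h0, dist_self]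
    rw [h0, dist_zero_right] at this
    exact hx (norm_le_zero_iff.1 this)

/-- Lipschitz functions are uniform limits of `C¹` functions with bounded gradients that converge
almost everywhere. -/
theorem lipschitz_exists_contDiff_approx {ψ : Eucl d → ℝ} {L : ℝ≥0} (h : LipschitzWith L ψ) :
    ∃ φ : ℕ → Eucl d → ℝ, (∀ n, ContDiff ℝ 1 (φ n)) ∧ (∀ n x, |φ n x - ψ x| ≤ L * (1 / ((n : ℝ) + 1)))
      ∧ (∀ n x, ‖gradient (φ n) x‖ ≤ L) ∧
      ∀ᵐ x, Tendsto (fun n => gradient (φ n) x) atTop (𝓝 (gradient ψ x)) := by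
  obtain ⟨φ, h1, h2, h3, h4, -⟩ := lipschitz_exists_smooth_approx h
  exact ⟨φ, fun n => (h1 n).of_le (by exact_mod_cast le_top), h2, h3, h4⟩

theorem tendsto_eLpNorm_of_bounded {E : Type*} [NormedAddCommGroup E] {μ : Measure (Eucl d)}
    [IsFiniteMeasure μ] {f : ℕ → Eucl d → E} {M : ℝ} (hm : ∀ n, AEStronglyMeasurable (f n) μ)
    (hb : ∀ n, ∀ᵐ x ∂μ, ‖f n x‖ ≤ M) (hl : ∀ᵐ x ∂μ, Tendsto (fun n => f n x) atTop (𝓝 0)) :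
    Tendsto (fun n => eLpNorm (f n) 2 μ) atTop (𝓝 0) := by
  have h1 : Tendsto (fun n => ∫⁻ x, ‖f n x‖ₑ ^ (2 : ℝ) ∂μ) atTop (𝓝 (∫⁻ _, 0 ∂μ)) := by
    refine tendsto_lintegral_of_dominated_convergence' (fun _ => ENNReal.ofReal M ^ (2 : ℝ))
      (fun n => (hm n).enorm.pow_const 2) (fun n => ?_) ?_ ?_
    · filter_upwards [hb n] with x hx
      gcongr
      rw [← ofReal_norm]
      exact ENNReal.ofReal_le_ofReal hx
    · rw [lintegral_const]
      exact ENNReal.mul_ne_top (ENNReal.rpow_ne_top_of_nonneg (by norm_num) ENNReal.ofReal_ne_top)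
        (measure_ne_top _ _)
    · filter_upwards [hl] with x hx
      have h2 : Tendsto (fun n => ‖f n x‖ₑ) atTop (𝓝 0) := by simpa using hx.enorm
      have := (ENNReal.continuous_rpow_const (y := (2 : ℝ))).tendsto 0 |>.comp h2
      simpa [Function.comp_def] using this
  rw [lintegral_zero] at h1
  have h3 := (ENNReal.continuous_rpow_const (y := (1 / 2 : ℝ))).tendsto 0 |>.comp h1
  rw [ENNReal.zero_rpow_of_pos (by norm_num)] at h3
  refine h3.congr fun n => ?_
  rw [eLpNorm_eq_lintegral_rpow_enorm_toReal two_ne_zero ENNReal.ofNat_ne_top]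
  simp

section LipschitzH1

variable {Ω : Set (Eucl d)} {ψ : Eucl d → ℝ} {L : ℝ≥0}

theorem lipschitz_memLp_of_isBounded (h : LipschitzWith L ψ) (hb : Bornology.IsBounded Ω)
    {μ : Measure (Eucl d)} [IsFiniteMeasure μ] (hμ : ∀ᵐ x ∂μ, x ∈ closure Ω) : MemLp ψ 2 μ := by
  have hc : IsCompact (closure Ω) := hb.isCompact_closure
  obtain ⟨M, hM⟩ := hc.exists_bound_of_continuousOn h.continuous.continuousOn
  exact MemLp.of_bound h.continuous.aestronglyMeasurable M (hμ.mono fun x hx => hM x hx)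

/-- Lipschitz functions are in `H¹`, with approximating functions as in the definition of traces. -/
theorem lipschitz_exists_approx_H1 (h : LipschitzWith L ψ) (hb : Bornology.IsBounded Ω)
    (ho : IsOpen Ω) : MemLp (jet (withGrad ψ)) 2 (volume.restrict Ω) ∧
    ∃ φ : ℕ → Eucl d → ℝ, (∀ n, IsCore (φ n)) ∧
      (∀ n, ∀ x ∈ closure Ω, |φ n x - ψ x| ≤ L * (1 / ((n : ℝ) + 1))) ∧
      Tendsto (fun n => eLpNorm (jet (withGrad ψ - withGrad (φ n))) 2 (volume.restrict Ω))
        atTop (𝓝 0) := by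
  have : IsFiniteMeasure ((volume : Measure (Eucl d)).restrict Ω) :=
    ⟨by rw [Measure.restrict_apply_univ]; exact hb.measure_lt_top⟩
  obtain ⟨φ, hφ, h1, h2, h3⟩ := lipschitz_exists_contDiff_approx h
  choose χ hχ he using fun n => exists_isCore_eqOn (hφ n) hb
  have hgm := measurable_gradient ψ
  have hgb : ∀ x, ‖gradient ψ x‖ ≤ L := fun x => by
    rw [norm_gradient]; exact norm_fderiv_le_of_lipschitzWith h x
  have hcl : ∀ᵐ x ∂(volume.restrict Ω), x ∈ closure Ω :=
    (ae_restrict_mem ho.measurableSet).mono fun x hx => subset_closure hx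
  have hm : MemLp (jet (withGrad ψ)) 2 (volume.restrict Ω) :=
    memLp_jet (lipschitz_memLp_of_isBounded h hb hcl) (MemLp.of_bound hgm.aestronglyMeasurable (L : ℝ)
      (Eventually.of_forall hgb))
  refine ⟨hm, χ, hχ, fun n x hx => ?_, ?_⟩
  · rw [(he n x hx).1]; exact h1 n x
  · have hlim0 : Tendsto (fun n : ℕ => (L : ℝ) * (1 / ((n : ℝ) + 1))) atTop (𝓝 0) := by
      simpa using tendsto_one_div_add_atTop_nhds_zero_nat.const_mul (L : ℝ)
    refine tendsto_eLpNorm_of_bounded (M := L * 1 + 2 * L)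
      (fun n => (memLp_jet_sub hm (hχ n).memLp_jet).1) (fun n => ?_) ?_
    · filter_upwards [hcl] with x hx
      refine (norm_jet_le _ _).trans (add_le_add ?_ ?_)
      · change ‖ψ x - χ n x‖ ≤ _
        rw [(he n x hx).1, norm_sub_rev]
        refine (h1 n x).trans ?_
        gcongr
        rw [div_le_one (by positivity)]
        linarith [n.cast_nonneg (α := ℝ)]
      · change ‖gradient ψ x - gradient (χ n) x‖ ≤ _
        rw [(he n x hx).2, two_mul]
        exact (norm_sub_le _ _).trans (add_le_add (hgb x) (h2 n x))
    · filter_upwards [hcl, ae_restrict_of_ae h3] with x hx h3x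
      refine squeeze_zero_norm (a := fun n : ℕ => L * (1 / ((n : ℝ) + 1))
        + ‖gradient ψ x - gradient (φ n) x‖) (fun n => ?_) ?_
      · refine (norm_jet_le _ _).trans (add_le_add ?_ ?_)
        · change ‖ψ x - χ n x‖ ≤ _
          rw [(he n x hx).1, norm_sub_rev]
          exact h1 n x
        · change ‖gradient ψ x - gradient (χ n) x‖ ≤ _
          rw [(he n x hx).2]
      · have h4 : Tendsto (fun n => ‖gradient ψ x - gradient (φ n) x‖) atTop (𝓝 0) := by
          simpa using ((tendsto_const_nhds (x := gradient ψ x)).sub h3x).norm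
        simpa using hlim0.add h4

theorem lipschitz_inH (h : LipschitzWith L ψ) (hb : Bornology.IsBounded Ω)
    (ho : IsOpen Ω) : InH Ω (withGrad ψ) := by
  obtain ⟨hm, φ, hφ, -, hlim⟩ := lipschitz_exists_approx_H1 h hb ho
  refine ⟨hm, fun ε hε => ?_⟩
  obtain ⟨n, hn⟩ := (hlim.eventually_lt_const hε).exists
  exact ⟨φ n, hφ n, hn.le⟩

/-- The approximations converge uniformly on the closure, hence also in `L²` of the boundary, whose
measure is finite. -/
theorem lipschitz_hasTrace {C : ℝ≥0} (h : LipschitzWith L ψ) (hD : TraceDomain Ω C) :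
    HasTrace Ω (withGrad ψ) ψ := by
  have := hD.isFiniteMeasure_surf
  obtain ⟨hm, φ, hφ, hle, hlim⟩ := lipschitz_exists_approx_H1 h hD.isBounded hD.isOpen
  have hcl : ∀ᵐ x ∂(surf (frontier Ω)), x ∈ closure Ω :=
    (ae_restrict_mem isClosed_frontier.measurableSet).mono fun x hx => frontier_subset_closure hx
  have hms := lipschitz_memLp_of_isBounded h hD.isBounded hcl
  refine (hasTrace_iff hD hm).2 ⟨hms, φ, hφ, hlim, ?_⟩
  have hlim0 : Tendsto (fun n : ℕ => (L : ℝ) * (1 / ((n : ℝ) + 1))) atTop (𝓝 0) := by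
    simpa using tendsto_one_div_add_atTop_nhds_zero_nat.const_mul (L : ℝ)
  refine tendsto_eLpNorm_of_bounded (M := L * 1) (fun n => (hms.sub (hD.memLp_surf (hφ n).1)).1)
    (fun n => ?_) ?_
  · filter_upwards [hcl] with x hx
    rw [Pi.sub_apply, norm_sub_rev]
    refine (hle n x hx).trans ?_
    gcongr
    rw [div_le_one (by positivity)]
    linarith [n.cast_nonneg (α := ℝ)]
  · filter_upwards [hcl] with x hx
    refine squeeze_zero_norm (fun n => ?_) hlim0
    rw [Pi.sub_apply, norm_sub_rev]
    exact hle n x hx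

end LipschitzH1

end

section

variable {d : ℕ}

/-! ### Bi-Lipschitz maps close to the identity -/

/-- `W` is a displacement field of size `ε ≤ 1/4` with support in `Ω`. -/
structure IsDisplacement (Ω : Set (Eucl d)) (W : Eucl d → Eucl d) (ε : ℝ≥0) : Prop where
  lip : LipschitzWith ε W
  bound : ∀ x, ‖W x‖ ≤ ε
  zero : ∀ x, x ∉ Ω → W x = 0
  le : ε ≤ 1 / 4

/-- The map `x ↦ x + W x`. -/
def shift (W : Eucl d → Eucl d) (x : Eucl d) : Eucl d := x + W x

section Displacement

variable {Ω : Set (Eucl d)} {W : Eucl d → Eucl d} {ε : ℝ≥0}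

theorem IsDisplacement.le_real (h : IsDisplacement Ω W ε) : (ε : ℝ) ≤ 1 / 4 := by
  have := h.le
  exact_mod_cast this

theorem IsDisplacement.lipschitz_shift (h : IsDisplacement Ω W ε) : LipschitzWith 2 (shift W) :=
  (LipschitzWith.id.add h.lip).weaken (by
    have := h.le
    calc 1 + ε ≤ 1 + 1 / 4 := by gcongr
      _ ≤ 2 := by rw [← NNReal.coe_le_coe]; norm_num)

/-- The lower Lipschitz constant is `1 - ε`, which is at least `1/2` because `ε ≤ 1/4`. -/
theorem IsDisplacement.norm_sub_le (h : IsDisplacement Ω W ε) (x y : Eucl d) :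
    ‖x - y‖ ≤ 2 * ‖shift W x - shift W y‖ := by
  have h1 : ‖W x - W y‖ ≤ ε * ‖x - y‖ := by
    simpa [dist_eq_norm] using h.lip.dist_le_mul x y
  have h2 : x - y = (shift W x - shift W y) - (W x - W y) := by simp only [shift]; abel
  have h3 : ‖x - y‖ ≤ ‖shift W x - shift W y‖ + ‖W x - W y‖ := by
    conv_lhs => rw [h2]
    exact _root_.norm_sub_le _ _
  nlinarith [h.le_real, norm_nonneg (x - y)]

theorem IsDisplacement.antilipschitz_shift (h : IsDisplacement Ω W ε) :
    AntilipschitzWith 2 (shift W) :=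
  AntilipschitzWith.of_le_mul_dist fun x y => by
    rw [dist_eq_norm, dist_eq_norm]; exact h.norm_sub_le x y

theorem IsDisplacement.injective_shift (h : IsDisplacement Ω W ε) :
    Function.Injective (shift W) := h.antilipschitz_shift.injective

/-- A preimage of `y` is a fixed point of the contraction `x ↦ y - W x`. -/
theorem IsDisplacement.surjective_shift (h : IsDisplacement Ω W ε) :
    Function.Surjective (shift W) := by
  intro y
  have hc : ContractingWith ε fun x => y - W x :=
    ⟨h.le.trans_lt (by rw [← NNReal.coe_lt_coe]; norm_num), LipschitzWith.of_dist_le_mul fun a b => by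
      rw [dist_sub_left]; exact h.lip.dist_le_mul a b⟩
  refine ⟨hc.fixedPoint, ?_⟩
  have := hc.fixedPoint_isFixedPt
  rw [Function.IsFixedPt] at this
  rw [shift]
  nth_rewrite 1 [← this]
  exact sub_add_cancel _ _

theorem IsDisplacement.shift_of_notMem (h : IsDisplacement Ω W ε) {x : Eucl d} (hx : x ∉ Ω) :
    shift W x = x := by rw [shift, h.zero x hx, add_zero]

/-- The map is injective and fixes every point outside `Ω`, so no point of `Ω` can be sent there. -/
theorem IsDisplacement.shift_mem_iff (h : IsDisplacement Ω W ε) {x : Eucl d} :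
    shift W x ∈ Ω ↔ x ∈ Ω := by
  constructor
  · intro hx
    by_contra hc
    rw [h.shift_of_notMem hc] at hx
    exact hc hx
  · intro hx
    by_contra hc
    have := h.injective_shift (h.shift_of_notMem hc)
    rw [this] at hc
    exact hc hx

theorem IsDisplacement.image_shift (h : IsDisplacement Ω W ε) : shift W '' Ω = Ω := by
  ext y
  obtain ⟨x, rfl⟩ := h.surjective_shift y
  rw [h.injective_shift.mem_set_image, h.shift_mem_iff]

/-- The inverse `S` is `2`-Lipschitz and `S y - y = -W (S y)`, which is a displacement of twice the
size. -/
theorem IsDisplacement.exists_inverse (h : IsDisplacement Ω W ε) (hε : 2 * ε ≤ 1 / 4) :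
    ∃ W', IsDisplacement Ω W' (2 * ε) ∧ (∀ x, shift W' (shift W x) = x) ∧
      ∀ y, shift W (shift W' y) = y := by
  obtain ⟨S, hS⟩ := h.surjective_shift.hasRightInverse
  have hS' : ∀ x, S (shift W x) = x := fun x => h.injective_shift (hS _)
  have hWS : ∀ y, S y - y = - W (S y) := fun y => by
    have h1 := hS y
    rw [shift] at h1
    nth_rewrite 2 [← h1]
    abel
  have hsh : ∀ y, shift (fun y => S y - y) y = S y := fun y => by simp [shift]
  refine ⟨fun y => S y - y, ⟨?_, fun x => ?_, fun x hx => ?_, hε⟩, fun x => ?_, fun y => ?_⟩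
  · refine LipschitzWith.of_dist_le_mul fun y z => ?_
    rw [hWS, hWS, dist_neg_neg]
    have h1 := h.lip.dist_le_mul (S y) (S z)
    have h2 := h.norm_sub_le (S y) (S z)
    rw [hS, hS, ← dist_eq_norm, ← dist_eq_norm] at h2
    push_cast
    nlinarith [ε.coe_nonneg]
  · rw [hWS, norm_neg]
    push_cast
    linarith [h.bound (S x), ε.coe_nonneg]
  · rw [hWS]
    have : S x = x := h.injective_shift (by rw [hS, h.shift_of_notMem hx])
    rw [this, h.zero x hx, neg_zero]
  · rw [hsh, hS']
  · rw [hsh, hS]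

theorem IsDisplacement.measurable_shift (h : IsDisplacement Ω W ε) : Measurable (shift W) :=
  h.lipschitz_shift.continuous.measurable

theorem IsDisplacement.volume_le (h : IsDisplacement Ω W ε) (s : Set (Eucl d)) :
    volume s ≤ 2 ^ d * volume (shift W '' s) := by
  have := euclideanHausdorffMeasure_image_le_of_edist_le (f := id) (g := shift W) (s := s) (K := 2)
    (fun x _ y _ => h.antilipschitz_shift x y) d
  rwa [EuclideanSpace.euclideanHausdorffMeasure_eq_volume, image_id] at this

/-- The `2`-antilipschitz bound alone controls the push-forward; `L²` bounds of compositions require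
no Jacobian. -/
theorem IsDisplacement.map_shift_le (h : IsDisplacement Ω W ε) :
    (volume.restrict Ω).map (shift W) ≤ (2 : ℝ≥0∞) ^ d • volume.restrict Ω := by
  refine Measure.le_iff.2 fun A hA => ?_
  rw [Measure.map_apply h.measurable_shift hA, Measure.smul_apply,
    Measure.restrict_apply (h.measurable_shift hA), Measure.restrict_apply hA, smul_eq_mul]
  refine (h.volume_le _).trans ?_
  gcongr
  rintro _ ⟨x, ⟨hx, hxΩ⟩, rfl⟩
  exact ⟨hx, h.shift_mem_iff.2 hxΩ⟩

theorem IsDisplacement.quasiMeasurePreserving (h : IsDisplacement Ω W ε) :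
    Measure.QuasiMeasurePreserving (shift W) (volume.restrict Ω) (volume.restrict Ω) :=
  ⟨h.measurable_shift, (Measure.absolutelyContinuous_of_le (h.map_shift_le)).trans
    (Measure.smul_absolutelyContinuous)⟩

theorem IsDisplacement.lintegral_comp_le (h : IsDisplacement Ω W ε)
    {F : Eucl d → ℝ≥0∞} (hF : Measurable F) :
    ∫⁻ x in Ω, F (shift W x) ≤ 2 ^ d * ∫⁻ x in Ω, F x := by
  rw [← lintegral_map hF h.measurable_shift]
  refine (lintegral_mono' (h.map_shift_le) le_rfl).trans ?_
  rw [lintegral_smul_measure, smul_eq_mul]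

theorem IsDisplacement.eLpNorm_comp_le {E : Type*} [NormedAddCommGroup E]
    (h : IsDisplacement Ω W ε)
    {F : Eucl d → E} (hF : AEStronglyMeasurable F (volume.restrict Ω)) :
    eLpNorm (F ∘ shift W) 2 (volume.restrict Ω) ≤ 2 ^ d * eLpNorm F 2 (volume.restrict Ω) := by
  rw [← eLpNorm_map_measure (hF.mono_ac (h.quasiMeasurePreserving).absolutelyContinuous)
    h.measurable_shift.aemeasurable]
  refine (eLpNorm_mono_measure _ (h.map_shift_le)).trans ?_
  rw [eLpNorm_smul_measure_of_ne_top ENNReal.ofNat_ne_top, smul_eq_mul]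
  gcongr
  refine (ENNReal.rpow_le_rpow_of_exponent_le (one_le_pow₀ one_le_two) ?_).trans_eq
    (ENNReal.rpow_one _)
  norm_num

theorem IsDisplacement.aestronglyMeasurable_comp {E : Type*} [NormedAddCommGroup E]
    (h : IsDisplacement Ω W ε)
    {F : Eucl d → E} (hF : AEStronglyMeasurable F (volume.restrict Ω)) :
    AEStronglyMeasurable (F ∘ shift W) (volume.restrict Ω) :=
  hF.comp_quasiMeasurePreserving (h.quasiMeasurePreserving)

theorem IsDisplacement.memLp_comp {E : Type*} [NormedAddCommGroup E]
    (h : IsDisplacement Ω W ε)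
    {F : Eucl d → E} (hF : MemLp F 2 (volume.restrict Ω)) :
    MemLp (F ∘ shift W) 2 (volume.restrict Ω) :=
  ⟨h.aestronglyMeasurable_comp hF.1, (h.eLpNorm_comp_le hF.1).trans_lt
    (ENNReal.mul_lt_top (ENNReal.pow_lt_top (by simp)) hF.2)⟩

/-! ### Change of variables -/

theorem IsDisplacement.hasFDerivAt_shift {x : Eucl d} (h : DifferentiableAt ℝ W x) :
    HasFDerivAt (shift W) (1 + fderiv ℝ W x) x :=
  (hasFDerivAt_id x).add h.hasFDerivAt

/-- By Rademacher's theorem `W` is differentiable off a null set, whose image under the Lipschitz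
map is again null. On the rest the change of variables for injective differentiable maps applies. -/
theorem IsDisplacement.setIntegral_image (h : IsDisplacement Ω W ε) {A : Set (Eucl d)}
    (hA : MeasurableSet A) (g : Eucl d → ℝ) :
    ∫ x in shift W '' A, g x = ∫ x in A, |(1 + fderiv ℝ W x).det| * g (shift W x) := by
  have hae : ∀ᵐ x : Eucl d, DifferentiableAt ℝ W x := h.lip.ae_differentiableAt
  set N := {x : Eucl d | ¬ DifferentiableAt ℝ W x} with hN
  have hN0 : volume N = 0 := hae
  have hNm : MeasurableSet N := (measurableSet_of_differentiableAt ℝ W).compl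
  have himN : volume (shift W '' N) = 0 := by
    have := euclideanHausdorffMeasure_image_le_of_edist_le (f := shift W) (g := id) (s := N)
      (K := 2) (fun x _ y _ => h.lipschitz_shift x y) d
    rw [EuclideanSpace.euclideanHausdorffMeasure_eq_volume, image_id, hN0, mul_zero] at this
    exact le_antisymm this zero_le
  have h1 : (shift W '' (A \ N) : Set (Eucl d)) =ᵐ[volume] shift W '' A := by
    rw [image_sdiff h.injective_shift]
    exact sdiff_null_ae_eq_self himN
  have h2 : (A \ N : Set (Eucl d)) =ᵐ[volume] A := sdiff_null_ae_eq_self hN0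
  rw [← setIntegral_congr_set h1, ← setIntegral_congr_set h2]
  have := integral_image_eq_integral_abs_det_fderiv_smul volume (hA.diff hNm)
    (fun x hx => (IsDisplacement.hasFDerivAt_shift (W := W)
      (not_not.1 hx.2)).hasFDerivWithinAt) (h.injective_shift.injOn) g
  simpa only [smul_eq_mul] using this

end Displacement

/-! ### The determinant near the identity -/

/-- The Leibniz formula is a polynomial in the matrix entries. -/
theorem contDiff_det_one_add : ContDiff ℝ 1 fun B : Eucl d →L[ℝ] Eucl d => (1 + B).det := by
  have : (fun B : Eucl d →L[ℝ] Eucl d => (1 + B).det) = fun B =>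
      ∑ σ : Equiv.Perm (Fin d), (Equiv.Perm.sign σ : ℤ) •
        ∏ i, ((1 : Matrix (Fin d) (Fin d) ℝ) (σ i) i + B (EuclideanSpace.single i 1) (σ i)) := by
    funext B
    rw [ContinuousLinearMap.det, ← LinearMap.det_toMatrix (EuclideanSpace.basisFun (Fin d) ℝ).toBasis,
      Matrix.det_apply]
    refine Finset.sum_congr rfl fun σ _ => ?_
    rw [Units.smul_def]
    congr 1
    refine Finset.prod_congr rfl fun i _ => ?_
    rw [LinearMap.toMatrix_apply]
    simp [Matrix.one_apply, EuclideanSpace.basisFun_apply]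
  rw [this]
  refine ContDiff.sum fun σ _ => ?_
  refine ContDiff.const_smul _ (contDiff_prod fun i _ => contDiff_const.add ?_)
  have h1 : ContDiff ℝ 1 fun B : Eucl d →L[ℝ] Eucl d => B (EuclideanSpace.single i 1) :=
    (ContinuousLinearMap.apply ℝ (Eucl d) (EuclideanSpace.single i (1 : ℝ))).contDiff
  exact (EuclideanSpace.proj (𝕜 := ℝ) (σ i)).contDiff.comp h1

theorem hasDerivAt_det_one_add (B : Eucl d →L[ℝ] Eucl d) :
    HasDerivAt (fun t : ℝ => (1 + t • B).det)
      (LinearMap.trace ℝ (Eucl d) (B : Eucl d →ₗ[ℝ] Eucl d)) 0 := by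
  set b := (EuclideanSpace.basisFun (Fin d) ℝ).toBasis
  set M := LinearMap.toMatrix b b (B : Eucl d →ₗ[ℝ] Eucl d) with hM
  have h1 : (fun t : ℝ => (1 + t • B).det) = fun t : ℝ =>
      Polynomial.eval t (1 + (Polynomial.X : Polynomial ℝ) • M.map Polynomial.C).det := by
    funext t
    rw [ContinuousLinearMap.det, ← LinearMap.det_toMatrix b, ← Polynomial.coe_evalRingHom,
      RingHom.map_det]
    congr 1
    ext i j
    rw [RingHom.mapMatrix_apply, Matrix.map_apply, Matrix.add_apply, Matrix.smul_apply,
      Matrix.map_apply, map_add, smul_eq_mul, map_mul]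
    simp only [Polynomial.coe_evalRingHom, Polynomial.eval_X, Polynomial.eval_C]
    rw [Matrix.one_apply, hM, LinearMap.toMatrix_apply, LinearMap.toMatrix_apply]
    simp [b, apply_ite]
  rw [h1]
  have h2 := (1 + (Polynomial.X : Polynomial ℝ) • M.map Polynomial.C).det.hasDerivAt (0 : ℝ)
  rwa [Matrix.derivative_det_one_add_X_smul, hM, ← LinearMap.trace_eq_matrix_trace] at h2

theorem exists_abs_det_sub_one_le (d : ℕ) : ∃ C : ℝ, 0 ≤ C ∧
    ∀ B : Eucl d →L[ℝ] Eucl d, ‖B‖ ≤ 1 → |(1 + B).det - 1| ≤ C * ‖B‖ := by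
  set D := fun B : Eucl d →L[ℝ] Eucl d => (1 + B).det with hD
  have h1 : ContDiff ℝ 1 D := contDiff_det_one_add
  obtain ⟨C, hC⟩ := (isCompact_closedBall (0 : Eucl d →L[ℝ] Eucl d) 1).exists_bound_of_continuousOn
    (h1.continuous_fderiv one_ne_zero).continuousOn
  refine ⟨max C 0, le_max_right _ _, fun B hB => ?_⟩
  have := (convex_closedBall (0 : Eucl d →L[ℝ] Eucl d) 1).norm_image_sub_le_of_norm_fderiv_le
    (f := D) (𝕜 := ℝ) (fun x _ => h1.differentiable one_ne_zero x)
    (fun x hx => (hC x hx).trans (le_max_left _ 0)) (Metric.mem_closedBall_self zero_le_one)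
    (mem_closedBall_zero_iff.2 hB)
  simpa [hD, ContinuousLinearMap.det] using this

/-- A bound for the derivative of the determinant near the identity. -/
def detConst (d : ℕ) : ℝ := (exists_abs_det_sub_one_le d).choose

theorem detConst_nonneg : 0 ≤ detConst d := (exists_abs_det_sub_one_le d).choose_spec.1

theorem abs_abs_det_sub_one_le {B : Eucl d →L[ℝ] Eucl d} (hB : ‖B‖ ≤ 1) :
    |(|(1 + B).det|) - 1| ≤ detConst d * ‖B‖ := by
  refine le_trans ?_ ((exists_abs_det_sub_one_le d).choose_spec.2 B hB)
  have := abs_abs_sub_abs_le_abs_sub (1 + B).det 1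
  rwa [abs_one] at this

theorem tendsto_abs_det_sub_one_div (B : Eucl d →L[ℝ] Eucl d) :
    Tendsto (fun t : ℝ => (|(1 + t • B).det| - 1) / t) (𝓝[>] 0)
      (𝓝 (LinearMap.trace ℝ (Eucl d) (B : Eucl d →ₗ[ℝ] Eucl d))) := by
  have h1 := hasDerivAt_det_one_add B
  have h0 : (1 + (0 : ℝ) • B).det = 1 := by simp [ContinuousLinearMap.det]
  have h2 : ∀ᶠ t : ℝ in 𝓝 0, 0 < (1 + t • B).det :=
    h1.continuousAt.eventually (lt_mem_nhds (one_pos.trans_eq h0.symm))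
  have h3 := (h1.tendsto_slope_zero_right)
  refine h3.congr' ?_
  filter_upwards [nhdsWithin_le_nhds h2] with t ht
  rw [zero_add, h0, abs_of_pos ht, smul_eq_mul, div_eq_inv_mul]

end

section

variable {d : ℕ}

/-! ### Transport of `H¹` functions -/

/-- The composition of an `H¹` function with `x ↦ x + W x`, with its gradient. -/
def pull (W : Eucl d → Eucl d) (u : SobPair d) : SobPair d :=
  (fun x => u.1 (shift W x), fun x => u.2 (shift W x)
    + ContinuousLinearMap.adjoint (fderiv ℝ W x) (u.2 (shift W x)))

theorem pull_fst (W : Eucl d → Eucl d) (u : SobPair d) : (pull W u).1 = u.1 ∘ shift W := rfl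

theorem pull_sub (W : Eucl d → Eucl d) (u v : SobPair d) : pull W (u - v) = pull W u - pull W v := by
  refine Prod.ext rfl (funext fun x => ?_)
  change _ - _ + ContinuousLinearMap.adjoint (fderiv ℝ W x) (_ - _) = _ + _ - (_ + _)
  rw [map_sub]
  abel

section Pull

variable {Ω : Set (Eucl d)} {W : Eucl d → Eucl d} {ε : ℝ≥0} {u v : SobPair d}

theorem IsDisplacement.norm_fderiv_le (h : IsDisplacement Ω W ε) (x : Eucl d) :
    ‖fderiv ℝ W x‖ ≤ ε := norm_fderiv_le_of_lipschitzWith h.lip x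

theorem IsDisplacement.norm_adjoint_apply_le (h : IsDisplacement Ω W ε) (x a : Eucl d) :
    ‖ContinuousLinearMap.adjoint (fderiv ℝ W x) a‖ ≤ ε * ‖a‖ := by
  refine (ContinuousLinearMap.le_opNorm _ _).trans ?_
  rw [LinearIsometryEquiv.norm_map]
  gcongr
  exact h.norm_fderiv_le x

theorem IsDisplacement.norm_jet_pull_le (h : IsDisplacement Ω W ε) (x : Eucl d) :
    ‖jet (pull W u) x‖ ≤ 2 * ‖jet u (shift W x)‖ := by
  have h1 : jet (pull W u) x = jet u (shift W x) + jet ((0 : Eucl d → ℝ), fun x =>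
      ContinuousLinearMap.adjoint (fderiv ℝ W x) (u.2 (shift W x))) x := by
    refine (WithLp.equiv 2 (ℝ × Eucl d)).injective (Prod.ext ?_ rfl)
    exact (add_zero _).symm
  rw [h1]
  refine (norm_add_le _ _).trans ?_
  rw [two_mul]
  gcongr
  refine (norm_jet_le _ _).trans ?_
  simp only [Pi.zero_apply, norm_zero, zero_add]
  refine (h.norm_adjoint_apply_le x _).trans ?_
  have := norm_snd_le_jet u (shift W x)
  nlinarith [h.le_real, norm_nonneg (u.2 (shift W x))]

theorem aestronglyMeasurable_adjoint_fderiv {μ : Measure (Eucl d)} {F : Eucl d → Eucl d}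
    (hF : AEStronglyMeasurable F μ) :
    AEStronglyMeasurable (fun x => ContinuousLinearMap.adjoint (fderiv ℝ W x) (F x)) μ := by
  have h1 : AEStronglyMeasurable (fun x => ContinuousLinearMap.adjoint (fderiv ℝ W x)) μ :=
    (ContinuousLinearMap.adjoint (𝕜 := ℝ) (E := Eucl d) (F := Eucl d)).continuous.comp_aestronglyMeasurable
      (measurable_fderiv ℝ W).aestronglyMeasurable
  exact isBoundedBilinearMap_apply.continuous.comp_aestronglyMeasurable (h1.prodMk hF)

theorem IsDisplacement.memLp_jet_pull (h : IsDisplacement Ω W ε)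
    (hu : MemLp (jet u) 2 (volume.restrict Ω)) : MemLp (jet (pull W u)) 2 (volume.restrict Ω) := by
  have h2 : MemLp (u.2 ∘ shift W) 2 (volume.restrict Ω) := h.memLp_comp (memLp_snd hu)
  refine memLp_jet (h.memLp_comp (memLp_fst hu)) (h2.add ?_)
  refine h2.mono (aestronglyMeasurable_adjoint_fderiv h2.1) (Eventually.of_forall fun x => ?_)
  refine (h.norm_adjoint_apply_le x _).trans ?_
  rw [Function.comp_apply]
  nlinarith [h.le_real, norm_nonneg (u.2 (shift W x))]

theorem IsDisplacement.eLpNorm_jet_pull_le (h : IsDisplacement Ω W ε)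
    (hu : MemLp (jet u) 2 (volume.restrict Ω)) :
    eLpNorm (jet (pull W u)) 2 (volume.restrict Ω)
      ≤ (2 * 2 ^ d) * eLpNorm (jet u) 2 (volume.restrict Ω) := by
  calc _ ≤ ENNReal.ofReal 2 * eLpNorm (jet u ∘ shift W) 2 (volume.restrict Ω) :=
        eLpNorm_le_mul_eLpNorm_of_ae_le_mul (Eventually.of_forall fun x => h.norm_jet_pull_le x) 2
    _ ≤ 2 * (2 ^ d * eLpNorm (jet u) 2 (volume.restrict Ω)) := by
        gcongr
        · simp
        · exact h.eLpNorm_comp_le hu.1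
    _ = _ := by rw [mul_assoc]

theorem IsDisplacement.hNorm_pull_le (h : IsDisplacement Ω W ε)
    (hu : MemLp (jet u) 2 (volume.restrict Ω)) :
    hNorm Ω (pull W u) ≤ (2 * 2 ^ d) * hNorm Ω u := by
  have := ENNReal.toReal_mono (ENNReal.mul_ne_top (by finiteness) hu.2.ne) (h.eLpNorm_jet_pull_le hu)
  rw [ENNReal.toReal_mul] at this
  simpa [hNorm] using this

theorem IsDisplacement.jet_pull_ae_eq (h : IsDisplacement Ω W ε) {φ : Eucl d → ℝ}
    (hφ : ContDiff ℝ 1 φ) {μ : Measure (Eucl d)} (hμ : μ ≪ volume) :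
    jet (withGrad (φ ∘ shift W)) =ᵐ[μ] jet (pull W (withGrad φ)) := by
  have hae : ∀ᵐ x : Eucl d, DifferentiableAt ℝ W x := h.lip.ae_differentiableAt
  filter_upwards [hμ.ae_le hae] with x hx
  refine jet_eq_iff.2 ⟨rfl, ?_⟩
  have h1 := ((hφ.differentiable one_ne_zero (shift W x)).hasFDerivAt).comp x
    (IsDisplacement.hasFDerivAt_shift hx)
  refine ext_inner_right ℝ fun a => ?_
  change inner ℝ (gradient (φ ∘ shift W) x) a = inner ℝ (gradient φ (shift W x)
    + ContinuousLinearMap.adjoint (fderiv ℝ W x) (gradient φ (shift W x))) a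
  rw [inner_gradient, h1.fderiv, inner_add_left, ContinuousLinearMap.adjoint_inner_left,
    inner_gradient, inner_gradient, ← map_add]
  rfl

theorem IsDisplacement.exists_lipschitz_comp (h : IsDisplacement Ω W ε) {φ : Eucl d → ℝ}
    (hφ : IsCore φ) : ∃ L, LipschitzWith L (φ ∘ shift W) := by
  obtain ⟨C, hC⟩ := hφ.1.lipschitzWith_of_hasCompactSupport hφ.2 one_ne_zero
  exact ⟨_, hC.comp h.lipschitz_shift⟩

/-- The composition of a `C¹` function with the map is only Lipschitz, but Lipschitz functions
belong to the closure of the `C¹` functions. The general case follows by density, as `pull` is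
bounded. -/
theorem IsDisplacement.inH_pull (h : IsDisplacement Ω W ε) (ho : IsOpen Ω)
    (hb : Bornology.IsBounded Ω) (hu : InH Ω u) : InH Ω (pull W u) := by
  refine InH.of_approx (h.memLp_jet_pull hu.memLp) fun η hη => ?_
  obtain ⟨φ, hφ, hle⟩ := hu.approx (η / (2 * 2 ^ d)) (ENNReal.div_pos hη.ne' (by finiteness))
  obtain ⟨L, hL⟩ := h.exists_lipschitz_comp hφ
  refine ⟨pull W (withGrad φ), (lipschitz_inH hL hb ho).congr (h.jet_pull_ae_eq hφ.1
    Measure.restrict_le_self.absolutelyContinuous), ?_⟩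
  rw [← pull_sub]
  refine (h.eLpNorm_jet_pull_le (memLp_jet_sub hu.memLp hφ.memLp_jet)).trans ?_
  calc _ ≤ (2 * 2 ^ d) * (η / (2 * 2 ^ d)) := by gcongr
    _ ≤ η := ENNReal.mul_div_le

/-- The map fixes `∂Ω` pointwise, so the boundary values of `C¹` functions do not change; density
gives the rest. Consequently `pull W u - u` has zero trace and may test equations that hold only
inside `Ω`. -/
theorem IsDisplacement.traceOn_pull {C : ℝ≥0} (h : IsDisplacement Ω W ε) (hD : TraceDomain Ω C)
    (hu : InH Ω u) : traceOn Ω (pull W u) =ᵐ[surf (frontier Ω)] traceOn Ω u := by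
  have hpu := h.inH_pull hD.isOpen hD.isBounded hu
  have hcore : ∀ φ, IsCore φ → InH Ω (pull W (withGrad φ)) ∧
      traceOn Ω (pull W (withGrad φ)) =ᵐ[surf (frontier Ω)] traceOn Ω (withGrad φ) := by
    intro φ hφ
    obtain ⟨L, hL⟩ := h.exists_lipschitz_comp hφ
    have h1 := lipschitz_inH hL hD.isBounded hD.isOpen
    have hj := h.jet_pull_ae_eq hφ.1 (Measure.restrict_le_self (s := Ω)).absolutelyContinuous
    have h2 := h1.congr hj
    refine ⟨h2, ?_⟩
    have h3 := HasTrace.unique hD h1.memLp h2.memLp (lipschitz_hasTrace hL hD)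
      (h2.hasTrace_traceOn hD) hj
    filter_upwards [h3, traceOn_withGrad hD hφ,
      ae_restrict_mem isClosed_frontier.measurableSet] with x hx1 hx2 hx
    rw [← hx1, hx2, Function.comp_apply, h.shift_of_notMem]
    exact fun hxΩ => (hD.isOpen.inter_frontier_eq ▸ ⟨hxΩ, hx⟩ : x ∈ (∅ : Set (Eucl d)))
  obtain ⟨φ, hφ, hlim⟩ := hu.exists_seq
  have hle : ∀ n, eLpNorm (traceOn Ω (pull W u) - traceOn Ω u) 2 (surf (frontier Ω)) ≤
      (C * (2 * 2 ^ d) + C) * eLpNorm (jet (u - withGrad (φ n))) 2 (volume.restrict Ω) := by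
    intro n
    have hs := hu.sub (hφ n).inH
    have hps := hpu.sub (hcore _ (hφ n)).1
    have e : traceOn Ω (pull W u) - traceOn Ω u =ᵐ[surf (frontier Ω)]
        traceOn Ω (pull W u - pull W (withGrad (φ n))) - traceOn Ω (u - withGrad (φ n)) := by
      filter_upwards [traceOn_sub hD hpu (hcore _ (hφ n)).1, traceOn_sub hD hu (hφ n).inH,
        (hcore _ (hφ n)).2] with x h1 h2 h3
      simp only [Pi.sub_apply] at *
      rw [h1, h2, h3]
      abel
    rw [eLpNorm_congr_ae e]
    refine (eLpNorm_sub_le (hps.memLp_traceOn hD).1 (hs.memLp_traceOn hD).1 one_le_two).trans ?_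
    rw [add_mul]
    refine add_le_add (((hps.hasTrace_traceOn hD).eLpNorm_le hD hps.memLp).trans ?_)
      ((hs.hasTrace_traceOn hD).eLpNorm_le hD hs.memLp)
    rw [← pull_sub, mul_assoc]
    gcongr
    exact h.eLpNorm_jet_pull_le hs.memLp
  have h0 := ge_of_tendsto' (ENNReal.Tendsto.const_mul hlim (Or.inr (by finiteness))) hle
  rw [mul_zero, nonpos_iff_eq_zero, eLpNorm_eq_zero_iff
    ((hpu.memLp_traceOn hD).sub (hu.memLp_traceOn hD)).1 two_ne_zero] at h0
  filter_upwards [h0] with x hx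
  exact sub_eq_zero.1 hx

/-! ### Displacement estimates -/

theorem IsDisplacement.smul (h : IsDisplacement Ω W ε) {s : ℝ} (hs : s ∈ Icc (0 : ℝ) 1) :
    IsDisplacement Ω (fun x => s • W x) ε where
  lip := LipschitzWith.of_dist_le_mul fun x y => by
    rw [dist_smul₀, Real.norm_of_nonneg hs.1]
    have := h.lip.dist_le_mul x y
    nlinarith [hs.2, dist_nonneg (x := W x) (y := W y)]
  bound x := by
    rw [norm_smul, Real.norm_of_nonneg hs.1]
    nlinarith [hs.2, h.bound x, norm_nonneg (W x)]
  zero x hx := by rw [h.zero x hx, smul_zero]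
  le := h.le

/-- The fundamental theorem of calculus on the segment, then Cauchy-Schwarz on `[0, 1]`. -/
theorem enorm_sub_sq_le {φ : Eucl d → ℝ} (hφ : ContDiff ℝ 1 φ) (x w : Eucl d) :
    ‖φ (x + w) - φ x‖ₑ ^ 2 ≤ ‖w‖ₑ ^ 2 * ∫⁻ s in Icc (0 : ℝ) 1, ‖gradient φ (x + s • w)‖ₑ ^ 2 := by
  have hder : ∀ s : ℝ, HasDerivAt (fun s : ℝ => φ (x + s • w)) (inner ℝ (gradient φ (x + s • w)) w) s := by
    intro s
    have h1 : HasDerivAt (fun s : ℝ => x + s • w) w s := by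
      simpa using ((hasDerivAt_id s).smul_const w).const_add x
    have := ((hφ.differentiable one_ne_zero (x + s • w)).hasFDerivAt).comp_hasDerivAt s h1
    rwa [← inner_gradient] at this
  have hc : Continuous fun s : ℝ => gradient φ (x + s • w) :=
    (continuous_gradient hφ).comp (by fun_prop)
  have hc' : Continuous fun s : ℝ => inner ℝ (gradient φ (x + s • w)) w := hc.inner continuous_const
  have hint := intervalIntegral.integral_eq_sub_of_hasDerivAt (a := 0) (b := 1)
    (fun s _ => hder s) (hc'.intervalIntegrable _ _)
  simp only [one_smul, zero_smul, add_zero] at hint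
  rw [intervalIntegral.integral_of_le zero_le_one, ← integral_Icc_eq_integral_Ioc] at hint
  rw [← hint]
  have : IsProbabilityMeasure (volume.restrict (Icc (0 : ℝ) 1)) := ⟨by simp⟩
  have h2 : ‖∫ s in Icc (0 : ℝ) 1, inner ℝ (gradient φ (x + s • w)) w‖ₑ
      ≤ ‖w‖ₑ * eLpNorm (fun s : ℝ => gradient φ (x + s • w)) 2 (volume.restrict (Icc (0 : ℝ) 1)) := by
    refine (enorm_integral_le_lintegral_enorm _).trans ?_
    refine (lintegral_mono (g := fun s => ‖w‖ₑ * ‖gradient φ (x + s • w)‖ₑ) fun s => ?_).trans ?_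
    · change _ ≤ ‖w‖ₑ * ‖gradient φ (x + s • w)‖ₑ
      rw [mul_comm]
      simp only [← ofReal_norm]
      rw [← ENNReal.ofReal_mul (norm_nonneg _)]
      exact ENNReal.ofReal_le_ofReal (norm_inner_le_norm _ _)
    · rw [lintegral_const_mul' _ _ enorm_ne_top, ← eLpNorm_one_eq_lintegral_enorm]
      gcongr
      exact eLpNorm_le_eLpNorm_of_exponent_le one_le_two hc.aestronglyMeasurable
  refine (pow_le_pow_left' h2 2).trans ?_
  rw [mul_pow, eLpNorm_eq_lintegral_rpow_enorm_toReal two_ne_zero ENNReal.ofNat_ne_top]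
  rw [← ENNReal.rpow_natCast (_ ^ _) 2, ← ENNReal.rpow_mul]
  norm_num

/-- Integrate the pointwise bound over `Ω` and exchange the integrals. Every intermediate map `x ↦ x
+ s W x` is again a displacement, so the composition with it costs the same factor `2 ^ d`. -/
theorem IsDisplacement.eLpNorm_comp_sub_le_core (h : IsDisplacement Ω W ε) {φ : Eucl d → ℝ}
    (hφ : IsCore φ) : eLpNorm (φ ∘ shift W - φ) 2 (volume.restrict Ω)
      ≤ ε * (2 ^ d * eLpNorm (gradient φ) 2 (volume.restrict Ω)) := by
  have hWc := h.lip.continuous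
  have hgc := continuous_gradient hφ.1
  have key : ∫⁻ x in Ω, ‖(φ ∘ shift W - φ) x‖ₑ ^ 2
      ≤ ε ^ 2 * (2 ^ d * ∫⁻ x in Ω, ‖gradient φ x‖ₑ ^ 2) := by
    calc _ ≤ ∫⁻ x in Ω, (ε : ℝ≥0∞) ^ 2 *
          ∫⁻ s in Icc (0 : ℝ) 1, ‖gradient φ (x + s • W x)‖ₑ ^ 2 := by
          refine lintegral_mono fun x => (enorm_sub_sq_le hφ.1 x (W x)).trans ?_
          gcongr
          rw [← ofReal_norm, ← ENNReal.ofReal_coe_nnreal]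
          exact ENNReal.ofReal_le_ofReal (h.bound x)
      _ = ε ^ 2 * ∫⁻ s in Icc (0 : ℝ) 1, ∫⁻ x in Ω, ‖gradient φ (x + s • W x)‖ₑ ^ 2 := by
          rw [lintegral_const_mul' _ _ (by finiteness), lintegral_lintegral_swap]
          have : Continuous fun z : Eucl d × ℝ => gradient φ (z.1 + z.2 • W z.1) :=
            hgc.comp (continuous_fst.add (continuous_snd.smul (hWc.comp continuous_fst)))
          exact (this.enorm.measurable.pow_const 2).aemeasurable
      _ ≤ ε ^ 2 * ∫⁻ s in Icc (0 : ℝ) 1, 2 ^ d * ∫⁻ x in Ω, ‖gradient φ x‖ₑ ^ 2 := by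
          gcongr 1
          refine setLIntegral_mono' measurableSet_Icc fun s hs => ?_
          exact (h.smul hs).lintegral_comp_le (hgc.enorm.measurable.pow_const 2)
      _ = _ := by simp
  have hrw : ∀ {E : Type} [NormedAddCommGroup E] (F : Eucl d → E),
      eLpNorm F 2 (volume.restrict Ω) = (∫⁻ x in Ω, ‖F x‖ₑ ^ 2) ^ (1 / 2 : ℝ) := fun F => by
    rw [eLpNorm_eq_lintegral_rpow_enorm_toReal two_ne_zero ENNReal.ofNat_ne_top]
    norm_num
  rw [hrw, hrw]
  refine (ENNReal.rpow_le_rpow key (by norm_num)).trans ?_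
  rw [ENNReal.mul_rpow_of_nonneg _ _ (by norm_num), ENNReal.mul_rpow_of_nonneg _ _ (by norm_num),
    ← ENNReal.rpow_natCast (ε : ℝ≥0∞) 2, ← ENNReal.rpow_mul]
  norm_num
  gcongr
  exact (ENNReal.rpow_le_rpow_of_exponent_le (one_le_pow₀ one_le_two) (by norm_num)).trans_eq
    (ENNReal.rpow_one _)

end Pull

end

/-! ### Lipschitz dependence of the mass and energy forms on the displacement -/

section

variable {d : ℕ}

section Displacement

variable {Ω : Set (Eucl d)} {W : Eucl d → Eucl d} {ε : ℝ≥0} {u v : SobPair d}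

/-- Passage to the limit along `C¹` functions. This first order estimate is the source of the `O(t)`
bounds for the mass form and for the operators `S (ω_t)`. -/
theorem IsDisplacement.eLpNorm_comp_sub_le (h : IsDisplacement Ω W ε) (hu : InH Ω u) :
    eLpNorm (u.1 ∘ shift W - u.1) 2 (volume.restrict Ω)
      ≤ ε * (2 ^ d * eLpNorm (jet u) 2 (volume.restrict Ω)) := by
  obtain ⟨φ, hφ, hlim⟩ := hu.exists_seq
  have hle : ∀ n, eLpNorm (u.1 ∘ shift W - u.1) 2 (volume.restrict Ω) ≤
      (2 ^ d + 1) * eLpNorm (jet (u - withGrad (φ n))) 2 (volume.restrict Ω)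
      + ε * (2 ^ d * (eLpNorm (jet u) 2 (volume.restrict Ω)
        + eLpNorm (jet (u - withGrad (φ n))) 2 (volume.restrict Ω))) := by
    intro n
    have hs := memLp_jet_sub hu.memLp (hφ n).memLp_jet
    have hs1 : MemLp (u.1 - φ n) 2 (volume.restrict Ω) := memLp_fst hs
    have hc := h.memLp_comp hs1
    have hφm : MemLp (φ n) 2 (volume.restrict Ω) := memLp_fst (hφ n).memLp_jet
    have e : u.1 ∘ shift W - u.1
        = ((u.1 - φ n) ∘ shift W - (u.1 - φ n)) + (φ n ∘ shift W - φ n) := by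
      funext x
      simp only [Pi.sub_apply, Pi.add_apply, Function.comp_apply]
      ring
    rw [e]
    refine (eLpNorm_add_le (hc.sub hs1).1 ((h.memLp_comp hφm).sub hφm).1 one_le_two).trans ?_
    refine add_le_add ?_ ((h.eLpNorm_comp_sub_le_core (hφ n)).trans ?_)
    · refine (eLpNorm_sub_le hc.1 hs1.1 one_le_two).trans ?_
      have h1 : eLpNorm (u.1 - φ n) 2 (volume.restrict Ω)
        ≤ eLpNorm (jet (u - withGrad (φ n))) 2 (volume.restrict Ω) :=
        eLpNorm_fst_le_jet (u - withGrad (φ n))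
      calc _ ≤ 2 ^ d * eLpNorm (u.1 - φ n) 2 (volume.restrict Ω)
            + eLpNorm (u.1 - φ n) 2 (volume.restrict Ω) :=
          add_le_add (h.eLpNorm_comp_le hs1.1) le_rfl
        _ = (2 ^ d + 1) * eLpNorm (u.1 - φ n) 2 (volume.restrict Ω) := by rw [add_mul, one_mul]
        _ ≤ _ := by gcongr
    · gcongr
      refine (eLpNorm_snd_le_jet (withGrad (φ n))).trans ?_
      have e : jet (withGrad (φ n)) = jet u - jet (u - withGrad (φ n)) := by
        funext x
        simp only [jet_sub, Pi.sub_apply]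
        abel
      rw [e]
      exact eLpNorm_sub_le hu.memLp.1 hs.1 one_le_two
  have hlim2 : Tendsto (fun n => (2 ^ d + 1) * eLpNorm (jet (u - withGrad (φ n))) 2 (volume.restrict Ω)
      + ε * (2 ^ d * (eLpNorm (jet u) 2 (volume.restrict Ω)
        + eLpNorm (jet (u - withGrad (φ n))) 2 (volume.restrict Ω)))) atTop
      (𝓝 ((2 ^ d + 1) * 0 + ε * (2 ^ d * (eLpNorm (jet u) 2 (volume.restrict Ω) + 0)))) :=
    (ENNReal.Tendsto.const_mul hlim (Or.inr (by finiteness))).add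
      (ENNReal.Tendsto.const_mul (ENNReal.Tendsto.const_mul (hlim.const_add _)
        (Or.inr (by finiteness))) (Or.inr (by finiteness)))
  rw [mul_zero, zero_add, add_zero] at hlim2
  exact ge_of_tendsto' hlim2 hle

theorem IsDisplacement.toReal_comp_sub_le (h : IsDisplacement Ω W ε) (hu : InH Ω u) :
    (eLpNorm (u.1 ∘ shift W - u.1) 2 (volume.restrict Ω)).toReal ≤ ε * (2 ^ d * hNorm Ω u) := by
  have := ENNReal.toReal_mono (ENNReal.mul_ne_top ENNReal.coe_ne_top
    (ENNReal.mul_ne_top (by finiteness) hu.memLp.2.ne)) (h.eLpNorm_comp_sub_le hu)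
  rw [ENNReal.toReal_mul, ENNReal.toReal_mul] at this
  simpa [hNorm] using this

theorem IsDisplacement.toReal_comp_le (h : IsDisplacement Ω W ε) (hu : InH Ω u) :
    (eLpNorm (u.1 ∘ shift W) 2 (volume.restrict Ω)).toReal ≤ 2 ^ d * hNorm Ω u := by
  have h0 := memLp_fst hu.memLp
  have := ENNReal.toReal_mono (ENNReal.mul_ne_top (by finiteness) hu.memLp.2.ne)
    ((h.eLpNorm_comp_le h0.1).trans (mul_le_mul_right (eLpNorm_fst_le_jet u) _))
  rw [ENNReal.toReal_mul] at this
  simpa [hNorm] using this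

theorem IsDisplacement.abs_det_le (h : IsDisplacement Ω W ε) (x : Eucl d) :
    |(|(1 + fderiv ℝ W x).det|) - 1| ≤ detConst d * ε := by
  have h1 := h.norm_fderiv_le x
  refine (abs_abs_det_sub_one_le (h1.trans (by linarith [h.le_real]))).trans ?_
  exact mul_le_mul_of_nonneg_left h1 detConst_nonneg

theorem measurable_abs_det_one_add (W : Eucl d → Eucl d) :
    Measurable fun x => |(1 + fderiv ℝ W x).det| :=
  ((contDiff_det_one_add (d := d)).continuous.measurable.comp (measurable_fderiv ℝ W)).abs

theorem toReal_eLpNorm_mono {A : Set (Eucl d)} (hA : A ⊆ Ω) {F : Eucl d → ℝ}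
    (hF : MemLp F 2 (volume.restrict Ω)) :
    (eLpNorm F 2 (volume.restrict A)).toReal ≤ (eLpNorm F 2 (volume.restrict Ω)).toReal :=
  ENNReal.toReal_mono hF.2.ne (eLpNorm_mono_measure _ (Measure.restrict_mono hA le_rfl))

/-- Change variables and replace the determinant, the first factor and the second factor one at a
time. Each of the three terms is of order `ε`. -/
theorem IsDisplacement.massForm_image_sub_eq (h : IsDisplacement Ω W ε) {A : Set (Eucl d)}
    (hA : MeasurableSet A) (hAΩ : A ⊆ Ω) (hu : InH Ω u) (hv : InH Ω v) :
    massForm (shift W '' A) 1 u v - massForm A 1 u v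
      = (∫ x in A, u.1 (shift W x) * v.1 (shift W x) * (|(1 + fderiv ℝ W x).det| - 1))
        + (∫ x in A, (u.1 (shift W x) - u.1 x) * v.1 (shift W x))
        + ∫ x in A, u.1 x * (v.1 (shift W x) - v.1 x) := by
  have hu1 := (memLp_fst hu.memLp)
  have hv1 := (memLp_fst hv.memLp)
  have hμ := Measure.restrict_mono hAΩ (le_refl (volume : Measure (Eucl d)))
  have huc : MemLp (fun x => u.1 (shift W x)) 2 (volume.restrict A) := (h.memLp_comp hu1).mono_measure hμ
  have hvc : MemLp (fun x => v.1 (shift W x)) 2 (volume.restrict A) := (h.memLp_comp hv1).mono_measure hμ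
  have hu1 := hu1.mono_measure hμ
  have hv1 := hv1.mono_measure hμ
  have i1 := integrable_mul_mul huc hvc (θ := fun x => |(1 + fderiv ℝ W x).det| - 1)
    ((measurable_abs_det_one_add W).sub_const 1).aestronglyMeasurable
    (Eventually.of_forall h.abs_det_le)
  have i2 : Integrable (fun x => (u.1 (shift W x) - u.1 x) * v.1 (shift W x)) (volume.restrict A) :=
    integrable_mul_of_memLp (huc.sub hu1) hvc
  have i3 : Integrable (fun x => u.1 x * (v.1 (shift W x) - v.1 x)) (volume.restrict A) :=
    integrable_mul_of_memLp hu1 (hvc.sub hv1)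
  have i4 := integrable_mul_of_memLp hu1 hv1
  have e1 : massForm (shift W '' A) 1 u v = ∫ x in A,
      |(1 + fderiv ℝ W x).det| * (u.1 (shift W x) * v.1 (shift W x)) := by
    simp only [massForm, Pi.one_apply, mul_one]
    exact h.setIntegral_image hA fun x => u.1 x * v.1 x
  have e2 : massForm A 1 u v = ∫ x in A, u.1 x * v.1 x := by
    simp only [massForm, Pi.one_apply, mul_one]
  have e3 : (∫ x in A, |(1 + fderiv ℝ W x).det| * (u.1 (shift W x) * v.1 (shift W x)))
      = (∫ x in A, u.1 (shift W x) * v.1 (shift W x) * (|(1 + fderiv ℝ W x).det| - 1))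
        + (∫ x in A, (u.1 (shift W x) - u.1 x) * v.1 (shift W x))
        + (∫ x in A, u.1 x * (v.1 (shift W x) - v.1 x)) + ∫ x in A, u.1 x * v.1 x := by
    rw [← integral_add i1 i2, ← integral_add (by exact i1.add i2) i3,
      ← integral_add (by exact (i1.add i2).add i3) i4]
    refine integral_congr_ae (Eventually.of_forall fun x => ?_)
    change _ * _ = _ * _ * _ + _ * _ + _ * _ + _ * _
    ring
  rw [e1, e2, e3]
  ring

/-- A bound for the derivative of `t ↦ ∫_{A_t} u v dx`. -/
def massConst (d : ℕ) : ℝ := detConst d * (2 ^ d * 2 ^ d) + 2 ^ d * 2 ^ d + 2 ^ d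

theorem massConst_nonneg : 0 ≤ massConst d := by
  have := detConst_nonneg (d := d)
  unfold massConst
  positivity

theorem IsDisplacement.abs_massForm_image_sub_le (h : IsDisplacement Ω W ε) {A : Set (Eucl d)}
    (hA : MeasurableSet A) (hAΩ : A ⊆ Ω) (hu : InH Ω u) (hv : InH Ω v) :
    |massForm (shift W '' A) 1 u v - massForm A 1 u v|
      ≤ massConst d * ε * hNorm Ω u * hNorm Ω v := by
  have hu1 := (memLp_fst hu.memLp)
  have hv1 := (memLp_fst hv.memLp)
  have hμ := Measure.restrict_mono hAΩ (le_refl (volume : Measure (Eucl d)))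
  have huc := h.memLp_comp hu1
  have hvc := h.memLp_comp hv1
  have hu0 := hNorm_nonneg (Ω := Ω) (u := u)
  have hv0 := hNorm_nonneg (Ω := Ω) (u := v)
  have b1 := abs_integral_mul_mul_le (huc.mono_measure hμ) (hvc.mono_measure hμ)
    (θ := fun x => |(1 + fderiv ℝ W x).det| - 1) (Eventually.of_forall h.abs_det_le)
  have b2 := abs_integral_mul_le ((huc.sub hu1).mono_measure hμ) (hvc.mono_measure hμ)
  have b3 := abs_integral_mul_le (hu1.mono_measure hμ) ((hvc.sub hv1).mono_measure hμ)
  have c1 := (toReal_eLpNorm_mono hAΩ huc).trans (h.toReal_comp_le hu)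
  have c2 := (toReal_eLpNorm_mono hAΩ hvc).trans (h.toReal_comp_le hv)
  have c3 := (toReal_eLpNorm_mono hAΩ (huc.sub hu1)).trans (h.toReal_comp_sub_le hu)
  have c4 := (toReal_eLpNorm_mono hAΩ (hvc.sub hv1)).trans (h.toReal_comp_sub_le hv)
  have c5 := toReal_fst_le hAΩ hu
  rw [h.massForm_image_sub_eq hA hAΩ hu hv]
  refine (abs_add_le _ _).trans ?_
  have hd0 : 0 ≤ detConst d * (ε : ℝ) := mul_nonneg detConst_nonneg ε.coe_nonneg
  rw [abs_of_nonneg hd0] at b1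
  calc _ ≤ _ := add_le_add ((abs_add_le _ _).trans (add_le_add b1 b2)) b3
    _ ≤ detConst d * ε * ((2 ^ d * hNorm Ω u) * (2 ^ d * hNorm Ω v))
        + (ε * (2 ^ d * hNorm Ω u)) * (2 ^ d * hNorm Ω v)
        + hNorm Ω u * (ε * (2 ^ d * hNorm Ω v)) := by
          gcongr
    _ = _ := by unfold massConst; ring

theorem isBddForm_massForm_image_sub (h : IsDisplacement Ω W ε) {A : Set (Eucl d)}
    (hA : MeasurableSet A) (hAΩ : A ⊆ Ω) (c : ℝ) :
    IsBddForm Ω (fun u v => c * (massForm (shift W '' A) 1 u v - massForm A 1 u v))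
      (|c| * (massConst d * ε)) := by
  have h1 : ∀ B : Set (Eucl d), B ⊆ Ω → IsBddForm Ω (massForm B 1) |1| := fun B hB =>
    isBddForm_massForm hB (measurable_const.aestronglyMeasurable)
      (Eventually.of_forall fun x => by simp)
  have a1 := h1 A hAΩ
  have a2 := h1 (shift W '' A) (by
    rw [← h.image_shift]; exact image_mono hAΩ)
  have : IsBddForm Ω (fun u v => massForm (shift W '' A) 1 u v - massForm A 1 u v)
      (massConst d * ε) :=
    ⟨fun u v hu hv => by rw [a1.symm u v hu hv, a2.symm u v hu hv],
    fun u v w hu hv hw => by rw [a1.add u v w hu hv hw, a2.add u v w hu hv hw]; ring,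
    fun c u v hu hv => by rw [a1.smul c u v hu hv, a2.smul c u v hu hv]; ring,
    fun u v hu hv => h.abs_massForm_image_sub_le hA hAΩ hu hv⟩
  exact this.smul_left' c

/-! ### The transported energy form -/

theorem pull_add (W : Eucl d → Eucl d) (u v : SobPair d) : pull W (u + v) = pull W u + pull W v := by
  refine Prod.ext rfl (funext fun x => ?_)
  change _ + _ + ContinuousLinearMap.adjoint (fderiv ℝ W x) (_ + _) = _ + _ + (_ + _)
  rw [map_add]
  abel

theorem pull_smul (W : Eucl d → Eucl d) (c : ℝ) (u : SobPair d) : pull W (c • u) = c • pull W u := by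
  refine Prod.ext rfl (funext fun x => ?_)
  change _ + ContinuousLinearMap.adjoint (fderiv ℝ W x) (c • _) = c • (_ + _)
  rw [map_smul, smul_add]
  rfl

theorem integrable_inner_of_memLp {E : Type*} [NormedAddCommGroup E] [InnerProductSpace ℝ E]
    {μ : Measure (Eucl d)} {f g : Eucl d → E} (hf : MemLp f 2 μ) (hg : MemLp g 2 μ) :
    Integrable (fun x => (inner ℝ (f x) (g x) : ℝ)) μ := by
  refine (integrable_mul_of_memLp hf.norm hg.norm).mono (hf.1.inner hg.1)
    (Eventually.of_forall fun x => ?_)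
  rw [norm_mul, norm_norm, norm_norm]
  exact norm_inner_le_norm _ _

/-- The integrand of the difference of the transported and the original energy form. -/
def pullDefect (W : Eucl d → Eucl d) (u v : SobPair d) (x : Eucl d) : ℝ :=
  (1 - |(1 + fderiv ℝ W x).det|) * inner ℝ (jet u (shift W x)) (jet v (shift W x))
    + (inner ℝ (ContinuousLinearMap.adjoint (fderiv ℝ W x) (u.2 (shift W x))) (v.2 (shift W x))
      + inner ℝ (u.2 (shift W x)) (ContinuousLinearMap.adjoint (fderiv ℝ W x) (v.2 (shift W x)))
      + inner ℝ (ContinuousLinearMap.adjoint (fderiv ℝ W x) (u.2 (shift W x)))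
        (ContinuousLinearMap.adjoint (fderiv ℝ W x) (v.2 (shift W x))))

/-- Variables are changed in `aForm Ω u v`, not in the transported form. Both integrands are then
evaluated at `shift W x` and their gradients need not be compared at different points. -/
theorem IsDisplacement.aForm_pull_sub_eq (h : IsDisplacement Ω W ε) (hΩ : MeasurableSet Ω)
    (hu : InH Ω u) (hv : InH Ω v) :
    aForm Ω (pull W u) (pull W v) - aForm Ω u v = ∫ x in Ω, pullDefect W u v x := by
  have e1 : aForm Ω (pull W u) (pull W v) = ∫ x in Ω, inner ℝ (jet (pull W u) x) (jet (pull W v) x) := by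
    simp only [aForm, inner_jet]
  have e2 : aForm Ω u v = ∫ x in Ω, |(1 + fderiv ℝ W x).det| *
      inner ℝ (jet u (shift W x)) (jet v (shift W x)) := by
    rw [← h.setIntegral_image hΩ fun x => inner ℝ (jet u x) (jet v x), h.image_shift]
    simp only [aForm, inner_jet]
  have i1 := integrable_inner_of_memLp (h.memLp_jet_pull hu.memLp) (h.memLp_jet_pull hv.memLp)
  have i2 : Integrable (fun x => |(1 + fderiv ℝ W x).det| *
      inner ℝ (jet u (shift W x)) (jet v (shift W x))) (volume.restrict Ω) := by
    refine (integrable_inner_of_memLp (h.memLp_comp hu.memLp) (h.memLp_comp hv.memLp)).bdd_mul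
      (c := detConst d * ε + 1) (measurable_abs_det_one_add W).aestronglyMeasurable
      (Eventually.of_forall fun x => ?_)
    have := abs_le.1 (h.abs_det_le x)
    rw [Real.norm_eq_abs, abs_abs]
    linarith [this.2]
  rw [e1, e2, ← integral_sub i1 i2]
  refine integral_congr_ae (Eventually.of_forall fun x => ?_)
  simp only [pullDefect, inner_jet, pull, inner_add_left, inner_add_right]
  ring

theorem IsDisplacement.abs_pullDefect_le (h : IsDisplacement Ω W ε) (u v : SobPair d) (x : Eucl d) :
    |pullDefect W u v x| ≤ (detConst d + 3) * ε * (‖jet u (shift W x)‖ * ‖jet v (shift W x)‖) := by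
  set y := shift W x
  have a1 := norm_snd_le_jet u y
  have a2 := norm_snd_le_jet v y
  have b1 := (h.norm_adjoint_apply_le x (u.2 y)).trans (mul_le_mul_of_nonneg_left a1 ε.coe_nonneg)
  have b2 := (h.norm_adjoint_apply_le x (v.2 y)).trans (mul_le_mul_of_nonneg_left a2 ε.coe_nonneg)
  have hε1 : (ε : ℝ) ≤ 1 := by linarith [h.le_real]
  have c0 : |1 - (|(1 + fderiv ℝ W x).det|)| ≤ detConst d * ε := by
    rw [abs_sub_comm]; exact h.abs_det_le x
  have hu := norm_nonneg (jet u y)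
  have hv := norm_nonneg (jet v y)
  have c1 : |(1 - |(1 + fderiv ℝ W x).det|) * inner ℝ (jet u y) (jet v y)|
      ≤ (detConst d * ε) * (‖jet u y‖ * ‖jet v y‖) := by
    rw [abs_mul]
    exact mul_le_mul c0 (abs_real_inner_le_norm _ _) (abs_nonneg _)
      (mul_nonneg detConst_nonneg ε.coe_nonneg)
  have c2 := (abs_real_inner_le_norm (ContinuousLinearMap.adjoint (fderiv ℝ W x) (u.2 y)) (v.2 y)).trans
    (mul_le_mul b1 a2 (norm_nonneg _) (mul_nonneg ε.coe_nonneg hu))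
  have c3 := (abs_real_inner_le_norm (u.2 y) (ContinuousLinearMap.adjoint (fderiv ℝ W x) (v.2 y))).trans
    (mul_le_mul a1 b2 (norm_nonneg _) hu)
  have c4 := (abs_real_inner_le_norm (ContinuousLinearMap.adjoint (fderiv ℝ W x) (u.2 y))
    (ContinuousLinearMap.adjoint (fderiv ℝ W x) (v.2 y))).trans
    (mul_le_mul b1 b2 (norm_nonneg _) (mul_nonneg ε.coe_nonneg hu))
  have c5 : ε * ‖jet u y‖ * (ε * ‖jet v y‖) ≤ ε * (‖jet u y‖ * ‖jet v y‖) := by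
    calc _ = ε * ε * (‖jet u y‖ * ‖jet v y‖) := by ring
      _ ≤ 1 * ε * (‖jet u y‖ * ‖jet v y‖) := by gcongr
      _ = _ := by ring
  unfold pullDefect
  refine (abs_add_le _ _).trans ((add_le_add c1 ((abs_add_le _ _).trans
    (add_le_add ((abs_add_le _ _).trans (add_le_add c2 c3)) (c4.trans c5)))).trans_eq ?_)
  ring

/-- A bound for the derivative of the transported energy form. -/
def pullConst (d : ℕ) : ℝ := (detConst d + 3) * (2 ^ d * 2 ^ d)

theorem pullConst_nonneg : 0 ≤ pullConst d := by
  have := detConst_nonneg (d := d)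
  unfold pullConst
  positivity

theorem IsDisplacement.hNorm_comp_le (h : IsDisplacement Ω W ε) (hu : InH Ω u) :
    (eLpNorm (jet u ∘ shift W) 2 (volume.restrict Ω)).toReal ≤ 2 ^ d * hNorm Ω u := by
  have := ENNReal.toReal_mono (ENNReal.mul_ne_top (by finiteness) hu.memLp.2.ne)
    (h.eLpNorm_comp_le hu.memLp.1)
  rw [ENNReal.toReal_mul] at this
  simpa [hNorm] using this

theorem IsDisplacement.abs_aForm_pull_sub_le (h : IsDisplacement Ω W ε) (hΩ : MeasurableSet Ω)
    (hu : InH Ω u) (hv : InH Ω v) :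
    |aForm Ω (pull W u) (pull W v) - aForm Ω u v| ≤ pullConst d * ε * hNorm Ω u * hNorm Ω v := by
  have huc := h.memLp_comp hu.memLp
  have hvc := h.memLp_comp hv.memLp
  have hd0 : 0 ≤ (detConst d + 3) * (ε : ℝ) :=
    mul_nonneg (by linarith [detConst_nonneg (d := d)]) ε.coe_nonneg
  have hv0 := hNorm_nonneg (Ω := Ω) (u := v)
  have hu0 := hNorm_nonneg (Ω := Ω) (u := u)
  rw [h.aForm_pull_sub_eq hΩ hu hv]
  have h1 : |∫ x in Ω, pullDefect W u v x| ≤ ∫ x in Ω, (detConst d + 3) * ε *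
      (‖(jet u ∘ shift W) x‖ * ‖(jet v ∘ shift W) x‖) := by
    rw [← Real.norm_eq_abs]
    exact norm_integral_le_of_norm_le ((integrable_mul_of_memLp huc.norm hvc.norm).const_mul _)
      (Eventually.of_forall fun x => h.abs_pullDefect_le u v x)
  rw [integral_const_mul] at h1
  have h2 := abs_integral_mul_le huc.norm hvc.norm
  rw [eLpNorm_norm, eLpNorm_norm] at h2
  calc _ ≤ _ := h1
    _ ≤ (detConst d + 3) * ε * ((2 ^ d * hNorm Ω u) * (2 ^ d * hNorm Ω v)) := by
        gcongr
        refine (le_abs_self _).trans (h2.trans ?_)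
        gcongr
        · exact h.hNorm_comp_le hu
        · exact h.hNorm_comp_le hv
    _ = _ := by unfold pullConst; ring

theorem isBddForm_aForm_pull_sub (h : IsDisplacement Ω W ε) (ho : IsOpen Ω)
    (hb : Bornology.IsBounded Ω) (c : ℝ) :
    IsBddForm Ω (fun u v => c * (aForm Ω (pull W u) (pull W v) - aForm Ω u v))
      (|c| * (pullConst d * ε)) := by
  have ha : ∀ u v w : SobPair d, InH Ω u → InH Ω v → InH Ω w →
      aForm Ω (u + v) w = aForm Ω u w + aForm Ω v w := fun u v w hu hv hw => by
    have := aForm_sub_left (hu.add hv).memLp hv.memLp hw.memLp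
    rw [add_sub_cancel_right] at this
    linarith
  have hs : ∀ (c : ℝ) (u v : SobPair d), InH Ω u → InH Ω v → aForm Ω (c • u) v = c * aForm Ω u v :=
    fun c u v hu hv => by
      rw [← inner_cls (hu.smul c) hv, ← inner_cls hu hv, cls_smul c hu]
      exact real_inner_smul_left (cls Ω u) (cls Ω v) c
  have hp := fun (u : SobPair d) (hu : InH Ω u) => h.inH_pull ho hb hu
  have : IsBddForm Ω (fun u v => aForm Ω (pull W u) (pull W v) - aForm Ω u v)
      (pullConst d * ε) :=
    ⟨fun u v _ _ => by rw [aForm_comm, aForm_comm (u := u)],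
    fun u v w hu hv hw => by
      rw [pull_add, ha _ _ _ (hp u hu) (hp v hv) (hp w hw), ha _ _ _ hu hv hw]; ring,
    fun c u v hu hv => by
      rw [pull_smul, hs c _ _ (hp u hu) (hp v hv), hs c _ _ hu hv]; ring,
    fun u v hu hv => h.abs_aForm_pull_sub_le ho.measurableSet hu hv⟩
  exact this.smul_left' c

end Displacement

end

section

variable {d : ℕ}

/-! ### Limits along `T_t = id + tV` -/

/-- `V` is a bounded Lipschitz field with support in `Ω`. -/
structure IsField (Ω : Set (Eucl d)) (V : Eucl d → Eucl d) (K : ℝ≥0) : Prop where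
  lip : LipschitzWith K V
  bound : ∀ x, ‖V x‖ ≤ K
  zero : ∀ x, x ∉ Ω → V x = 0

theorem shift_smul (V : Eucl d → Eucl d) (t : ℝ) : shift (t • V) = flow V t := rfl

theorem tendsto_diffQuot {φ : Eucl d → ℝ} {x : Eucl d} (hφ : DifferentiableAt ℝ φ x) (v : Eucl d) :
    Tendsto (fun t : ℝ => (φ (x + t • v) - φ x) / t) (𝓝[>] 0) (𝓝 (inner ℝ (gradient φ x) v)) := by
  have h1 : HasDerivAt (fun s : ℝ => x + s • v) v 0 := by
    simpa using ((hasDerivAt_id (0 : ℝ)).smul_const v).const_add x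
  have h0 : x = x + (0 : ℝ) • v := by simp
  have h2 : HasFDerivAt φ (fderiv ℝ φ x) (x + (0 : ℝ) • v) := h0 ▸ hφ.hasFDerivAt
  have h3 := (h2.comp_hasDerivAt 0 h1).tendsto_slope_zero_right
  rw [inner_gradient]
  refine h3.congr fun t => ?_
  simp [div_eq_inv_mul]

section Field

variable {Ω : Set (Eucl d)} {V : Eucl d → Eucl d} {K : ℝ≥0} {u v : SobPair d}

theorem IsField.displacement (h : IsField Ω V K) {t : ℝ} (ht : 0 ≤ t) (htK : t * K ≤ 1 / 4) :
    IsDisplacement Ω (t • V) (t.toNNReal * K) where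
  lip := LipschitzWith.of_dist_le_mul fun x y => by
    rw [Pi.smul_apply, Pi.smul_apply, dist_smul₀, Real.norm_of_nonneg ht, NNReal.coe_mul,
      Real.coe_toNNReal t ht, mul_assoc]
    exact mul_le_mul_of_nonneg_left (h.lip.dist_le_mul x y) ht
  bound x := by
    rw [Pi.smul_apply, norm_smul, Real.norm_of_nonneg ht, NNReal.coe_mul, Real.coe_toNNReal t ht]
    exact mul_le_mul_of_nonneg_left (h.bound x) ht
  zero x hx := by rw [Pi.smul_apply, h.zero x hx, smul_zero]
  le := by
    rw [← NNReal.coe_le_coe, NNReal.coe_mul, Real.coe_toNNReal t ht]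
    exact_mod_cast htK

theorem eventually_pos_mul_le (K : ℝ≥0) {c : ℝ} (hc : 0 < c) :
    ∀ᶠ t : ℝ in 𝓝[>] 0, 0 < t ∧ t * K ≤ c := by
  have h1 : Tendsto (fun t : ℝ => t * K) (𝓝[>] 0) (𝓝 0) := by
    have : Tendsto (fun t : ℝ => t * K) (𝓝 0) (𝓝 (0 * K)) := tendsto_id.mul_const _
    rw [zero_mul] at this
    exact this.mono_left nhdsWithin_le_nhds
  filter_upwards [self_mem_nhdsWithin, h1.eventually (ge_mem_nhds hc)] with t h2 h3
  exact ⟨h2, h3⟩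

theorem IsField.eventually_displacement (h : IsField Ω V K) :
    ∀ᶠ t : ℝ in 𝓝[>] 0, 0 < t ∧ IsDisplacement Ω (t • V) (t.toNNReal * K) :=
  (eventually_pos_mul_le K (by norm_num : (0 : ℝ) < 1 / 4)).mono fun _ ht =>
    ⟨ht.1, h.displacement ht.1.le ht.2⟩

theorem IsField.memLp_inner (h : IsField Ω V K) {μ : Measure (Eucl d)} {F : Eucl d → Eucl d}
    (hF : MemLp F 2 μ) : MemLp (fun x => inner ℝ (F x) (V x)) 2 μ := by
  refine (hF.norm.const_mul (K : ℝ)).mono (hF.1.inner h.lip.continuous.aestronglyMeasurable)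
    (Eventually.of_forall fun x => ?_)
  rw [norm_mul, norm_norm, Real.norm_of_nonneg K.coe_nonneg, mul_comm]
  exact (abs_real_inner_le_norm _ _).trans (mul_le_mul_of_nonneg_left (h.bound x) (norm_nonneg _))

theorem IsField.isBddFunctional_integral_inner (h : IsField Ω V K)
    {f : Eucl d → ℝ} (hf : MemLp f 2 (volume.restrict Ω)) :
    IsBddFunctional Ω (fun v => ∫ x in Ω, f x * inner ℝ (v.2 x) (V x))
      ((eLpNorm f 2 (volume.restrict Ω)).toReal * K) where
  add u v hu hv := by
    rw [← integral_add (integrable_mul_of_memLp hf (h.memLp_inner (memLp_snd hu.memLp)))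
      (integrable_mul_of_memLp hf (h.memLp_inner (memLp_snd hv.memLp)))]
    refine integral_congr_ae (Eventually.of_forall fun x => ?_)
    simp only [Prod.snd_add, Pi.add_apply, inner_add_left]; ring
  smul c u hu := by
    rw [← integral_const_mul]
    refine integral_congr_ae (Eventually.of_forall fun x => ?_)
    simp only [Prod.smul_snd, Pi.smul_apply, real_inner_smul_left]; ring
  bound u hu := by
    refine (abs_integral_mul_le hf (h.memLp_inner (memLp_snd hu.memLp))).trans ?_
    rw [mul_assoc]
    refine mul_le_mul_of_nonneg_left ?_ ENNReal.toReal_nonneg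
    have := eLpNorm_le_nnreal_smul_eLpNorm_of_ae_le_mul (f := fun x => inner ℝ (u.2 x) (V x))
      (g := jet u) (c := K) (μ := volume.restrict Ω) (Eventually.of_forall fun x => by
        rw [← NNReal.coe_le_coe]
        push_cast
        exact (abs_real_inner_le_norm _ _).trans ((mul_le_mul (norm_snd_le_jet u x) (h.bound x)
          (norm_nonneg _) (norm_nonneg _)).trans_eq (mul_comm _ _))) 2
    exact (ENNReal.toReal_mono (by
      rw [ENNReal.smul_def, smul_eq_mul]
      exact ENNReal.mul_ne_top ENNReal.coe_ne_top hu.memLp.2.ne) this).trans_eq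
      (by simp [ENNReal.smul_def, ENNReal.toReal_mul, hNorm])

theorem IsField.abs_diffQuot_le (h : IsField Ω V K) {φ : Eucl d → ℝ} {L : ℝ≥0}
    (hL : LipschitzWith L φ) {t : ℝ} (ht : 0 < t) (x : Eucl d) :
    |(φ (flow V t x) - φ x) / t| ≤ L * K := by
  rw [abs_div, abs_of_pos ht, div_le_iff₀ ht]
  have h1 := hL.dist_le_mul (flow V t x) x
  rw [Real.dist_eq, dist_eq_norm, flow, add_sub_cancel_left, norm_smul,
    Real.norm_of_nonneg ht.le] at h1
  refine h1.trans ?_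
  calc _ ≤ (L : ℝ) * (t * K) := by gcongr; exact h.bound x
    _ = _ := by ring

/-- The difference quotients along the flow converge weakly in `L²` to the derivative along `V`. -/
theorem IsField.tendsto_integral_diffQuot (h : IsField Ω V K) (hb : Bornology.IsBounded Ω)
    {g : Eucl d → ℝ} (hg : MemLp g 2 (volume.restrict Ω)) (hu : InH Ω u) :
    Tendsto (fun t : ℝ => ∫ x in Ω, g x * ((u.1 (flow V t x) - u.1 x) / t)) (𝓝[>] 0)
      (𝓝 (∫ x in Ω, g x * inner ℝ (u.2 x) (V x))) := by
  set G := (eLpNorm g 2 (volume.restrict Ω)).toReal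
  have hquot : ∀ t : ℝ, IsDisplacement Ω (t • V) (t.toNNReal * K) → ∀ u : SobPair d, InH Ω u →
      MemLp (fun x => (u.1 (flow V t x) - u.1 x) / t) 2 (volume.restrict Ω) := by
    intro t ht u hu
    have h1 := memLp_fst hu.memLp
    have := ((ht.memLp_comp h1).sub h1).mul_const (t⁻¹)
    exact this
  -- The constant is the displacement estimate for size `t K`, divided by `t`; with this uniform
  -- bound `C¹` functions suffice.
  refine tendsto_functional_of_core (Ω := Ω)
    (ℓt := fun t u => ∫ x in Ω, g x * ((u.1 (flow V t x) - u.1 x) / t))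
    (ℓ := fun u => ∫ x in Ω, g x * inner ℝ (u.2 x) (V x))
    (K := G * (K * 2 ^ d)) (by positivity) ?_ ?_ ?_ hu
  · filter_upwards [h.eventually_displacement] with t ⟨ht0, ht⟩
    refine ⟨fun u v hu hv => ?_, fun c u hu => ?_, fun u hu => ?_⟩
    · rw [← integral_add (integrable_mul_of_memLp hg (hquot t ht u hu))
        (integrable_mul_of_memLp hg (hquot t ht v hv))]
      refine integral_congr_ae (Eventually.of_forall fun x => ?_)
      simp only [Prod.fst_add, Pi.add_apply]
      ring
    · rw [← integral_const_mul]
      refine integral_congr_ae (Eventually.of_forall fun x => ?_)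
      simp only [Prod.smul_fst, Pi.smul_apply, smul_eq_mul]
      ring
    · refine (abs_integral_mul_le hg (hquot t ht u hu)).trans ?_
      rw [mul_assoc]
      refine mul_le_mul_of_nonneg_left ?_ ENNReal.toReal_nonneg
      have e : (fun x => (u.1 (flow V t x) - u.1 x) / t) = t⁻¹ • (u.1 ∘ shift (t • V) - u.1) := by
        funext x
        simp [shift_smul, div_eq_inv_mul]
      rw [e, eLpNorm_const_smul, ENNReal.toReal_mul, toReal_enorm, norm_inv,
        Real.norm_of_nonneg ht0.le]
      have := ht.toReal_comp_sub_le hu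
      rw [NNReal.coe_mul, Real.coe_toNNReal t ht0.le] at this
      calc _ ≤ t⁻¹ * (t * K * (2 ^ d * hNorm Ω u)) := by gcongr
        _ = _ := by field_simp
  · refine (h.isBddFunctional_integral_inner hg).mono (mul_le_mul_of_nonneg_left ?_
      ENNReal.toReal_nonneg)
    exact le_mul_of_one_le_right K.coe_nonneg (one_le_pow₀ one_le_two)
  · intro φ hφ
    obtain ⟨L, hL⟩ := hφ.1.lipschitzWith_of_hasCompactSupport hφ.2 one_ne_zero
    have : IsFiniteMeasure ((volume : Measure (Eucl d)).restrict Ω) :=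
      ⟨by rw [Measure.restrict_apply_univ]; exact hb.measure_lt_top⟩
    have hfin : Integrable g (volume.restrict Ω) := hg.integrable one_le_two
    refine tendsto_integral_filter_of_dominated_convergence (fun x => |g x| * (L * K)) ?_ ?_
      (hfin.abs.mul_const _) ?_
    · filter_upwards [h.eventually_displacement] with t ⟨ht0, ht⟩
      exact hg.1.mul (hquot t ht _ hφ.inH).1
    · filter_upwards [h.eventually_displacement] with t ⟨ht0, ht⟩
      refine Eventually.of_forall fun x => ?_
      rw [norm_mul, Real.norm_eq_abs]
      exact mul_le_mul_of_nonneg_left (h.abs_diffQuot_le hL ht0 x) (abs_nonneg _)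
    · refine Eventually.of_forall fun x => ?_
      exact (tendsto_diffQuot (hφ.1.differentiable one_ne_zero x) (V x)).const_mul (g x)

theorem fderiv_smul_field (V : Eucl d → Eucl d) (t : ℝ) (x : Eucl d) :
    fderiv ℝ (t • V) x = t • fderiv ℝ V x := by
  rw [fderiv_const_smul_field]; rfl

theorem tendsto_flow (V : Eucl d → Eucl d) (x : Eucl d) :
    Tendsto (fun t : ℝ => flow V t x) (𝓝[>] 0) (𝓝 x) := by
  have : Tendsto (fun t : ℝ => x + t • V x) (𝓝 0) (𝓝 (x + (0 : ℝ) • V x)) :=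
    (tendsto_id.smul_const (V x)).const_add x
  rw [zero_smul, add_zero] at this
  exact this.mono_left nhdsWithin_le_nhds

/-- The derivative of volume integrals of `C¹` functions along the flow. -/
theorem IsField.tendsto_integral_image (h : IsField Ω V K) {A : Set (Eucl d)}
    (hA : MeasurableSet A) (hb : Bornology.IsBounded A) {g : Eucl d → ℝ} (hg : IsCore g) :
    Tendsto (fun t : ℝ => ((∫ x in flow V t '' A, g x) - ∫ x in A, g x) / t) (𝓝[>] 0)
      (𝓝 (∫ x in A, (inner ℝ (gradient g x) (V x) + g x * divergence V x))) := by
  obtain ⟨L, hL⟩ := hg.1.lipschitzWith_of_hasCompactSupport hg.2 one_ne_zero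
  obtain ⟨M, hM⟩ := hg.2.exists_bound_of_continuous hg.1.continuous
  have : IsFiniteMeasure ((volume : Measure (Eucl d)).restrict A) :=
    ⟨by rw [Measure.restrict_apply_univ]; exact hb.measure_lt_top⟩
  have hdet : ∀ t : ℝ, IsDisplacement Ω (t • V) (t.toNNReal * K) → ∀ x,
      |(1 + t • fderiv ℝ V x).det| ≤ detConst d + 1 := fun t ht x => by
    have h1 := (abs_le.1 (ht.abs_det_le x)).2
    rw [fderiv_smul_field] at h1
    have h2 := mul_le_mul_of_nonneg_left ht.le_real (detConst_nonneg (d := d))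
    linarith [detConst_nonneg (d := d)]
  have hdm : ∀ t : ℝ, Measurable fun x => |(1 + t • fderiv ℝ V x).det| := fun t => by
    have := measurable_abs_det_one_add (t • V)
    simpa only [fderiv_smul_field] using this
  have hgm : ∀ t : ℝ, Measurable fun x => g (flow V t x) := fun t =>
    hg.1.continuous.measurable.comp (by
      unfold flow
      exact measurable_id.add (h.lip.continuous.measurable.const_smul t))
  have hdq := fun t (ht0 : 0 < t) x => h.abs_diffQuot_le hL ht0 x
  -- A discrete product rule: the quotient splits into the determinant times the quotient of `g`,
  -- plus `g` times the quotient of the determinant. Both parts are bounded uniformly in `x`.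
  have hlim : Tendsto (fun t : ℝ => ∫ x in A,
      (|(1 + t • fderiv ℝ V x).det| * ((g (flow V t x) - g x) / t)
        + g x * ((|(1 + t • fderiv ℝ V x).det| - 1) / t))) (𝓝[>] 0)
      (𝓝 (∫ x in A, (inner ℝ (gradient g x) (V x) + g x * divergence V x))) := by
    refine tendsto_integral_filter_of_dominated_convergence
      (fun _ => (detConst d + 1) * (L * K) + M * (detConst d * K)) ?_ ?_ (integrable_const _) ?_
    · exact Eventually.of_forall fun t => (((hdm t).mul (((hgm t).sub
        hg.1.continuous.measurable).div_const t)).add (hg.1.continuous.measurable.mul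
        (((hdm t).sub_const 1).div_const t))).aestronglyMeasurable
    · filter_upwards [h.eventually_displacement] with t ⟨ht0, ht⟩
      refine Eventually.of_forall fun x => (norm_add_le _ _).trans (add_le_add ?_ ?_)
      · rw [norm_mul, Real.norm_eq_abs, Real.norm_eq_abs, abs_abs]
        exact mul_le_mul (hdet t ht x) (hdq t ht0 x) (abs_nonneg _)
          (by linarith [detConst_nonneg (d := d)])
      · rw [norm_mul, norm_div, Real.norm_of_nonneg ht0.le]
        refine mul_le_mul (hM x) ?_ (by positivity) ((norm_nonneg _).trans (hM x))
        rw [div_le_iff₀ ht0]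
        have := ht.abs_det_le x
        rw [fderiv_smul_field, NNReal.coe_mul, Real.coe_toNNReal t ht0.le] at this
        rw [Real.norm_eq_abs]
        linarith
    · refine Eventually.of_forall fun x => ?_
      have h1 : Tendsto (fun t : ℝ => |(1 + t • fderiv ℝ V x).det|) (𝓝[>] 0) (𝓝 1) := by
        have : Continuous fun t : ℝ => |(1 + t • fderiv ℝ V x).det| :=
          ((contDiff_det_one_add (d := d)).continuous.comp
            (continuous_id.smul continuous_const)).abs
        have h0 : Tendsto (fun t : ℝ => |(1 + t • fderiv ℝ V x).det|) (𝓝 0)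
          (𝓝 |(1 + (0 : ℝ) • fderiv ℝ V x).det|) := this.tendsto 0
        have h2 : |(1 + (0 : ℝ) • fderiv ℝ V x).det| = 1 := by simp [ContinuousLinearMap.det]
        rw [h2] at h0
        exact h0.mono_left nhdsWithin_le_nhds
      have h2 := (h1.mul (tendsto_diffQuot (hg.1.differentiable one_ne_zero x) (V x))).add
        ((tendsto_abs_det_sub_one_div (fderiv ℝ V x)).const_mul (g x))
      rw [one_mul] at h2
      exact h2
  refine hlim.congr' ?_
  filter_upwards [h.eventually_displacement] with t ⟨ht0, ht⟩
  have e1 := ht.setIntegral_image hA g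
  rw [shift_smul] at e1
  simp only [fderiv_smul_field] at e1
  rw [e1]
  have i1 : Integrable (fun x => |(1 + t • fderiv ℝ V x).det| * g (flow V t x)) (volume.restrict A) := by
    refine Integrable.of_bound ((hdm t).mul (hgm t)).aestronglyMeasurable ((detConst d + 1) * M)
      (Eventually.of_forall fun x => ?_)
    rw [norm_mul, Real.norm_eq_abs, abs_abs]
    exact mul_le_mul (hdet t ht x) (hM _) (norm_nonneg _) (by linarith [detConst_nonneg (d := d)])
  have i2 : Integrable g (volume.restrict A) :=
    Integrable.of_bound hg.1.continuous.aestronglyMeasurable M (Eventually.of_forall hM)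
  rw [← integral_sub i1 i2, ← integral_div]
  refine integral_congr_ae (Eventually.of_forall fun x => ?_)
  field_simp
  ring

/-- The derivative of the transported energy form. -/
def energyForm (Ω : Set (Eucl d)) (V : Eucl d → Eucl d) (u v : SobPair d) : ℝ :=
  ∫ x in Ω, (aPrime V x (u.2 x) (v.2 x) + divergence V x * (u.1 x * v.1 x))

theorem abs_divergence_le (h : LipschitzWith K V) (x : Eucl d) : |divergence V x| ≤ d * K := by
  rw [divergence, LinearMap.trace_eq_sum_inner _ (EuclideanSpace.basisFun (Fin d) ℝ)]
  refine (Finset.abs_sum_le_sum_abs _ _).trans ?_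
  have : ∀ i ∈ Finset.univ, |inner ℝ (EuclideanSpace.basisFun (Fin d) ℝ i)
      ((fderiv ℝ V x : Eucl d →ₗ[ℝ] Eucl d) (EuclideanSpace.basisFun (Fin d) ℝ i))| ≤ (K : ℝ) := by
    intro i _
    refine (abs_real_inner_le_norm _ _).trans ?_
    have h1 := (fderiv ℝ V x).le_opNorm (EuclideanSpace.basisFun (Fin d) ℝ i)
    rw [OrthonormalBasis.norm_eq_one, mul_one] at h1
    rw [OrthonormalBasis.norm_eq_one, one_mul]
    exact h1.trans (norm_fderiv_le_of_lipschitzWith h x)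
  refine (Finset.sum_le_sum this).trans_eq ?_
  simp

theorem measurable_divergence (V : Eucl d → Eucl d) : Measurable (divergence V) := by
  have : Continuous fun B : Eucl d →L[ℝ] Eucl d => LinearMap.trace ℝ (Eucl d) (B : Eucl d →ₗ[ℝ] Eucl d) := by
    have := ((LinearMap.trace ℝ (Eucl d)).comp
      (ContinuousLinearMap.coeLM ℝ : (Eucl d →L[ℝ] Eucl d) →ₗ[ℝ] (Eucl d →ₗ[ℝ] Eucl d))).continuous_of_finiteDimensional
    exact this
  exact this.measurable.comp (measurable_fderiv ℝ V)

theorem abs_energyIntegrand_le (h : LipschitzWith K V) (u v : SobPair d) (x : Eucl d) :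
    |aPrime V x (u.2 x) (v.2 x) + divergence V x * (u.1 x * v.1 x)|
      ≤ (d + 2) * K * (‖jet u x‖ * ‖jet v x‖) := by
  have h1 : aPrime V x (u.2 x) (v.2 x) + divergence V x * (u.1 x * v.1 x)
      = divergence V x * inner ℝ (jet u x) (jet v x) - inner ℝ (u.2 x) (fderiv ℝ V x (v.2 x))
        - inner ℝ (fderiv ℝ V x (u.2 x)) (v.2 x) := by
    rw [aPrime, inner_jet]; ring
  have hf := norm_fderiv_le_of_lipschitzWith h x
  have a1 := norm_snd_le_jet u x
  have a2 := norm_snd_le_jet v x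
  have hu := norm_nonneg (jet u x)
  have hv := norm_nonneg (jet v x)
  have b1 : ‖fderiv ℝ V x (u.2 x)‖ ≤ K * ‖jet u x‖ :=
    ((fderiv ℝ V x).le_opNorm _).trans (mul_le_mul hf a1 (norm_nonneg _) K.coe_nonneg)
  have b2 : ‖fderiv ℝ V x (v.2 x)‖ ≤ K * ‖jet v x‖ :=
    ((fderiv ℝ V x).le_opNorm _).trans (mul_le_mul hf a2 (norm_nonneg _) K.coe_nonneg)
  have c1 : |divergence V x * inner ℝ (jet u x) (jet v x)| ≤ (d * K) * (‖jet u x‖ * ‖jet v x‖) := by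
    rw [abs_mul]
    exact mul_le_mul (abs_divergence_le h x) (abs_real_inner_le_norm _ _) (abs_nonneg _) (by positivity)
  have c2 := (abs_real_inner_le_norm (u.2 x) (fderiv ℝ V x (v.2 x))).trans
    (mul_le_mul a1 b2 (norm_nonneg _) hu)
  have c3 := (abs_real_inner_le_norm (fderiv ℝ V x (u.2 x)) (v.2 x)).trans
    (mul_le_mul b1 a2 (norm_nonneg _) (by positivity))
  rw [h1]
  refine (abs_sub _ _).trans ((add_le_add ((abs_sub _ _).trans (add_le_add c1 c2)) c3).trans_eq ?_)
  ring

theorem integrable_energyIntegrand (h : LipschitzWith K V) (hu : InH Ω u) (hv : InH Ω v) :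
    Integrable (fun x => aPrime V x (u.2 x) (v.2 x) + divergence V x * (u.1 x * v.1 x))
      (volume.restrict Ω) := by
  refine ((integrable_mul_of_memLp hu.memLp.norm hv.memLp.norm).const_mul ((d + 2) * K : ℝ)).mono' ?_
    (Eventually.of_forall fun x => abs_energyIntegrand_le h u v x)
  have hd := (measurable_divergence V).aestronglyMeasurable (μ := volume.restrict Ω)
  have hu2 := (memLp_snd hu.memLp).1
  have hv2 := (memLp_snd hv.memLp).1
  have hf : ∀ F : Eucl d → Eucl d, AEStronglyMeasurable F (volume.restrict Ω) →
      AEStronglyMeasurable (fun x => fderiv ℝ V x (F x)) (volume.restrict Ω) := fun F hF =>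
    isBoundedBilinearMap_apply.continuous.comp_aestronglyMeasurable
      ((measurable_fderiv ℝ V).aestronglyMeasurable.prodMk hF)
  exact (((hd.mul (hu2.inner hv2)).sub (hu2.inner (hf _ hv2))).sub ((hf _ hu2).inner hv2)).add
    (hd.mul ((memLp_fst hu.memLp).1.mul (memLp_fst hv.memLp).1))

theorem isBddForm_energyForm (h : LipschitzWith K V) : IsBddForm Ω (energyForm Ω V) ((d + 2) * K) where
  symm u v _ _ := integral_congr_ae (Eventually.of_forall fun x => by
    simp only [aPrime]
    rw [real_inner_comm, real_inner_comm (fderiv ℝ V x (v.2 x)),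
      real_inner_comm (v.2 x) (fderiv ℝ V x (u.2 x))]
    ring)
  add u v w hu hv hw := by
    rw [energyForm, energyForm, energyForm, ← integral_add (integrable_energyIntegrand h hu hw)
      (integrable_energyIntegrand h hv hw)]
    refine integral_congr_ae (Eventually.of_forall fun x => ?_)
    simp only [aPrime, Prod.fst_add, Prod.snd_add, Pi.add_apply, inner_add_left, map_add]
    ring
  smul c u v hu hv := by
    rw [energyForm, energyForm, ← integral_const_mul]
    refine integral_congr_ae (Eventually.of_forall fun x => ?_)
    simp only [aPrime, Prod.smul_fst, Prod.smul_snd, Pi.smul_apply, real_inner_smul_left, map_smul,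
      smul_eq_mul]
    ring
  bound u v hu hv := by
    have h1 : |energyForm Ω V u v| ≤ ∫ x in Ω, (d + 2) * K * (‖jet u x‖ * ‖jet v x‖) := by
      rw [← Real.norm_eq_abs]
      exact norm_integral_le_of_norm_le ((integrable_mul_of_memLp hu.memLp.norm
        hv.memLp.norm).const_mul _) (Eventually.of_forall fun x => abs_energyIntegrand_le h u v x)
    rw [integral_const_mul] at h1
    have h2 := abs_integral_mul_le hu.memLp.norm hv.memLp.norm
    rw [eLpNorm_norm, eLpNorm_norm] at h2
    rw [mul_assoc]
    exact h1.trans (mul_le_mul_of_nonneg_left ((le_abs_self _).trans h2) (by positivity))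

theorem IsCore.exists_jet_bound {φ : Eucl d → ℝ} (hφ : IsCore φ) :
    ∃ M, 0 ≤ M ∧ ∀ x, ‖jet (withGrad φ) x‖ ≤ M := by
  obtain ⟨L, hL⟩ := hφ.1.lipschitzWith_of_hasCompactSupport hφ.2 one_ne_zero
  obtain ⟨M, hM⟩ := hφ.2.exists_bound_of_continuous hφ.1.continuous
  refine ⟨M + L, add_nonneg ((norm_nonneg _).trans (hM 0)) L.coe_nonneg, fun x =>
    (norm_jet_le _ _).trans (add_le_add (hM x) ?_)⟩
  rw [withGrad_snd, norm_gradient]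
  exact norm_fderiv_le_of_lipschitzWith hL x

theorem IsCore.continuous_jet {φ : Eucl d → ℝ} (hφ : IsCore φ) : Continuous (jet (withGrad φ)) :=
  (WithLp.prod_continuous_toLp 2 ℝ (Eucl d)).comp
    (hφ.1.continuous.prodMk (continuous_gradient hφ.1))

theorem aestronglyMeasurable_pullDefect {W : Eucl d → Eucl d} (hW : Continuous (shift W))
    {φ ψ : Eucl d → ℝ} (hφ : IsCore φ) (hψ : IsCore ψ) {μ : Measure (Eucl d)} :
    AEStronglyMeasurable (pullDefect W (withGrad φ) (withGrad ψ)) μ := by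
  have a1 := (hφ.continuous_jet.comp hW).aestronglyMeasurable (μ := μ)
  have a2 := (hψ.continuous_jet.comp hW).aestronglyMeasurable (μ := μ)
  have b1 := ((continuous_gradient hφ.1).comp hW).aestronglyMeasurable (μ := μ)
  have b2 := ((continuous_gradient hψ.1).comp hW).aestronglyMeasurable (μ := μ)
  have c1 := aestronglyMeasurable_adjoint_fderiv (W := W) b1
  have c2 := aestronglyMeasurable_adjoint_fderiv (W := W) b2
  exact (((measurable_const.sub (measurable_abs_det_one_add W)).aestronglyMeasurable).mul
    (a1.inner a2)).add (((c1.inner b2).add (b1.inner c2)).add (c1.inner c2))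

/-- The minus sign appears because the functions are transported here, whereas the form with `A'`
arises when the domain is transported. The uniform bound of `pullDefect` reduces the claim to `C¹`
functions and to a pointwise limit. -/
theorem IsField.tendsto_aForm_pull (h : IsField Ω V K) (ho : IsOpen Ω) (hb : Bornology.IsBounded Ω)
    (hu : InH Ω u) (hv : InH Ω v) :
    Tendsto (fun t : ℝ => t⁻¹ * (aForm Ω (pull (t • V) u) (pull (t • V) v) - aForm Ω u v)) (𝓝[>] 0)
      (𝓝 (- energyForm Ω V u v)) := by
  have : IsFiniteMeasure ((volume : Measure (Eucl d)).restrict Ω) :=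
    ⟨by rw [Measure.restrict_apply_univ]; exact hb.measure_lt_top⟩
  have hE : IsBddForm Ω (fun u v => - energyForm Ω V u v) ((d + 2) * K) := by
    have := (isBddForm_energyForm (Ω := Ω) h.lip).smul_left' (-1)
    simpa using this
  refine tendsto_form_of_core (K := max (pullConst d * K) ((d + 2) * K))
    (βt := fun t u v => t⁻¹ * (aForm Ω (pull (t • V) u) (pull (t • V) v) - aForm Ω u v))
    (β := fun u v => - energyForm Ω V u v)
    (le_max_of_le_right (by positivity)) ?_ ?_ ?_ hu hv
  · filter_upwards [h.eventually_displacement] with t ⟨ht0, ht⟩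
    have h1 := isBddForm_aForm_pull_sub ht ho hb t⁻¹
    refine ⟨h1.symm, h1.add, h1.smul, fun u v hu hv => (h1.bound u v hu hv).trans ?_⟩
    have hv0 := hNorm_nonneg (Ω := Ω) (u := v)
    have hu0 := hNorm_nonneg (Ω := Ω) (u := u)
    gcongr
    rw [abs_of_pos (inv_pos.2 ht0), NNReal.coe_mul, Real.coe_toNNReal t ht0.le]
    refine le_trans (le_of_eq ?_) (le_max_left _ _)
    field_simp
  · refine ⟨hE.symm, hE.add, hE.smul, fun u v hu hv => (hE.bound u v hu hv).trans ?_⟩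
    have hv0 := hNorm_nonneg (Ω := Ω) (u := v)
    have hu0 := hNorm_nonneg (Ω := Ω) (u := u)
    gcongr
    exact le_max_right _ _
  · intro φ ψ hφ hψ
    obtain ⟨M, hM0, hM⟩ := hφ.exists_jet_bound
    obtain ⟨N, hN0, hN⟩ := hψ.exists_jet_bound
    have hlim : Tendsto (fun t : ℝ => ∫ x in Ω, t⁻¹ * pullDefect (t • V) (withGrad φ) (withGrad ψ) x)
        (𝓝[>] 0) (𝓝 (∫ x in Ω, -(aPrime V x (gradient φ x) (gradient ψ x)
          + divergence V x * (φ x * ψ x)))) := by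
      refine tendsto_integral_filter_of_dominated_convergence
        (fun _ => (detConst d + 3) * K * (M * N)) ?_ ?_ (integrable_const _) ?_
      · filter_upwards [h.eventually_displacement] with t ⟨ht0, ht⟩
        exact (aestronglyMeasurable_pullDefect ht.lipschitz_shift.continuous hφ hψ).const_mul _
      · filter_upwards [h.eventually_displacement] with t ⟨ht0, ht⟩
        refine Eventually.of_forall fun x => ?_
        rw [norm_mul, norm_inv, Real.norm_of_nonneg ht0.le, Real.norm_eq_abs, inv_mul_le_iff₀ ht0]
        refine (ht.abs_pullDefect_le _ _ x).trans ?_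
        rw [NNReal.coe_mul, Real.coe_toNNReal t ht0.le]
        have := detConst_nonneg (d := d)
        calc _ ≤ (detConst d + 3) * (t * K) * (M * N) := by
              gcongr
              · exact hM _
              · exact hN _
          _ = _ := by ring
      · refine Eventually.of_forall fun x => ?_
        set B := fderiv ℝ V x with hB
        have hfl := tendsto_flow V x
        have j1 := (hφ.continuous_jet.tendsto x).comp hfl
        have j2 := (hψ.continuous_jet.tendsto x).comp hfl
        have a1 := ((continuous_gradient hφ.1).tendsto x).comp hfl
        have a2 := ((continuous_gradient hψ.1).tendsto x).comp hfl
        have b1 := ((ContinuousLinearMap.adjoint B).continuous.tendsto _).comp a1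
        have b2 := ((ContinuousLinearMap.adjoint B).continuous.tendsto _).comp a2
        have t0 : Tendsto (fun t : ℝ => t) (𝓝[>] 0) (𝓝 0) := nhdsWithin_le_nhds
        have hl := ((tendsto_abs_det_sub_one_div B).neg.mul (j1.inner (𝕜 := ℝ) j2)).add
          (((b1.inner (𝕜 := ℝ) a2).add (a1.inner (𝕜 := ℝ) b2)).add
            (t0.mul (b1.inner (𝕜 := ℝ) b2)))
        have hval : -(aPrime V x (gradient φ x) (gradient ψ x) + divergence V x * (φ x * ψ x))
            = -(LinearMap.trace ℝ (Eucl d) (B : Eucl d →ₗ[ℝ] Eucl d)) *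
              inner ℝ (jet (withGrad φ) x) (jet (withGrad ψ) x) +
              (inner ℝ (ContinuousLinearMap.adjoint B (gradient φ x)) (gradient ψ x)
              + inner ℝ (gradient φ x) (ContinuousLinearMap.adjoint B (gradient ψ x))
              + 0 * inner ℝ (ContinuousLinearMap.adjoint B (gradient φ x))
                (ContinuousLinearMap.adjoint B (gradient ψ x))) := by
          rw [aPrime, inner_jet, ContinuousLinearMap.adjoint_inner_left,
            ContinuousLinearMap.adjoint_inner_right, divergence, withGrad_fst, withGrad_fst,
            withGrad_snd, withGrad_snd]
          ring
        rw [hval]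
        refine hl.congr' ?_
        filter_upwards [self_mem_nhdsWithin] with t ht0
        have ht0 : t ≠ 0 := (Set.mem_Ioi.1 ht0).ne'
        have had : ContinuousLinearMap.adjoint (t • B) = t • ContinuousLinearMap.adjoint B := by
          rw [map_smulₛₗ]; simp
        simp only [pullDefect, fderiv_smul_field, ← hB, had, shift_smul, Function.comp_apply,
          smul_apply, real_inner_smul_left, real_inner_smul_right, withGrad_snd]
        field_simp
        ring
    have e0 : (∫ x in Ω, -(aPrime V x (gradient φ x) (gradient ψ x)
          + divergence V x * (φ x * ψ x))) = - energyForm Ω V (withGrad φ) (withGrad ψ) := by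
      rw [integral_neg]; rfl
    rw [e0] at hlim
    refine hlim.congr' ?_
    filter_upwards [h.eventually_displacement] with t ⟨ht0, ht⟩
    rw [integral_const_mul, ← ht.aForm_pull_sub_eq ho.measurableSet hφ.inH hψ.inH]

/-- Transport by maps that tend to the identity is strongly continuous. -/
theorem tendsto_hNorm_pull_sub {W : ℝ → Eucl d → Eucl d} {ε : ℝ → ℝ≥0}
    (ho : IsOpen Ω) (hb : Bornology.IsBounded Ω)
    (hW : ∀ᶠ t in 𝓝[>] 0, IsDisplacement Ω (W t) (ε t)) (hε : Tendsto ε (𝓝[>] 0) (𝓝 0))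
    (hu : InH Ω u) : Tendsto (fun t => hNorm Ω (pull (W t) u - u)) (𝓝[>] 0) (𝓝 0) := by
  have : IsFiniteMeasure ((volume : Measure (Eucl d)).restrict Ω) :=
    ⟨by rw [Measure.restrict_apply_univ]; exact hb.measure_lt_top⟩
  set m : ℝ := ((volume.restrict Ω : Measure (Eucl d)) univ ^ (2 : ℝ≥0∞).toReal⁻¹).toReal
  -- For compactly supported `C¹` functions the convergence is uniform in `x`, by uniform continuity
  -- of the gradient.
  have hcore : ∀ φ, IsCore φ → ∀ η : ℝ, 0 < η →
      ∀ᶠ t in 𝓝[>] 0, hNorm Ω (pull (W t) (withGrad φ) - withGrad φ) ≤ m * (3 * η) := by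
    intro φ hφ η hη
    obtain ⟨L, hL⟩ := hφ.1.lipschitzWith_of_hasCompactSupport hφ.2 one_ne_zero
    have huc : UniformContinuous (gradient φ) := by
      refine HasCompactSupport.uniformContinuous_of_continuous ?_ (continuous_gradient hφ.1)
      exact (hφ.2.fderiv ℝ).comp_left (g := (InnerProductSpace.toDual ℝ (Eucl d)).symm) (map_zero _)
    obtain ⟨δ, hδ, huc⟩ := Metric.uniformContinuous_iff.1 huc η hη
    have hε' : Tendsto (fun t => (ε t : ℝ)) (𝓝[>] 0) (𝓝 0) :=
      (NNReal.continuous_coe.tendsto 0).comp hε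
    have hεL : Tendsto (fun t => (ε t : ℝ) * L) (𝓝[>] 0) (𝓝 0) := by
      simpa using hε'.mul_const (L : ℝ)
    filter_upwards [hW, hε'.eventually (gt_mem_nhds hδ), hεL.eventually (gt_mem_nhds hη)]
      with t ht h1 h2
    have hpt : ∀ x, ‖jet (pull (W t) (withGrad φ) - withGrad φ) x‖ ≤ 3 * η := by
      intro x
      have hd : dist (shift (W t) x) x ≤ ε t := by
        rw [dist_eq_norm, shift, add_sub_cancel_left]; exact ht.bound x
      have c1 : ‖φ (shift (W t) x) - φ x‖ ≤ η := by
        rw [← dist_eq_norm]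
        refine (hL.dist_le_mul _ _).trans ?_
        nlinarith [L.coe_nonneg]
      have c2 : ‖gradient φ (shift (W t) x) - gradient φ x‖ ≤ η := by
        rw [← dist_eq_norm]
        exact (huc (hd.trans_lt h1)).le
      have c3 : ‖ContinuousLinearMap.adjoint (fderiv ℝ (W t) x) (gradient φ (shift (W t) x))‖ ≤ η := by
        refine (ht.norm_adjoint_apply_le x _).trans (le_trans ?_ h2.le)
        refine mul_le_mul_of_nonneg_left ?_ (ε t).coe_nonneg
        rw [norm_gradient]
        exact norm_fderiv_le_of_lipschitzWith hL _
      refine (norm_jet_le _ _).trans ?_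
      change ‖φ (shift (W t) x) - φ x‖ + ‖(gradient φ (shift (W t) x)
        + ContinuousLinearMap.adjoint (fderiv ℝ (W t) x) (gradient φ (shift (W t) x))) - gradient φ x‖ ≤ _
      rw [add_sub_right_comm]
      linarith [norm_add_le (gradient φ (shift (W t) x) - gradient φ x)
        (ContinuousLinearMap.adjoint (fderiv ℝ (W t) x) (gradient φ (shift (W t) x)))]
    have h3 := eLpNorm_le_of_ae_bound (p := 2) (μ := volume.restrict Ω) (Eventually.of_forall hpt)
    have h4 := ENNReal.toReal_mono (ENNReal.mul_ne_top (by finiteness) ENNReal.ofReal_ne_top) h3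
    rwa [ENNReal.toReal_mul, ENNReal.toReal_ofReal (by positivity)] at h4
  have hm0 : 0 ≤ m := ENNReal.toReal_nonneg
  refine Metric.tendsto_nhds.2 fun η hη => ?_
  -- The factor `2 * 2 ^ d + 1` bounds the operator `pull - id`, so the approximation error
  -- contributes less than `η / 2`.
  obtain ⟨φ, hφ, hlt⟩ := hu.exists_hNorm_lt (ε := η / (2 * (2 * 2 ^ d + 1))) (by positivity)
  filter_upwards [hW, hcore φ hφ (η / (6 * (m + 1))) (by positivity)] with t ht h1
  rw [Real.dist_eq, sub_zero, abs_of_nonneg hNorm_nonneg]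
  have hs := hu.sub (hφ.inH (Ω := Ω))
  have hps := ht.inH_pull ho hb hs
  have hpφ := ht.inH_pull ho hb (hφ.inH (Ω := Ω))
  have e : pull (W t) u - u = (pull (W t) (u - withGrad φ) - (u - withGrad φ))
      + (pull (W t) (withGrad φ) - withGrad φ) := by
    rw [pull_sub]; abel
  rw [e]
  have b1 := hNorm_add_le (hps.sub hs) (hpφ.sub hφ.inH)
  have b2 := hNorm_sub_le hps hs
  have b3 := ht.hNorm_pull_le hs.memLp
  have b4 : m * (3 * (η / (6 * (m + 1)))) < η / 2 := by
    rw [show m * (3 * (η / (6 * (m + 1)))) = (η / 2) * (m / (m + 1)) by field_simp; ring]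
    have : m / (m + 1) < 1 := by rw [div_lt_one (by positivity)]; linarith
    nlinarith
  have b5 : (2 * 2 ^ d + 1) * hNorm Ω (u - withGrad φ) < η / 2 := by
    calc _ < (2 * 2 ^ d + 1) * (η / (2 * (2 * 2 ^ d + 1))) := by gcongr
      _ = η / 2 := by field_simp
  linarith

end Field

end

section

variable {d : ℕ}

/-! ### Graphs over hyperplanes -/

variable {m : ℕ}

/-- Isometric coordinates on the hyperplane orthogonal to the unit vector `e`. -/
structure Frame (e : Eucl (m + 1)) where
  Q : Eucl m →ₗᵢ[ℝ] Eucl (m + 1)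
  orth : ∀ y, inner ℝ (Q y) e = 0
  surj : ∀ x, inner ℝ x e = 0 → ∃ y, Q y = x

theorem exists_frame {e : Eucl (m + 1)} (he : ‖e‖ = 1) : Nonempty (Frame e) := by
  have hfr : Fact (Module.finrank ℝ (Eucl (m + 1)) = m + 1) := ⟨by simp⟩
  have he0 : e ≠ 0 := by rintro rfl; simp at he
  let b := OrthonormalBasis.fromOrthogonalSpanSingleton (𝕜 := ℝ) m he0
  refine ⟨⟨(ℝ ∙ e)ᗮ.subtypeₗᵢ.comp b.repr.symm.toLinearIsometry, fun y => ?_, fun x hx => ?_⟩⟩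
  · exact Submodule.inner_left_of_mem_orthogonal (Submodule.mem_span_singleton_self e)
      (b.repr.symm y).2
  · have hx' : x ∈ (ℝ ∙ e)ᗮ := by
      rw [Submodule.mem_orthogonal_singleton_iff_inner_left]; exact hx
    exact ⟨b.repr ⟨x, hx'⟩, by simp⟩

section Frame

variable {e : Eucl (m + 1)} (F : Frame e) {g : Eucl (m + 1) → ℝ} {L : ℝ≥0}

/-- The coordinates `(y, s) ↦ Q y + s e`. -/
def Frame.coord (z : Eucl m × ℝ) : Eucl (m + 1) := F.Q z.1 + z.2 • e

theorem Frame.inner_coord (he : ‖e‖ = 1) (z : Eucl m × ℝ) : inner ℝ (F.coord z) e = z.2 := by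
  rw [coord, inner_add_left, F.orth, real_inner_smul_left, real_inner_self_eq_norm_sq, he]
  ring

theorem Frame.coord_sub (he : ‖e‖ = 1) (z : Eucl m × ℝ) :
    F.coord z - (inner ℝ (F.coord z) e) • e = F.Q z.1 := by
  rw [F.inner_coord he, coord, add_sub_cancel_right]

theorem Frame.norm_coord_sq (he : ‖e‖ = 1) (z : Eucl m × ℝ) :
    ‖F.coord z‖ ^ 2 = ‖z.1‖ ^ 2 + ‖z.2‖ ^ 2 := by
  have : inner ℝ (F.Q z.1) (z.2 • e) = 0 := by rw [real_inner_smul_right, F.orth, mul_zero]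
  rw [coord, norm_add_sq_real, this, norm_smul, he, LinearIsometry.norm_map]
  ring

theorem Frame.exists_coord (he : ‖e‖ = 1) (x : Eucl (m + 1)) :
    ∃ y, F.coord (y, inner ℝ x e) = x := by
  obtain ⟨y, hy⟩ := F.surj (x - (inner ℝ x e) • e) (by
    rw [inner_sub_left, real_inner_smul_left, real_inner_self_eq_norm_sq, he]; ring)
  exact ⟨y, by rw [coord, hy, sub_add_cancel]⟩

theorem Frame.continuous_coord : Continuous F.coord :=
  (F.Q.continuous.comp continuous_fst).add (continuous_snd.smul continuous_const)

theorem Frame.measurePreserving_coord (he : ‖e‖ = 1) :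
    MeasurePreserving F.coord volume volume := by
  let M : WithLp 2 (Eucl m × ℝ) →ₗ[ℝ] Eucl (m + 1) :=
    { toFun := fun z => F.coord (WithLp.ofLp z)
      map_add' := fun z w => by
        simp only [coord, WithLp.ofLp_add, Prod.fst_add, Prod.snd_add, map_add, add_smul]; abel
      map_smul' := fun c z => by
        simp only [coord, WithLp.ofLp_smul, Prod.smul_fst, Prod.smul_snd, map_smul, smul_add,
          smul_smul, smul_eq_mul, RingHom.id_apply] }
  have hM : ∀ z, ‖M z‖ = ‖z‖ := fun z => by
    have h1 := F.norm_coord_sq he (WithLp.ofLp z)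
    have h2 := WithLp.prod_norm_sq_eq_of_L2 z
    rw [← sq_eq_sq₀ (norm_nonneg _) (norm_nonneg _), h2]
    exact h1
  let M' : WithLp 2 (Eucl m × ℝ) →ₗᵢ[ℝ] Eucl (m + 1) := ⟨M, hM⟩
  have hfin : Module.finrank ℝ (WithLp 2 (Eucl m × ℝ)) = Module.finrank ℝ (Eucl (m + 1)) := by
    rw [LinearEquiv.finrank_eq (WithLp.linearEquiv 2 ℝ (Eucl m × ℝ))]
    simp
  let M'' := M'.toLinearIsometryEquiv hfin
  have h1 := M''.measurePreserving
  exact h1.comp (WithLp.volume_preserving_toLp (Eucl m) ℝ)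

theorem Frame.measurableEmbedding_coord (he : ‖e‖ = 1) : MeasurableEmbedding F.coord := by
  refine F.continuous_coord.measurableEmbedding fun z w h => ?_
  have h1 : F.coord (z - w) = F.coord z - F.coord w := by
    simp only [coord, Prod.fst_sub, Prod.snd_sub, map_sub, sub_smul]; abel
  have h2 := F.norm_coord_sq he (z - w)
  rw [h1, h, sub_self, norm_zero] at h2
  have h3 : ‖(z - w).1‖ = 0 := by nlinarith [norm_nonneg (z - w).1, sq_nonneg ‖(z - w).2‖]
  have h4 : ‖(z - w).2‖ = 0 := by nlinarith [norm_nonneg (z - w).2, sq_nonneg ‖(z - w).1‖]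
  exact sub_eq_zero.1 (Prod.ext (norm_eq_zero.1 h3) (norm_eq_zero.1 h4))

/-- The graph map `y ↦ Q y + g (Q y) e`. -/
def Frame.graph (g : Eucl (m + 1) → ℝ) (y : Eucl m) : Eucl (m + 1) := F.coord (y, g (F.Q y))

theorem Frame.inner_graph (he : ‖e‖ = 1) (y : Eucl m) : inner ℝ (F.graph g y) e = g (F.Q y) :=
  F.inner_coord he _

theorem Frame.graph_sub (he : ‖e‖ = 1) (y : Eucl m) :
    F.graph g y - (inner ℝ (F.graph g y) e) • e = F.Q y := F.coord_sub he _

theorem Frame.range_graph (he : ‖e‖ = 1) (g : Eucl (m + 1) → ℝ) :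
    range (F.graph g) = {x | inner ℝ x e = g (x - (inner ℝ x e) • e)} := by
  ext x
  constructor
  · rintro ⟨y, rfl⟩
    rw [mem_ofPred_eq, F.graph_sub he, F.inner_graph he]
  · intro hx
    obtain ⟨y, hy⟩ := F.exists_coord he x
    refine ⟨y, ?_⟩
    have h1 := F.coord_sub he (y, inner ℝ x e)
    rw [hy] at h1
    rw [mem_ofPred_eq, h1] at hx
    rw [graph, ← hx, hy]

theorem Frame.lipschitz_graph (he : ‖e‖ = 1) (hg : LipschitzWith L g) :
    LipschitzWith (1 + L) (F.graph g) := by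
  have h1 : LipschitzWith L fun y => g (F.Q y) • e := by
    refine LipschitzWith.of_dist_le_mul fun y z => ?_
    rw [dist_eq_norm, ← sub_smul, norm_smul, he, mul_one, ← dist_eq_norm, ← F.Q.dist_map y z]
    exact hg.dist_le_mul _ _
  exact F.Q.lipschitz.add h1

/-- The orthogonal projection along `e` inverts the graph map and does not increase distances. -/
theorem Frame.antilipschitz_graph (he : ‖e‖ = 1) : AntilipschitzWith 1 (F.graph g) := by
  refine AntilipschitzWith.of_le_mul_dist fun y z => ?_
  have h1 : F.graph g y - F.graph g z = F.coord (y - z, g (F.Q y) - g (F.Q z)) := by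
    simp only [graph, coord, map_sub, sub_smul]; abel
  have h2 := F.norm_coord_sq he (y - z, g (F.Q y) - g (F.Q z))
  rw [← h1] at h2
  rw [NNReal.coe_one, one_mul, dist_eq_norm, dist_eq_norm]
  refine abs_le_of_sq_le_sq' ?_ (norm_nonneg _) |>.2
  rw [h2]
  nlinarith [sq_nonneg ‖g (F.Q y) - g (F.Q z)‖]

end Frame

/-! ### The area formula for bi-Lipschitz maps -/

/-- The directional difference quotients are bounded below by a multiple of `‖k‖`, and the bound
survives in the limit. -/
theorem injective_fderiv_of_antilipschitz {X Y : Type*} [NormedAddCommGroup X] [NormedSpace ℝ X]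
    [NormedAddCommGroup Y] [NormedSpace ℝ Y] {ψ : X → Y} {c : ℝ≥0} (h : AntilipschitzWith c ψ)
    {x : X} (hd : DifferentiableAt ℝ ψ x) : Function.Injective (fderiv ℝ ψ x) := by
  rw [injective_iff_map_eq_zero]
  intro k hk
  have h1 : Tendsto (fun t : ℝ => t⁻¹ • (ψ (x + t • k) - ψ x)) (𝓝[>] 0) (𝓝 (fderiv ℝ ψ x k)) := by
    have := (hd.hasFDerivAt.hasLineDerivAt k).tendsto_slope_zero_right
    simpa using this
  have h2 : ∀ᶠ t : ℝ in 𝓝[>] 0, ‖k‖ ≤ c * ‖t⁻¹ • (ψ (x + t • k) - ψ x)‖ := by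
    filter_upwards [self_mem_nhdsWithin] with t ht
    have ht : 0 < t := ht
    have := h.le_mul_dist (x + t • k) x
    rw [dist_eq_norm, dist_eq_norm, add_sub_cancel_left, norm_smul, Real.norm_of_nonneg ht.le] at this
    rw [norm_smul, norm_inv, Real.norm_of_nonneg ht.le]
    calc ‖k‖ = t⁻¹ * (t * ‖k‖) := by field_simp
      _ ≤ t⁻¹ * (c * ‖ψ (x + t • k) - ψ x‖) := by gcongr
      _ = _ := by ring
  have h3 := ge_of_tendsto (h1.norm.const_mul (c : ℝ)) h2
  rw [hk, norm_zero, mul_zero] at h3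
  exact norm_le_zero_iff.1 h3

/-- The points of non-differentiability form a null set by Rademacher's theorem, and their image has
measure zero because `ψ` is Lipschitz. At the other points the lower Lipschitz bound makes the
derivative injective. -/
theorem euclideanHausdorffMeasure_image_eq_of_bilipschitz {ψ : Eucl m → Eucl d} {K c : ℝ≥0}
    (hL : LipschitzWith K ψ) (hA : AntilipschitzWith c ψ) {s : Set (Eucl m)} (hs : MeasurableSet s) :
    μHE[m] (ψ '' s) = ∫⁻ x in s, ENNReal.ofReal (fderiv ℝ ψ x).toLinearMap.normDet := by
  have hae : ∀ᵐ x : Eucl m, DifferentiableAt ℝ ψ x := hL.ae_differentiableAt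
  set N := {x : Eucl m | ¬ DifferentiableAt ℝ ψ x} with hN
  have hN0 : volume N = 0 := hae
  have hNm : MeasurableSet N := (measurableSet_of_differentiableAt ℝ ψ).compl
  have himN : μHE[m] (ψ '' N) = 0 := by
    have := euclideanHausdorffMeasure_image_le_of_edist_le (f := ψ) (g := id) (s := N)
      (K := K) (fun x _ y _ => hL x y) m
    rw [EuclideanSpace.euclideanHausdorffMeasure_eq_volume, image_id, hN0, mul_zero] at this
    exact le_antisymm this zero_le
  have h1 : μHE[m] (ψ '' (s \ N)) = μHE[m] (ψ '' s) := by
    rw [image_sdiff hA.injective]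
    exact measure_sdiff_null himN
  have h2 : (s \ N : Set (Eucl m)) =ᵐ[volume] s := sdiff_null_ae_eq_self hN0
  rw [← h1, ← setLIntegral_congr h2]
  exact euclideanHausdorffMeasure_image_eq_lintegral (hs.diff hNm) (fun x hx => not_not.1 hx.2)
    (fun x hx => injective_fderiv_of_antilipschitz hA (not_not.1 hx.2)) hA.injective.injOn

end

section

variable {d : ℕ}

/-! ### Domains that are locally subgraphs -/

variable {m : ℕ}

theorem surf_eq (S : Set (Eucl (m + 1))) : surf S = (μHE[m] : Measure (Eucl (m + 1))).restrict S := rfl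

/-- In `B(x, r)`, the set `D` lies below the graph of the Lipschitz function `g` in direction `e`. -/
structure SubgraphNear (D : Set (Eucl (m + 1))) (x e : Eucl (m + 1)) (g : Eucl (m + 1) → ℝ)
    (L : ℝ≥0) (r : ℝ) : Prop where
  norm_eq : ‖e‖ = 1
  lip : LipschitzWith L g
  pos : 0 < r
  mem_iff : ∀ y ∈ Metric.ball x r, y ∈ D ↔ inner ℝ y e < g (y - (inner ℝ y e) • e)

section Subgraph

variable {D : Set (Eucl (m + 1))} {x e : Eucl (m + 1)} {g : Eucl (m + 1) → ℝ} {L : ℝ≥0} {r : ℝ}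

/-- The Jacobian of the graph map. -/
def Frame.jac (F : Frame e) (g : Eucl (m + 1) → ℝ) (y : Eucl m) : ℝ :=
  (fderiv ℝ (F.graph g) y).toLinearMap.normDet

theorem Frame.measurable_jac (F : Frame e) : Measurable (F.jac g) :=
  continuous_normDet.measurable.comp (measurable_fderiv ℝ (F.graph g))

theorem Frame.jac_nonneg (F : Frame e) (y : Eucl m) : 0 ≤ F.jac g y := LinearMap.normDet_nonneg _

/-- The surface measure on the graph. -/
def Frame.graphMeasure (F : Frame e) (g : Eucl (m + 1) → ℝ) : Measure (Eucl (m + 1)) :=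
  (volume.withDensity fun y => ENNReal.ofReal (F.jac g y)).map (F.graph g)

theorem Frame.measurableEmbedding_graph (F : Frame e) (he : ‖e‖ = 1) (hg : LipschitzWith L g) :
    MeasurableEmbedding (F.graph g) :=
  (F.lipschitz_graph he hg).continuous.measurableEmbedding (F.antilipschitz_graph he).injective

theorem Frame.restrict_range_eq (F : Frame e) (he : ‖e‖ = 1) (hg : LipschitzWith L g) :
    (μHE[m] : Measure (Eucl (m + 1))).restrict (range (F.graph g)) = F.graphMeasure g := by
  have hm := (F.measurableEmbedding_graph he hg).measurable
  refine Measure.ext fun A hA => ?_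
  rw [graphMeasure, Measure.map_apply hm hA, withDensity_apply _ (hm hA), Measure.restrict_apply hA,
    ← image_preimage_eq_inter_range]
  exact euclideanHausdorffMeasure_image_eq_of_bilipschitz (F.lipschitz_graph he hg)
    (F.antilipschitz_graph he) (hm hA)

/-- The Lipschitz constant of the graph map is enough for the trace inequality; the exact Jacobian
enters only in the Gauss-Green formula. -/
theorem Frame.graphMeasure_le (F : Frame e) (he : ‖e‖ = 1) (hg : LipschitzWith L g) :
    F.graphMeasure g ≤ ((1 + L : ℝ≥0) : ℝ≥0∞) ^ m • volume.map (F.graph g) := by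
  have hm := (F.measurableEmbedding_graph he hg).measurable
  rw [← F.restrict_range_eq he hg]
  refine Measure.le_iff.2 fun A hA => ?_
  rw [Measure.restrict_apply hA, ← image_preimage_eq_inter_range, Measure.smul_apply,
    Measure.map_apply hm hA, smul_eq_mul]
  have := euclideanHausdorffMeasure_image_le_of_edist_le (f := F.graph g) (g := id)
    (s := F.graph g ⁻¹' A) (K := 1 + L) (fun x _ y _ => F.lipschitz_graph he hg x y) m
  rwa [EuclideanSpace.euclideanHausdorffMeasure_eq_volume, image_id] at this

theorem Frame.integral_graphMeasure (F : Frame e) (he : ‖e‖ = 1) (hg : LipschitzWith L g)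
    (h : Eucl (m + 1) → ℝ) :
    ∫ x, h x ∂(F.graphMeasure g) = ∫ y, F.jac g y * h (F.graph g y) := by
  rw [graphMeasure, (F.measurableEmbedding_graph he hg).integral_map,
    integral_withDensity_eq_integral_toReal_smul F.measurable_jac.ennreal_ofReal
      (Eventually.of_forall fun _ => ENNReal.ofReal_lt_top)]
  refine integral_congr_ae (Eventually.of_forall fun y => ?_)
  simp only [ENNReal.toReal_ofReal (F.jac_nonneg y), smul_eq_mul]

theorem SubgraphNear.isOpen_subgraph (h : SubgraphNear D x e g L r) :
    IsOpen {y : Eucl (m + 1) | inner ℝ y e < g (y - (inner ℝ y e) • e)} := by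
  have := h.lip.continuous
  exact isOpen_lt (by fun_prop) (by fun_prop)

/-- Strict inequalities persist nearby. At equality `y` itself is outside `D`, while the points `y -
t • e` with small `t > 0` are inside. -/
theorem SubgraphNear.mem_frontier_iff (h : SubgraphNear D x e g L r) {y : Eucl (m + 1)}
    (hy : y ∈ Metric.ball x r) :
    y ∈ frontier D ↔ inner ℝ y e = g (y - (inner ℝ y e) • e) := by
  have hc := h.lip.continuous
  have hf : Continuous fun y : Eucl (m + 1) => inner ℝ y e - g (y - (inner ℝ y e) • e) := by fun_prop
  have hB := Metric.isOpen_ball.mem_nhds hy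
  have hmem : ∀ z ∈ Metric.ball x r, z ∈ D ↔ inner ℝ z e - g (z - (inner ℝ z e) • e) < 0 :=
    fun z hz => (h.mem_iff z hz).trans sub_neg.symm
  rw [← sub_eq_zero]
  constructor
  · intro hfr
    rcases lt_trichotomy (inner ℝ y e - g (y - (inner ℝ y e) • e)) 0 with hlt | heq | hgt
    · exfalso
      refine hfr.2 (mem_interior_iff_mem_nhds.2 ?_)
      filter_upwards [hB, hf.continuousAt.eventually (gt_mem_nhds hlt)] with z hz h1
      exact (hmem z hz).2 h1
    · exact heq
    · exfalso
      have h2 : ∀ᶠ z in 𝓝 y, z ∉ D := by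
        filter_upwards [hB, hf.continuousAt.eventually (lt_mem_nhds hgt)] with z hz h1
        rw [hmem z hz]
        exact not_lt.2 h1.le
      exact (mem_closure_iff_frequently.1 hfr.1) h2
  · intro heq
    rw [frontier_eq_closure_inter_closure]
    refine ⟨?_, subset_closure fun hD => (heq.not_lt) ((hmem y hy).1 hD)⟩
    have hlim : Tendsto (fun t : ℝ => y - t • e) (𝓝[>] 0) (𝓝 y) := by
      have : Tendsto (fun t : ℝ => y - t • e) (𝓝 0) (𝓝 (y - (0 : ℝ) • e)) :=
        (tendsto_id.smul_const e).const_sub y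
      rw [zero_smul, sub_zero] at this
      exact this.mono_left nhdsWithin_le_nhds
    refine mem_closure_of_tendsto hlim ?_
    filter_upwards [self_mem_nhdsWithin, hlim.eventually hB] with t ht hz
    rw [hmem _ hz]
    have e1 : inner ℝ (y - t • e) e = inner ℝ y e - t := by
      rw [inner_sub_left, real_inner_smul_left, real_inner_self_eq_norm_sq, h.norm_eq]; ring
    have e2 : y - t • e - (inner ℝ y e - t) • e = y - (inner ℝ y e) • e := by
      rw [sub_smul]; abel
    rw [e1, e2]
    have : 0 < t := ht
    linarith

theorem SubgraphNear.frontier_inter (h : SubgraphNear D x e g L r) (F : Frame e) :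
    frontier D ∩ Metric.ball x r = range (F.graph g) ∩ Metric.ball x r := by
  ext y
  rw [F.range_graph h.norm_eq]
  exact ⟨fun hy => ⟨(h.mem_frontier_iff hy.2).1 hy.1, hy.2⟩,
    fun hy => ⟨(h.mem_frontier_iff hy.2).2 hy.1, hy.2⟩⟩

theorem SubgraphNear.surf_restrict (h : SubgraphNear D x e g L r) (F : Frame e) :
    (surf (frontier D)).restrict (Metric.ball x r)
      = (F.graphMeasure g).restrict (Metric.ball x r) := by
  rw [surf_eq, ← F.restrict_range_eq h.norm_eq h.lip,
    Measure.restrict_restrict Metric.isOpen_ball.measurableSet,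
    Measure.restrict_restrict Metric.isOpen_ball.measurableSet, inter_comm, h.frontier_inter F,
    inter_comm]

/-- The divergence theorem in the direction of the graph. -/
theorem SubgraphNear.integral_gradient (h : SubgraphNear D x e g L r) (F : Frame e)
    {ψ : Eucl (m + 1) → ℝ} (hψ : IsCore ψ) (hs : tsupport ψ ⊆ Metric.ball x r) :
    ∫ y in D, inner ℝ (gradient ψ y) e = ∫ y, ψ (F.graph g y) := by
  set S := {y : Eucl (m + 1) | inner ℝ y e < g (y - (inner ℝ y e) • e)} with hS
  have hSo : IsOpen S := h.isOpen_subgraph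
  have hcg := h.lip.continuous
  have h0 : ∀ y, y ∉ Metric.ball x r → inner ℝ (gradient ψ y) e = 0 := fun y hy => by
    have : y ∉ tsupport (fderiv ℝ ψ) := fun hc => hy (hs (tsupport_fderiv_subset ℝ hc))
    rw [inner_gradient, image_eq_zero_of_notMem_tsupport this]; rfl
  have hgc : Continuous fun y => inner ℝ (gradient ψ y) e :=
    (continuous_gradient hψ.1).inner continuous_const
  have hgs : HasCompactSupport fun y => inner ℝ (gradient ψ y) e := by
    have : (fun y => inner ℝ (gradient ψ y) e) = fun y => fderiv ℝ ψ y e :=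
      funext fun y => inner_gradient ψ y e
    rw [this]
    exact hψ.2.fderiv_apply ℝ e
  -- As `ψ` is supported in the ball, `D` may be replaced by the global subgraph.
  have e1 : ∫ y in D, inner ℝ (gradient ψ y) e = ∫ y in S, inner ℝ (gradient ψ y) e := by
    have hB := Metric.isOpen_ball (x := x) (ε := r) |>.measurableSet
    have : ∀ A : Set (Eucl (m + 1)), ∫ y in A, inner ℝ (gradient ψ y) e
        = ∫ y in A ∩ Metric.ball x r, inner ℝ (gradient ψ y) e := fun A => by
      rw [← setIntegral_eq_integral_of_forall_compl_eq_zero (μ := volume.restrict A) h0,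
        Measure.restrict_restrict hB, inter_comm]
    rw [this D, this S]
    congr 2
    ext y
    exact ⟨fun hy => ⟨(h.mem_iff y hy.2).1 hy.1, hy.2⟩, fun hy => ⟨(h.mem_iff y hy.2).2 hy.1, hy.2⟩⟩
  have hmp := F.measurePreserving_coord h.norm_eq
  have hme := F.measurableEmbedding_coord h.norm_eq
  rw [e1, ← integral_indicator hSo.measurableSet, ← hmp.integral_comp hme, Measure.volume_eq_prod,
    integral_prod _ (by
      rw [← Measure.volume_eq_prod]
      exact (hmp.integrable_comp_emb hme).2
        ((hgc.integrable_of_hasCompactSupport hgs).indicator hSo.measurableSet))]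
  -- Fubini with the direction `e` innermost: on each line the integral of the derivative up to the
  -- height of the graph is the value of `ψ` there.
  refine integral_congr_ae (Eventually.of_forall fun y => ?_)
  have hind : ∀ s : ℝ, S.indicator (fun y => inner ℝ (gradient ψ y) e) (F.coord (y, s))
      = (Iio (g (F.Q y))).indicator (fun s => deriv (fun s : ℝ => ψ (F.coord (y, s))) s) s := by
    intro s
    have hder : HasDerivAt (fun s : ℝ => F.coord (y, s)) e s := by
      simpa [Frame.coord] using ((hasDerivAt_id s).smul_const e).const_add (F.Q y)
    have hd2 := ((hψ.1.differentiable one_ne_zero (F.coord (y, s))).hasFDerivAt).comp_hasDerivAt s hder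
    have hiff : F.coord (y, s) ∈ S ↔ s ∈ Iio (g (F.Q y)) := by
      rw [hS, mem_ofPred_eq, F.coord_sub h.norm_eq, F.inner_coord h.norm_eq]; rfl
    by_cases hs : s ∈ Iio (g (F.Q y))
    · rw [indicator_of_mem hs, indicator_of_mem (hiff.2 hs), inner_gradient]
      exact hd2.deriv.symm
    · rw [indicator_of_notMem hs, indicator_of_notMem (fun hc => hs (hiff.1 hc))]
  simp only [hind]
  rw [integral_indicator measurableSet_Iio, ← integral_Iic_eq_integral_Iio]
  have hcd : ContDiff ℝ 1 fun s : ℝ => F.coord (y, s) :=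
    by
    unfold Frame.coord; fun_prop
  refine HasCompactSupport.integral_Iic_deriv_eq (hψ.1.comp hcd) ?_ _
  refine hψ.2.comp_isClosedEmbedding (g := fun s : ℝ => F.coord (y, s)) ?_
  refine (Isometry.isClosedEmbedding ?_)
  refine Isometry.of_dist_eq fun s t => ?_
  have : F.coord (y, s) - F.coord (y, t) = (s - t) • e := by
    simp only [Frame.coord, sub_smul]; abel
  rw [dist_eq_norm, this, norm_smul, h.norm_eq, mul_one, Real.dist_eq, Real.norm_eq_abs]

/-- The local trace inequality. -/
theorem SubgraphNear.lintegral_le (h : SubgraphNear D x e g L r) (ho : IsOpen D)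
    (hb : Bornology.IsBounded D) : ∃ C : ℝ≥0, ∀ φ : Eucl (m + 1) → ℝ, ContDiff ℝ 1 φ →
      ∫⁻ y in Metric.ball x (r / 4), ‖φ y‖ₑ ^ 2 ∂(surf (frontier D))
        ≤ C * ∫⁻ y in D, ‖jet (withGrad φ) y‖ₑ ^ 2 := by
  obtain ⟨F⟩ := exists_frame h.norm_eq
  have hr := h.pos
  let b : ContDiffBump x := ⟨r / 4, r / 2, by linarith, by linarith⟩
  have hbc : IsCore b := ⟨b.contDiff, b.hasCompactSupport⟩
  obtain ⟨M, hM0, hM⟩ := hbc.exists_jet_bound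
  refine ⟨(1 + L) ^ m * (M.toNNReal + 1), fun φ hφ => ?_⟩
  -- The divergence theorem along `e` is applied to the localised square of `φ`; its derivative is
  -- controlled by the squared jet since `2 |φ| |∇φ| ≤ φ² + |∇φ|²`.
  set ψ : Eucl (m + 1) → ℝ := fun y => b y * (φ y) ^ 2 with hψd
  have hψ : IsCore ψ := ⟨b.contDiff.mul (hφ.pow 2), b.hasCompactSupport.mul_right⟩
  have hψ0 : ∀ y, 0 ≤ ψ y := fun y => mul_nonneg b.nonneg (sq_nonneg _)
  have hts : tsupport ψ ⊆ Metric.ball x r := by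
    refine (tsupport_mul_subset_left (f := b) (g := fun y => φ y ^ 2)).trans ?_
    rw [b.tsupport_eq]
    exact Metric.closedBall_subset_ball (by change r / 2 < r; linarith)
  have hme := F.measurableEmbedding_graph h.norm_eq h.lip
  have a1 : ∫⁻ y in Metric.ball x (r / 4), ‖φ y‖ₑ ^ 2 ∂(surf (frontier D))
      ≤ ∫⁻ y, ENNReal.ofReal (ψ y) ∂(F.graphMeasure g) := by
    calc _ ≤ ∫⁻ y in Metric.ball x (r / 4), ENNReal.ofReal (ψ y) ∂(surf (frontier D)) := by
          refine setLIntegral_mono' Metric.isOpen_ball.measurableSet fun y hy => ?_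
          have : ψ y = φ y ^ 2 := by
            rw [hψd]
            simp only [b.one_of_mem_closedBall (Metric.ball_subset_closedBall hy), one_mul]
          rw [this, ← sq_abs, ENNReal.ofReal_pow (abs_nonneg _), ← Real.norm_eq_abs, ofReal_norm]
      _ ≤ ∫⁻ y in Metric.ball x r, ENNReal.ofReal (ψ y) ∂(surf (frontier D)) :=
          lintegral_mono_set (Metric.ball_subset_ball (by linarith))
      _ ≤ _ := by
          rw [h.surf_restrict F]
          exact setLIntegral_le_lintegral _ _
  have hψg : Integrable (fun y => ψ (F.graph g y)) volume := by
    refine (hψ.1.continuous.comp (F.lipschitz_graph h.norm_eq h.lip).continuous).integrable_of_hasCompactSupport ?_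
    exact hψ.2.comp_isClosedEmbedding ((F.antilipschitz_graph h.norm_eq).isClosedEmbedding
      (F.lipschitz_graph h.norm_eq h.lip).uniformContinuous)
  have a2 : ∫⁻ y, ENNReal.ofReal (ψ y) ∂(F.graphMeasure g) ≤
      ((1 + L : ℝ≥0) : ℝ≥0∞) ^ m * ENNReal.ofReal (∫ y in D, inner ℝ (gradient ψ y) e) := by
    refine (lintegral_mono' (F.graphMeasure_le h.norm_eq h.lip) le_rfl).trans ?_
    rw [lintegral_smul_measure, smul_eq_mul, hme.lintegral_map, h.integral_gradient F hψ hts,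
      ofReal_integral_eq_lintegral_ofReal hψg (Eventually.of_forall fun y => hψ0 _)]
  have hpt : ∀ y, inner ℝ (gradient ψ y) e ≤ (M + 1) * ‖jet (withGrad φ) y‖ ^ 2 := by
    intro y
    have hd1 := (b.contDiff (n := 1)).differentiable one_ne_zero y |>.hasFDerivAt
    have hd2 := (hφ.differentiable one_ne_zero y).hasFDerivAt.pow 2
    have hd : HasFDerivAt ψ (b y • (2 • φ y ^ (2 - 1)) • fderiv ℝ φ y + φ y ^ 2 • fderiv ℝ b y) y :=
      hd1.mul hd2
    have hval : inner ℝ (gradient ψ y) e = b y * (2 * φ y * inner ℝ (gradient φ y) e)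
        + φ y ^ 2 * inner ℝ (gradient b y) e := by
      rw [inner_gradient, inner_gradient, inner_gradient, hd.fderiv]
      simp
    have c1 : |inner ℝ (gradient b y) e| ≤ M := by
      refine (abs_real_inner_le_norm _ _).trans ?_
      rw [h.norm_eq, mul_one]
      exact (norm_snd_le_jet (withGrad b) y).trans (hM y)
    have c2 : |inner ℝ (gradient φ y) e| ≤ ‖gradient φ y‖ := by
      refine (abs_real_inner_le_norm _ _).trans_eq ?_
      rw [h.norm_eq, mul_one]
    have c3 : |2 * φ y * inner ℝ (gradient φ y) e| ≤ ‖φ y‖ ^ 2 + ‖gradient φ y‖ ^ 2 := by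
      rw [abs_mul, abs_mul, abs_two, ← Real.norm_eq_abs (φ y)]
      nlinarith [sq_nonneg (‖φ y‖ - ‖gradient φ y‖), norm_nonneg (φ y), norm_nonneg (gradient φ y)]
    have c4 := norm_jet_sq (withGrad φ) y
    rw [withGrad_fst, withGrad_snd] at c4
    rw [hval, c4]
    have c5 : b y * (2 * φ y * inner ℝ (gradient φ y) e) ≤ ‖φ y‖ ^ 2 + ‖gradient φ y‖ ^ 2 := by
      refine (le_abs_self _).trans ?_
      rw [abs_mul, abs_of_nonneg b.nonneg]
      exact (mul_le_of_le_one_left (abs_nonneg _) b.le_one).trans c3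
    have c6 : φ y ^ 2 * inner ℝ (gradient b y) e ≤ ‖φ y‖ ^ 2 * M := by
      rw [Real.norm_eq_abs, sq_abs]
      exact mul_le_mul_of_nonneg_left ((le_abs_self _).trans c1) (sq_nonneg _)
    nlinarith [sq_nonneg ‖gradient φ y‖]
  have : IsFiniteMeasure ((volume : Measure (Eucl (m + 1))).restrict D) :=
    ⟨by rw [Measure.restrict_apply_univ]; exact hb.measure_lt_top⟩
  have hjm : MemLp (jet (withGrad φ)) 2 (volume.restrict D) := by
    obtain ⟨χ, hχ, he⟩ := exists_isCore_eqOn hφ hb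
    refine (hχ.memLp_jet (μ := volume.restrict D)).ae_eq ?_
    filter_upwards [ae_restrict_mem ho.measurableSet] with y hy
    exact jet_eq_iff.2 (he y (subset_closure hy))
  have a3 : ENNReal.ofReal (∫ y in D, inner ℝ (gradient ψ y) e) ≤
      (M.toNNReal + 1 : ℝ≥0) * ∫⁻ y in D, ‖jet (withGrad φ) y‖ₑ ^ 2 := by
    have hi : Integrable (fun y => (M + 1) * ‖jet (withGrad φ) y‖ ^ 2) (volume.restrict D) :=
      (hjm.integrable_norm_pow two_ne_zero).const_mul _
    have h1 : ∫ y in D, inner ℝ (gradient ψ y) e ≤ ∫ y in D, (M + 1) * ‖jet (withGrad φ) y‖ ^ 2 := by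
      refine integral_mono ?_ hi hpt
      refine (((continuous_gradient hψ.1).inner continuous_const).integrable_of_hasCompactSupport
        ?_).integrableOn
      have : (fun y => inner ℝ (gradient ψ y) e) = fun y => fderiv ℝ ψ y e :=
        funext fun y => inner_gradient ψ y e
      rw [this]
      exact hψ.2.fderiv_apply ℝ e
    refine (ENNReal.ofReal_le_ofReal h1).trans_eq ?_
    rw [ofReal_integral_eq_lintegral_ofReal hi (Eventually.of_forall fun y => by positivity),
      ← lintegral_const_mul' _ _ ENNReal.coe_ne_top]
    refine lintegral_congr fun y => ?_
    rw [ENNReal.ofReal_mul (by positivity), ENNReal.ofReal_pow (norm_nonneg _), ofReal_norm,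
      ENNReal.ofReal_add hM0 zero_le_one, ENNReal.ofReal_one]
    rfl
  refine a1.trans (a2.trans ?_)
  rw [ENNReal.coe_mul, ENNReal.coe_pow, mul_assoc]
  gcongr

end Subgraph

/-- Bounded open sets that are locally Lipschitz subgraphs have traces. -/
theorem exists_traceDomain_of_subgraph {D : Set (Eucl (m + 1))} (ho : IsOpen D)
    (hb : Bornology.IsBounded D) (h : ∀ x ∈ frontier D, ∃ e g L r, SubgraphNear D x e g L r) :
    ∃ C, TraceDomain D C := by
  have hc : IsCompact (frontier D) :=
    (hb.isCompact_closure).of_isClosed_subset isClosed_frontier frontier_subset_closure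
  have key : ∃ C : ℝ≥0, ∀ φ : Eucl (m + 1) → ℝ, ContDiff ℝ 1 φ →
      ∫⁻ y in frontier D, ‖φ y‖ₑ ^ 2 ∂(surf (frontier D))
        ≤ C * ∫⁻ y in D, ‖jet (withGrad φ) y‖ₑ ^ 2 := by
    -- Compactness of the boundary: finitely many of the local inequalities suffice, and their
    -- constants add up.
    refine hc.induction_on (p := fun S => ∃ C : ℝ≥0, ∀ φ : Eucl (m + 1) → ℝ, ContDiff ℝ 1 φ →
      ∫⁻ y in S, ‖φ y‖ₑ ^ 2 ∂(surf (frontier D))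
        ≤ C * ∫⁻ y in D, ‖jet (withGrad φ) y‖ₑ ^ 2) ⟨0, fun φ _ => by simp⟩ ?_ ?_ ?_
    · rintro s t hst ⟨C, hC⟩
      exact ⟨C, fun φ hφ => (lintegral_mono_set hst).trans (hC φ hφ)⟩
    · rintro s t ⟨C, hC⟩ ⟨C', hC'⟩
      refine ⟨C + C', fun φ hφ => (lintegral_union_le _ _ _).trans ?_⟩
      rw [ENNReal.coe_add, add_mul]
      exact add_le_add (hC φ hφ) (hC' φ hφ)
    · intro x hx
      obtain ⟨e, g, L, r, hg⟩ := h x hx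
      obtain ⟨C, hC⟩ := hg.lintegral_le ho hb
      exact ⟨_, mem_nhdsWithin_of_mem_nhds (Metric.ball_mem_nhds x (by linarith [hg.pos])), C, hC⟩
  obtain ⟨C, hC⟩ := key
  refine ⟨NNReal.sqrt C, ho, hb, fun φ hφ => ?_⟩
  have h1 := hC φ hφ
  rw [surf, Measure.restrict_restrict isClosed_frontier.measurableSet, inter_self] at h1
  have hrw : ∀ {E : Type} [NormedAddCommGroup E] (F : Eucl (m + 1) → E) (μ : Measure (Eucl (m + 1))),
      eLpNorm F 2 μ = (∫⁻ x, ‖F x‖ₑ ^ 2 ∂μ) ^ (1 / 2 : ℝ) := fun F μ => by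
    rw [eLpNorm_eq_lintegral_rpow_enorm_toReal two_ne_zero ENNReal.ofNat_ne_top]
    norm_num
  rw [hrw, hrw, surf]
  refine (ENNReal.rpow_le_rpow h1 (by norm_num)).trans_eq ?_
  rw [ENNReal.mul_rpow_of_nonneg _ _ (by norm_num)]
  congr 1
  rw [NNReal.sqrt_eq_rpow, ← ENNReal.coe_rpow_of_nonneg _ (by norm_num)]

theorem IsLipschitzDomain.exists_traceDomain {D : Set (Eucl (m + 1))} (h : IsLipschitzDomain D) :
    ∃ C, TraceDomain D C := by
  refine exists_traceDomain_of_subgraph h.isOpen h.isBounded fun x hx => ?_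
  obtain ⟨e, g, L, he, hg, hev⟩ := h.chart x hx
  obtain ⟨r, hr, hball⟩ := Metric.eventually_nhds_iff_ball.1 hev
  exact ⟨e, g, L, r, he, hg, hr, hball⟩

end

section

variable {d : ℕ}

/-! ### Outer normals and graph charts of `C¹` domains -/

section Normal

variable {ω : Set (Eucl d)} {x : Eucl d} {ρ : Eucl d → ℝ}

theorem IsDefiningFunction.eq_zero (h : IsDefiningFunction 1 ω x ρ) (ho : IsOpen ω)
    (hx : x ∈ frontier ω) : ρ x = 0 := by
  have hc := h.contDiffAt.continuousAt
  have hm := h.mem_iff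
  rw [ho.frontier_eq] at hx
  refine le_antisymm ?_ (not_lt.1 fun hlt => hx.2 (hm.self_of_nhds.2 hlt))
  by_contra hpos
  rw [not_le] at hpos
  refine mem_closure_iff_frequently.1 hx.1 ?_
  filter_upwards [hm, hc.eventually (lt_mem_nhds hpos)] with y h1 h2 h3
  exact (h1.1 h3).not_gt h2

theorem IsDefiningFunction.hasDerivAt_line (h : IsDefiningFunction 1 ω x ρ) (v : Eucl d) :
    Tendsto (fun t : ℝ => (ρ (x + t • v) - ρ x) / t) (𝓝[>] 0) (𝓝 (inner ℝ (gradient ρ x) v)) :=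
  tendsto_diffQuot (h.contDiffAt.differentiableAt one_ne_zero) v

/-- If two unit normals `a`, `b` differ, then along `b - a` the first defining function decreases
and the second increases. Points close to `x` on this ray would lie in `ω` by the one criterion and
outside by the other. -/
theorem IsOuterNormal.unique (ho : IsOpen ω) (hx : x ∈ frontier ω) {ν ν' : Eucl d}
    (h : IsOuterNormal ω x ν) (h' : IsOuterNormal ω x ν') : ν = ν' := by
  obtain ⟨ρ, hρ, rfl⟩ := h
  obtain ⟨σ, hσ, rfl⟩ := h'
  have hρ0 := norm_pos_iff.2 hρ.gradient_ne_zero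
  have hσ0 := norm_pos_iff.2 hσ.gradient_ne_zero
  set a := ‖gradient ρ x‖⁻¹ • gradient ρ x with ha
  set b := ‖gradient σ x‖⁻¹ • gradient σ x with hb
  have na : ‖a‖ = 1 := by rw [ha, norm_smul, norm_inv, norm_norm, inv_mul_cancel₀ hρ0.ne']
  have nb : ‖b‖ = 1 := by rw [hb, norm_smul, norm_inv, norm_norm, inv_mul_cancel₀ hσ0.ne']
  by_contra hne
  have hab : inner ℝ a b < 1 := lt_of_le_of_ne
    ((real_inner_le_norm a b).trans_eq (by rw [na, nb, one_mul]))
    fun hc => hne ((inner_eq_one_iff_of_norm_eq_one na nb).1 hc)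
  have h1 : inner ℝ (gradient ρ x) (b - a) < 0 := by
    have : gradient ρ x = ‖gradient ρ x‖ • a := by rw [ha, smul_smul, mul_inv_cancel₀ hρ0.ne', one_smul]
    rw [this, real_inner_smul_left, inner_sub_right, real_inner_self_eq_norm_sq, na]
    nlinarith
  have h2 : 0 < inner ℝ (gradient σ x) (b - a) := by
    have : gradient σ x = ‖gradient σ x‖ • b := by rw [hb, smul_smul, mul_inv_cancel₀ hσ0.ne', one_smul]
    rw [this, real_inner_smul_left, inner_sub_right, real_inner_self_eq_norm_sq, nb,
      real_inner_comm]
    nlinarith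
  have hl := tendsto_flow (fun _ => b - a) x
  have ev := ((hρ.hasDerivAt_line (b - a)).eventually (gt_mem_nhds h1)).and
    (((hσ.hasDerivAt_line (b - a)).eventually (lt_mem_nhds h2)).and
      ((hl.eventually hρ.mem_iff).and ((hl.eventually hσ.mem_iff).and self_mem_nhdsWithin)))
  obtain ⟨t, e1, e2, e3, e4, ht⟩ := ev.exists
  have ht : 0 < t := ht
  rw [hρ.eq_zero ho hx, sub_zero] at e1
  rw [hσ.eq_zero ho hx, sub_zero] at e2
  have f1 : ρ (flow (fun _ => b - a) t x) < 0 := by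
    by_contra hc; exact absurd e1 (not_lt.2 (div_nonneg (not_lt.1 hc) ht.le))
  have f2 : ¬ σ (flow (fun _ => b - a) t x) < 0 := fun hc =>
    absurd e2 (not_lt.2 (div_nonpos_of_nonpos_of_nonneg hc.le ht.le))
  exact f2 (e4.1 (e3.2 f1))

theorem IsDefiningFunction.outerNormal_eq (h : IsDefiningFunction 1 ω x ρ) (ho : IsOpen ω)
    (hx : x ∈ frontier ω) : outerNormal ω x = ‖gradient ρ x‖⁻¹ • gradient ρ x := by
  have hex : ∃ ν, IsOuterNormal ω x ν := ⟨_, ρ, h, rfl⟩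
  rw [outerNormal, dif_pos hex]
  exact IsOuterNormal.unique ho hx hex.choose_spec ⟨ρ, h, rfl⟩

theorem IsDefiningFunction.continuousAt_gradient (h : IsDefiningFunction 1 ω x ρ) :
    ContinuousAt (gradient ρ) x :=
  ((InnerProductSpace.toDual ℝ (Eucl d)).symm.continuous.continuousAt).comp
    (h.contDiffAt.continuousAt_fderiv one_ne_zero)

theorem IsDefiningFunction.eventually (h : IsDefiningFunction 1 ω x ρ) :
    ∀ᶠ y in 𝓝 x, IsDefiningFunction 1 ω y ρ := by
  filter_upwards [h.contDiffAt.eventually (by simp),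
    h.continuousAt_gradient.eventually_ne h.gradient_ne_zero, h.mem_iff.eventually_nhds]
    with y h1 h2 h3
  exact ⟨h1, h2, h3⟩

theorem IsC2Domain.exists_definingFunction (h : IsC2Domain ω) (hx : x ∈ frontier ω) :
    ∃ ρ, IsDefiningFunction 1 ω x ρ := by
  obtain ⟨ρ, hρ⟩ := h.chart x hx
  exact ⟨ρ, hρ.contDiffAt.of_le (by norm_num), hρ.gradient_ne_zero, hρ.mem_iff⟩

theorem IsC2Domain.norm_outerNormal (h : IsC2Domain ω) (hx : x ∈ frontier ω) :
    ‖outerNormal ω x‖ = 1 := by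
  obtain ⟨ρ, hρ⟩ := h.exists_definingFunction hx
  rw [hρ.outerNormal_eq h.isOpen hx, norm_smul, norm_inv, norm_norm,
    inv_mul_cancel₀ (norm_pos_iff.2 hρ.gradient_ne_zero).ne']

theorem IsC2Domain.continuousOn_outerNormal (h : IsC2Domain ω) :
    ContinuousOn (outerNormal ω) (frontier ω) := by
  intro x hx
  obtain ⟨ρ, hρ⟩ := h.exists_definingFunction hx
  have hc : ContinuousWithinAt (fun y => ‖gradient ρ y‖⁻¹ • gradient ρ y) (frontier ω) x :=
    ((hρ.continuousAt_gradient.norm.inv₀ (norm_pos_iff.2 hρ.gradient_ne_zero).ne').smul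
      hρ.continuousAt_gradient).continuousWithinAt
  refine hc.congr_of_eventuallyEq ?_ (hρ.outerNormal_eq h.isOpen hx)
  filter_upwards [nhdsWithin_le_nhds hρ.eventually, self_mem_nhdsWithin] with y h1 h2
  exact h1.outerNormal_eq h.isOpen h2

end Normal

section Chart

variable {m : ℕ} {ω : Set (Eucl (m + 1))} {x : Eucl (m + 1)} {ρ : Eucl (m + 1) → ℝ}

/-- A Lipschitz implicit function theorem. Where `∂ₑρ > c` and `|∇ρ| < M`, the mean value theorem
gives a cone condition of slope `M / c` for the zero set, so the height is a Lipschitz function of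
the projection. The direction `e` need not be normal; this freedom is used in the Gauss-Green
formula. -/
theorem IsDefiningFunction.exists_subgraph (h : IsDefiningFunction 1 ω x ρ) (ho : IsOpen ω)
    (hx : x ∈ frontier ω) {e : Eucl (m + 1)} (he : ‖e‖ = 1) (hpos : 0 < inner ℝ (gradient ρ x) e) :
    ∃ g L r, SubgraphNear ω x e g L r ∧
      ∀ y ∈ Metric.ball x r, IsDefiningFunction 1 ω y ρ ∧ 0 < inner ℝ (gradient ρ y) e := by
  set c := inner ℝ (gradient ρ x) e / 2 with hc
  have hc0 : 0 < c := by positivity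
  have hcg := h.continuousAt_gradient
  have ev : ∀ᶠ y in 𝓝 x, IsDefiningFunction 1 ω y ρ ∧ c < inner ℝ (gradient ρ y) e ∧
      ‖gradient ρ y‖ < ‖gradient ρ x‖ + 1 :=
    h.eventually.and (((hcg.inner continuousAt_const).eventually (lt_mem_nhds (half_lt_self hpos))).and
      (hcg.norm.eventually (gt_mem_nhds (lt_add_one _))))
  obtain ⟨R, hR, hball⟩ := Metric.eventually_nhds_iff_ball.1 ev
  set M := ‖gradient ρ x‖ + 1 with hM
  have hM0 : 0 < M := by positivity
  have mvt : ∀ y ∈ Metric.ball x R, ∀ z ∈ Metric.ball x R, ∃ ξ ∈ Metric.ball x R,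
      ρ z - ρ y = inner ℝ (gradient ρ ξ) (z - y) := by
    intro y hy z hz
    obtain ⟨ξ, hξ, heq⟩ := domain_mvt (f := ρ) (f' := fderiv ℝ ρ) (s := Metric.ball x R)
      (fun y hy => ((hball y hy).1.contDiffAt.differentiableAt one_ne_zero).hasFDerivAt.hasFDerivWithinAt)
      (convex_ball x R) hy hz
    exact ⟨ξ, (convex_ball x R).segment_subset hy hz hξ, by rw [inner_gradient]; exact heq⟩
  let π : Eucl (m + 1) → Eucl (m + 1) := fun y => y - (inner ℝ y e) • e
  have hdec : ∀ y z : Eucl (m + 1), z - y = (π z - π y) + (inner ℝ z e - inner ℝ y e) • e := by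
    intro y z; simp only [π, sub_smul]; abel
  have cone : ∀ y ∈ Metric.ball x R, ∀ z ∈ Metric.ball x R, ρ z = ρ y →
      |inner ℝ z e - inner ℝ y e| ≤ M / c * ‖π z - π y‖ := by
    intro y hy z hz hyz
    obtain ⟨ξ, hξ, heq⟩ := mvt y hy z hz
    rw [hyz, sub_self, hdec, inner_add_right, real_inner_smul_right] at heq
    have h1 := (hball ξ hξ).2.1
    have h2 : |inner ℝ (gradient ρ ξ) (π z - π y)| ≤ M * ‖π z - π y‖ :=
      (abs_real_inner_le_norm _ _).trans
        (mul_le_mul_of_nonneg_right (hball ξ hξ).2.2.le (norm_nonneg _))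
    have h3 : |inner ℝ z e - inner ℝ y e| * inner ℝ (gradient ρ ξ) e
        = |inner ℝ (gradient ρ ξ) (π z - π y)| := by
      have h4 : inner ℝ (gradient ρ ξ) (π z - π y)
          = -((inner ℝ z e - inner ℝ y e) * inner ℝ (gradient ρ ξ) e) := by linarith
      rw [h4, abs_neg, abs_mul, abs_of_pos (hc0.trans h1)]
    rw [div_mul_eq_mul_div, le_div_iff₀ hc0]
    nlinarith [abs_nonneg (inner ℝ z e - inner ℝ y e)]
  set Z := {y | y ∈ Metric.ball x R ∧ ρ y = 0} with hZ
  set i := Function.invFunOn π Z with hi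
  have hiZ : ∀ z ∈ Z, i (π z) ∈ Z ∧ π (i (π z)) = π z := fun z hz =>
    ⟨Function.invFunOn_mem ⟨z, hz, rfl⟩, Function.invFunOn_eq ⟨z, hz, rfl⟩⟩
  have hlip : LipschitzOnWith (M / c).toNNReal (fun p => inner ℝ (i p) e) (π '' Z) := by
    refine LipschitzOnWith.of_dist_le_mul ?_
    rintro _ ⟨y, hy, rfl⟩ _ ⟨z, hz, rfl⟩
    have h1 := hiZ y hy
    have h2 := hiZ z hz
    have h3 := cone _ h2.1.1 _ h1.1.1 (h1.1.2.trans h2.1.2.symm)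
    rw [h1.2, h2.2] at h3
    rw [Real.dist_eq, dist_eq_norm, Real.coe_toNNReal _ (by positivity)]
    exact h3
  -- The height is defined only on the projection of the zero set in the ball and is extended to the
  -- whole space with the same Lipschitz constant.
  obtain ⟨g, hg, hgeq⟩ := hlip.extend_real
  have hgZ : ∀ z ∈ Z, g (π z) = inner ℝ z e := by
    intro z hz
    rw [← hgeq ⟨z, hz, rfl⟩]
    have h1 := hiZ z hz
    have h3 := cone _ hz.1 _ h1.1.1 (h1.1.2.trans hz.2.symm)
    rw [h1.2, sub_self, norm_zero, mul_zero] at h3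
    exact sub_eq_zero.1 (abs_eq_zero.1 (le_antisymm h3 (abs_nonneg _)))
  have hρx := h.eq_zero ho hx
  have hline : ∀ s : ℝ, |s| ≤ R / 2 → ∀ y ∈ Metric.ball x (R / 2), y + s • e ∈ Metric.ball x R := by
    intro s hs y hy
    rw [mem_ball_iff_norm] at *
    calc ‖y + s • e - x‖ = ‖(y - x) + s • e‖ := by congr 1; abel
      _ ≤ ‖y - x‖ + ‖s • e‖ := norm_add_le _ _
      _ < R / 2 + R / 2 := by
        rw [norm_smul, he, mul_one, Real.norm_eq_abs]
        exact add_lt_add_of_lt_of_le hy hs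
      _ = R := by ring
  have hinc : ∀ y ∈ Metric.ball x R, ∀ s : ℝ, y + s • e ∈ Metric.ball x R →
      ∃ κ, 0 < κ ∧ ρ (y + s • e) - ρ y = s * κ := by
    intro y hy s hs
    obtain ⟨ξ, hξ, heq⟩ := mvt y hy _ hs
    rw [add_sub_cancel_left, real_inner_smul_right] at heq
    exact ⟨_, hc0.trans (hball ξ hξ).2.1, heq⟩
  have hxR := Metric.mem_ball_self (x := x) hR
  have hxR2 := Metric.mem_ball_self (x := x) (half_pos hR)
  have hs1 : |R / 2| ≤ R / 2 := (abs_of_pos (half_pos hR)).le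
  have hs2 : |(-(R / 2))| ≤ R / 2 := by rw [abs_neg]; exact hs1
  have hp1 : 0 < ρ (x + (R / 2) • e) := by
    obtain ⟨κ, hκ, heq⟩ := hinc x hxR (R / 2) (hline _ hs1 x hxR2)
    rw [hρx, sub_zero] at heq
    rw [heq]; positivity
  have hp2 : ρ (x + (-(R / 2)) • e) < 0 := by
    obtain ⟨κ, hκ, heq⟩ := hinc x hxR (-(R / 2)) (hline _ hs2 x hxR2)
    rw [hρx, sub_zero] at heq
    rw [heq]; nlinarith
  have hcρ : ∀ y ∈ Metric.ball x R, ContinuousAt ρ y := fun y hy =>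
    (hball y hy).1.contDiffAt.continuousAt
  have ev1 : ∀ᶠ y in 𝓝 x, 0 < ρ (y + (R / 2) • e) := by
    have : ContinuousAt (fun y => ρ (y + (R / 2) • e)) x :=
      ContinuousAt.comp (hcρ _ (hline _ hs1 x hxR2)) (continuousAt_id.add continuousAt_const)
    exact this.eventually (lt_mem_nhds hp1)
  have ev2 : ∀ᶠ y in 𝓝 x, ρ (y + (-(R / 2)) • e) < 0 := by
    have : ContinuousAt (fun y => ρ (y + (-(R / 2)) • e)) x :=
      ContinuousAt.comp (hcρ _ (hline _ hs2 x hxR2)) (continuousAt_id.add continuousAt_const)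
    exact this.eventually (gt_mem_nhds hp2)
  -- The radius is chosen so that `ρ` changes sign on the segment of half-length `R / 2` through
  -- every point of the ball; its zero, which the monotonicity along `e` separates from the negative
  -- part, lies on the graph.
  obtain ⟨r, hr, hrb⟩ := Metric.eventually_nhds_iff_ball.1 (ev1.and ev2)
  refine ⟨g, (M / c).toNNReal, min r (R / 2), ⟨he, hg, lt_min hr (half_pos hR), fun y hy => ?_⟩,
    fun y hy => ?_⟩
  · have hyr : y ∈ Metric.ball x r := Metric.ball_subset_ball (min_le_left _ _) hy
    have hyR2 : y ∈ Metric.ball x (R / 2) := Metric.ball_subset_ball (min_le_right _ _) hy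
    have hyR : y ∈ Metric.ball x R := Metric.ball_subset_ball (by linarith) hyR2
    have hcont : ContinuousOn (fun s : ℝ => ρ (y + s • e)) (Icc (-(R / 2)) (R / 2)) := by
      intro s hs
      refine ContinuousAt.continuousWithinAt ?_
      exact ContinuousAt.comp (g := ρ) (hcρ _ (hline s (abs_le.2 hs) y hyR2))
        (continuousAt_const.add (continuousAt_id.smul continuousAt_const))
    obtain ⟨s, hs, hs0⟩ := intermediate_value_Icc (by linarith) hcont
      (⟨(hrb y hyr).2.le, (hrb y hyr).1.le⟩ : (0 : ℝ) ∈ Icc _ _)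
    have hzR := hline s (abs_le.2 hs) y hyR2
    have hie : inner ℝ (y + s • e) e = inner ℝ y e + s := by
      rw [inner_add_left, real_inner_smul_left, real_inner_self_eq_norm_sq, he]; ring
    have hπ : π (y + s • e) = y - (inner ℝ y e) • e := by
      simp only [π, hie, add_smul]; abel
    have hgz := hgZ (y + s • e) ⟨hzR, hs0⟩
    rw [hπ, hie] at hgz
    rw [hgz, (hball y hyR).1.mem_iff.self_of_nhds]
    obtain ⟨κ, hκ, heq⟩ := hinc y hyR s hzR
    simp only at hs0
    rw [hs0] at heq
    constructor
    · intro hlt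
      have : 0 < s * κ := by linarith
      have : 0 < s := pos_of_mul_pos_left this hκ.le
      linarith
    · intro hlt
      have : 0 < s := by linarith
      nlinarith
  · have hyR : y ∈ Metric.ball x R := Metric.ball_subset_ball
      ((min_le_right _ _).trans (by linarith)) hy
    exact ⟨(hball y hyR).1, hc0.trans (hball y hyR).2.1⟩

theorem IsC2Domain.exists_traceDomain (h : IsC2Domain ω) (hb : Bornology.IsBounded ω) :
    ∃ C, TraceDomain ω C := by
  refine exists_traceDomain_of_subgraph h.isOpen hb fun x hx => ?_
  obtain ⟨ρ, hρ⟩ := h.exists_definingFunction hx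
  have h0 := norm_pos_iff.2 hρ.gradient_ne_zero
  obtain ⟨g, L, r, hs, -⟩ := hρ.exists_subgraph h.isOpen hx (e := ‖gradient ρ x‖⁻¹ • gradient ρ x)
    (by rw [norm_smul, norm_inv, norm_norm, inv_mul_cancel₀ h0.ne'])
    (by rw [real_inner_smul_right, real_inner_self_eq_norm_sq]; positivity)
  exact ⟨_, g, L, r, hs⟩

/-! ### The Jacobian of a graph -/

/-- The Gram operator is a rank one perturbation of the identity, whose determinant is `1 + ‖w‖²`.
-/
theorem normDet_sq_of_inner {E : Type*} [NormedAddCommGroup E] [InnerProductSpace ℝ E]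
    [FiniteDimensional ℝ E] (A : Eucl m →ₗ[ℝ] E) (w : Eucl m)
    (h : ∀ k l, inner ℝ (A k) (A l) = inner ℝ k l + inner ℝ w k * inner ℝ w l) :
    A.normDet ^ 2 = 1 + ‖w‖ ^ 2 := by
  have h1 := A.normDet_sq
  have h2 : LinearMap.adjoint A ∘ₗ A = LinearMap.transvection (innerₛₗ ℝ w) w := by
    refine LinearMap.ext fun k => ext_inner_right ℝ fun l => ?_
    rw [LinearMap.comp_apply, LinearMap.adjoint_inner_left, h, LinearMap.transvection.apply,
      inner_add_left, real_inner_smul_left]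
    rfl
  rw [h2, LinearMap.transvection.det] at h1
  have h3 : innerₛₗ ℝ w w = ‖w‖ ^ 2 := real_inner_self_eq_norm_sq w
  rw [h3] at h1
  exact h1

end Chart

end

/-! ### The Gauss-Green formula for `C¹` functions -/

section
variable {m : ℕ} {ω : Set (Eucl (m + 1))} {x e : Eucl (m + 1)} {g : Eucl (m + 1) → ℝ} {L : ℝ≥0}
  {r : ℝ} {ρ : Eucl (m + 1) → ℝ}

theorem Frame.fderiv_graph (F : Frame e) (he : ‖e‖ = 1) {y : Eucl m}
    (hd : DifferentiableAt ℝ (F.graph g) y) (k : Eucl m) :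
    fderiv ℝ (F.graph g) y k = F.Q k + (inner ℝ (fderiv ℝ (F.graph g) y k) e) • e := by
  have h1 : HasFDerivAt (F.graph g) (fderiv ℝ (F.graph g) y) y := hd.hasFDerivAt
  have h2 := h1.sub ((((innerSL ℝ e).hasFDerivAt (x := F.graph g y)).comp y h1).smul_const e)
  have h3 : HasFDerivAt F.Q F.Q.toContinuousLinearMap y := F.Q.toContinuousLinearMap.hasFDerivAt
  have h4 : (F.graph g - fun z => ((innerSL ℝ e) ∘ F.graph g) z • e) = F.Q := by
    funext z
    rw [← F.graph_sub he (g := g), real_inner_comm]; rfl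
  rw [h4] at h2
  have h5 := DFunLike.congr_fun (h2.unique h3) k
  have h6 : fderiv ℝ (F.graph g) y k - (inner ℝ e (fderiv ℝ (F.graph g) y k)) • e = F.Q k := h5
  rw [← h6, real_inner_comm, sub_add_cancel]

/-- At a point of the graph, the tangent space is orthogonal to the normal. -/
theorem SubgraphNear.inner_outerNormal_fderiv (h : SubgraphNear ω x e g L r) (ho : IsOpen ω)
    (hdef : ∀ y ∈ Metric.ball x r, IsDefiningFunction 1 ω y ρ) (F : Frame e) {y : Eucl m}
    (hy : F.graph g y ∈ Metric.ball x r) (hd : DifferentiableAt ℝ (F.graph g) y) (k : Eucl m) :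
    inner ℝ (outerNormal ω (F.graph g y)) (fderiv ℝ (F.graph g) y k) = 0 := by
  have hfr : ∀ z, F.graph g z ∈ Metric.ball x r → F.graph g z ∈ frontier ω := fun z hz =>
    ((h.frontier_inter F).ge ⟨mem_range_self z, hz⟩).1
  have hev : ρ ∘ F.graph g =ᶠ[𝓝 y] fun _ => 0 := by
    filter_upwards [(F.lipschitz_graph h.norm_eq h.lip).continuous.continuousAt.preimage_mem_nhds
      (Metric.isOpen_ball.mem_nhds hy)] with z hz
    exact (hdef _ hz).eq_zero ho (hfr z hz)
  have h1 := (((hdef _ hy).contDiffAt.differentiableAt one_ne_zero).hasFDerivAt.comp y hd.hasFDerivAt)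
  have h2 := (h1.congr_of_eventuallyEq hev.symm).unique (hasFDerivAt_const (0 : ℝ) y)
  have h3 : fderiv ℝ ρ (F.graph g y) (fderiv ℝ (F.graph g) y k) = 0 := DFunLike.congr_fun h2 k
  rw [(hdef _ hy).outerNormal_eq ho (hfr y hy), real_inner_smul_left, inner_gradient, h3, mul_zero]

/-- Let `a = n · e` and let `w` be the coordinates of `n - a e`. Tangent vectors `Q k + η e` are
orthogonal to `n`, so `η = -(w/a) · k`, and the Jacobian is the square root of `1 + |w|²/a²`. As
`|w|² = 1 - a²`, this equals `1/a`. -/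
theorem SubgraphNear.jac_mul_inner (h : SubgraphNear ω x e g L r) (ho : IsOpen ω)
    (hdef : ∀ y ∈ Metric.ball x r, IsDefiningFunction 1 ω y ρ ∧ 0 < inner ℝ (gradient ρ y) e)
    (F : Frame e) {y : Eucl m} (hy : F.graph g y ∈ Metric.ball x r)
    (hd : DifferentiableAt ℝ (F.graph g) y) :
    F.jac g y * inner ℝ (outerNormal ω (F.graph g y)) e = 1 := by
  have he := h.norm_eq
  have hfr : F.graph g y ∈ frontier ω := ((h.frontier_inter F).ge ⟨mem_range_self y, hy⟩).1
  have hρ := (hdef _ hy).1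
  have hn0 := norm_pos_iff.2 hρ.gradient_ne_zero
  have heq := hρ.outerNormal_eq ho hfr
  have hort := h.inner_outerNormal_fderiv ho (fun z hz => (hdef z hz).1) F hy hd
  set n := outerNormal ω (F.graph g y) with hn
  have hn1 : ‖n‖ = 1 := by rw [heq, norm_smul, norm_inv, norm_norm, inv_mul_cancel₀ hn0.ne']
  set a := inner ℝ n e with ha
  have ha0 : 0 < a := by
    rw [ha, heq, real_inner_smul_left]; exact mul_pos (inv_pos.2 hn0) (hdef _ hy).2
  obtain ⟨w, hw⟩ := F.surj (n - a • e) (by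
    rw [inner_sub_left, real_inner_smul_left, real_inner_self_eq_norm_sq, he]; ring)
  set D := fderiv ℝ (F.graph g) y with hD
  have hDk : ∀ k, D k = F.Q k + (inner ℝ (D k) e) • e := F.fderiv_graph he hd
  have hη : ∀ k, inner ℝ (D k) e = -(inner ℝ (a⁻¹ • w) k) := fun k => by
    have h1 : inner ℝ (n - a • e) (F.Q k) = inner ℝ w k := by rw [← hw, F.Q.inner_map_map]
    have h2 : inner ℝ e (F.Q k) = 0 := by rw [real_inner_comm, F.orth]
    rw [inner_sub_left, real_inner_smul_left, h2, mul_zero, sub_zero] at h1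
    have h3 := hort k
    rw [hDk, inner_add_right, real_inner_smul_right, h1, ← ha] at h3
    rw [real_inner_smul_left]
    field_simp
    linarith
  have hw2 : ‖w‖ ^ 2 = 1 - a ^ 2 := by
    have h1 : ‖F.Q w‖ ^ 2 = ‖n - a • e‖ ^ 2 := by rw [hw]
    rw [F.Q.norm_map, norm_sub_sq_real, real_inner_smul_right, norm_smul, he, hn1, ← ha,
      Real.norm_eq_abs, mul_one, sq_abs] at h1
    rw [h1]; ring
  have hsq : F.jac g y ^ 2 = (a⁻¹) ^ 2 := by
    rw [Frame.jac, normDet_sq_of_inner _ (a⁻¹ • w), norm_smul, mul_pow, hw2, Real.norm_eq_abs, sq_abs]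
    · field_simp; ring
    · intro k l
      change inner ℝ (D k) (D l) = _
      rw [← neg_mul_neg, ← hη k, ← hη l]
      conv_lhs => rw [hDk k, hDk l]
      rw [inner_add_left, inner_add_right, inner_add_right, F.Q.inner_map_map, real_inner_smul_left,
        real_inner_smul_left, real_inner_smul_right, real_inner_smul_right, F.orth,
        real_inner_comm (F.Q l) e, F.orth, real_inner_self_eq_norm_sq, he]
      ring
  rw [(pow_left_inj₀ (F.jac_nonneg y) (inv_nonneg.2 ha0.le) two_ne_zero).1 hsq,
    inv_mul_cancel₀ ha0.ne']

/-- The Gauss-Green formula in the direction `v`, for one function. -/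
def GaussGreen (ω : Set (Eucl d)) (v : Eucl d) (φ : Eucl d → ℝ) : Prop :=
  ∫ y in ω, inner ℝ (gradient φ y) v
    = ∫ y, φ y * inner ℝ (outerNormal ω y) v ∂(surf (frontier ω))

/-- The Jacobian cancels the factor `n · e`, so the surface integral becomes the parameter integral
in `SubgraphNear.integral_gradient`. -/
theorem IsDefiningFunction.gaussGreen_of_pos (h : IsDefiningFunction 1 ω x ρ) (ho : IsOpen ω)
    (hx : x ∈ frontier ω) (he : ‖e‖ = 1) (hpos : 0 < inner ℝ (gradient ρ x) e) :
    ∃ r > 0, ∀ ψ, IsCore ψ → tsupport ψ ⊆ Metric.ball x r → GaussGreen ω e ψ := by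
  obtain ⟨g, L, r, hs, hdef⟩ := h.exists_subgraph ho hx he hpos
  obtain ⟨F⟩ := exists_frame he
  refine ⟨r, hs.pos, fun ψ hψ hsupp => ?_⟩
  have h0 : ∀ y ∉ Metric.ball x r, ψ y * inner ℝ (outerNormal ω y) e = 0 := fun y hy => by
    rw [image_eq_zero_of_notMem_tsupport fun hc => hy (hsupp hc), zero_mul]
  rw [GaussGreen, hs.integral_gradient F hψ hsupp, ← setIntegral_eq_integral_of_forall_compl_eq_zero h0,
    hs.surf_restrict F, setIntegral_eq_integral_of_forall_compl_eq_zero h0,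
    F.integral_graphMeasure he hs.lip]
  refine integral_congr_ae ?_
  filter_upwards [(F.lipschitz_graph he hs.lip).ae_differentiableAt] with y hd
  by_cases hy : F.graph g y ∈ Metric.ball x r
  · rw [mul_left_comm, hs.jac_mul_inner ho hdef F hy hd, mul_one]
  · rw [image_eq_zero_of_notMem_tsupport fun hc => hy (hsupp hc), zero_mul, mul_zero]

theorem IsCore.integrable_inner_gradient {φ : Eucl d → ℝ} (h : IsCore φ) (v : Eucl d)
    (μ : Measure (Eucl d)) [IsFiniteMeasureOnCompacts μ] :
    Integrable (fun y => inner ℝ (gradient φ y) v) μ := by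
  simp_rw [inner_gradient]
  exact ((h.1.continuous_fderiv one_ne_zero).clm_apply continuous_const).integrable_of_hasCompactSupport
    (h.2.fderiv_apply ℝ v)

theorem IsC2Domain.aestronglyMeasurable_outerNormal {ω : Set (Eucl d)} (h : IsC2Domain ω) :
    AEStronglyMeasurable (outerNormal ω) (surf (frontier ω)) :=
  h.continuousOn_outerNormal.aestronglyMeasurable isClosed_frontier.measurableSet

theorem IsC2Domain.ae_norm_outerNormal {ω : Set (Eucl d)} (h : IsC2Domain ω) :
    ∀ᵐ y ∂(surf (frontier ω)), ‖outerNormal ω y‖ = 1 := by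
  filter_upwards [ae_restrict_mem isClosed_frontier.measurableSet] with y hy
  exact h.norm_outerNormal hy

theorem IsC2Domain.integrable_mul_outerNormal {ω : Set (Eucl d)} (h : IsC2Domain ω)
    {φ : Eucl d → ℝ} (hφ : Integrable φ (surf (frontier ω))) (v : Eucl d) :
    Integrable (fun y => φ y * inner ℝ (outerNormal ω y) v) (surf (frontier ω)) := by
  refine hφ.mul_bdd (c := ‖v‖) (h.aestronglyMeasurable_outerNormal.inner aestronglyMeasurable_const) ?_
  filter_upwards [h.ae_norm_outerNormal] with y hy
  have := norm_inner_le_norm (𝕜 := ℝ) (outerNormal ω y) v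
  rwa [hy, one_mul] at this

/-- At a boundary point the graph argument covers the directions with positive normal component, and
these span. Away from the boundary the surface term vanishes; the volume term is zero outside the
closure and inside `ω` is the integral of a derivative of a compactly supported function. -/
theorem IsC2Domain.gaussGreen_near (h : IsC2Domain ω) (hfin : IsFiniteMeasure (surf (frontier ω)))
    (v x : Eucl (m + 1)) :
    ∃ r > 0, ∀ ψ, IsCore ψ → tsupport ψ ⊆ Metric.ball x r → GaussGreen ω v ψ := by
  by_cases hx : x ∈ frontier ω
  · obtain ⟨ρ, hρ⟩ := h.exists_definingFunction hx
    have hn0 := norm_pos_iff.2 hρ.gradient_ne_zero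
    set n := ‖gradient ρ x‖⁻¹ • gradient ρ x with hn
    have hn1 : ‖n‖ = 1 := by rw [hn, norm_smul, norm_inv, norm_norm, inv_mul_cancel₀ hn0.ne']
    have hg : gradient ρ x = ‖gradient ρ x‖ • n := by
      rw [hn, smul_smul, mul_inv_cancel₀ hn0.ne', one_smul]
    -- With this `c` the vector `q = c n + v` satisfies `n · q > 0`, and `v = q - c n` is a
    -- combination of two admissible directions.
    set c := ‖v‖ + 1 with hc
    set q := c • n + v with hq
    have hnq : 0 < inner ℝ n q := by
      rw [hq, inner_add_right, real_inner_smul_right, real_inner_self_eq_norm_sq, hn1]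
      have := neg_le_of_abs_le (abs_real_inner_le_norm n v)
      rw [hn1, one_mul] at this
      rw [hc]; linarith
    have hq0 : 0 < ‖q‖ := norm_pos_iff.2 fun h0 => by simp [h0] at hnq
    obtain ⟨r₁, hr₁, h1⟩ := hρ.gaussGreen_of_pos h.isOpen hx hn1 (by
      rw [hg, real_inner_smul_left, real_inner_self_eq_norm_sq, hn1]; simpa using hn0)
    obtain ⟨r₂, hr₂, h2⟩ := hρ.gaussGreen_of_pos h.isOpen hx (e := ‖q‖⁻¹ • q)
      (by rw [norm_smul, norm_inv, norm_norm, inv_mul_cancel₀ hq0.ne']) (by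
        rw [hg, real_inner_smul_left, real_inner_smul_right]; positivity)
    refine ⟨min r₁ r₂, lt_min hr₁ hr₂, fun ψ hψ hs => ?_⟩
    have e1 := h1 ψ hψ (hs.trans (Metric.ball_subset_ball (min_le_left _ _)))
    have e2 := h2 ψ hψ (hs.trans (Metric.ball_subset_ball (min_le_right _ _)))
    have hv : v = ‖q‖ • (‖q‖⁻¹ • q) - c • n := by
      rw [smul_smul, mul_inv_cancel₀ hq0.ne', one_smul, hq, add_sub_cancel_left]
    rw [GaussGreen] at e1 e2 ⊢
    have hψi : Integrable ψ (surf (frontier ω)) :=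
      hψ.1.continuous.integrable_of_hasCompactSupport hψ.2
    rw [hv]
    simp_rw [inner_sub_right, inner_smul_right_eq_smul _ _ ‖q‖, inner_smul_right_eq_smul _ _ c,
      smul_eq_mul, mul_sub, mul_left_comm (ψ _)]
    rw [integral_sub, integral_sub, integral_const_mul, integral_const_mul, integral_const_mul,
      integral_const_mul, e1, e2]
    · exact (h.integrable_mul_outerNormal hψi _).const_mul _
    · exact (h.integrable_mul_outerNormal hψi _).const_mul _
    · exact (hψ.integrable_inner_gradient _ _).const_mul _
    · exact (hψ.integrable_inner_gradient _ _).const_mul _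
  · have hfr : ∀ {r : ℝ} {ψ : Eucl (m + 1) → ℝ}, Disjoint (frontier ω) (Metric.ball x r) →
        tsupport ψ ⊆ Metric.ball x r →
        ∫ y, ψ y * inner ℝ (outerNormal ω y) v ∂(surf (frontier ω)) = 0 := fun hd hs => by
      rw [surf]
      refine setIntegral_eq_zero_of_forall_eq_zero fun y hy => ?_
      rw [image_eq_zero_of_notMem_tsupport fun hc => hd.notMem_of_mem_left hy (hs hc), zero_mul]
    obtain ⟨r, hr, hd⟩ := Metric.isOpen_iff.1 isClosed_frontier.isOpen_compl x hx
    have hd' : Disjoint (frontier ω) (Metric.ball x r) :=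
      (subset_compl_iff_disjoint_left.1 hd)
    have hgs : ∀ {s : ℝ} {ψ : Eucl (m + 1) → ℝ}, tsupport ψ ⊆ Metric.ball x s →
        ∀ y ∉ Metric.ball x s, inner ℝ (gradient ψ y) v = 0 := fun hs y hy => by
      rw [inner_gradient, image_eq_zero_of_notMem_tsupport fun hc =>
        hy (hs (tsupport_fderiv_subset ℝ hc))]
      rfl
    by_cases hxω : x ∈ ω
    · obtain ⟨s, hs0, hs⟩ := Metric.isOpen_iff.1 h.isOpen x hxω
      refine ⟨min r s, lt_min hr hs0, fun ψ hψ hsu => ?_⟩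
      have hbs : Metric.ball x (min r s) ⊆ ω := (Metric.ball_subset_ball (min_le_right _ _)).trans hs
      rw [GaussGreen, hfr hd' (hsu.trans (Metric.ball_subset_ball (min_le_left _ _))),
        setIntegral_eq_integral_of_forall_compl_eq_zero fun y hy => hgs hsu y fun hc => hy (hbs hc)]
      simp_rw [inner_gradient]
      have := integral_mul_fderiv_eq_neg_fderiv_mul_of_integrable (μ := volume) (f := fun _ => (1 : ℝ))
        (g := ψ) (v := v) (by simp) (by
          simp_rw [one_mul, ← inner_gradient]; exact hψ.integrable_inner_gradient v volume)
        (by simpa using hψ.1.continuous.integrable_of_hasCompactSupport hψ.2)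
        (fun y _ => differentiableAt_const _)
        (fun y _ => hψ.1.differentiable one_ne_zero y)
      simpa using this
    · have hxc : x ∉ closure ω := fun hc => hx (by rw [h.isOpen.frontier_eq]; exact ⟨hc, hxω⟩)
      obtain ⟨s, hs0, hs⟩ := Metric.isOpen_iff.1 isClosed_closure.isOpen_compl x hxc
      refine ⟨min r s, lt_min hr hs0, fun ψ hψ hsu => ?_⟩
      rw [GaussGreen, hfr hd' (hsu.trans (Metric.ball_subset_ball (min_le_left _ _)))]
      refine setIntegral_eq_zero_of_forall_eq_zero fun y hy => ?_
      exact hgs hsu y fun hc => hs (Metric.ball_subset_ball (min_le_right _ _) hc) (subset_closure hy)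

theorem GaussGreen.add {ω : Set (Eucl d)} (h : IsC2Domain ω)
    (hfin : IsFiniteMeasure (surf (frontier ω))) {v : Eucl d} {φ ψ : Eucl d → ℝ}
    (hφ : IsCore φ) (hψ : IsCore ψ) (h1 : GaussGreen ω v φ) (h2 : GaussGreen ω v ψ) :
    GaussGreen ω v (fun y => φ y + ψ y) := by
  rw [GaussGreen] at *
  have : ∀ y, gradient (fun y => φ y + ψ y) y = gradient φ y + gradient ψ y := fun y =>
    gradient_add' (hφ.1.differentiable one_ne_zero y) (hψ.1.differentiable one_ne_zero y)
  simp_rw [this, inner_add_left, add_mul]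
  rw [integral_add, integral_add, h1, h2]
  · exact h.integrable_mul_outerNormal (hφ.1.continuous.integrable_of_hasCompactSupport hφ.2) _
  · exact h.integrable_mul_outerNormal (hψ.1.continuous.integrable_of_hasCompactSupport hψ.2) _
  · exact hφ.integrable_inner_gradient _ _
  · exact hψ.integrable_inner_gradient _ _

/-- The Gauss-Green formula for compactly supported `C¹` functions. -/
theorem IsC2Domain.gaussGreen (h : IsC2Domain ω) (hfin : IsFiniteMeasure (surf (frontier ω)))
    (v : Eucl (m + 1)) {φ : Eucl (m + 1) → ℝ} (hφ : IsCore φ) : GaussGreen ω v φ := by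
  choose r hr hGG using fun x => h.gaussGreen_near hfin v x
  -- Induction replaces a partition of unity: a bump `b` splits off the local part `b ψ`, and `(1 -
  -- b) ψ` vanishes on the ball of radius `r x / 4`, so one ball fewer is needed.
  have key : ∀ t : Finset (Eucl (m + 1)), ∀ ψ, IsCore ψ →
      (∀ y, ψ y ≠ 0 → ∃ x ∈ t, y ∈ Metric.closedBall x (r x / 4)) → GaussGreen ω v ψ := by
    classical
    intro t
    induction t using Finset.induction_on with
    | empty =>
      intro ψ _ hψ0
      have : ψ = fun _ => 0 := funext fun y => by
        by_contra hy
        obtain ⟨x, hx, -⟩ := hψ0 y hy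
        simp at hx
      rw [this, GaussGreen]
      simp [gradient]
    | insert x t _ ih =>
      intro ψ hψ hψ0
      have hrx := hr x
      let b : ContDiffBump x := ⟨r x / 4, r x / 2, by linarith, by linarith⟩
      have hb1 : IsCore fun y => b y * ψ y := ⟨b.contDiff.mul hψ.1, b.hasCompactSupport.mul_right⟩
      have hb2 : IsCore fun y => (1 - b y) * ψ y :=
        ⟨(contDiff_const.sub b.contDiff).mul hψ.1, hψ.2.mul_left⟩
      have e1 : GaussGreen ω v fun y => b y * ψ y := by
        refine hGG x _ hb1 (((tsupport_mul_subset_left).trans ?_))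
        change tsupport b ⊆ _
        rw [b.tsupport_eq]
        exact Metric.closedBall_subset_ball (by change r x / 2 < r x; linarith)
      have e2 : GaussGreen ω v fun y => (1 - b y) * ψ y := by
        refine ih _ hb2 fun y hy => ?_
        obtain ⟨z, hz, hyz⟩ := hψ0 y (right_ne_zero_of_mul hy)
        rcases Finset.mem_insert.1 hz with rfl | hz
        · exact absurd (by rw [b.one_of_mem_closedBall hyz, sub_self]) (left_ne_zero_of_mul hy)
        · exact ⟨z, hz, hyz⟩
      have := e1.add h hfin hb1 hb2 e2
      convert this using 2 with y
      ring
  obtain ⟨t, ht⟩ := hφ.2.isCompact.elim_finite_subcover (fun x => Metric.ball x (r x / 4))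
    (fun x => Metric.isOpen_ball) fun y _ => mem_iUnion.2 ⟨y, Metric.mem_ball_self (by linarith [hr y])⟩
  refine key t φ hφ fun y hy => ?_
  obtain ⟨x, hx⟩ := mem_iUnion.1 (ht (subset_tsupport φ hy))
  obtain ⟨hxt, hyx⟩ := mem_iUnion.1 hx
  exact ⟨x, hxt, Metric.ball_subset_closedBall hyx⟩

end

/-! ### Gauss-Green for Lipschitz functions and the divergence theorem -/

section
variable {d : ℕ}

theorem IsCore.mul {φ ψ : Eucl d → ℝ} (h : IsCore φ) (h' : IsCore ψ) :
    IsCore fun x => φ x * ψ x := ⟨h.1.mul h'.1, h.2.mul_right⟩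

theorem gradient_mul {φ ψ : Eucl d → ℝ} {x : Eucl d} (h : DifferentiableAt ℝ φ x)
    (h' : DifferentiableAt ℝ ψ x) :
    gradient (fun y => φ y * ψ y) x = φ x • gradient ψ x + ψ x • gradient φ x := by
  refine ext_inner_right ℝ fun v => ?_
  rw [inner_gradient, fderiv_fun_mul h h', inner_add_left, real_inner_smul_left, real_inner_smul_left,
    inner_gradient, inner_gradient]
  rfl

theorem lipschitzWith_mul_of_bounded {φ ψ : Eucl d → ℝ} {L L' M M' : ℝ≥0} (h : LipschitzWith L φ)
    (h' : LipschitzWith L' ψ) (hM : ∀ x, |φ x| ≤ M) (hM' : ∀ x, |ψ x| ≤ M') :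
    LipschitzWith (M * L' + L * M') fun x => φ x * ψ x := by
  refine LipschitzWith.of_dist_le_mul fun x y => ?_
  have h1 := h.dist_le_mul x y
  have h2 := h'.dist_le_mul x y
  rw [Real.dist_eq] at *
  have e : φ x * ψ x - φ y * ψ y = φ x * (ψ x - ψ y) + (φ x - φ y) * ψ y := by ring
  rw [e]
  refine (abs_add_le _ _).trans ?_
  rw [abs_mul, abs_mul]
  have h3 : |φ x| * |ψ x - ψ y| ≤ M * (L' * dist x y) :=
    mul_le_mul (hM x) h2 (abs_nonneg _) M.coe_nonneg
  have h4 : |φ x - φ y| * |ψ y| ≤ L * dist x y * M' :=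
    mul_le_mul h1 (hM' y) (abs_nonneg _) (by positivity)
  push_cast
  linarith

theorem lipschitz_integrable_inner_gradient {φ : Eucl d → ℝ} {L : ℝ≥0} (h : LipschitzWith L φ)
    {μ : Measure (Eucl d)} [IsFiniteMeasure μ] (v : Eucl d) :
    Integrable (fun y => inner ℝ (gradient φ y) v) μ := by
  refine Integrable.of_bound ((measurable_gradient φ).inner measurable_const).aestronglyMeasurable
    (L * ‖v‖) (Eventually.of_forall fun y => ?_)
  refine (abs_real_inner_le_norm _ _).trans (mul_le_mul_of_nonneg_right ?_ (norm_nonneg _))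
  rw [norm_gradient]
  exact norm_fderiv_le_of_lipschitzWith h y

/-- The Gauss-Green formula for Lipschitz functions. -/
theorem IsC2Domain.gaussGreen_of_lipschitz {m : ℕ} {ω : Set (Eucl (m + 1))} (h : IsC2Domain ω)
    (hb : Bornology.IsBounded ω) (v : Eucl (m + 1)) {φ : Eucl (m + 1) → ℝ} {L : ℝ≥0}
    (hφ : LipschitzWith L φ) : GaussGreen ω v φ := by
  obtain ⟨C, hD⟩ := h.exists_traceDomain hb
  have hfin := hD.isFiniteMeasure_surf
  have hfinv := hD.isFiniteMeasure_vol
  obtain ⟨φn, hn, hn1, hn2, hn3⟩ := lipschitz_exists_contDiff_approx hφ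
  have hGG : ∀ n, GaussGreen ω v (φn n) := fun n => by
    obtain ⟨χ, hχ, he⟩ := exists_isCore_eqOn (hn n) hb
    have h1 := h.gaussGreen hfin v hχ
    rw [GaussGreen] at h1 ⊢
    have e1 : ∫ y in ω, inner ℝ (gradient (φn n) y) v = ∫ y in ω, inner ℝ (gradient χ y) v :=
      setIntegral_congr_fun h.isOpen.measurableSet fun y hy => by
        simp only [(he y (subset_closure hy)).2]
    rw [e1, h1]
    exact setIntegral_congr_fun isClosed_frontier.measurableSet fun y hy => by
      simp only [(he y (frontier_subset_closure hy)).1]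
  have t1 : Tendsto (fun n => ∫ y in ω, inner ℝ (gradient (φn n) y) v) atTop
      (𝓝 (∫ y in ω, inner ℝ (gradient φ y) v)) := by
    refine tendsto_integral_of_dominated_convergence (fun _ => L * ‖v‖)
      (fun n => ((measurable_gradient _).inner measurable_const).aestronglyMeasurable)
      (integrable_const _) (fun n => Eventually.of_forall fun y => ?_) ?_
    · exact (abs_real_inner_le_norm _ _).trans
        (mul_le_mul_of_nonneg_right (hn2 n y) (norm_nonneg _))
    · filter_upwards [ae_restrict_of_ae hn3] with y hy
      exact hy.inner tendsto_const_nhds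
  obtain ⟨M, hM⟩ := hb.isCompact_closure.exists_bound_of_continuousOn hφ.continuous.continuousOn
  have t2 : Tendsto (fun n => ∫ y, φn n y * inner ℝ (outerNormal ω y) v ∂(surf (frontier ω))) atTop
      (𝓝 (∫ y, φ y * inner ℝ (outerNormal ω y) v ∂(surf (frontier ω)))) := by
    refine tendsto_integral_of_dominated_convergence (fun _ => (M + L) * ‖v‖)
      (fun n => (hn n).continuous.aestronglyMeasurable.mul
        (h.aestronglyMeasurable_outerNormal.inner aestronglyMeasurable_const))
      (integrable_const _) (fun n => ?_) (Eventually.of_forall fun y => ?_)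
    · filter_upwards [h.ae_norm_outerNormal, ae_restrict_mem isClosed_frontier.measurableSet]
        with y hy hyf
      have h1 := abs_real_inner_le_norm (outerNormal ω y) v
      rw [hy, one_mul] at h1
      have h2 := hM y (frontier_subset_closure hyf)
      have h3 := hn1 n y
      have h4 : (L : ℝ) * (1 / ((n : ℝ) + 1)) ≤ L := by
        refine mul_le_of_le_one_right L.coe_nonneg ?_
        rw [div_le_one (by positivity)]
        linarith [(Nat.cast_nonneg n : (0 : ℝ) ≤ n)]
      rw [Real.norm_eq_abs] at h2 ⊢
      rw [abs_mul]
      have h5 : |φn n y| ≤ M + L := by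
        have := abs_sub_abs_le_abs_sub (φn n y) (φ y)
        linarith
      exact mul_le_mul h5 h1 (abs_nonneg _) ((abs_nonneg _).trans h5)
    · refine Tendsto.mul_const _ ?_
      refine tendsto_iff_norm_sub_tendsto_zero.2 (squeeze_zero (fun _ => norm_nonneg _)
        (fun n => hn1 n y) ?_)
      simpa using tendsto_one_div_add_atTop_nhds_zero_nat.const_mul (L : ℝ)
  exact tendsto_nhds_unique t1 (t2.congr fun n => (hGG n).symm)

theorem IsField.exists_lipschitzWith_mul_inner {Ω : Set (Eucl d)} {V : Eucl d → Eucl d} {K : ℝ≥0}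
    (hV : IsField Ω V K) {g : Eucl d → ℝ} (hg : IsCore g) :
    ∃ C : ℝ≥0, ∀ e : Eucl d, ‖e‖ = 1 → LipschitzWith C fun y => g y * inner ℝ e (V y) := by
  obtain ⟨L, hL⟩ := hg.1.lipschitzWith_of_hasCompactSupport hg.2 one_ne_zero
  obtain ⟨M, hM⟩ := hg.2.exists_bound_of_continuous hg.1.continuous
  refine ⟨_, fun e he => lipschitzWith_mul_of_bounded (M := M.toNNReal) (M' := K) (L' := K) hL
    (LipschitzWith.of_dist_le_mul fun x y => ?_)
    (fun x => (hM x).trans (Real.le_coe_toNNReal M)) fun x => ?_⟩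
  · rw [Real.dist_eq, ← inner_sub_right]
    refine (abs_real_inner_le_norm _ _).trans ?_
    rw [he, one_mul, ← dist_eq_norm]
    exact hV.lip.dist_le_mul x y
  · refine (abs_real_inner_le_norm _ _).trans ?_
    rw [he, one_mul]
    exact hV.bound x

/-- This is the expansion of `div (g V)` in components, valid wherever the Lipschitz field is
differentiable. It reduces the divergence theorem to the scalar Gauss-Green formula. -/
theorem IsField.ae_sum_inner_gradient_mul {Ω : Set (Eucl d)} {V : Eucl d → Eucl d} {K : ℝ≥0}
    (hV : IsField Ω V K) {g : Eucl d → ℝ} (hg : IsCore g)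
    (b : OrthonormalBasis (Fin d) ℝ (Eucl d)) :
    ∀ᵐ y, ∑ i, inner ℝ (gradient (fun y => g y * inner ℝ (b i) (V y)) y) (b i)
      = inner ℝ (gradient g y) (V y) + g y * divergence V y := by
  filter_upwards [hV.lip.ae_differentiableAt] with y hd
  have hdi : ∀ i, HasFDerivAt (fun y => inner ℝ (b i) (V y)) ((innerSL ℝ (b i)).comp (fderiv ℝ V y)) y :=
    fun i => ((innerSL ℝ (b i)).hasFDerivAt).comp y hd.hasFDerivAt
  simp_rw [fun i => gradient_mul (hg.1.differentiable one_ne_zero y) (hdi i).differentiableAt,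
    inner_add_left, real_inner_smul_left, inner_gradient, (hdi _).fderiv, Finset.sum_add_distrib,
    ← Finset.mul_sum]
  rw [divergence, LinearMap.trace_eq_sum_inner _ b, add_comm]
  congr 1
  conv_rhs => rw [← b.sum_repr (V y), map_sum]
  refine Finset.sum_congr rfl fun i _ => ?_
  rw [map_smul, b.repr_apply_apply, smul_eq_mul]

/-- The divergence theorem for a Lipschitz field times a `C¹` function. -/
theorem IsC2Domain.integral_divergence {m : ℕ} {ω Ω : Set (Eucl (m + 1))} (h : IsC2Domain ω)
    (hb : Bornology.IsBounded ω) {V : Eucl (m + 1) → Eucl (m + 1)} {K : ℝ≥0} (hV : IsField Ω V K)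
    {g : Eucl (m + 1) → ℝ} (hg : IsCore g) :
    ∫ y in ω, (inner ℝ (gradient g y) (V y) + g y * divergence V y)
      = ∫ y, g y * inner ℝ (V y) (outerNormal ω y) ∂(surf (frontier ω)) := by
  obtain ⟨C, hD⟩ := h.exists_traceDomain hb
  have hfin := hD.isFiniteMeasure_surf
  have hfinv := hD.isFiniteMeasure_vol
  let b := EuclideanSpace.basisFun (Fin (m + 1)) ℝ
  obtain ⟨C', hC'⟩ := hV.exists_lipschitzWith_mul_inner hg
  have hlip := fun i => hC' (b i) (b.norm_eq_one i)
  have hGG := fun i => h.gaussGreen_of_lipschitz hb (b i) (hlip i)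
  simp only [GaussGreen] at hGG
  have hsum := Finset.sum_congr (rfl : (Finset.univ : Finset (Fin (m + 1))) = _) fun i _ => hGG i
  rw [← integral_finsetSum _ fun i _ => lipschitz_integrable_inner_gradient (hlip i) (b i),
    ← integral_finsetSum _ fun i _ => h.integrable_mul_outerNormal (memLp_one_iff_integrable.1
      ((lipschitz_memLp_of_isBounded (hlip i) hb ?_).mono_exponent one_le_two)) (b i)] at hsum
  · refine Eq.trans (integral_congr_ae ?_) (hsum.trans (integral_congr_ae ?_))
    · filter_upwards [ae_restrict_of_ae (hV.ae_sum_inner_gradient_mul hg b)] with y hy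
      exact hy.symm
    · refine Eventually.of_forall fun y => ?_
      simp only
      rw [← b.sum_inner_mul_inner (V y) (outerNormal ω y), Finset.mul_sum]
      refine Finset.sum_congr rfl fun i _ => ?_
      rw [real_inner_comm (b i) (V y), real_inner_comm (b i) (outerNormal ω y)]
      ring
  · filter_upwards [ae_restrict_mem isClosed_frontier.measurableSet] with y hy
    exact frontier_subset_closure hy

/-! ### The form of the divergence theorem -/

/-- The integral of `div (u v V)` over `A`. -/
def divForm (A : Set (Eucl d)) (V : Eucl d → Eucl d) (u v : SobPair d) : ℝ :=
  ∫ x in A, (inner ℝ (u.1 x • v.2 x + v.1 x • u.2 x) (V x) + u.1 x * v.1 x * divergence V x)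

section DivForm

variable {Ω A : Set (Eucl d)} {V : Eucl d → Eucl d} {K : ℝ≥0} {u v : SobPair d}

theorem IsField.abs_divIntegrand_le (hV : IsField Ω V K) (u v : SobPair d) (x : Eucl d) :
    |inner ℝ (u.1 x • v.2 x + v.1 x • u.2 x) (V x) + u.1 x * v.1 x * divergence V x|
      ≤ (d + 2) * K * (‖jet u x‖ * ‖jet v x‖) := by
  have a1 := norm_fst_le_jet u x
  have a2 := norm_snd_le_jet u x
  have b1 := norm_fst_le_jet v x
  have b2 := norm_snd_le_jet v x
  have hu := norm_nonneg (jet u x)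
  have hv := norm_nonneg (jet v x)
  have c1 : ‖u.1 x • v.2 x + v.1 x • u.2 x‖ ≤ 2 * (‖jet u x‖ * ‖jet v x‖) := by
    refine (norm_add_le _ _).trans ?_
    rw [norm_smul, norm_smul]
    have := mul_le_mul a1 b2 (norm_nonneg _) hu
    have := mul_le_mul b1 a2 (norm_nonneg _) hv
    linarith
  have c2 := (abs_real_inner_le_norm (u.1 x • v.2 x + v.1 x • u.2 x) (V x)).trans
    (mul_le_mul c1 (hV.bound x) (norm_nonneg _) (by positivity))
  have c3 : |u.1 x * v.1 x * divergence V x| ≤ (‖jet u x‖ * ‖jet v x‖) * (d * K) := by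
    rw [abs_mul, abs_mul]
    exact mul_le_mul (mul_le_mul a1 b1 (abs_nonneg _) hu) (abs_divergence_le hV.lip x) (abs_nonneg _)
      (by positivity)
  refine (abs_add_le _ _).trans ((add_le_add c2 c3).trans_eq ?_)
  ring

theorem IsField.integrable_divIntegrand (hV : IsField Ω V K) (hA : A ⊆ Ω) (hu : InH Ω u)
    (hv : InH Ω v) :
    Integrable (fun x => inner ℝ (u.1 x • v.2 x + v.1 x • u.2 x) (V x)
      + u.1 x * v.1 x * divergence V x) (volume.restrict A) := by
  have hu := hu.mono hA
  have hv := hv.mono hA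
  refine ((integrable_mul_of_memLp hu.memLp.norm hv.memLp.norm).const_mul ((d + 2) * K : ℝ)).mono' ?_
    (Eventually.of_forall fun x => hV.abs_divIntegrand_le u v x)
  have hu1 := (memLp_fst hu.memLp).1
  have hv1 := (memLp_fst hv.memLp).1
  exact (((hu1.smul (memLp_snd hv.memLp).1).add (hv1.smul (memLp_snd hu.memLp).1)).inner
    hV.lip.continuous.aestronglyMeasurable).add
      ((hu1.mul hv1).mul (measurable_divergence V).aestronglyMeasurable)

theorem IsField.isBddForm_divForm (hV : IsField Ω V K) (hA : A ⊆ Ω) :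
    IsBddForm Ω (divForm A V) ((d + 2) * K) where
  symm u v _ _ := integral_congr_ae (Eventually.of_forall fun x => by
    simp only; rw [add_comm (u.1 x • v.2 x), mul_comm (u.1 x)])
  add u v w hu hv hw := by
    rw [divForm, divForm, divForm, ← integral_add (hV.integrable_divIntegrand hA hu hw)
      (hV.integrable_divIntegrand hA hv hw)]
    refine integral_congr_ae (Eventually.of_forall fun x => ?_)
    simp only [Prod.fst_add, Prod.snd_add, Pi.add_apply, inner_add_left, add_smul, smul_add]
    ring
  smul c u v hu hv := by
    rw [divForm, divForm, ← integral_const_mul]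
    refine integral_congr_ae (Eventually.of_forall fun x => ?_)
    simp only [Prod.smul_fst, Prod.smul_snd, Pi.smul_apply, real_inner_smul_left, inner_add_left,
      smul_eq_mul]
    ring
  bound u v hu hv := by
    have hu' := hu.mono hA
    have hv' := hv.mono hA
    have h1 : |divForm A V u v| ≤ ∫ x in A, (d + 2) * K * (‖jet u x‖ * ‖jet v x‖) := by
      rw [← Real.norm_eq_abs]
      exact norm_integral_le_of_norm_le ((integrable_mul_of_memLp hu'.memLp.norm
        hv'.memLp.norm).const_mul _) (Eventually.of_forall fun x => hV.abs_divIntegrand_le u v x)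
    rw [integral_const_mul] at h1
    have h2 := abs_integral_mul_le hu'.memLp.norm hv'.memLp.norm
    rw [eLpNorm_norm, eLpNorm_norm] at h2
    rw [mul_assoc]
    refine h1.trans (mul_le_mul_of_nonneg_left ((le_abs_self _).trans (h2.trans ?_)) (by positivity))
    exact mul_le_mul (hNorm_mono hu hA) (hNorm_mono hv hA) hNorm_nonneg hNorm_nonneg

theorem IsBddForm.mono {β : SobPair d → SobPair d → ℝ} {c c' : ℝ} (h : IsBddForm Ω β c)
    (hc : c ≤ c') : IsBddForm Ω β c' :=
  ⟨h.symm, h.add, h.smul, fun u v hu hv => (h.bound u v hu hv).trans (by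
    have := hNorm_nonneg (Ω := Ω) (u := u)
    have := hNorm_nonneg (Ω := Ω) (u := v)
    gcongr)⟩

/-- Density, in the form of `tendsto_form_of_core` for a constant family. -/
theorem IsBddForm.eq_of_core {β γ : SobPair d → SobPair d → ℝ} {c c' : ℝ} (h : IsBddForm Ω β c)
    (h' : IsBddForm Ω γ c')
    (he : ∀ φ ψ, IsCore φ → IsCore ψ → β (withGrad φ) (withGrad ψ) = γ (withGrad φ) (withGrad ψ))
    (hu : InH Ω u) (hv : InH Ω v) : β u v = γ u v := by
  have h0 : 0 ≤ max 0 (max c c') := le_max_left _ _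
  have := tendsto_form_of_core (l := (atTop : Filter ℕ)) (βt := fun _ => β) h0
    (Eventually.of_forall fun _ => h.mono ((le_max_left _ _).trans (le_max_right _ _)))
    (h'.mono ((le_max_right c c').trans (le_max_right _ _)))
    (fun φ ψ hφ hψ => by rw [he φ ψ hφ hψ]; exact tendsto_const_nhds) hu hv
  exact tendsto_nhds_unique tendsto_const_nhds this

theorem divForm_core {φ ψ : Eucl d → ℝ} (hφ : IsCore φ) (hψ : IsCore ψ) :
    divForm A V (withGrad φ) (withGrad ψ) = ∫ x in A,
      (inner ℝ (gradient (fun y => φ y * ψ y) x) (V x) + (φ x * ψ x) * divergence V x) :=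
  integral_congr_ae (Eventually.of_forall fun x => by
    simp only [gradient_mul (hφ.1.differentiable one_ne_zero x) (hψ.1.differentiable one_ne_zero x)]
    rfl)

/-- The derivative of the mass form on a moving domain. -/
theorem IsField.tendsto_massForm_image (hV : IsField Ω V K) (hb : Bornology.IsBounded Ω)
    (hA : MeasurableSet A) (hAΩ : A ⊆ Ω) (hu : InH Ω u) (hv : InH Ω v) :
    Tendsto (fun t : ℝ => t⁻¹ * (massForm (flow V t '' A) 1 u v
      - massForm A 1 u v)) (𝓝[>] 0) (𝓝 (divForm A V u v)) := by
  refine tendsto_form_of_core (K := max ((d + 2) * K) (massConst d * K)) (βt := fun t u v =>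
      t⁻¹ * (massForm (flow V t '' A) 1 u v - massForm A 1 u v))
    (le_max_of_le_left (by positivity)) ?_ ((hV.isBddForm_divForm hAΩ).mono (le_max_left _ _)) ?_ hu hv
  · filter_upwards [hV.eventually_displacement] with t ht
    rw [← shift_smul]
    refine (isBddForm_massForm_image_sub ht.2 hA hAΩ t⁻¹).mono ?_
    refine le_trans (le_of_eq ?_) (le_max_right _ _)
    rw [abs_of_pos (inv_pos.2 ht.1)]
    push_cast
    rw [Real.coe_toNNReal _ ht.1.le]
    field_simp [ht.1.ne']
  · intro φ ψ hφ hψ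
    rw [divForm_core hφ hψ]
    refine (hV.tendsto_integral_image hA (hb.subset hAΩ) (hφ.mul hψ)).congr fun t => ?_
    simp only [massForm, withGrad_fst, Pi.one_apply, mul_one]
    ring

/-- Both sides are bounded forms on `H¹(Ω)`, so the divergence theorem for products of `C¹`
functions suffices. -/
theorem IsC2Domain.divForm_eq {m : ℕ} {ω Ω : Set (Eucl (m + 1))} (h : IsC2Domain ω)
    (hb : Bornology.IsBounded ω) {V : Eucl (m + 1) → Eucl (m + 1)} {K : ℝ≥0} (hV : IsField Ω V K)
    (hsub : ω ⊆ Ω) {u v : SobPair (m + 1)} (hu : InH Ω u) (hv : InH Ω v) :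
    divForm ω V u v = traceForm ω (fun y => inner ℝ (V y) (outerNormal ω y)) u v := by
  obtain ⟨C, hD⟩ := h.exists_traceDomain hb
  refine (hV.isBddForm_divForm hsub).eq_of_core (isBddForm_traceForm hD hsub (M := K) ?_ ?_) ?_ hu hv
  · exact hV.lip.continuous.aestronglyMeasurable.inner h.aestronglyMeasurable_outerNormal
  · filter_upwards [h.ae_norm_outerNormal] with y hy
    refine (abs_real_inner_le_norm _ _).trans ?_
    rw [hy, mul_one]
    exact hV.bound y
  · intro φ ψ hφ hψ
    rw [divForm_core hφ hψ, h.integral_divergence hb hV (hφ.mul hψ), traceForm]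
    refine integral_congr_ae ?_
    filter_upwards [traceOn_withGrad hD hφ, traceOn_withGrad hD hψ] with y h1 h2
    rw [h1, h2]

end DivForm

end

/-! ### The tangential Jacobian and its derivative -/

section
variable {m : ℕ}

theorem zero_smul_clm {d : ℕ} (B : Eucl d →L[ℝ] Eucl d) : (0 : ℝ) • B = 0 := zero_smul ℝ B

theorem hasFDerivAt_det_one_add (d : ℕ) {f' : (Eucl d →L[ℝ] Eucl d) →L[ℝ] ℝ}
    (hf : HasFDerivAt (fun B : Eucl d →L[ℝ] Eucl d => (1 + B).det) f' 0) (B : Eucl d →L[ℝ] Eucl d) :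
    f' B = LinearMap.trace ℝ (Eucl d) (B : Eucl d →ₗ[ℝ] Eucl d) := by
  have h1 : HasDerivAt (fun t : ℝ => t • B) B 0 := by
    simpa using (hasDerivAt_id (0 : ℝ)).smul_const B
  have h2 : HasFDerivAt (fun B : Eucl d →L[ℝ] Eucl d => (1 + B).det) f' ((0 : ℝ) • B) := by
    rwa [zero_smul_clm]
  have h3 := h2.comp_hasDerivAt (0 : ℝ) h1
  exact h3.unique (hasDerivAt_det_one_add B)

/-- The quadratic term does not contribute at `t = 0`. The Gram operator of `1 + tB` on a hyperplane
has this shape. -/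
theorem hasDerivAt_det_one_add_quadratic {d : ℕ} (Y Z : Eucl d →L[ℝ] Eucl d) :
    HasDerivAt (fun t : ℝ => (1 + (t • Y + t ^ 2 • Z)).det)
      (LinearMap.trace ℝ (Eucl d) (Y : Eucl d →ₗ[ℝ] Eucl d)) 0 := by
  have h0 := (contDiff_det_one_add (d := d)).differentiable one_ne_zero 0
  have h1 : HasDerivAt (fun t : ℝ => t • Y + t ^ 2 • Z) Y 0 := by
    have h1 : HasDerivAt (fun t : ℝ => t • Y) ((1 : ℝ) • Y) 0 := (hasDerivAt_id (0 : ℝ)).smul_const Y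
    have h2 : HasDerivAt (fun t : ℝ => t ^ 2 • Z) ((0 : ℝ) • Z) 0 := by
      have := ((hasDerivAt_pow 2 (0 : ℝ))).smul_const Z
      simpa only [Nat.cast_ofNat, Nat.add_one_sub_one, pow_one, mul_zero] using this
    have h3 := h1.add h2
    rw [one_smul ℝ Y, zero_smul_clm, add_zero] at h3
    exact h3
  have h2 : HasFDerivAt (fun B : Eucl d →L[ℝ] Eucl d => (1 + B).det)
      (fderiv ℝ (fun B : Eucl d →L[ℝ] Eucl d => (1 + B).det) 0) ((0 : ℝ) • Y + (0 : ℝ) ^ 2 • Z) := by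
    have : (0 : ℝ) • Y + (0 : ℝ) ^ 2 • Z = 0 := by
      rw [zero_pow two_ne_zero, zero_smul_clm, zero_smul_clm, add_zero]
    rw [this]
    exact h0.hasFDerivAt
  have h3 := h2.comp_hasDerivAt 0 h1
  rwa [hasFDerivAt_det_one_add d h0.hasFDerivAt] at h3

section Tangential

variable {n : Eucl (m + 1)} (F : Frame n)

theorem Frame.adjoint_self (F : Frame n) : F.Q.toContinuousLinearMap.adjoint n = 0 := by
  refine ext_inner_right ℝ fun k => ?_
  rw [ContinuousLinearMap.adjoint_inner_left, inner_zero_left, real_inner_comm]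
  exact F.orth k

theorem Frame.adjoint_comp (F : Frame n) (k : Eucl m) :
    F.Q.toContinuousLinearMap.adjoint (F.Q k) = k := by
  refine ext_inner_right ℝ fun l => ?_
  rw [ContinuousLinearMap.adjoint_inner_left]
  exact F.Q.inner_map_map k l

theorem Frame.comp_adjoint (F : Frame n) (hn : ‖n‖ = 1) (x : Eucl (m + 1)) :
    F.Q (F.Q.toContinuousLinearMap.adjoint x) = x - (inner ℝ n x) • n := by
  obtain ⟨y, hy⟩ := F.surj (x - (inner ℝ n x) • n) (by
    rw [inner_sub_left, real_inner_smul_left, real_inner_self_eq_norm_sq, hn, real_inner_comm]; ring)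
  have hx : x = F.Q y + (inner ℝ n x) • n := by rw [hy, sub_add_cancel]
  conv_lhs => rw [hx, map_add, map_smul, F.adjoint_self, F.adjoint_comp, smul_zero, add_zero]
  exact hy

/-- The tangential Jacobian of `1 + t B`. -/
def Frame.tangentJac (F : Frame n) (B : Eucl (m + 1) →L[ℝ] Eucl (m + 1)) (t : ℝ) : ℝ :=
  ((1 + t • B).comp F.Q.toContinuousLinearMap).toLinearMap.normDet

/-- The range of `D` is orthogonal to `n`, so `D` factors through the isometry `F.Q`, and the norm
determinant is multiplicative. Hence the ratio of the two Jacobians does not depend on the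
parametrisation. -/
theorem Frame.normDet_comp_eq (F : Frame n) (hn : ‖n‖ = 1) (B : Eucl (m + 1) →L[ℝ] Eucl (m + 1)) (t : ℝ)
    {D : Eucl m →L[ℝ] Eucl (m + 1)} (hD : ∀ k, inner ℝ n (D k) = 0) :
    ((1 + t • B).comp D).toLinearMap.normDet = F.tangentJac B t * D.toLinearMap.normDet := by
  set D' := F.Q.toContinuousLinearMap.adjoint.comp D with hD'
  have h1 : D = F.Q.toContinuousLinearMap.comp D' := by
    ext1 k
    exact ((F.comp_adjoint hn (D k)).trans (by rw [hD, zero_smul, sub_zero])).symm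
  have h2 : D.toLinearMap.normDet = D'.toLinearMap.normDet := by
    rw [h1, ContinuousLinearMap.toLinearMap_comp, LinearMap.normDet_comp_of_finrank_eq _ _ rfl]
    have : F.Q.toContinuousLinearMap.toLinearMap.normDet = 1 := F.Q.normDet_eq_one
    rw [this, one_mul]
  rw [h2]
  conv_lhs => rw [h1, ← ContinuousLinearMap.comp_assoc, ContinuousLinearMap.toLinearMap_comp,
    LinearMap.normDet_comp_of_finrank_eq _ _ rfl]
  rfl

theorem Frame.tangentJac_sq (F : Frame n) (B : Eucl (m + 1) →L[ℝ] Eucl (m + 1)) (t : ℝ) :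
    F.tangentJac B t ^ 2 = (1 + (t • F.Q.toContinuousLinearMap.adjoint.comp
      ((B + B.adjoint).comp F.Q.toContinuousLinearMap) + t ^ 2 • F.Q.toContinuousLinearMap.adjoint.comp
        ((B.adjoint.comp B).comp F.Q.toContinuousLinearMap))).det := by
  rw [Frame.tangentJac]
  refine (ContinuousLinearMap.normDet_sq ((1 + t • B).comp F.Q.toContinuousLinearMap)).trans ?_
  congr 1
  refine ContinuousLinearMap.ext fun k => ext_inner_right ℝ fun l => ?_
  have h1 : inner ℝ (F.Q k) (F.Q l) = inner ℝ k l := F.Q.inner_map_map k l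
  simp only [ContinuousLinearMap.comp_apply, _root_.add_apply,
    _root_.smul_apply, one_apply_eq_self, inner_add_left, inner_smul_left,
    ContinuousLinearMap.adjoint_inner_left, inner_add_right, inner_smul_right, map_add,
    LinearIsometry.coe_toContinuousLinearMap, h1, RCLike.conj_to_real]
  ring

/-- Cyclicity of the trace, as `Q Q*` is the projection `1 - n ⊗ n`. -/
theorem Frame.trace_conj (F : Frame n) (hn : ‖n‖ = 1) (B : Eucl (m + 1) →L[ℝ] Eucl (m + 1)) :
    LinearMap.trace ℝ (Eucl m) (F.Q.toContinuousLinearMap.adjoint.comp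
      (B.comp F.Q.toContinuousLinearMap) : Eucl m →L[ℝ] Eucl m).toLinearMap
      = LinearMap.trace ℝ (Eucl (m + 1)) B.toLinearMap - inner ℝ (B n) n := by
  rw [ContinuousLinearMap.toLinearMap_comp, LinearMap.trace_comp_comm',
    ← ContinuousLinearMap.toLinearMap_comp]
  have : (B.comp F.Q.toContinuousLinearMap).comp F.Q.toContinuousLinearMap.adjoint
      = B - InnerProductSpace.rankOne ℝ (B n) n := by
    ext1 x
    change B (F.Q (F.Q.toContinuousLinearMap.adjoint x)) = B x - inner ℝ n x • B n
    rw [F.comp_adjoint hn, map_sub, map_smul]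
  rw [this, ContinuousLinearMap.toLinearMap_sub, map_sub, InnerProductSpace.trace_rankOne,
    real_inner_comm]

theorem trace_adjoint {d : ℕ} (B : Eucl d →L[ℝ] Eucl d) :
    LinearMap.trace ℝ (Eucl d) B.adjoint.toLinearMap = LinearMap.trace ℝ (Eucl d) B.toLinearMap := by
  rw [LinearMap.trace_eq_sum_inner _ (EuclideanSpace.basisFun (Fin d) ℝ),
    LinearMap.trace_eq_sum_inner _ (EuclideanSpace.basisFun (Fin d) ℝ)]
  refine Finset.sum_congr rfl fun i _ => ?_
  change inner ℝ _ (B.adjoint _) = inner ℝ _ (B _)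
  rw [ContinuousLinearMap.adjoint_inner_right, real_inner_comm]

/-- The squared Jacobian is a Gram determinant with derivative the trace of `Q* (B + B*) Q`. The
square root at `1` halves it, and `B`, `B*` contribute equally. For `B = DV` this is the tangential
divergence. -/
theorem Frame.tendsto_tangentJac (F : Frame n) (hn : ‖n‖ = 1) (B : Eucl (m + 1) →L[ℝ] Eucl (m + 1)) :
    Tendsto (fun t : ℝ => (F.tangentJac B t - 1) / t) (𝓝[>] 0)
      (𝓝 (LinearMap.trace ℝ (Eucl (m + 1)) B.toLinearMap - inner ℝ (B n) n)) := by
  have h1 := hasDerivAt_det_one_add_quadratic (F.Q.toContinuousLinearMap.adjoint.comp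
      ((B + B.adjoint).comp F.Q.toContinuousLinearMap)) (F.Q.toContinuousLinearMap.adjoint.comp
        ((B.adjoint.comp B).comp F.Q.toContinuousLinearMap))
  simp_rw [← F.tangentJac_sq] at h1
  have h0 : F.tangentJac B 0 = 1 := by
    rw [Frame.tangentJac, zero_smul_clm, add_zero]
    exact F.Q.normDet_eq_one
  have h2 := h1.sqrt (by rw [h0]; norm_num)
  have h3 : (fun t => √(F.tangentJac B t ^ 2)) = F.tangentJac B :=
    funext fun t => Real.sqrt_sq (LinearMap.normDet_nonneg _)
  rw [h3, h0, F.trace_conj hn, ContinuousLinearMap.toLinearMap_add, map_add, trace_adjoint,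
    _root_.add_apply, inner_add_left, ContinuousLinearMap.adjoint_inner_left,
    real_inner_comm n (B n), one_pow, Real.sqrt_one] at h2
  have h4 := h2.tendsto_slope_zero_right
  refine (h4.congr fun t => ?_).trans_eq ?_
  · rw [zero_add, h0, smul_eq_mul, inv_mul_eq_div]
  · congr 1
    rw [real_inner_comm]; ring

/-- For `J ≥ 0` one has `|J - 1| ≤ |J² - 1|`, and `J²` is the determinant of `1 + X` with `‖X‖ ≤ 3 t
‖B‖`. The bound dominates the difference quotients of the surface measure. -/
theorem Frame.abs_tangentJac_sub_one_le (F : Frame n) (B : Eucl (m + 1) →L[ℝ] Eucl (m + 1)) {t : ℝ}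
    (ht : 0 ≤ t) (hB : 3 * (t * ‖B‖) ≤ 1) :
    |F.tangentJac B t - 1| ≤ detConst m * (3 * (t * ‖B‖)) := by
  set X := t • F.Q.toContinuousLinearMap.adjoint.comp
      ((B + B.adjoint).comp F.Q.toContinuousLinearMap) + t ^ 2 • F.Q.toContinuousLinearMap.adjoint.comp
        ((B.adjoint.comp B).comp F.Q.toContinuousLinearMap) with hX
  have hQ : ‖F.Q.toContinuousLinearMap‖ ≤ 1 := F.Q.norm_toContinuousLinearMap_le
  have hQ' : ‖F.Q.toContinuousLinearMap.adjoint‖ ≤ 1 := by rwa [LinearIsometryEquiv.norm_map]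
  have hconj : ∀ A : Eucl (m + 1) →L[ℝ] Eucl (m + 1), ‖F.Q.toContinuousLinearMap.adjoint.comp
      (A.comp F.Q.toContinuousLinearMap)‖ ≤ ‖A‖ := fun A =>
    calc _ ≤ ‖F.Q.toContinuousLinearMap.adjoint‖ * (‖A‖ * ‖F.Q.toContinuousLinearMap‖) :=
          (ContinuousLinearMap.opNorm_comp_le _ _).trans
            (mul_le_mul_of_nonneg_left (ContinuousLinearMap.opNorm_comp_le _ _) (norm_nonneg _))
      _ ≤ 1 * (‖A‖ * 1) := by gcongr
      _ = ‖A‖ := by ring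
  have hA : ‖B.adjoint‖ = ‖B‖ := LinearIsometryEquiv.norm_map _ _
  have hb := norm_nonneg B
  have hXn : ‖X‖ ≤ 3 * (t * ‖B‖) := by
    calc ‖X‖ ≤ t * ‖B + B.adjoint‖ + t ^ 2 * ‖B.adjoint.comp B‖ := by
          refine (norm_add_le _ _).trans ?_
          rw [norm_smul, norm_smul, Real.norm_of_nonneg ht, Real.norm_of_nonneg (sq_nonneg t)]
          gcongr <;> exact hconj _
      _ ≤ t * (‖B‖ + ‖B‖) + t ^ 2 * (‖B‖ * ‖B‖) := by
          gcongr
          · exact (norm_add_le _ _).trans_eq (by rw [hA])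
          · exact (ContinuousLinearMap.opNorm_comp_le _ _).trans_eq (by rw [hA])
      _ ≤ 3 * (t * ‖B‖) := by nlinarith [mul_nonneg ht hb]
  have h1 := abs_abs_det_sub_one_le (hXn.trans hB)
  rw [← F.tangentJac_sq, abs_of_nonneg (sq_nonneg (F.tangentJac B t))] at h1
  have hN : 0 ≤ F.tangentJac B t := LinearMap.normDet_nonneg _
  have h2 : |F.tangentJac B t ^ 2 - 1| = |F.tangentJac B t - 1| * (F.tangentJac B t + 1) := by
    have e : F.tangentJac B t ^ 2 - 1 = (F.tangentJac B t - 1) * (F.tangentJac B t + 1) := by ring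
    rw [e, abs_mul, abs_of_nonneg (by linarith : 0 ≤ F.tangentJac B t + 1)]
  have h3 : |F.tangentJac B t - 1| ≤ |F.tangentJac B t ^ 2 - 1| := by
    rw [h2]
    exact le_mul_of_one_le_right (abs_nonneg _) (by linarith)
  exact h3.trans (h1.trans (mul_le_mul_of_nonneg_left hXn detConst_nonneg))

end Tangential

end

/-! ### The derivative of the perimeter -/

section
variable {m : ℕ}

section Perimeter

variable {Ω ω U : Set (Eucl (m + 1))} {V W : Eucl (m + 1) → Eucl (m + 1)} {K : ℝ≥0}
  {x e : Eucl (m + 1)} {g : Eucl (m + 1) → ℝ} {L : ℝ≥0} {r : ℝ} {ρ : Eucl (m + 1) → ℝ}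

/-- The integrand of the tangential divergence. -/
def tangentialDiv (ω : Set (Eucl d)) (V : Eucl d → Eucl d) (x : Eucl d) : ℝ :=
  divergence V x - inner ℝ (fderiv ℝ V x (outerNormal ω x)) (outerNormal ω x)

theorem SubgraphNear.setIntegral_eq (h : SubgraphNear ω x e g L r) (F : Frame e)
    {A : Set (Eucl (m + 1))} (hA : MeasurableSet A) (hAr : A ⊆ frontier ω ∩ Metric.ball x r)
    (f : Eucl (m + 1) → ℝ) :
    ∫ y in A, f y ∂(surf (frontier ω)) = ∫ y in F.graph g ⁻¹' A, F.jac g y * f (F.graph g y) := by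
  have hm := (F.measurableEmbedding_graph h.norm_eq h.lip).measurable
  have h1 : (surf (frontier ω)).restrict A = (F.graphMeasure g).restrict A := by
    have := congrArg (fun μ => Measure.restrict μ A) (h.surf_restrict F)
    simpa only [Measure.restrict_restrict hA, inter_eq_left.2 (hAr.trans inter_subset_right)] using this
  rw [h1, ← integral_indicator hA, F.integral_graphMeasure h.norm_eq h.lip, ← integral_indicator (hm hA)]
  refine integral_congr_ae (Eventually.of_forall fun y => ?_)
  by_cases hy : F.graph g y ∈ A
  · simp only [indicator_of_mem hy, indicator_of_mem (show y ∈ F.graph g ⁻¹' A from hy)]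
  · simp only [indicator_of_notMem hy, indicator_of_notMem (show y ∉ F.graph g ⁻¹' A from hy), mul_zero]

/-- The derivative of the transported surface measure of a small piece of the boundary. -/
theorem SubgraphNear.tendsto_surface (h : SubgraphNear ω x e g L r) (hω : IsC2Domain ω)
    (hfin : IsFiniteMeasure (surf (frontier ω)))
    (hdef : ∀ y ∈ Metric.ball x r, IsDefiningFunction 1 ω y ρ)
    (hW : IsField Ω W K) (hU : IsOpen U) (hωU : frontier ω ⊆ U) (hV : ContDiffOn ℝ 1 V U)
    (hVW : ∀ y ∈ frontier ω, W y = V y) {M : ℝ} (hM : ∀ y ∈ frontier ω, ‖fderiv ℝ V y‖ ≤ M)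
    {A : Set (Eucl (m + 1))} (hA : MeasurableSet A) (hAr : A ⊆ frontier ω ∩ Metric.ball x r) :
    Tendsto (fun t : ℝ => ((μHE[m] : Measure (Eucl (m + 1))).real (flow W t '' A)
      - (μHE[m] : Measure (Eucl (m + 1))).real A) / t) (𝓝[>] 0)
      (𝓝 (∫ y in A, tangentialDiv ω V y ∂(surf (frontier ω)))) := by
  obtain ⟨F⟩ := exists_frame h.norm_eq
  have he := h.norm_eq
  have hL := F.lipschitz_graph he h.lip
  have hm := (F.measurableEmbedding_graph he h.lip).measurable
  set s := F.graph g ⁻¹' A with hs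
  have hsm : MeasurableSet s := hm hA
  have himg : F.graph g '' s = A := by
    rw [hs, image_preimage_eq_inter_range, inter_eq_left]
    exact fun y hy => ((h.frontier_inter F).le (hAr hy)).1
  have hfinA : (μHE[m] : Measure (Eucl (m + 1))) A < ∞ := by
    have h1 : surf (frontier ω) A = μHE[m] A := by
      rw [surf_eq, Measure.restrict_apply hA, inter_eq_left.2 (hAr.trans inter_subset_left)]
    rw [← h1]; exact measure_lt_top _ _
  have hA0 := euclideanHausdorffMeasure_image_eq_of_bilipschitz hL (F.antilipschitz_graph he) hsm
  rw [himg] at hA0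
  have hjac : Integrable (F.jac g) (volume.restrict s) := by
    refine ⟨F.measurable_jac.aestronglyMeasurable, ?_⟩
    rw [hasFiniteIntegral_iff_ofReal (Eventually.of_forall F.jac_nonneg)]
    exact hA0 ▸ hfinA
  have hM0 : ∀ y ∈ s, 0 ≤ M := fun y hy => (norm_nonneg _).trans (hM _ (hAr hy).1)
  have hfr : ∀ z, F.graph g z ∈ Metric.ball x r → F.graph g z ∈ frontier ω := fun z hz =>
    ((h.frontier_inter F).ge ⟨mem_range_self z, hz⟩).1
  set J : ℝ → Eucl m → ℝ := fun t y => (fderiv ℝ (flow W t ∘ F.graph g) y).toLinearMap.normDet with hJ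
  have hJm : ∀ t, Measurable (J t) := fun t =>
    continuous_normDet.measurable.comp (measurable_fderiv ℝ _)
  -- The area formula for the flow composed with the graph map, which is bi-Lipschitz for small `t`.
  have hvol : ∀ᶠ t in 𝓝[>] (0 : ℝ), (μHE[m] : Measure (Eucl (m + 1))) (flow W t '' A)
      = ∫⁻ y in s, ENNReal.ofReal (J t y) := by
    filter_upwards [hW.eventually_displacement] with t ht
    rw [← himg, ← image_comp]
    rw [← shift_smul] at *
    exact euclideanHausdorffMeasure_image_eq_of_bilipschitz (ht.2.lipschitz_shift.comp hL)
      (ht.2.antilipschitz_shift.comp (F.antilipschitz_graph he)) hsm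
  -- Near `y` the graph stays in `∂ω`, where `W = V`. The composition is therefore differentiable by
  -- the regularity of `V` alone, whatever `W` does off `∂ω`.
  have hJeq : ∀ y ∈ s, DifferentiableAt ℝ (F.graph g) y →
      ∃ Fn : Frame (outerNormal ω (F.graph g y)), ∀ t,
        J t y = Fn.tangentJac (fderiv ℝ V (F.graph g y)) t * F.jac g y := by
    intro y hy hd
    have hyA : F.graph g y ∈ frontier ω ∩ Metric.ball x r := hAr hy
    have hn := hω.norm_outerNormal hyA.1
    obtain ⟨Fn⟩ := exists_frame hn
    refine ⟨Fn, fun t => ?_⟩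
    rw [Frame.jac, ← Fn.normDet_comp_eq hn _ t (h.inner_outerNormal_fderiv hω.isOpen hdef F hyA.2 hd)]
    have hVd : HasFDerivAt V (fderiv ℝ V (F.graph g y)) (F.graph g y) :=
      ((hV.contDiffAt (hU.mem_nhds (hωU hyA.1))).differentiableAt one_ne_zero).hasFDerivAt
    have h1 : HasFDerivAt (fun z => F.graph g z + t • V (F.graph g z))
        ((1 + t • fderiv ℝ V (F.graph g y)).comp (fderiv ℝ (F.graph g) y)) y :=
      hd.hasFDerivAt.add ((hVd.comp y hd.hasFDerivAt).const_smul t)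
    have h2 : flow W t ∘ F.graph g =ᶠ[𝓝 y] fun z => F.graph g z + t • V (F.graph g z) := by
      filter_upwards [hL.continuous.continuousAt.preimage_mem_nhds
        (Metric.isOpen_ball.mem_nhds hyA.2)] with z hz
      rw [Function.comp_apply, flow, hVW _ (hfr z hz)]
    simp only [hJ]
    rw [(h1.congr_of_eventuallyEq h2).fderiv]
  set M₁ := max M 0 with hM₁
  have hM₁0 : 0 ≤ M₁ := le_max_right _ _
  have hgood : ∀ᵐ y ∂(volume.restrict s), y ∈ s ∧ DifferentiableAt ℝ (F.graph g) y :=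
    (ae_restrict_mem hsm).and (ae_restrict_of_ae hL.ae_differentiableAt)
  have hbd : ∀ t : ℝ, 0 ≤ t → 3 * (t * M₁) ≤ 1 → ∀ y ∈ s, DifferentiableAt ℝ (F.graph g) y →
      |J t y - F.jac g y| ≤ detConst m * (3 * (t * M₁)) * F.jac g y := by
    intro t ht htM y hy hd
    obtain ⟨Fn, hFn⟩ := hJeq y hy hd
    have hB : ‖fderiv ℝ V (F.graph g y)‖ ≤ M₁ := (hM _ (hAr hy).1).trans (le_max_left _ _)
    have h2 : 3 * (t * ‖fderiv ℝ V (F.graph g y)‖) ≤ 3 * (t * M₁) := by gcongr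
    have h1 := Fn.abs_tangentJac_sub_one_le (fderiv ℝ V (F.graph g y)) ht (h2.trans htM)
    rw [hFn, ← sub_one_mul, abs_mul, abs_of_nonneg (F.jac_nonneg y)]
    exact mul_le_mul_of_nonneg_right (h1.trans (mul_le_mul_of_nonneg_left h2 detConst_nonneg))
      (F.jac_nonneg y)
  have hsmall : ∀ᶠ t in 𝓝[>] (0 : ℝ), 0 < t ∧ 3 * (t * M₁) ≤ 1 := by
    refine (eventually_mem_nhdsWithin : ∀ᶠ t : ℝ in 𝓝[>] 0, t ∈ Ioi 0).and ?_
    have : Tendsto (fun t : ℝ => 3 * (t * M₁)) (𝓝[>] 0) (𝓝 (3 * (0 * M₁))) :=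
      (((tendsto_id.mul_const M₁).const_mul 3).mono_left nhdsWithin_le_nhds)
    exact (this.eventually (gt_mem_nhds (by simp))).mono fun t ht => ht.le
  have hint : ∀ t : ℝ, 0 < t → 3 * (t * M₁) ≤ 1 → Integrable (J t) (volume.restrict s) := by
    intro t ht htM
    have h1 : Integrable (fun y => J t y - F.jac g y) (volume.restrict s) := by
      refine (hjac.const_mul (detConst m * (3 * (t * M₁)))).mono'
        ((hJm t).sub F.measurable_jac).aestronglyMeasurable ?_
      filter_upwards [hgood] with y hy
      exact hbd t ht.le htM y hy.1 hy.2
    exact (h1.add hjac).congr (Eventually.of_forall fun y => sub_add_cancel _ _)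
  have hreal : (fun t : ℝ => ∫ y in s, (J t y - F.jac g y) / t) =ᶠ[𝓝[>] 0] fun t =>
      ((μHE[m] : Measure (Eucl (m + 1))).real (flow W t '' A)
        - (μHE[m] : Measure (Eucl (m + 1))).real A) / t := by
    filter_upwards [hvol, hsmall] with t h1 h2
    rw [integral_div, integral_sub (hint t h2.1 h2.2) hjac, Measure.real, Measure.real, h1, hA0,
      integral_eq_lintegral_of_nonneg_ae (Eventually.of_forall fun y => LinearMap.normDet_nonneg _)
        (hJm t).aestronglyMeasurable,
      integral_eq_lintegral_of_nonneg_ae (Eventually.of_forall F.jac_nonneg)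
        F.measurable_jac.aestronglyMeasurable]
    rfl
  refine Tendsto.congr' hreal ?_
  rw [h.setIntegral_eq F hA hAr]
  refine tendsto_integral_filter_of_dominated_convergence
    (fun y => detConst m * (3 * M₁) * F.jac g y)
    (Eventually.of_forall fun t => (((hJm t).sub F.measurable_jac).div_const t).aestronglyMeasurable)
    ?_ (hjac.const_mul _) ?_
  · filter_upwards [hsmall] with t ht
    filter_upwards [hgood] with y hy
    rw [norm_div, Real.norm_eq_abs, Real.norm_of_nonneg ht.1.le, div_le_iff₀ ht.1]
    refine (hbd t ht.1.le ht.2 y hy.1 hy.2).trans_eq (by ring)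
  · filter_upwards [hgood] with y hy
    obtain ⟨Fn, hFn⟩ := hJeq y hy.1 hy.2
    have h1 := (Fn.tendsto_tangentJac (hω.norm_outerNormal (hAr hy.1).1)
      (fderiv ℝ V (F.graph g y))).const_mul (F.jac g y)
    refine h1.congr fun t => ?_
    rw [hFn]; ring

theorem exists_norm_fderiv_le {d : ℕ} {ω U : Set (Eucl d)} {V : Eucl d → Eucl d}
    (hb : Bornology.IsBounded ω) (hU : IsOpen U) (hωU : frontier ω ⊆ U) (hV : ContDiffOn ℝ 1 V U) :
    ∃ M, ∀ y ∈ frontier ω, ‖fderiv ℝ V y‖ ≤ M :=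
  (hb.isCompact_closure.of_isClosed_subset isClosed_frontier
    frontier_subset_closure).exists_bound_of_continuousOn
      ((hV.continuousOn_fderiv_of_isOpen hU le_rfl).mono hωU)

theorem IsC2Domain.continuousOn_tangentialDiv {d : ℕ} {ω U : Set (Eucl d)} {V : Eucl d → Eucl d}
    (hω : IsC2Domain ω) (hU : IsOpen U) (hωU : frontier ω ⊆ U) (hV : ContDiffOn ℝ 1 V U) :
    ContinuousOn (tangentialDiv ω V) (frontier ω) := by
  have h1 : ContinuousOn (fderiv ℝ V) (frontier ω) :=
    (hV.continuousOn_fderiv_of_isOpen hU le_rfl).mono hωU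
  have h2 := hω.continuousOn_outerNormal
  have h3 : Continuous fun B : Eucl d →L[ℝ] Eucl d =>
      LinearMap.trace ℝ (Eucl d) (B : Eucl d →ₗ[ℝ] Eucl d) :=
    ((LinearMap.trace ℝ (Eucl d)).comp (ContinuousLinearMap.coeLM ℝ :
      (Eucl d →L[ℝ] Eucl d) →ₗ[ℝ] (Eucl d →ₗ[ℝ] Eucl d))).continuous_of_finiteDimensional
  exact (h3.comp_continuousOn h1).sub ((h1.clm_apply h2).inner h2)

/-- The derivative of the transported surface measure of the boundary. -/
theorem IsC2Domain.tendsto_surface (hω : IsC2Domain ω) (hb : Bornology.IsBounded ω)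
    (hW : IsField Ω W K) (hU : IsOpen U) (hωU : frontier ω ⊆ U) (hV : ContDiffOn ℝ 1 V U)
    (hVW : ∀ y ∈ frontier ω, W y = V y) :
    Tendsto (fun t : ℝ => ((μHE[m] : Measure (Eucl (m + 1))).real (flow W t '' frontier ω)
      - (μHE[m] : Measure (Eucl (m + 1))).real (frontier ω)) / t) (𝓝[>] 0)
      (𝓝 (tangentialDivIntegral ω V)) := by
  obtain ⟨C, hD⟩ := hω.exists_traceDomain hb
  have hfin := hD.isFiniteMeasure_surf
  obtain ⟨M, hM⟩ := exists_norm_fderiv_le hb hU hωU hV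
  have hc : IsCompact (frontier ω) :=
    hb.isCompact_closure.of_isClosed_subset isClosed_frontier frontier_subset_closure
  have hfinA : ∀ A, MeasurableSet A → A ⊆ frontier ω → (μHE[m] : Measure (Eucl (m + 1))) A ≠ ∞ := by
    intro A hA hAf
    have h1 : surf (frontier ω) A = μHE[m] A := by
      rw [surf_eq, Measure.restrict_apply hA, inter_eq_left.2 hAf]
    rw [← h1]; exact measure_ne_top _ _
  have hint : Integrable (tangentialDiv ω V) (surf (frontier ω)) := by
    obtain ⟨N, hN⟩ := hc.exists_bound_of_continuousOn (hω.continuousOn_tangentialDiv hU hωU hV)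
    exact Integrable.of_bound ((hω.continuousOn_tangentialDiv hU hωU hV).aestronglyMeasurable
      isClosed_frontier.measurableSet) N
        ((ae_restrict_mem isClosed_frontier.measurableSet).mono fun y hy => hN y hy)
  -- The local claim includes all measurable subsets, so that a finite cover of the boundary can be
  -- cut into disjoint pieces and the derivatives added.
  let P : Set (Eucl (m + 1)) → Prop := fun S => ∃ S', MeasurableSet S' ∧ S ⊆ S' ∧
    ∀ A, MeasurableSet A → A ⊆ frontier ω ∩ S' →
      Tendsto (fun t : ℝ => ((μHE[m] : Measure (Eucl (m + 1))).real (flow W t '' A)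
      - (μHE[m] : Measure (Eucl (m + 1))).real A) / t) (𝓝[>] 0)
      (𝓝 (∫ y in A, tangentialDiv ω V y ∂(surf (frontier ω))))
  have key : P (frontier ω) := by
    refine hc.induction_on (p := P) ?_ ?_ ?_ ?_
    · refine ⟨∅, MeasurableSet.empty, subset_rfl, fun A hA hAS => ?_⟩
      have : A = ∅ := subset_empty_iff.1 (hAS.trans inter_subset_right)
      simp [this]
    · rintro S T hST ⟨T', h1, h2, h3⟩
      exact ⟨T', h1, hST.trans h2, h3⟩
    · rintro S T ⟨S', h1, h2, h3⟩ ⟨T', k1, k2, k3⟩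
      refine ⟨S' ∪ T', h1.union k1, union_subset_union h2 k2, fun A hA hAS => ?_⟩
      have a1 := h3 (A ∩ S') (hA.inter h1) fun y hy => ⟨(hAS hy.1).1, hy.2⟩
      have a2 := k3 (A \ S') (hA.diff h1) fun y hy =>
        ⟨(hAS hy.1).1, ((hAS hy.1).2).resolve_left hy.2⟩
      have hAf : A ⊆ frontier ω := hAS.trans inter_subset_left
      have e1 : ∫ y in A, tangentialDiv ω V y ∂(surf (frontier ω))
          = (∫ y in A ∩ S', tangentialDiv ω V y ∂(surf (frontier ω)))
            + ∫ y in A \ S', tangentialDiv ω V y ∂(surf (frontier ω)) :=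
        (integral_inter_add_sdiff h1 hint.integrableOn).symm
      rw [e1]
      refine (a1.add a2).congr' ?_
      filter_upwards [hW.eventually_displacement] with t ht
      rw [← shift_smul]
      have hinj := ht.2.injective_shift
      have himage : ∀ B, MeasurableSet B → MeasurableSet (shift (t • W) '' B) := fun B hB =>
        (ht.2.lipschitz_shift.continuous.measurableEmbedding hinj).measurableSet_image.2 hB
      have hfini : ∀ B, MeasurableSet B → B ⊆ frontier ω →
          (μHE[m] : Measure (Eucl (m + 1))) (shift (t • W) '' B) ≠ ∞ := by
        intro B hB hBf
        have := euclideanHausdorffMeasure_image_le_of_edist_le (f := shift (t • W)) (g := id)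
          (s := B) (K := 2) (fun x _ y _ => ht.2.lipschitz_shift x y) m
        rw [image_id] at this
        exact (this.trans_lt (ENNReal.mul_lt_top (by simp) (hfinA B hB hBf).lt_top)).ne
      have e2 : (μHE[m] : Measure (Eucl (m + 1))).real A
          = (μHE[m] : Measure (Eucl (m + 1))).real (A ∩ S')
            + (μHE[m] : Measure (Eucl (m + 1))).real (A \ S') :=
        (measureReal_inter_add_sdiff h1 (hfinA A hA hAf)).symm
      have e3 : (μHE[m] : Measure (Eucl (m + 1))).real (shift (t • W) '' A)
          = (μHE[m] : Measure (Eucl (m + 1))).real (shift (t • W) '' (A ∩ S'))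
            + (μHE[m] : Measure (Eucl (m + 1))).real (shift (t • W) '' (A \ S')) := by
        rw [← measureReal_inter_add_sdiff (himage _ h1) (hfini A hA hAf), ← image_inter hinj,
          ← image_sdiff hinj]
      rw [e2, e3]; ring
    · intro x hx
      obtain ⟨ρ, hρ⟩ := hω.exists_definingFunction hx
      have hn0 := norm_pos_iff.2 hρ.gradient_ne_zero
      obtain ⟨g, L, r, hs, hdef⟩ := hρ.exists_subgraph hω.isOpen hx
        (e := ‖gradient ρ x‖⁻¹ • gradient ρ x)
        (by rw [norm_smul, norm_inv, norm_norm, inv_mul_cancel₀ hn0.ne'])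
        (by rw [real_inner_smul_right, real_inner_self_eq_norm_sq]; positivity)
      exact ⟨Metric.ball x r, nhdsWithin_le_nhds (Metric.ball_mem_nhds x hs.pos), Metric.ball x r,
        Metric.isOpen_ball.measurableSet, subset_rfl, fun A hA hAr =>
          hs.tendsto_surface hω hfin (fun y hy => (hdef y hy).1) hW hU hωU hV hVW hM hA hAr⟩
  obtain ⟨S', h1, h2, h3⟩ := key
  have := h3 (frontier ω) isClosed_frontier.measurableSet fun y hy => ⟨hy, h2 hy⟩
  have e : ∫ y in frontier ω, tangentialDiv ω V y ∂(surf (frontier ω)) = tangentialDivIntegral ω V := by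
    rw [surf, Measure.restrict_restrict isClosed_frontier.measurableSet, inter_self]
    rfl
  rwa [e] at this

/-- The derivative of the perimeter. -/
theorem IsC2Domain.tendsto_perimeter (hω : IsC2Domain ω) (hb : Bornology.IsBounded ω)
    (hW : IsField Ω W K) (hU : IsOpen U) (hωU : frontier ω ⊆ U) (hV : ContDiffOn ℝ 1 V U)
    (hVW : ∀ y ∈ frontier ω, W y = V y) :
    Tendsto (fun t : ℝ => ((surf (frontier (flow W t '' ω))).real univ
      - (surf (frontier ω)).real univ) / t) (𝓝[>] 0) (𝓝 (tangentialDivIntegral ω V)) := by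
  refine (hω.tendsto_surface hb hW hU hωU hV hVW).congr' ?_
  -- The inverse has displacement size `2 t K`, which must not exceed `1/4`. The map is then a
  -- homeomorphism and carries the boundary of `ω` to the boundary of its image.
  have hsmall : ∀ᶠ t in 𝓝[>] (0 : ℝ), 0 < t ∧ t * (K : ℝ) ≤ 1 / 8 := eventually_pos_mul_le K (by norm_num)
  filter_upwards [hW.eventually_displacement, hsmall] with t ht h8
  obtain ⟨W', h1, h2, h3⟩ := ht.2.exists_inverse (by
    rw [← NNReal.coe_le_coe]
    push_cast
    rw [Real.coe_toNNReal _ ht.1.le]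
    linarith [h8.2])
  let Φ : Eucl (m + 1) ≃ₜ Eucl (m + 1) :=
    { toFun := shift (t • W), invFun := shift W', left_inv := h2, right_inv := h3
      continuous_toFun := ht.2.lipschitz_shift.continuous
      continuous_invFun := h1.lipschitz_shift.continuous }
  have hfr : frontier (flow W t '' ω) = flow W t '' frontier ω := (Φ.image_frontier ω).symm
  rw [hfr, measureReal_def, measureReal_def, measureReal_def, measureReal_def, surf_eq, surf_eq,
    Measure.restrict_apply_univ, Measure.restrict_apply_univ]

end Perimeter

end

/-! ### The state and adjoint systems as operator equations -/

section
variable {d : ℕ}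

section State

variable {Ω A : Set (Eucl d)} {C : ℝ≥0} {α : ℝ} {f ud un : Eucl d → ℝ} {u p v w : SobPair d}

/-- The operators and vectors that represent the forms of the state system on `H¹(Ω)`. -/
structure StateOperators (α : ℝ) (f ud un : Eucl d → ℝ) (Ω : Set (Eucl d))
    (B : HSpace Ω →L[ℝ] HSpace Ω) (S : Set (Eucl d) → HSpace Ω →L[ℝ] HSpace Ω) (F g : HSpace Ω) :
    Prop where
  symPSD_B : SymPSD B
  inner_B : ∀ u v, InH Ω u → InH Ω v → inner ℝ (B (cls Ω u)) (cls Ω v) = traceForm Ω 1 u v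
  symPSD_S : ∀ A, A ⊆ Ω → SymPSD (S A)
  inner_S : ∀ A, A ⊆ Ω → ∀ u v, InH Ω u → InH Ω v →
    inner ℝ (S A (cls Ω u)) (cls Ω v) = 1 / α * massForm A 1 u v
  inner_F : ∀ v, InH Ω v → inner ℝ F (cls Ω v)
    = (∫ x in Ω, f x * v.1 x) + ∫ x, un x * traceOn Ω v x ∂(surf (frontier Ω))
  inner_g : ∀ w, InH Ω w → inner ℝ g (cls Ω w) = ∫ x, ud x * traceOn Ω w x ∂(surf (frontier Ω))

theorem isBddFunctional_integral {f : Eucl d → ℝ} (hf : MemLp f 2 (volume.restrict Ω)) :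
    IsBddFunctional Ω (fun v => ∫ x in Ω, f x * v.1 x) (eLpNorm f 2 (volume.restrict Ω)).toReal where
  add u v hu hv := by
    rw [← integral_add (integrable_mul_of_memLp hf (memLp_fst hu.memLp))
      (integrable_mul_of_memLp hf (memLp_fst hv.memLp))]
    refine integral_congr_ae (Eventually.of_forall fun x => ?_)
    simp only [Prod.fst_add, Pi.add_apply]; ring
  smul c u hu := by
    rw [← integral_const_mul]
    refine integral_congr_ae (Eventually.of_forall fun x => ?_)
    simp only [Prod.smul_fst, Pi.smul_apply, smul_eq_mul]; ring
  bound u hu := (abs_integral_mul_le hf (memLp_fst hu.memLp)).trans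
    (mul_le_mul_of_nonneg_left (toReal_fst_le subset_rfl hu) ENNReal.toReal_nonneg)

theorem TraceDomain.isBddFunctional_trace (hD : TraceDomain Ω C) {f : Eucl d → ℝ}
    (hf : MemLp f 2 (surf (frontier Ω))) :
    IsBddFunctional Ω (fun v => ∫ x, f x * traceOn Ω v x ∂(surf (frontier Ω)))
      ((eLpNorm f 2 (surf (frontier Ω))).toReal * C) where
  add u v hu hv := by
    rw [← integral_add (integrable_mul_of_memLp hf (hu.memLp_traceOn hD))
      (integrable_mul_of_memLp hf (hv.memLp_traceOn hD))]
    refine integral_congr_ae ?_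
    filter_upwards [traceOn_add hD hu hv] with x hx
    rw [hx, Pi.add_apply]; ring
  smul c u hu := by
    rw [← integral_const_mul]
    refine integral_congr_ae ?_
    filter_upwards [traceOn_smul hD hu c] with x hx
    rw [hx, Pi.smul_apply, smul_eq_mul]; ring
  bound u hu := by
    rw [mul_assoc]
    exact (abs_integral_mul_le hf (hu.memLp_traceOn hD)).trans
      (mul_le_mul_of_nonneg_left (toReal_traceOn_le hD hu) ENNReal.toReal_nonneg)

theorem IsBddFunctional.add' {ℓ ℓ' : SobPair d → ℝ} {K K' : ℝ} (h : IsBddFunctional Ω ℓ K)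
    (h' : IsBddFunctional Ω ℓ' K') : IsBddFunctional Ω (fun u => ℓ u + ℓ' u) (K + K') :=
  ⟨fun u v hu hv => by rw [h.add u v hu hv, h'.add u v hu hv]; ring,
    fun c u hu => by rw [h.smul c u hu, h'.smul c u hu]; ring,
    fun u hu => (abs_add_le _ _).trans (by rw [add_mul]; exact add_le_add (h.bound u hu) (h'.bound u hu))⟩

theorem isBddForm_massForm_one (hA : A ⊆ Ω) : IsBddForm Ω (massForm A 1) |1| :=
  isBddForm_massForm hA measurable_const.aestronglyMeasurable
    (Eventually.of_forall fun x => by simp)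

/-- All data are bounded forms and functionals on `H¹(Ω)`, and the two forms are nonnegative on the
diagonal because `α > 0`. -/
theorem TraceDomain.exists_stateOperators (hD : TraceDomain Ω C) (hα : 0 < α)
    (hf : MemLp f 2 (volume.restrict Ω)) (hud : MemLp ud 2 (surf (frontier Ω)))
    (hun : MemLp un 2 (surf (frontier Ω))) :
    ∃ B S F g, StateOperators α f ud un Ω B S F g := by
  obtain ⟨B, -, hB1, hB2⟩ := (isBddForm_traceForm hD subset_rfl (θ := 1) (M := 1)
    measurable_const.aestronglyMeasurable (Eventually.of_forall fun x => by simp)).exists_op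
      (by positivity)
  -- For sets that are not contained in `Ω` the operator is set to zero; it is never used there.
  have hS : ∀ A : Set (Eucl d), ∃ S : HSpace Ω →L[ℝ] HSpace Ω, A ⊆ Ω →
      (∀ x y, inner ℝ (S x) y = inner ℝ x (S y)) ∧ ∀ u v, InH Ω u → InH Ω v →
        inner ℝ (S (cls Ω u)) (cls Ω v) = 1 / α * massForm A 1 u v := fun A => by
    by_cases hA : A ⊆ Ω
    · obtain ⟨S, -, h1, h2⟩ := ((isBddForm_massForm_one hA).smul_left' (1 / α)).exists_op
        (by positivity)
      exact ⟨S, fun _ => ⟨h1, h2⟩⟩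
    · exact ⟨0, fun h => absurd h hA⟩
  choose S hS using hS
  obtain ⟨F, hF⟩ := ((isBddFunctional_integral hf).add' (hD.isBddFunctional_trace hun)).exists_riesz
  obtain ⟨g, hg⟩ := (hD.isBddFunctional_trace hud).exists_riesz
  refine ⟨B, S, F, g, ⟨hB1, fun x => ?_⟩, hB2, fun A hA => ⟨(hS A hA).1, fun x => ?_⟩,
    fun A hA => (hS A hA).2, hF, hg⟩
  · obtain ⟨u, hu, rfl⟩ := exists_cls_eq x
    rw [hB2 u u hu hu]
    exact integral_nonneg fun x => by
      simp only [Pi.zero_apply, Pi.one_apply, mul_one]; exact mul_self_nonneg _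
  · obtain ⟨u, hu, rfl⟩ := exists_cls_eq x
    rw [(hS A hA).2 u u hu hu]
    exact mul_nonneg (by positivity) (integral_nonneg fun x => by
      simp only [Pi.zero_apply, Pi.one_apply, mul_one]; exact mul_self_nonneg _)

theorem eq_of_inner_cls {x y : HSpace Ω} (h : ∀ v, InH Ω v → inner ℝ x (cls Ω v) = inner ℝ y (cls Ω v)) :
    x = y := ext_inner_right ℝ fun z => by
  obtain ⟨v, hv, rfl⟩ := exists_cls_eq z
  exact h v hv

theorem fst_ae_eq_of_cls_eq (hu : InH Ω u) (hv : InH Ω v) (h : cls Ω u = cls Ω v) :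
    u.1 =ᵐ[volume.restrict Ω] v.1 :=
  ((cls_eq_iff hu hv).1 h).mono fun _ hx => (jet_eq_iff.1 hx).1

theorem massForm_one (A : Set (Eucl d)) (u v : SobPair d) :
    massForm A 1 u v = ∫ x in A, u.1 x * v.1 x := by
  simp only [massForm, Pi.one_apply, mul_one]

theorem traceForm_one (u v : SobPair d) :
    traceForm Ω 1 u v = ∫ x, traceOn Ω u x * traceOn Ω v x ∂(surf (frontier Ω)) := by
  simp only [traceForm, Pi.one_apply, mul_one]

theorem TraceDomain.integral_sub_mul_traceOn (hD : TraceDomain Ω C)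
    (hud : MemLp ud 2 (surf (frontier Ω))) (hu : InH Ω u) (hw : InH Ω w) :
    ∫ x, (traceOn Ω u x - ud x) * traceOn Ω w x ∂(surf (frontier Ω))
      = traceForm Ω 1 u w - ∫ x, ud x * traceOn Ω w x ∂(surf (frontier Ω)) := by
  rw [traceForm_one, ← integral_sub (integrable_mul_of_memLp (hu.memLp_traceOn hD)
    (hw.memLp_traceOn hD)) (integrable_mul_of_memLp hud (hw.memLp_traceOn hD))]
  simp only [sub_mul]

section Operators

variable {B : HSpace Ω →L[ℝ] HSpace Ω} {S : Set (Eucl d) → HSpace Ω →L[ℝ] HSpace Ω} {F g : HSpace Ω}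

/-- Testing with all of `H¹(Ω)` is equality of the Riesz representatives. Everything about the state
is proved for the operator equations and carried back by this equivalence. -/
theorem StateOperators.isState_iff (h : StateOperators α f ud un Ω B S F g) (hD : TraceDomain Ω C)
    (hud : MemLp ud 2 (surf (frontier Ω))) (hA : A ⊆ Ω) :
    IsState α f ud un Ω A u p ↔ InH Ω u ∧ InH Ω p ∧ cls Ω u + S A (cls Ω p) = F ∧
      cls Ω p = B (cls Ω u) - g := by
  constructor
  · intro hs
    have hu := (isH1_iff hD).1 hs.memU
    have hp := (isH1_iff hD).1 hs.memP
    refine ⟨hu, hp, eq_of_inner_cls fun v hv => ?_, eq_of_inner_cls fun v hv => ?_⟩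
    · have := hs.eqU v ((isH1_iff hD).2 hv)
      rw [inner_add_left, inner_cls hu hv, h.inner_S A hA p v hp hv, h.inner_F v hv, massForm_one, this]
    · rw [inner_cls hp hv, inner_sub_left, h.inner_B u v hu hv, h.inner_g v hv,
        hs.eqP v ((isH1_iff hD).2 hv), hD.integral_sub_mul_traceOn hud hu hv]
  · rintro ⟨hu, hp, h1, h2⟩
    refine ⟨(isH1_iff hD).2 hu, (isH1_iff hD).2 hp, fun v hv => ?_, fun v hv => ?_⟩
    · have hv := (isH1_iff hD).1 hv
      have := congrArg (fun x => inner ℝ x (cls Ω v)) h1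
      rwa [inner_add_left, inner_cls hu hv, h.inner_S A hA p v hp hv, h.inner_F v hv,
        massForm_one] at this
    · have hv := (isH1_iff hD).1 hv
      have := congrArg (fun x => inner ℝ x (cls Ω v)) h2
      rwa [inner_cls hp hv, inner_sub_left, h.inner_B u v hu hv, h.inner_g v hv,
        ← hD.integral_sub_mul_traceOn hud hu hv] at this

/-- Eliminating `p` leaves `u + S (B u) = F + S g`, which is solvable by
`SymPSD.surjective_add_comp`. -/
theorem StateOperators.exists_isState (h : StateOperators α f ud un Ω B S F g) (hD : TraceDomain Ω C)
    (hud : MemLp ud 2 (surf (frontier Ω))) (hA : A ⊆ Ω) : ∃ u p, IsState α f ud un Ω A u p := by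
  obtain ⟨x, hx⟩ := h.symPSD_B.surjective_add_comp (h.symPSD_S A hA) (F + S A g)
  obtain ⟨u, hu, hux⟩ := exists_cls_eq x
  obtain ⟨p, hp, hpx⟩ := exists_cls_eq (B x - g)
  refine ⟨u, p, (h.isState_iff hD hud hA).2 ⟨hu, hp, ?_, by rw [hux, hpx]⟩⟩
  rw [hux, hpx, map_sub, ← add_sub_assoc, hx, add_sub_cancel_right]

theorem SymPSD.eq_zero_of_add_comp {H : Type*} [NormedAddCommGroup H] [InnerProductSpace ℝ H]
    {B C : H →L[ℝ] H} (hB : SymPSD B) (hC : SymPSD C) {x : H} (hx : x + C (B x) = 0) : x = 0 := by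
  have := hB.norm_le_of_add_comp hC x
  rw [hx, norm_zero, mul_zero] at this
  exact norm_le_zero_iff.1 this

theorem SymPSD.system_unique {H : Type*} [NormedAddCommGroup H] [InnerProductSpace ℝ H]
    {B C : H →L[ℝ] H} (hB : SymPSD B) (hC : SymPSD C) {F g u p u₂ p₂ : H} (a1 : u + C p = F)
    (b1 : p = B u - g) (a2 : u₂ + C p₂ = F) (b2 : p₂ = B u₂ - g) : u₂ = u ∧ p₂ = p := by
  have e : u₂ - u = 0 := by
    refine hB.eq_zero_of_add_comp hC ?_
    have hB : B (u₂ - u) = p₂ - p := by rw [b1, b2, map_sub]; abel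
    rw [hB, map_sub, eq_sub_of_add_eq' a1, eq_sub_of_add_eq' a2]
    abel
  have e' := sub_eq_zero.1 e
  exact ⟨e', by rw [b1, b2, e']⟩

theorem StateOperators.cls_unique (h : StateOperators α f ud un Ω B S F g) (hD : TraceDomain Ω C)
    (hud : MemLp ud 2 (surf (frontier Ω))) (hA : A ⊆ Ω) {u₂ p₂ : SobPair d}
    (h1 : IsState α f ud un Ω A u p) (h2 : IsState α f ud un Ω A u₂ p₂) :
    cls Ω u₂ = cls Ω u ∧ cls Ω p₂ = cls Ω p := by
  obtain ⟨-, -, a1, b1⟩ := (h.isState_iff hD hud hA).1 h1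
  obtain ⟨-, -, a2, b2⟩ := (h.isState_iff hD hud hA).1 h2
  exact h.symPSD_B.system_unique (h.symPSD_S A hA) a1 b1 a2 b2

/-- Adding the equation of `p` to the first adjoint equation gives `v + p = B w`. The second one
then reads `w + S (B w) = 0`, so `w = 0` and `v = -p`. -/
theorem StateOperators.isAdjoint_cls (h : StateOperators α f ud un Ω B S F g) (hD : TraceDomain Ω C)
    (hud : MemLp ud 2 (surf (frontier Ω))) (hA : A ⊆ Ω) (hs : IsState α f ud un Ω A u p)
    (ha : IsAdjoint α ud Ω A u p v w) : cls Ω v = cls Ω (-p) ∧ cls Ω w = 0 := by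
  obtain ⟨hu, hp, -, hpB⟩ := (h.isState_iff hD hud hA).1 hs
  have hv := (isH1_iff hD).1 ha.memV
  have hw := (isH1_iff hD).1 ha.memW
  have e1 : cls Ω v + cls Ω p = B (cls Ω w) := by
    rw [hpB]
    refine eq_of_inner_cls fun r hr => ?_
    rw [inner_add_left, inner_sub_left, inner_cls hv hr, h.inner_B u r hu hr, h.inner_B w r hw hr,
      h.inner_g r hr, ha.eqV r ((isH1_iff hD).2 hr)]
    have e : ∫ x, (traceOn Ω w x - traceOn Ω u x + ud x) * traceOn Ω r x ∂(surf (frontier Ω))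
        = traceForm Ω 1 w r
          - ∫ x, (traceOn Ω u x - ud x) * traceOn Ω r x ∂(surf (frontier Ω)) := by
      rw [traceForm_one, ← integral_sub (integrable_mul_of_memLp (hw.memLp_traceOn hD)
        (hr.memLp_traceOn hD)) (integrable_mul_of_memLp (f := fun x => traceOn Ω u x - ud x)
          ((hu.memLp_traceOn hD).sub hud) (hr.memLp_traceOn hD))]
      refine integral_congr_ae (Eventually.of_forall fun x => ?_)
      simp only
      ring
    rw [e, hD.integral_sub_mul_traceOn hud hu hr]
    ring
  have e2 : cls Ω w + S A (B (cls Ω w)) = 0 := by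
    refine eq_of_inner_cls fun s hs => ?_
    rw [← e1, ← cls_add hv hp, inner_add_left, inner_cls hw hs, h.inner_S A hA _ s (hv.add hp) hs,
      inner_zero_left, ha.eqW s ((isH1_iff hD).2 hs), massForm_one]
    simp only [Prod.fst_add, Pi.add_apply]
    ring
  have e3 := h.symPSD_B.eq_zero_of_add_comp (h.symPSD_S A hA) e2
  refine ⟨?_, e3⟩
  rw [e3, map_zero] at e1
  rw [cls_neg hp]
  exact eq_neg_of_add_eq_zero_left e1

theorem IsState.isAdjoint (hD : TraceDomain Ω C) (hs : IsState α f ud un Ω A u p) :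
    IsAdjoint α ud Ω A u p (-p) 0 := by
  have hp := (isH1_iff hD).1 hs.memP
  refine ⟨(isH1_iff hD).2 hp.neg, (isH1_iff hD).2 InH.zero, fun r hr => ?_, fun s hs => ?_⟩
  · have h1 : aForm Ω (-p) r = - aForm Ω p r := by
      rw [aForm, aForm, ← integral_neg]
      refine integral_congr_ae (Eventually.of_forall fun x => ?_)
      simp only [Prod.fst_neg, Prod.snd_neg, Pi.neg_apply, inner_neg_left]; ring
    rw [h1, hs.eqP r hr, ← integral_neg]
    refine integral_congr_ae ?_
    filter_upwards [traceOn_zero hD] with x hx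
    rw [hx, Pi.zero_apply]; ring
  · have h1 : aForm Ω (0 : SobPair d) s = 0 := by simp [aForm]
    rw [h1]
    simp

end Operators

end State

end

/-! ### First order expansion of the state -/

section
variable {d : ℕ}

section Abstract

variable {H : Type*} [NormedAddCommGroup H] [InnerProductSpace ℝ H]

/-- The tracking functional at the solution of the system is affine in the solution. -/
theorem system_energy_eq {B C : H →L[ℝ] H} {F g u p : H} (hu : u + C p = F) (hp : p = B u - g) :
    inner ℝ (B u) u - 2 * inner ℝ g u + inner ℝ (C p) p = inner ℝ F p - inner ℝ g u := by
  have h1 : B u = p + g := by rw [hp, sub_add_cancel]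
  rw [h1, ← hu, inner_add_left, inner_add_left, real_inner_comm u p]
  ring

/-- Pair the derivative equation with `p` and use the symmetry of `B` and `C`. Up to sign `p` is its
own adjoint state, so `u'` drops out. -/
theorem system_derivative_eq {B C C' : H →L[ℝ] H} (hB : SymPSD B) (hC : SymPSD C) {F g u p u' : H}
    (hu : u + C p = F) (hp : p = B u - g) (hu' : u' + C (B u') + C' p = 0) :
    inner ℝ F (B u') - inner ℝ g u' = - inner ℝ (C' p) p := by
  have h1 : inner ℝ F (B u') = inner ℝ (p + g) u' + inner ℝ p (C (B u')) := by
    rw [← hu, inner_add_left, ← hB.symm, hC.symm, hp, sub_add_cancel]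
  have h2 : inner ℝ p (u' + C (B u') + C' p) = 0 := by rw [hu', inner_zero_right]
  rw [inner_add_right, inner_add_right] at h2
  rw [h1, inner_add_left, real_inner_comm p (C' p)]
  linarith

/-- The functional `⟨F, p⟩ - ⟨g, u⟩` is linear in the state, so the weak derivatives of the state
suffice for its derivative. -/
theorem perturbed_system_expansion [CompleteSpace H] {ι : Type*} {l : Filter ι}
    {B C C' : H →L[ℝ] H} {Ct : ι → H →L[ℝ] H}
    {ε : ι → ℝ} {K : ℝ} (hB : SymPSD B) (hC0 : SymPSD C) (hC : ∀ᶠ t in l, SymPSD (Ct t))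
    (hK : ∀ᶠ t in l, 0 < ε t ∧ ‖Ct t - C‖ ≤ K * ε t) (hε : Tendsto ε l (𝓝 0))
    (hC' : ∀ x y, Tendsto (fun t => (inner ℝ (Ct t x) y - inner ℝ (C x) y) / ε t) l (𝓝 (inner ℝ (C' x) y)))
    {F g u p : H} {ut pt : ι → H} (hu : u + C p = F) (hp : p = B u - g)
    (hut : ∀ᶠ t in l, ut t + Ct t (pt t) = F ∧ pt t = B (ut t) - g) :
    ∃ u', u' + C (B u') + C' p = 0 ∧
      (∀ z, Tendsto (fun t => (inner ℝ (ut t) z - inner ℝ u z) / ε t) l (𝓝 (inner ℝ u' z))) ∧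
      (∀ z, Tendsto (fun t => (inner ℝ (pt t) z - inner ℝ p z) / ε t) l (𝓝 (inner ℝ (B u') z))) ∧
      Tendsto (fun t => ((inner ℝ F (pt t) - inner ℝ g (ut t)) - (inner ℝ F p - inner ℝ g u)) / ε t) l
        (𝓝 (- inner ℝ (C' p) p)) := by
  obtain ⟨u', h1, h2, h3⟩ := perturbed_system_weak_deriv hB hC0 hC hK hε hC' hu hp hut
  have e : ∀ (c : ℝ) (a b z : H), inner ℝ (c⁻¹ • (a - b)) z = (inner ℝ a z - inner ℝ b z) / c :=
    fun c a b z => by rw [real_inner_smul_left, inner_sub_left]; ring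
  simp_rw [e] at h2 h3
  refine ⟨u', h1, h2, h3, ?_⟩
  rw [← system_derivative_eq hB hC0 hu hp h1, real_inner_comm (B u') F, real_inner_comm u' g]
  refine ((h3 F).sub (h2 g)).congr fun t => ?_
  rw [real_inner_comm F (pt t), real_inner_comm g (ut t), real_inner_comm F p, real_inner_comm g u]
  ring

theorem opNorm_le_of_inner {T : H →L[ℝ] H} {c : ℝ} (hc : 0 ≤ c)
    (h : ∀ x y, |inner ℝ (T x) y| ≤ c * ‖x‖ * ‖y‖) : ‖T‖ ≤ c := by
  refine T.opNorm_le_bound hc fun x => ?_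
  have h1 := (le_abs_self _).trans (h x (T x))
  rw [real_inner_self_eq_norm_sq, sq] at h1
  rcases eq_or_lt_of_le (norm_nonneg (T x)) with h0 | h0
  · rw [← h0]; positivity
  · exact le_of_mul_le_mul_right h1 h0

end Abstract

section Perturbation

variable {Ω ω : Set (Eucl d)} {C K : ℝ≥0} {α : ℝ} {f ud un : Eucl d → ℝ} {u p : SobPair d}
  {W : Eucl d → Eucl d} {B : HSpace Ω →L[ℝ] HSpace Ω} {S : Set (Eucl d) → HSpace Ω →L[ℝ] HSpace Ω}
  {F g : HSpace Ω}

theorem IsField.eventually_image_subset (hW : IsField Ω W K) (hsub : ω ⊆ Ω) :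
    ∀ᶠ t in 𝓝[>] (0 : ℝ), flow W t '' ω ⊆ Ω := by
  filter_upwards [hW.eventually_displacement] with t ht
  rw [← shift_smul]
  exact (image_mono hsub).trans ht.2.image_shift.le

theorem StateOperators.norm_sub_le (h : StateOperators α f ud un Ω B S F g) (hα : 0 < α)
    (hW : IsField Ω W K) (hω : MeasurableSet ω) (hsub : ω ⊆ Ω) :
    ∀ᶠ t in 𝓝[>] (0 : ℝ), 0 < t ∧ ‖S (flow W t '' ω) - S ω‖ ≤ 1 / α * (massConst d * K) * t := by
  filter_upwards [hW.eventually_displacement, hW.eventually_image_subset hsub] with t ht hsubt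
  have hm0 := massConst_nonneg (d := d)
  refine ⟨ht.1, opNorm_le_of_inner (mul_nonneg (by positivity) ht.1.le) fun x y => ?_⟩
  obtain ⟨u, hu, rfl⟩ := exists_cls_eq x
  obtain ⟨v, hv, rfl⟩ := exists_cls_eq y
  have h1 := ht.2.abs_massForm_image_sub_le hω hsub hu hv
  rw [shift_smul, NNReal.coe_mul, Real.coe_toNNReal _ ht.1.le] at h1
  rw [_root_.sub_apply, inner_sub_left, h.inner_S _ hsubt u v hu hv, h.inner_S _ hsub u v hu hv,
    ← mul_sub, abs_mul, abs_of_pos (one_div_pos.2 hα), norm_cls hu, norm_cls hv]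
  calc 1 / α * |massForm (flow W t '' ω) 1 u v - massForm ω 1 u v|
      ≤ 1 / α * (massConst d * (t * K) * hNorm Ω u * hNorm Ω v) :=
        mul_le_mul_of_nonneg_left h1 (by positivity)
    _ = _ := by ring

theorem hNorm_sub_eq (hu : InH Ω u) (hp : InH Ω p) : hNorm Ω (u - p) = ‖cls Ω u - cls Ω p‖ := by
  rw [← norm_cls (hu.sub hp), cls_sub hu hp]

/-- First order expansion of the state under a perturbation of the source support. -/
structure StateDerivative (Ω : Set (Eucl d)) (p : SobPair d)
    (B S D : HSpace Ω →L[ℝ] HSpace Ω) (u' p' : SobPair d) : Prop where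
  inH_u : InH Ω u'
  inH_p : InH Ω p'
  eq_u : cls Ω u' + S (cls Ω p') + D (cls Ω p) = 0
  eq_p : cls Ω p' = B (cls Ω u')

theorem IsField.exists_divOp (hW : IsField Ω W K) (hα : 0 < α) (hsub : ω ⊆ Ω) :
    ∃ D : HSpace Ω →L[ℝ] HSpace Ω, ∀ u v, InH Ω u → InH Ω v →
      inner ℝ (D (cls Ω u)) (cls Ω v) = 1 / α * divForm ω W u v := by
  obtain ⟨D, -, -, h⟩ := ((hW.isBddForm_divForm hsub).smul_left' (1 / α)).exists_op (by positivity)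
  exact ⟨D, h⟩

-- The perturbation results with `ε t = t`, `Ct t = S (flow W t '' ω)` and `C' = D`. They apply
-- because the moved states are still functions on the fixed set `Ω`.
set_option maxHeartbeats 1000000 in
theorem StateOperators.exists_stateDerivative (h : StateOperators α f ud un Ω B S F g)
    (hD : TraceDomain Ω C) (hud : MemLp ud 2 (surf (frontier Ω))) (hα : 0 < α)
    (hW : IsField Ω W K) (hω : MeasurableSet ω) (hsub : ω ⊆ Ω) (hs : IsState α f ud un Ω ω u p)
    {D : HSpace Ω →L[ℝ] HSpace Ω} (hDiv : ∀ u v, InH Ω u → InH Ω v →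
      inner ℝ (D (cls Ω u)) (cls Ω v) = 1 / α * divForm ω W u v)
    {ut pt : ℝ → SobPair d}
    (ht : ∀ᶠ t in 𝓝[>] (0 : ℝ), IsState α f ud un Ω (flow W t '' ω) (ut t) (pt t)) :
    ∃ u' p', StateDerivative Ω p B (S ω) D u' p' ∧
      (∀ v, InH Ω v → Tendsto (fun t => (aForm Ω (ut t) v - aForm Ω u v) / t) (𝓝[>] 0)
        (𝓝 (aForm Ω u' v))) ∧
      (∀ v, InH Ω v → Tendsto (fun t => (aForm Ω (pt t) v - aForm Ω p v) / t) (𝓝[>] 0)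
        (𝓝 (aForm Ω p' v))) ∧
      Tendsto (fun t => ((inner ℝ F (cls Ω (pt t)) - inner ℝ g (cls Ω (ut t)))
        - (inner ℝ F (cls Ω p) - inner ℝ g (cls Ω u))) / t) (𝓝[>] 0)
        (𝓝 (-(1 / α * divForm ω W p p))) ∧
      ∃ M, 0 ≤ M ∧ ∀ᶠ t in 𝓝[>] (0 : ℝ), hNorm Ω (ut t - u) ≤ M * t ∧ hNorm Ω (pt t - p) ≤ M * t := by
  obtain ⟨hu, hp, hF, hg⟩ := (h.isState_iff hD hud hsub).1 hs
  have hsubt := hW.eventually_image_subset hsub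
  have hst : ∀ᶠ t in 𝓝[>] (0 : ℝ), InH Ω (ut t) ∧ InH Ω (pt t) ∧
      cls Ω (ut t) + S (flow W t '' ω) (cls Ω (pt t)) = F ∧ cls Ω (pt t) = B (cls Ω (ut t)) - g := by
    filter_upwards [ht, hsubt] with t h1 h2
    exact (h.isState_iff hD hud h2).1 h1
  have hε : Tendsto (fun t : ℝ => t) (𝓝[>] 0) (𝓝 0) := nhdsWithin_le_nhds
  have hC := hsubt.mono fun t ht => h.symPSD_S _ ht
  have hK := h.norm_sub_le hα hW hω hsub
  have hC' : ∀ x y, Tendsto (fun t => (inner ℝ (S (flow W t '' ω) x) y - inner ℝ (S ω x) y) / t)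
      (𝓝[>] 0) (𝓝 (inner ℝ (D x) y)) := by
    intro x y
    obtain ⟨a, ha, rfl⟩ := exists_cls_eq x
    obtain ⟨b, hb, rfl⟩ := exists_cls_eq y
    rw [hDiv a b ha hb]
    refine ((hW.tendsto_massForm_image hD.isBounded hω hsub ha hb).const_mul (1 / α)).congr' ?_
    filter_upwards [hsubt] with t ht
    rw [h.inner_S _ ht a b ha hb, h.inner_S _ hsub a b ha hb]
    ring
  obtain ⟨x, hx1, hx2, hx3, hx4⟩ := perturbed_system_expansion h.symPSD_B (h.symPSD_S ω hsub) hC hK hε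
    hC' hF hg (hst.mono fun t ht => ht.2.2)
  obtain ⟨M, hM0, hM⟩ := perturbed_system_bound h.symPSD_B hC hK hε hF hg (hst.mono fun t ht => ht.2.2)
  obtain ⟨u', hu', rfl⟩ := exists_cls_eq x
  obtain ⟨p', hp', hpe⟩ := exists_cls_eq (B (cls Ω u'))
  rw [hDiv p p hp hp] at hx4
  refine ⟨u', p', ⟨hu', hp', by rw [hpe, hx1], hpe⟩, fun v hv => ?_, fun v hv => ?_, hx4, M, hM0, ?_⟩
  · rw [← inner_cls hu' hv]
    refine (hx2 (cls Ω v)).congr' ?_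
    filter_upwards [hst] with t ht
    rw [inner_cls ht.1 hv, inner_cls hu hv]
  · rw [← inner_cls hp' hv, hpe]
    refine (hx3 (cls Ω v)).congr' ?_
    filter_upwards [hst] with t ht
    rw [inner_cls ht.2.1 hv, inner_cls hp hv]
  · filter_upwards [hM, hst] with t h1 h2
    exact ⟨(hNorm_sub_eq h2.1 hu).trans_le h1.1, (hNorm_sub_eq h2.2.1 hp).trans_le h1.2⟩

/-! ### The shape functional -/

/-- The state equations reduce the quadratic part by `system_energy_eq`, with the trace form from
the boundary norm and the mass form from `‖p‖²`. The term in `ud²` does not depend on the source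
support. -/
theorem StateOperators.cost_eq (h : StateOperators α f ud un Ω B S F g)
    (hD : TraceDomain Ω C) (hud : MemLp ud 2 (surf (frontier Ω))) {A : Set (Eucl d)} (hA : A ⊆ Ω)
    (hs : IsState α f ud un Ω A u p) (lam β γ₀ : ℝ) :
    cost α lam β γ₀ ud Ω A u p = 1 / 2 * (inner ℝ F (cls Ω p) - inner ℝ g (cls Ω u)
        + ∫ x, (ud x) ^ 2 ∂(surf (frontier Ω)))
      + lam * (surf (frontier A)).real univ + β * ((volume : Measure (Eucl d)).real A - γ₀) := by
  obtain ⟨hu, hp, hF, hg⟩ := (h.isState_iff hD hud hA).1 hs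
  have h1 := system_energy_eq hF hg
  rw [h.inner_B u u hu hu, h.inner_g u hu, h.inner_S A hA p p hp hp, massForm_one] at h1
  have htu := hu.memLp_traceOn hD
  have h2 : ∫ x, (traceOn Ω u x - ud x) ^ 2 ∂(surf (frontier Ω))
      = traceForm Ω 1 u u - 2 * (∫ x, ud x * traceOn Ω u x ∂(surf (frontier Ω)))
        + ∫ x, (ud x) ^ 2 ∂(surf (frontier Ω)) := by
    have i1 := integrable_mul_of_memLp htu htu
    have i2 := (integrable_mul_of_memLp hud htu).const_mul 2
    have i3 : Integrable (fun x => traceOn Ω u x * traceOn Ω u x - 2 * (ud x * traceOn Ω u x))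
      (surf (frontier Ω)) := i1.sub i2
    rw [traceForm_one, ← integral_const_mul, ← integral_sub i1 i2, ← integral_add i3 hud.integrable_sq]
    refine integral_congr_ae (Eventually.of_forall fun x => ?_)
    simp only
    ring
  have h3 : ∫ x in A, (p.1 x) ^ 2 = ∫ x in A, p.1 x * p.1 x := by simp only [sq]
  rw [cost, h2, h3, h.inner_g u hu, ← sub_eq_iff_eq_add.2 h1.symm]
  ring

/-- The functional is defined through a choice of a solution; uniqueness makes the choice
irrelevant. -/
theorem StateOperators.shapeFunctional_eq (h : StateOperators α f ud un Ω B S F g)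
    (hD : TraceDomain Ω C) (hud : MemLp ud 2 (surf (frontier Ω))) {A : Set (Eucl d)} (hA : A ⊆ Ω)
    (hs : IsState α f ud un Ω A u p) (lam β γ₀ : ℝ) :
    shapeFunctional α lam β γ₀ f ud un Ω A = 1 / 2 * (inner ℝ F (cls Ω p) - inner ℝ g (cls Ω u)
        + ∫ x, (ud x) ^ 2 ∂(surf (frontier Ω)))
      + lam * (surf (frontier A)).real univ + β * ((volume : Measure (Eucl d)).real A - γ₀) := by
  have hex : ∃ s : SobPair d × SobPair d, IsState α f ud un Ω A s.1 s.2 := ⟨(u, p), hs⟩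
  rw [shapeFunctional, dif_pos hex, h.cost_eq hD hud hA hex.choose_spec]
  obtain ⟨h1, h2⟩ := h.cls_unique hD hud hA hs hex.choose_spec
  rw [h1, h2]

/-- The constant `1` is replaced by a compactly supported `C¹` function equal to it on `Ω`. -/
theorem IsField.tendsto_volume_image (hW : IsField Ω W K) (hb : Bornology.IsBounded Ω)
    (hω : MeasurableSet ω) (hsub : ω ⊆ Ω) :
    Tendsto (fun t : ℝ => ((volume : Measure (Eucl d)).real (flow W t '' ω)
      - (volume : Measure (Eucl d)).real ω) / t) (𝓝[>] 0) (𝓝 (∫ x in ω, divergence W x)) := by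
  obtain ⟨χ, hχ, he⟩ := exists_isCore_eqOn (contDiff_const (c := (1 : ℝ))) hb
  have hone : ∀ A, MeasurableSet A → A ⊆ Ω → ∫ x in A, χ x = (volume : Measure (Eucl d)).real A := by
    intro A hA hAΩ
    rw [setIntegral_congr_fun hA (g := fun _ => (1 : ℝ)) fun x hx => (he x (subset_closure (hAΩ hx))).1]
    simp
  have h1 := hW.tendsto_integral_image hω (hb.subset hsub) hχ
  have h2 : ∫ x in ω, (inner ℝ (gradient χ x) (W x) + χ x * divergence W x)
      = ∫ x in ω, divergence W x := by
    refine setIntegral_congr_fun hω fun x hx => ?_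
    have := he x (subset_closure (hsub hx))
    rw [this.1, this.2, gradient, fderiv_const_apply, map_zero, inner_zero_left, zero_add, one_mul]
  rw [h2] at h1
  refine h1.congr' ?_
  filter_upwards [hW.eventually_displacement, hW.eventually_image_subset hsub] with t ht hst
  rw [hone ω hω hsub, hone _ _ hst]
  rw [← shift_smul]
  exact (ht.2.lipschitz_shift.continuous.measurableEmbedding ht.2.injective_shift).measurableSet_image.2 hω

end Perturbation

section Eulerian

variable {m : ℕ} {Ω ω U : Set (Eucl (m + 1))} {C K : ℝ≥0} {α : ℝ} {f ud un : Eucl (m + 1) → ℝ}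
  {u p : SobPair (m + 1)} {W V : Eucl (m + 1) → Eucl (m + 1)} {B : HSpace Ω →L[ℝ] HSpace Ω}
  {S : Set (Eucl (m + 1)) → HSpace Ω →L[ℝ] HSpace Ω} {F g : HSpace Ω}

/-- The Eulerian derivative of the shape functional, with the derivative of the mass form. -/
theorem StateOperators.hasEulerianDerivative (h : StateOperators α f ud un Ω B S F g)
    (hD : TraceDomain Ω C) (hud : MemLp ud 2 (surf (frontier Ω))) (hα : 0 < α)
    (hω : IsC2Domain ω) (hsub : ω ⊆ Ω) (hW : IsField Ω W K) (hWV : ∀ y ∈ closure Ω, W y = V y)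
    (hU : IsOpen U) (hωU : frontier ω ⊆ U) (hV : ContDiffOn ℝ 1 V U)
    (hs : IsState α f ud un Ω ω u p) (lam β γ₀ : ℝ) :
    HasEulerianDerivative (shapeFunctional α lam β γ₀ f ud un) Ω ω V
      (-(1 / (2 * α)) * divForm ω W p p + lam * tangentialDivIntegral ω V
        + β * ∫ x in ω, divergence W x) := by
  have hωm := hω.isOpen.measurableSet
  have hb := hD.isBounded.subset hsub
  obtain ⟨hu, hp, hF, hg⟩ := (h.isState_iff hD hud hsub).1 hs
  have hsubt := hW.eventually_image_subset hsub
  -- A family of states is fixed for all `t`, with an arbitrary default where the moved set leaves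
  -- `Ω`, which does not happen for small `t > 0`.
  have hex : ∀ t, ∃ s : SobPair (m + 1) × SobPair (m + 1), flow W t '' ω ⊆ Ω →
      IsState α f ud un Ω (flow W t '' ω) s.1 s.2 := fun t => by
    by_cases ht : flow W t '' ω ⊆ Ω
    · obtain ⟨u, p, h1⟩ := h.exists_isState hD hud ht
      exact ⟨(u, p), fun _ => h1⟩
    · exact ⟨0, fun h1 => absurd h1 ht⟩
  choose s hst using hex
  obtain ⟨D, hDiv⟩ := hW.exists_divOp (ω := ω) hα hsub
  obtain ⟨u', p', -, -, -, hE, -⟩ := h.exists_stateDerivative hD hud hα hW hωm hsub hs hDiv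
    (hsubt.mono fun t ht => hst t ht)
  have t1 := hE.const_mul (1 / 2)
  have t2 := (hω.tendsto_perimeter hb hW hU hωU hV fun y hy =>
    hWV y (closure_mono hsub (frontier_subset_closure hy))).const_mul lam
  have t3 := (hW.tendsto_volume_image hD.isBounded hωm hsub).const_mul β
  have t4 := (t1.add t2).add t3
  have e : -(1 / (2 * α)) * divForm ω W p p = 1 / 2 * -(1 / α * divForm ω W p p) := by
    field_simp
  rw [HasEulerianDerivative, e]
  refine t4.congr' ?_
  -- The original field and its extension have the same flow on `Ω`, and the flow of `W` maps `Ω`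
  -- onto itself.
  have himg : ∀ t A, A ⊆ Ω → flow V t '' A = flow W t '' A := fun t A hA =>
    image_congr fun x hx => by rw [flow, flow, hWV x (subset_closure (hA hx))]
  filter_upwards [hW.eventually_displacement, hsubt] with t ht hsub_t
  have hΩt : flow W t '' Ω = Ω := by rw [← shift_smul]; exact ht.2.image_shift
  rw [himg t Ω subset_rfl, himg t ω hsub, hΩt, h.shapeFunctional_eq hD hud hsub_t (hst t hsub_t),
    h.shapeFunctional_eq hD hud hsub hs]
  ring

end Eulerian

end

/-! ### Testing weak gradients with Lipschitz functions that vanish outside the domain -/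

section
variable {d : ℕ}

section WeakGradient

variable {Ω : Set (Eucl d)} {f : Eucl d → ℝ} {Df : Eucl d → Eucl d}

theorem HasWeakGradient.integral_eq_of_tendsto (hb : Bornology.IsBounded Ω)
    (hf : MemLp f 2 (volume.restrict Ω)) (hDf : MemLp Df 2 (volume.restrict Ω)) {L M : ℝ}
    {φ : ℕ → Eucl d → ℝ} {ψ : Eucl d → ℝ} (hc : ∀ n, Continuous (φ n))
    (h : ∀ᶠ n in atTop, ∫ x in Ω, f x • gradient (φ n) x = - ∫ x in Ω, φ n x • Df x)
    (hL : ∀ n x, ‖gradient (φ n) x‖ ≤ L) (hM : ∀ᵐ x ∂(volume.restrict Ω), ∀ n, |φ n x| ≤ M)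
    (h1 : ∀ᵐ x ∂(volume.restrict Ω), Tendsto (fun n => gradient (φ n) x) atTop (𝓝 (gradient ψ x)))
    (h2 : ∀ᵐ x ∂(volume.restrict Ω), Tendsto (fun n => φ n x) atTop (𝓝 (ψ x))) :
    ∫ x in Ω, f x • gradient ψ x = - ∫ x in Ω, ψ x • Df x := by
  have : IsFiniteMeasure (volume.restrict Ω) := isFiniteMeasure_restrict.2 hb.measure_lt_top.ne
  have t1 : Tendsto (fun n => ∫ x in Ω, f x • gradient (φ n) x) atTop
      (𝓝 (∫ x in Ω, f x • gradient ψ x)) := by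
    refine tendsto_integral_of_dominated_convergence (fun x => |f x| * L)
      (fun n => hf.1.smul (measurable_gradient _).aestronglyMeasurable)
      ((hf.integrable one_le_two).abs.mul_const L) (fun n => Eventually.of_forall fun x => ?_) ?_
    · rw [norm_smul, Real.norm_eq_abs]
      exact mul_le_mul_of_nonneg_left (hL n x) (abs_nonneg _)
    · filter_upwards [h1] with x hx using hx.const_smul _
  have t2 : Tendsto (fun n => ∫ x in Ω, φ n x • Df x) atTop (𝓝 (∫ x in Ω, ψ x • Df x)) := by
    refine tendsto_integral_of_dominated_convergence (fun x => M * ‖Df x‖)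
      (fun n => (hc n).aestronglyMeasurable.smul hDf.1)
      ((hDf.integrable one_le_two).norm.const_mul M) (fun n => ?_) ?_
    · filter_upwards [hM] with x hx
      rw [norm_smul, Real.norm_eq_abs]
      exact mul_le_mul_of_nonneg_right (hx n) (norm_nonneg _)
    · filter_upwards [h2] with x hx using hx.smul_const _
  exact tendsto_nhds_unique (t1.congr' h) t2.neg

/-- Mollification at a scale below `δ / 2` keeps the supports in `Ω` and gives smooth test
functions. -/
theorem HasWeakGradient.integral_lipschitz_of_ball_subset (hw : HasWeakGradient Ω f Df)
    (ho : IsOpen Ω)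
    (hb : Bornology.IsBounded Ω) (hf : MemLp f 2 (volume.restrict Ω))
    (hDf : MemLp Df 2 (volume.restrict Ω)) {ψ : Eucl d → ℝ} {L : ℝ≥0} (hψ : LipschitzWith L ψ)
    {δ : ℝ} (hδ : 0 < δ) (hs : ∀ x, ψ x ≠ 0 → Metric.ball x δ ⊆ Ω) :
    ∫ x in Ω, f x • gradient ψ x = - ∫ x in Ω, ψ x • Df x := by
  obtain ⟨φ, h0, h1, h2, h3, h4⟩ := lipschitz_exists_smooth_approx hψ
  obtain ⟨M, hM⟩ := hb.isCompact_closure.exists_bound_of_continuousOn hψ.continuous.continuousOn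
  have hlim : Tendsto (fun n : ℕ => 1 / ((n : ℝ) + 1)) atTop (𝓝 0) :=
    tendsto_one_div_add_atTop_nhds_zero_nat
  refine HasWeakGradient.integral_eq_of_tendsto (φ := φ) (L := L) (M := M + L) hb hf hDf
    (fun n => (h0 n).continuous) ?_ h2 ?_ (ae_restrict_of_ae h3) (Eventually.of_forall fun x => ?_)
  · filter_upwards [hlim.eventually_lt_const (half_pos hδ)] with n hn
    have hsub : tsupport (φ n) ⊆ Ω := fun x hx => by
      obtain ⟨z, hz, hxz⟩ := Metric.mem_closure_iff.1 hx (δ / 2) (half_pos hδ)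
      obtain ⟨y, hy, hy0⟩ := h4 n z hz
      refine hs y hy0 (Metric.mem_ball.2 ?_)
      have := dist_triangle x z y
      rw [Metric.mem_ball, dist_comm] at hy
      linarith
    exact hw (φ n) (h0 n) (Metric.isCompact_of_isClosed_isBounded (isClosed_tsupport _)
      (hb.subset hsub)) hsub
  · filter_upwards [ae_restrict_mem ho.measurableSet] with x hx n
    have a1 := hM x (subset_closure hx)
    have a2 := h1 n x
    have a3 := abs_sub_abs_le_abs_sub (φ n x) (ψ x)
    have a4 : (L : ℝ) * (1 / ((n : ℝ) + 1)) ≤ L := mul_le_of_le_one_right L.coe_nonneg (by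
      rw [div_le_one (by positivity)]
      linarith [(Nat.cast_nonneg n : (0 : ℝ) ≤ n)])
    rw [Real.norm_eq_abs] at a1
    linarith
  · refine tendsto_iff_norm_sub_tendsto_zero.2 (squeeze_zero (fun _ => norm_nonneg _)
        (fun n => h1 n x) ?_)
    simpa using hlim.const_mul (L : ℝ)

theorem abs_le_mul_infDist_compl {ψ : Eucl d → ℝ} {L : ℝ≥0} (hψ : LipschitzWith L ψ)
    (ho : IsOpen Ω) (hne : Ωᶜ.Nonempty) (h0 : ∀ x ∉ Ω, ψ x = 0) (x : Eucl d) :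
    |ψ x| ≤ L * Metric.infDist x Ωᶜ := by
  obtain ⟨z, hz, he⟩ := ho.isClosed_compl.exists_infDist_eq_dist hne x
  rw [he]
  simpa [Real.dist_eq, h0 z hz] using hψ.dist_le_mul x z

/-- Truncate `ψ` between `-h n` and `h n`, where `h n` vanishes near the complement. The truncations
keep a uniform Lipschitz bound, stay away from the boundary, and coincide with `ψ` near each point
of `Ω` for large `n`. No regularity of the boundary is needed. -/
theorem HasWeakGradient.integral_lipschitz (hw : HasWeakGradient Ω f Df) (ho : IsOpen Ω)
    (hb : Bornology.IsBounded Ω) (hne : Ωᶜ.Nonempty) (hf : MemLp f 2 (volume.restrict Ω))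
    (hDf : MemLp Df 2 (volume.restrict Ω)) {ψ : Eucl d → ℝ} {L : ℝ≥0} (hψ : LipschitzWith L ψ)
    (h0 : ∀ x ∉ Ω, ψ x = 0) :
    ∫ x in Ω, f x • gradient ψ x = - ∫ x in Ω, ψ x • Df x := by
  have hd := abs_le_mul_infDist_compl hψ ho hne h0
  obtain ⟨M, hM⟩ := hb.isCompact_closure.exists_bound_of_continuousOn hψ.continuous.continuousOn
  let r : Eucl d → ℝ := fun x => Metric.infDist x Ωᶜ
  let ε : ℕ → ℝ := fun n => 1 / ((n : ℝ) + 1)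
  have hε : ∀ n, 0 < ε n := fun n => by positivity
  have hlim : Tendsto ε atTop (𝓝 0) := tendsto_one_div_add_atTop_nhds_zero_nat
  -- The slope `L + 1` exceeds the slope in `|ψ| ≤ L r`; the gap `r x` absorbs `ε n` as soon as `ε n
  -- < r x`.
  let h : ℕ → Eucl d → ℝ := fun n x => max ((L + 1) * r x - ε n) 0
  have hh : ∀ n x y, h n x ≤ h n y + (L + 1) * dist x y := fun n x y => by
    have h1 : (L + 1 : ℝ) * r x ≤ (L + 1) * (r y + dist x y) :=
      mul_le_mul_of_nonneg_left Metric.infDist_le_infDist_add_dist (by positivity)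
    have h2 : 0 ≤ (L + 1 : ℝ) * dist x y := by positivity
    refine max_le ?_ (add_nonneg (le_max_right _ _) h2)
    have := le_max_left ((L + 1) * r y - ε n) 0
    simp only [h]
    linarith
  let φ : ℕ → Eucl d → ℝ := fun n x => max (min (ψ x) (h n x)) (-(h n x))
  have hφ : ∀ n, LipschitzWith (L + 1) (φ n) := fun n => LipschitzWith.of_le_add_mul _ fun x y => by
    have a1 := hh n x y
    have a2 := hh n y x
    have a3 := (le_abs_self _).trans (hψ.dist_le_mul x y)
    have a4 : (0 : ℝ) ≤ dist x y := dist_nonneg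
    rw [dist_comm y x] at a2
    have a5 : ψ x ≤ ψ y + (L + 1) * dist x y := by linarith
    push_cast
    refine max_le ?_ ?_
    · rw [← sub_le_iff_le_add]
      refine le_max_of_le_left (le_min ?_ ?_)
      · linarith [min_le_left (ψ x) (h n x)]
      · linarith [min_le_right (ψ x) (h n x)]
    · linarith [le_max_right (min (ψ y) (h n y)) (-(h n y))]
  have habs : ∀ n x, |φ n x| ≤ |ψ x| := fun n x => by
    have h1 : 0 ≤ h n x := le_max_right _ _
    rw [abs_le]
    refine ⟨?_, max_le ((min_le_left _ _).trans (le_abs_self _)) (by linarith [abs_nonneg (ψ x)])⟩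
    rcases le_total (ψ x) (h n x) with h2 | h2
    · exact le_max_of_le_left (by rw [min_eq_left h2]; exact neg_abs_le _)
    · exact le_max_of_le_left (by rw [min_eq_right h2]; linarith [abs_nonneg (ψ x)])
  have hev : ∀ x ∈ Ω, ∀ᶠ n in atTop, φ n =ᶠ[𝓝 x] ψ := fun x hx => by
    have hr : 0 < r x := (ho.isClosed_compl.notMem_iff_infDist_pos hne).1 (not_not.2 hx)
    filter_upwards [hlim.eventually_lt_const hr] with n hn
    have hlt : |ψ x| < (L + 1) * r x - ε n := by
      have := hd x
      simp only [r] at hn ⊢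
      linarith
    have hc : Continuous fun y => (L + 1) * r y - ε n :=
      (continuous_const.mul (Metric.continuous_infDist_pt _)).sub continuous_const
    filter_upwards [hψ.continuous.abs.continuousAt.eventually_lt hc.continuousAt hlt] with y hy
    have := abs_lt.1 (hy.trans_le (le_max_left _ 0))
    simp only [φ]
    rw [min_eq_left this.2.le, max_eq_left this.1.le]
  refine HasWeakGradient.integral_eq_of_tendsto (φ := φ) (L := (L + 1 : ℝ≥0)) (M := M) hb hf hDf
    (fun n => (hφ n).continuous) (Eventually.of_forall fun n => ?_)
    (fun n x => by rw [norm_gradient]; exact norm_fderiv_le_of_lipschitzWith (hφ n) x) ?_ ?_ ?_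
  · refine hw.integral_lipschitz_of_ball_subset ho hb hf hDf (hφ n) (δ := ε n / (L + 1))
      (div_pos (hε n) (by positivity)) fun x hx => ?_
    refine (Metric.ball_subset_ball ?_).trans (Metric.ball_infDist_compl_subset (x := x))
    rw [div_le_iff₀ (by positivity), mul_comm]
    by_contra hlt
    have : h n x = 0 := max_eq_right (by simp only [r]; linarith)
    refine hx ?_
    simp only [φ, this, neg_zero]
    exact max_eq_right (min_le_right _ _)
  · filter_upwards [ae_restrict_mem ho.measurableSet] with x hx n
    exact (habs n x).trans (hM x (subset_closure hx))
  · filter_upwards [ae_restrict_mem ho.measurableSet] with x hx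
    refine tendsto_const_nhds.congr' ?_
    filter_upwards [hev x hx] with n hn
    rw [gradient, gradient, hn.fderiv_eq]
  · filter_upwards [ae_restrict_mem ho.measurableSet] with x hx
    refine tendsto_const_nhds.congr' ?_
    filter_upwards [hev x hx] with n hn using hn.eq_of_nhds.symm

end WeakGradient

section Divergence

variable {Ω : Set (Eucl d)} {V : Eucl d → Eucl d} {K : ℝ≥0} {f : Eucl d → ℝ} {Df : Eucl d → Eucl d}
  {p : SobPair d}

theorem IsField.memLp_mul_divergence (hV : IsField Ω V K) {μ : Measure (Eucl d)}
    (hf : MemLp f 2 μ) : MemLp (fun x => f x * divergence V x) 2 μ := by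
  refine (hf.const_mul (d * K : ℝ)).mono
    (hf.1.mul (measurable_divergence V).aestronglyMeasurable) (Eventually.of_forall fun x => ?_)
  rw [norm_mul, norm_mul, mul_comm, Real.norm_of_nonneg (by positivity : (0 : ℝ) ≤ d * K)]
  exact mul_le_mul_of_nonneg_right (abs_divergence_le hV.lip x) (norm_nonneg _)

/-- Each product of `φ` with a component of `V` is a Lipschitz function vanishing outside `Ω`;
testing with it and summing the components gives the divergence. -/
theorem HasWeakGradient.integral_inner_core (hw : HasWeakGradient Ω f Df) (hV : IsField Ω V K)
    (ho : IsOpen Ω) (hb : Bornology.IsBounded Ω) (hne : Ωᶜ.Nonempty)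
    (hf : MemLp f 2 (volume.restrict Ω)) (hDf : MemLp Df 2 (volume.restrict Ω)) {φ : Eucl d → ℝ}
    (hφ : IsCore φ) :
    ∫ x in Ω, f x * (inner ℝ (gradient φ x) (V x) + φ x * divergence V x)
      = - ∫ x in Ω, inner ℝ (Df x) (V x) * φ x := by
  have : IsFiniteMeasure (volume.restrict Ω) := isFiniteMeasure_restrict.2 hb.measure_lt_top.ne
  let b := EuclideanSpace.basisFun (Fin d) ℝ
  obtain ⟨C, hC⟩ := hV.exists_lipschitzWith_mul_inner hφ
  have hlip := fun i => hC (b i) (b.norm_eq_one i)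
  obtain ⟨M, hM⟩ := hφ.2.exists_bound_of_continuous hφ.1.continuous
  have hi1 : ∀ i, Integrable (fun x => f x • gradient (fun y => φ y * inner ℝ (b i) (V y)) x)
      (volume.restrict Ω) := fun i =>
    ((hf.integrable one_le_two).mul_const (C : ℝ)).mono
      (hf.1.smul (measurable_gradient _).aestronglyMeasurable) (Eventually.of_forall fun x => by
        rw [norm_smul, norm_mul, Real.norm_of_nonneg C.coe_nonneg, norm_gradient]
        exact mul_le_mul_of_nonneg_left (norm_fderiv_le_of_lipschitzWith (hlip i) x) (norm_nonneg _))
  have hi2 : ∀ i, Integrable (fun x => (φ x * inner ℝ (b i) (V x)) • Df x) (volume.restrict Ω) :=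
    fun i => ((hDf.integrable one_le_two).norm.const_mul (M * K)).mono'
      ((hlip i).continuous.aestronglyMeasurable.smul hDf.1) (Eventually.of_forall fun x => by
        rw [norm_smul, norm_mul]
        refine mul_le_mul_of_nonneg_right (mul_le_mul (hM x) ?_ (norm_nonneg _)
          ((norm_nonneg _).trans (hM x))) (norm_nonneg _)
        refine (norm_inner_le_norm _ _).trans ?_
        rw [b.norm_eq_one, one_mul]
        exact hV.bound x)
  have hi : ∀ i, ∫ x in Ω, f x * inner ℝ (gradient (fun y => φ y * inner ℝ (b i) (V y)) x) (b i)
      = - ∫ x in Ω, φ x * inner ℝ (b i) (V x) * inner ℝ (b i) (Df x) := fun i => by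
    have h1 := congrArg (fun z => inner ℝ (b i) z) (hw.integral_lipschitz ho hb hne hf hDf (hlip i)
      fun x hx => by simp [hV.zero x hx])
    simp only [inner_neg_right] at h1
    rw [← integral_inner (hi1 i), ← integral_inner (hi2 i)] at h1
    simp only [real_inner_smul_right] at h1
    simp only [real_inner_comm (b i)] at h1 ⊢
    exact h1
  have hs := Finset.sum_congr (rfl : (Finset.univ : Finset (Fin d)) = _) fun i _ => hi i
  rw [Finset.sum_neg_distrib, ← integral_finsetSum _ fun i _ => ?_,
    ← integral_finsetSum _ fun i _ => ?_] at hs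
  · refine Eq.trans (integral_congr_ae ?_) (hs.trans (congrArg Neg.neg (integral_congr_ae ?_)))
    · filter_upwards [ae_restrict_of_ae (hV.ae_sum_inner_gradient_mul hφ b)] with x hx
      rw [← Finset.mul_sum, hx]
    · refine Eventually.of_forall fun x => ?_
      simp only
      rw [← b.sum_inner_mul_inner (Df x) (V x), Finset.sum_mul]
      refine Finset.sum_congr rfl fun i _ => ?_
      rw [real_inner_comm (b i) (Df x)]
      ring
  · have := (hi2 i).const_inner (𝕜 := ℝ) (b i)
    simpa only [real_inner_smul_right] using this
  · have := (hi1 i).const_inner (𝕜 := ℝ) (b i)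
    simpa only [real_inner_smul_right, real_inner_comm (b i)] using this

theorem IsBddFunctional.eq_of_core {ℓ ℓ' : SobPair d → ℝ} {c c' : ℝ} (h : IsBddFunctional Ω ℓ c)
    (h' : IsBddFunctional Ω ℓ' c') (he : ∀ φ, IsCore φ → ℓ (withGrad φ) = ℓ' (withGrad φ))
    (hp : InH Ω p) : ℓ p = ℓ' p :=
  tendsto_nhds_unique tendsto_const_nhds (tendsto_functional_of_core (l := (atTop : Filter ℕ))
    (ℓt := fun _ => ℓ) (K := max 0 (max c c')) (le_max_left _ _) (Eventually.of_forall fun _ =>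
      h.mono ((le_max_left _ _).trans (le_max_right _ _)))
    (h'.mono ((le_max_right c c').trans (le_max_right _ _)))
    (fun φ hφ => by rw [he φ hφ]; exact tendsto_const_nhds) hp)

/-- The integral of `div (f p V)` over `Ω` vanishes, since `V` does on the boundary. -/
theorem HasWeakGradient.integral_inner (hw : HasWeakGradient Ω f Df) (hV : IsField Ω V K)
    (ho : IsOpen Ω) (hb : Bornology.IsBounded Ω) (hne : Ωᶜ.Nonempty)
    (hf : MemLp f 2 (volume.restrict Ω)) (hDf : MemLp Df 2 (volume.restrict Ω)) (hp : InH Ω p) :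
    ∫ x in Ω, f x * inner ℝ (p.2 x) (V x)
      = - (∫ x in Ω, divergence V x * (p.1 x * f x)) - ∫ x in Ω, p.1 x * inner ℝ (Df x) (V x) := by
  have hG := (hV.memLp_mul_divergence hf).add (hV.memLp_inner hDf)
  have h1 := isBddFunctional_integral hG.neg
  have hd : ∀ u, InH Ω u → Integrable (fun x => divergence V x * (u.1 x * f x)) (volume.restrict Ω) :=
    fun u hu => (integrable_mul_of_memLp (hV.memLp_mul_divergence hf) (memLp_fst hu.memLp)).congr
      (Eventually.of_forall fun x => by simp only; ring)
  have hD : ∀ u, InH Ω u → Integrable (fun x => u.1 x * inner ℝ (Df x) (V x)) (volume.restrict Ω) :=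
    fun u hu => integrable_mul_of_memLp (memLp_fst hu.memLp) (hV.memLp_inner hDf)
  have hR : ∀ u, InH Ω u → ∫ x in Ω, (-((fun x => f x * divergence V x)
      + fun x => inner ℝ (Df x) (V x))) x * u.1 x
      = - (∫ x in Ω, divergence V x * (u.1 x * f x)) - ∫ x in Ω, u.1 x * inner ℝ (Df x) (V x) :=
    fun u hu => by
      rw [← neg_add', ← integral_add (hd u hu) (hD u hu), ← integral_neg]
      refine integral_congr_ae (Eventually.of_forall fun x => ?_)
      simp only [Pi.neg_apply, Pi.add_apply]
      ring
  rw [← hR p hp]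
  refine (hV.isBddFunctional_integral_inner hf).eq_of_core h1 (fun φ hφ => ?_) hp
  have hφ' := hφ.inH (Ω := Ω)
  rw [hR _ hφ']
  have h2 := hw.integral_inner_core hV ho hb hne hf hDf hφ
  have h3 : Integrable (fun x => f x * inner ℝ ((withGrad φ).2 x) (V x)) (volume.restrict Ω) :=
    integrable_mul_of_memLp hf (hV.memLp_inner (memLp_snd hφ'.memLp))
  have h4 : ∫ x in Ω, f x * (inner ℝ (gradient φ x) (V x) + φ x * divergence V x)
      = (∫ x in Ω, f x * inner ℝ ((withGrad φ).2 x) (V x))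
        + ∫ x in Ω, divergence V x * ((withGrad φ).1 x * f x) := by
    rw [← integral_add h3 (hd _ hφ')]
    refine integral_congr_ae (Eventually.of_forall fun x => ?_)
    simp only [withGrad]
    ring
  have h5 : ∫ x in Ω, inner ℝ (Df x) (V x) * φ x
      = ∫ x in Ω, (withGrad φ).1 x * inner ℝ (Df x) (V x) :=
    integral_congr_ae (Eventually.of_forall fun x => mul_comm _ _)
  linarith

end Divergence

end

/-! ### Interior equations and transport along the flow -/

section
variable {d : ℕ}

section Interior

variable {Ω ω : Set (Eucl d)} {C K : ℝ≥0} {α : ℝ} {f ud un G : Eucl d → ℝ} {V : Eucl d → Eucl d}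
  {u p : SobPair d}

/-- `-Δu + u = G` in `Ω`, tested with the functions of vanishing trace. -/
def SolvesInside (Ω : Set (Eucl d)) (u : SobPair d) (G : Eucl d → ℝ) : Prop :=
  ∀ v, InH Ω v → traceOn Ω v =ᵐ[surf (frontier Ω)] 0 → aForm Ω u v = ∫ x in Ω, G x * v.1 x

theorem IsState.solvesInside_snd (hD : TraceDomain Ω C) (hs : IsState α f ud un Ω ω u p) :
    SolvesInside Ω p 0 := fun v hv h0 => by
  rw [hs.eqP v ((isH1_iff hD).2 hv)]
  simp only [Pi.zero_apply, zero_mul, integral_zero]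
  exact integral_eq_zero_of_ae (h0.mono fun x hx => by simp [hx])

theorem memLp_indicator_fst (hω : MeasurableSet ω) (hp : InH Ω p) :
    MemLp (ω.indicator p.1) 2 (volume.restrict Ω) := (memLp_fst hp.memLp).indicator hω

theorem integral_indicator_mul (hω : MeasurableSet ω) (hsub : ω ⊆ Ω) (g h : Eucl d → ℝ) :
    ∫ x in Ω, ω.indicator g x * h x = ∫ x in ω, g x * h x := by
  have : ∀ x, ω.indicator g x * h x = ω.indicator (fun x => g x * h x) x := fun x => by
    by_cases hx : x ∈ ω <;> simp [hx]
  simp only [this]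
  rw [setIntegral_indicator hω, inter_eq_self_of_subset_right hsub]

theorem integral_source_mul (hω : MeasurableSet ω) (hsub : ω ⊆ Ω)
    (hf : MemLp f 2 (volume.restrict Ω)) (hp : InH Ω p) {h : Eucl d → ℝ}
    (hh : MemLp h 2 (volume.restrict Ω)) :
    ∫ x in Ω, (f x - 1 / α * ω.indicator p.1 x) * h x
      = (∫ x in Ω, f x * h x) - 1 / α * ∫ x in ω, p.1 x * h x := by
  rw [← integral_indicator_mul hω hsub, ← integral_const_mul, ← integral_sub
    (integrable_mul_of_memLp hf hh)
    ((integrable_mul_of_memLp (memLp_indicator_fst hω hp) hh).const_mul _)]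
  exact integral_congr_ae (Eventually.of_forall fun x => by simp only; ring)

theorem IsState.solvesInside_fst (hD : TraceDomain Ω C) (hω : MeasurableSet ω) (hsub : ω ⊆ Ω)
    (hf : MemLp f 2 (volume.restrict Ω)) (hs : IsState α f ud un Ω ω u p) :
    SolvesInside Ω u fun x => f x - 1 / α * ω.indicator p.1 x := fun v hv h0 => by
  rw [integral_source_mul hω hsub hf ((isH1_iff hD).1 hs.memP) (memLp_fst hv.memLp)]
  have h1 := hs.eqU v ((isH1_iff hD).2 hv)
  rw [integral_eq_zero_of_ae (μ := surf (frontier Ω)) (h0.mono fun x hx => by simp [hx])] at h1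
  linarith

theorem IsDisplacement.traceOn_pull_sub {W : Eucl d → Eucl d} {ε : ℝ≥0} (hD : TraceDomain Ω C)
    (h : IsDisplacement Ω W ε) (hu : InH Ω u) :
    traceOn Ω (pull W u - u) =ᵐ[surf (frontier Ω)] 0 := by
  filter_upwards [traceOn_sub hD (h.inH_pull hD.isOpen hD.isBounded hu) hu, h.traceOn_pull hD hu]
    with x h1 h2
  rw [h1, Pi.sub_apply, h2, sub_self]; rfl

theorem aForm_sub_right (hu : InH Ω u) {v w : SobPair d} (hv : InH Ω v) (hw : InH Ω w) :
    aForm Ω u (v - w) = aForm Ω u v - aForm Ω u w := by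
  rw [aForm_comm, aForm_sub_left hv.memLp hw.memLp hu.memLp, aForm_comm, aForm_comm (u := w)]

/-- The difference of `p` and its transport has zero trace, so it is admissible as a test function.
-/
theorem SolvesInside.aForm_pull_sub {W : Eucl d → Eucl d} {ε : ℝ≥0} (hu : SolvesInside Ω u G)
    (hD : TraceDomain Ω C) (hiu : InH Ω u) (h : IsDisplacement Ω W ε) (hp : InH Ω p) :
    aForm Ω u (pull W p) - aForm Ω u p = ∫ x in Ω, G x * (p.1 (shift W x) - p.1 x) := by
  have hpp := h.inH_pull hD.isOpen hD.isBounded hp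
  rw [← aForm_sub_right hiu hpp hp, hu _ (hpp.sub hp) (h.traceOn_pull_sub hD hp)]
  rfl

theorem IsField.exists_inverse (hV : IsField Ω V K) : ∃ S : ℝ → Eucl d → Eucl d,
    ∀ᶠ t in 𝓝[>] (0 : ℝ), 0 < t ∧ IsDisplacement Ω (t • V) (t.toNNReal * K) ∧
      IsDisplacement Ω (S t) (2 * (t.toNNReal * K)) ∧
      ∀ x, shift (S t) (shift (t • V) x) = x := by
  have h : ∀ t : ℝ, ∃ S : Eucl d → Eucl d, 0 < t ∧ t * K ≤ 1 / 8 →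
      IsDisplacement Ω S (2 * (t.toNNReal * K)) ∧ ∀ x, shift S (shift (t • V) x) = x := fun t => by
    by_cases ht : 0 < t ∧ t * K ≤ 1 / 8
    · obtain ⟨S, h1, h2, -⟩ := (hV.displacement ht.1.le (by linarith [ht.2])).exists_inverse (by
        rw [← NNReal.coe_le_coe]
        push_cast
        rw [Real.coe_toNNReal _ ht.1.le]
        linarith [ht.2])
      exact ⟨S, fun _ => ⟨h1, h2⟩⟩
    · exact ⟨0, fun h => absurd h ht⟩
  choose S hS using h
  refine ⟨S, ?_⟩
  filter_upwards [eventually_pos_mul_le K (by norm_num : (0 : ℝ) < 1 / 8)] with t ht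
  exact ⟨ht.1, hV.displacement ht.1.le (by linarith [ht.2]), hS t ht⟩

/-- The function values agree, and the weak gradient is determined by them. This avoids a chain rule
for the derivatives of `W` and `S`. -/
theorem IsDisplacement.jet_pull_pull {W S : Eucl d → Eucl d} {ε ε' : ℝ≥0} (h : IsDisplacement Ω W ε)
    (h' : IsDisplacement Ω S ε') (hSW : ∀ x, shift S (shift W x) = x) (ho : IsOpen Ω)
    (hb : Bornology.IsBounded Ω) (hu : InH Ω u) :
    jet (pull W (pull S u)) =ᵐ[volume.restrict Ω] jet u :=
  InH.jet_ae_eq ho (h.inH_pull ho hb (h'.inH_pull ho hb hu)) hu (Eventually.of_forall fun x => by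
    simp [pull_fst, hSW])

/-- The derivative of the energy form at solutions of two equations, the second one homogeneous. -/
theorem SolvesInside.energyForm_eq (hu : SolvesInside Ω u G) (hp : SolvesInside Ω p 0)
    (hD : TraceDomain Ω C) (hG : MemLp G 2 (volume.restrict Ω)) (hiu : InH Ω u) (hip : InH Ω p)
    (hV : IsField Ω V K) : energyForm Ω V u p = - ∫ x in Ω, G x * inner ℝ (p.2 x) (V x) := by
  have ho := hD.isOpen
  have hb := hD.isBounded
  obtain ⟨S, hS⟩ := hV.exists_inverse
  have hεS : Tendsto (fun t : ℝ => 2 * (t.toNNReal * K)) (𝓝[>] 0) (𝓝 0) := by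
    have : Continuous fun t : ℝ => 2 * (t.toNNReal * K) := by fun_prop
    have h := this.tendsto 0
    simp only [Real.toNNReal_zero, zero_mul, mul_zero] at h
    exact h.mono_left nhdsWithin_le_nhds
  have h0 := tendsto_hNorm_pull_sub ho hb (hS.mono fun t ht => ht.2.2.1) hεS hiu
  have h1 := hV.tendsto_integral_diffQuot hb hG hip
  have h2 := hV.tendsto_aForm_pull ho hb hiu hip
  have h3 : Tendsto (fun t => pullConst d * K * hNorm Ω p * hNorm Ω (pull (S t) u - u)) (𝓝[>] 0)
      (𝓝 0) := by simpa using h0.const_mul (pullConst d * K * hNorm Ω p)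
  -- Write `T`, `T'` for the transports by `t • V` and by its inverse. Then `u = T T' u`, and `a(T'
  -- u, p) = a(u, p)` since the equation of `p` is homogeneous. So `a(u, T p) - a(u, p)` and `a(T u,
  -- T p) - a(u, p)` differ by the form defect at `T' u - u`, which is `o(t)`. The first is
  -- expressed by the equation of `u`, the second has derivative `-energyForm`.
  have h4 : Tendsto (fun t : ℝ => (∫ x in Ω, G x * ((p.1 (flow V t x) - p.1 x) / t))
      - t⁻¹ * (aForm Ω (pull (t • V) u) (pull (t • V) p) - aForm Ω u p)) (𝓝[>] 0) (𝓝 0) := by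
    refine squeeze_zero_norm' ?_ h3
    filter_upwards [hS] with t ⟨ht, hW, hSt, hinv⟩
    have hu1 := hSt.inH_pull ho hb hiu
    have hp1 := hW.inH_pull ho hb hip
    have e1 : ∫ x in Ω, G x * ((p.1 (flow V t x) - p.1 x) / t)
        = t⁻¹ * (aForm Ω u (pull (t • V) p) - aForm Ω u p) := by
      rw [hu.aForm_pull_sub hD hiu hW hip, ← integral_const_mul, shift_smul]
      exact integral_congr_ae (Eventually.of_forall fun x => by simp only; ring)
    have e2 := aForm_congr (hW.jet_pull_pull hSt hinv ho hb hiu) (ae_eq_refl (jet (pull (t • V) p)))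
    have e3 := hp.aForm_pull_sub hD hip hSt hiu
    simp only [Pi.zero_apply, zero_mul, integral_zero] at e3
    rw [aForm_comm, aForm_comm (u := p)] at e3
    have hR := isBddForm_aForm_pull_sub hW ho hb t⁻¹
    have e4 := (hR.functional hip).sub hu1 hiu
    have e5 := hR.bound _ _ (hu1.sub hiu) hip
    rw [e4, e2] at e5
    rw [e1, Real.norm_eq_abs]
    refine le_of_eq_of_le (congrArg abs ?_) (e5.trans_eq ?_)
    · rw [sub_eq_zero.1 e3]
    · rw [abs_of_pos (inv_pos.2 ht)]
      push_cast
      rw [Real.coe_toNNReal _ ht.le]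
      field_simp
  have := tendsto_nhds_unique h4 (h1.sub h2)
  linarith

theorem IsState.energyForm_eq (hD : TraceDomain Ω C) (hω : MeasurableSet ω) (hsub : ω ⊆ Ω)
    (hf : MemLp f 2 (volume.restrict Ω)) (hs : IsState α f ud un Ω ω u p) (hV : IsField Ω V K) :
    energyForm Ω V u p = 1 / α * (∫ x in ω, p.1 x * inner ℝ (p.2 x) (V x))
      - ∫ x in Ω, f x * inner ℝ (p.2 x) (V x) := by
  have hip := (isH1_iff hD).1 hs.memP
  rw [(hs.solvesInside_fst hD hω hsub hf).energyForm_eq (hs.solvesInside_snd hD) hD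
    (hf.sub ((memLp_indicator_fst hω hip).const_mul _)) ((isH1_iff hD).1 hs.memU) hip hV,
    integral_source_mul hω hsub hf hip (hV.memLp_inner (memLp_snd hip.memLp))]
  ring

/-- Pulling back a solution changes it by a term of first order. -/
theorem SolvesInside.exists_hNorm_pull_sub_le (hu : SolvesInside Ω u G) (hD : TraceDomain Ω C)
    (hG : MemLp G 2 (volume.restrict Ω)) (hiu : InH Ω u) (hV : IsField Ω V K) :
    ∃ M, 0 ≤ M ∧ ∀ᶠ t in 𝓝[>] (0 : ℝ), hNorm Ω (pull (t • V) u - u) ≤ M * t := by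
  have ho := hD.isOpen
  have hb := hD.isBounded
  obtain ⟨S, hS⟩ := hV.exists_inverse
  set Γ := (eLpNorm G 2 (volume.restrict Ω)).toReal
  have hN := hNorm_nonneg (Ω := Ω) (u := u)
  have hP := pullConst_nonneg (d := d)
  have hΓ : 0 ≤ Γ := ENNReal.toReal_nonneg
  refine ⟨pullConst d * K * hNorm Ω u * (2 * 2 ^ d) + Γ * (2 * K * 2 ^ d), by positivity, ?_⟩
  filter_upwards [hS] with t ⟨ht, hW, hSt, hinv⟩
  have hpu := (hW.inH_pull ho hb hiu)
  set r := pull (t • V) u - u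
  have hr : InH Ω r := hpu.sub hiu
  have hr' := hSt.inH_pull ho hb hr
  have e0 : aForm Ω r r = hNorm Ω r * hNorm Ω r := by
    rw [← inner_cls hr hr, real_inner_self_eq_norm_mul_norm, norm_cls hr]
  -- The change `r` tests itself, written as the transport of its inverse transport. The first
  -- bracket is the form defect; the second is evaluated by the equation of `u`. Both are at most a
  -- multiple of `t ‖r‖`, and division by `‖r‖` replaces second order regularity.
  have e1 : aForm Ω r r = (aForm Ω (pull (t • V) u) (pull (t • V) (pull (S t) r))
      - aForm Ω u (pull (S t) r)) + (aForm Ω u (pull (S t) r) - aForm Ω u r) := by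
    rw [aForm_congr (ae_eq_refl _) (hW.jet_pull_pull hSt hinv ho hb hr),
      aForm_sub_left hpu.memLp hiu.memLp hr.memLp]
    ring
  have hrn := hNorm_nonneg (Ω := Ω) (u := r)
  have e2 := hW.abs_aForm_pull_sub_le ho.measurableSet hiu hr'
  have e3 := hSt.hNorm_pull_le hr.memLp
  have e4 : |aForm Ω u (pull (S t) r) - aForm Ω u r| ≤ Γ * (2 * (t * K) * (2 ^ d * hNorm Ω r)) := by
    rw [hu.aForm_pull_sub hD hiu hSt hr]
    refine (abs_integral_mul_le hG ((hSt.memLp_comp (memLp_fst hr.memLp)).sub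
      (memLp_fst hr.memLp))).trans (mul_le_mul_of_nonneg_left ?_ hΓ)
    refine (hSt.toReal_comp_sub_le hr).trans_eq ?_
    push_cast
    rw [Real.coe_toNNReal _ ht.le]
  have e5 : pullConst d * ((t.toNNReal * K : ℝ≥0) : ℝ) * hNorm Ω u * hNorm Ω (pull (S t) r)
      ≤ pullConst d * (t * K) * hNorm Ω u * ((2 * 2 ^ d) * hNorm Ω r) := by
    push_cast
    rw [Real.coe_toNNReal _ ht.le]
    gcongr
  rcases hrn.eq_or_lt with h0 | h0
  · rw [← h0]; positivity
  · refine le_of_mul_le_mul_right ?_ h0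
    rw [← e0, e1]
    refine (le_abs_self _).trans ((abs_add_le _ _).trans
      ((add_le_add (e2.trans e5) e4).trans_eq ?_))
    ring

end Interior

end

/-! ### Material derivatives -/

section
variable {d : ℕ}

section Material

variable {Ω : Set (Eucl d)} {K : ℝ≥0} {V : Eucl d → Eucl d} {u u' : SobPair d}
  {ut : ℝ → SobPair d} {M M' : ℝ}

/-- The embedding of `H¹` into `L²`. -/
theorem exists_embedding (ho : IsOpen Ω) : ∃ j : HSpace Ω →L[ℝ] Lp ℝ 2 (volume.restrict Ω),
    Function.Injective j ∧ ∀ v (hv : InH Ω v), j (cls Ω v) = (memLp_fst hv.memLp).toLp v.1 := by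
  let j : HSpace Ω →L[ℝ] Lp ℝ 2 (volume.restrict Ω) :=
    ((WithLp.fstL 2 ℝ ℝ (Eucl d)).compLpL 2 (volume.restrict Ω)).comp (HSpace Ω).subtypeL
  have hj : ∀ v (hv : InH Ω v), j (cls Ω v) = (memLp_fst hv.memLp).toLp v.1 := fun v hv => by
    refine Lp.ext ?_
    have h1 : j (cls Ω v) = (WithLp.fstL 2 ℝ ℝ (Eucl d)).compLpL 2 (volume.restrict Ω)
      (hv.memLp.toLp (jet v)) := by rw [← coe_cls hv]; rfl
    rw [h1]
    filter_upwards [ContinuousLinearMap.coeFn_compLpL (WithLp.fstL 2 ℝ ℝ (Eucl d))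
      (hv.memLp.toLp (jet v)), hv.memLp.coeFn_toLp, (memLp_fst hv.memLp).coeFn_toLp] with x a b c
    rw [a, b, c]
    rfl
  refine ⟨j, fun a b hab => ?_, hj⟩
  obtain ⟨v, hv, rfl⟩ := exists_cls_eq a
  obtain ⟨w, hw, rfl⟩ := exists_cls_eq b
  rw [hj v hv, hj w hw, MemLp.toLp_eq_toLp_iff] at hab
  exact (cls_eq_iff hv hw).2 (InH.jet_ae_eq ho hv hw hab)

theorem hNorm_smul (c : ℝ) (hu : InH Ω u) : hNorm Ω (c • u) = |c| * hNorm Ω u := by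
  rw [← norm_cls (hu.smul c), cls_smul c hu, ← norm_cls hu]
  exact norm_smul c _

/-- The quotient is the sum of the displacement of `u_t - u` divided by `t`, of `(u_t - u)/t`, and
of the difference quotient of `u` along the flow. The first is `O(t)` in `L²` because `u_t - u` is
`O(t)` in `H¹`; the others tend weakly to `u'` and to `∇u · V`. -/
theorem IsField.tendsto_integral_material (hV : IsField Ω V K) (hb : Bornology.IsBounded Ω)
    (hu : InH Ω u) (hu' : InH Ω u')
    (hut : ∀ᶠ t in 𝓝[>] (0 : ℝ), InH Ω (ut t) ∧ hNorm Ω (ut t - u) ≤ M * t)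
    (hlim : ∀ v, InH Ω v → Tendsto (fun t => (aForm Ω (ut t) v - aForm Ω u v) / t) (𝓝[>] 0)
      (𝓝 (aForm Ω u' v))) {g : Eucl d → ℝ} (hg : MemLp g 2 (volume.restrict Ω)) :
    Tendsto (fun t => ∫ x in Ω, g x * (((ut t).1 (flow V t x) - u.1 x) / t)) (𝓝[>] 0)
      (𝓝 (∫ x in Ω, g x * (u'.1 x + inner ℝ (u.2 x) (V x)))) := by
  set Γ := (eLpNorm g 2 (volume.restrict Ω)).toReal
  have hΓ : 0 ≤ Γ := ENNReal.toReal_nonneg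
  have hgf := isBddFunctional_integral hg
  -- An `L²` test function acts on `H¹` through the form `a`, in which the convergence of `(u_t -
  -- u)/t` is given.
  obtain ⟨F, hF⟩ := hgf.exists_riesz
  obtain ⟨v, hv, rfl⟩ := exists_cls_eq F
  have hFv : ∀ w, InH Ω w → aForm Ω w v = ∫ x in Ω, g x * w.1 x := fun w hw => by
    rw [← hF w hw, inner_cls hv hw, aForm_comm]
  have hlim0 : Tendsto (fun t : ℝ => Γ * (K * (2 ^ d * (M * t)))) (𝓝[>] 0) (𝓝 0) := by
    have h : Continuous fun t : ℝ => Γ * (K * (2 ^ d * (M * t))) := by fun_prop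
    have := h.tendsto 0
    simp only [mul_zero] at this
    exact this.mono_left nhdsWithin_le_nhds
  have t1 : Tendsto (fun t : ℝ => t⁻¹ * ∫ x in Ω, g x * ((ut t - u).1 (shift (t • V) x)
      - (ut t - u).1 x)) (𝓝[>] 0) (𝓝 0) := by
    refine squeeze_zero_norm' ?_ hlim0
    filter_upwards [hut, hV.eventually_displacement] with t ⟨h1, h2⟩ ⟨ht, hW⟩
    have hw := h1.sub hu
    have a1 := abs_integral_mul_le hg ((hW.memLp_comp (memLp_fst hw.memLp)).sub (memLp_fst hw.memLp))
    have a2 := hW.toReal_comp_sub_le hw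
    push_cast at a2
    rw [Real.coe_toNNReal _ ht.le] at a2
    have a3 : t * K * (2 ^ d * hNorm Ω (ut t - u)) ≤ t * K * (2 ^ d * (M * t)) := by gcongr
    rw [Real.norm_eq_abs, abs_mul, abs_of_pos (inv_pos.2 ht), inv_mul_le_iff₀ ht]
    refine a1.trans ((mul_le_mul_of_nonneg_left (a2.trans a3) hΓ).trans_eq ?_)
    ring
  have t2 := (t1.add (hlim v hv)).add (hV.tendsto_integral_diffQuot hb hg hu)
  rw [zero_add, hFv u' hu', ← integral_add (integrable_mul_of_memLp hg (memLp_fst hu'.memLp))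
    (integrable_mul_of_memLp hg (hV.memLp_inner (memLp_snd hu.memLp)))] at t2
  simp only [← mul_add] at t2
  refine t2.congr' ?_
  filter_upwards [hut, hV.eventually_displacement] with t ⟨h1, h2⟩ ⟨ht, hW⟩
  have hw := memLp_fst (h1.sub hu).memLp
  have i1 : Integrable (fun x => g x * ((ut t - u).1 (shift (t • V) x) - (ut t - u).1 x))
    (volume.restrict Ω) := integrable_mul_of_memLp hg ((hW.memLp_comp hw).sub hw)
  have i2 := integrable_mul_of_memLp hg hw
  have i3 : Integrable (fun x => g x * ((u.1 (flow V t x) - u.1 x) / t)) (volume.restrict Ω) :=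
    integrable_mul_of_memLp hg
      (((hW.memLp_comp (memLp_fst hu.memLp)).sub (memLp_fst hu.memLp)).mul_const t⁻¹)
  have i4 : Integrable (fun x => t⁻¹ * (g x * ((ut t - u).1 (shift (t • V) x) - (ut t - u).1 x))
    + t⁻¹ * (g x * (ut t - u).1 x)) (volume.restrict Ω) := (i1.const_mul _).add (i2.const_mul _)
  rw [← aForm_sub_left h1.memLp hu.memLp hv.memLp, hFv _ (h1.sub hu), div_eq_inv_mul,
    ← integral_const_mul, ← integral_const_mul, ← integral_add (i1.const_mul _) (i2.const_mul _),
    ← integral_add i4 i3]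
  refine integral_congr_ae (Eventually.of_forall fun x => ?_)
  simp only [shift_smul, Prod.fst_sub, Pi.sub_apply]
  ring

/-- First order perturbations of a function which is stable under the flow have a weak material
derivative. -/
theorem IsField.exists_materialDerivative (hV : IsField Ω V K) (ho : IsOpen Ω)
    (hb : Bornology.IsBounded Ω) (hu : InH Ω u) (hu' : InH Ω u')
    (hut : ∀ᶠ t in 𝓝[>] (0 : ℝ), InH Ω (ut t) ∧ hNorm Ω (ut t - u) ≤ M * t)
    (hpull : ∀ᶠ t in 𝓝[>] (0 : ℝ), hNorm Ω (pull (t • V) u - u) ≤ M' * t)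
    (hlim : ∀ v, InH Ω v → Tendsto (fun t => (aForm Ω (ut t) v - aForm Ω u v) / t) (𝓝[>] 0)
      (𝓝 (aForm Ω u' v))) :
    ∃ udot, InH Ω udot ∧
      udot.1 =ᵐ[volume.restrict Ω] (fun x => u'.1 x + inner ℝ (u.2 x) (V x)) ∧
      ∃ z : ℝ → SobPair d, (∀ᶠ t in 𝓝[>] (0 : ℝ), InH Ω (z t) ∧
        ∀ x, (z t).1 x = ((ut t).1 (flow V t x) - u.1 x) / t) ∧
        ∀ v, InH Ω v → Tendsto (fun t => aForm Ω (z t) v) (𝓝[>] 0) (𝓝 (aForm Ω udot v)) := by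
  let z : ℝ → SobPair d := fun t => t⁻¹ • (pull (t • V) (ut t) - u)
  have hz1 : ∀ t x, (z t).1 x = ((ut t).1 (flow V t x) - u.1 x) / t := fun t x => by
    rw [div_eq_inv_mul]; rfl
  have hz : ∀ᶠ t in 𝓝[>] (0 : ℝ), InH Ω (z t) := by
    filter_upwards [hut, hV.eventually_displacement] with t h1 h2
    exact ((h2.2.inH_pull ho hb h1.1).sub hu).smul _
  -- The transport of `u_t - u` costs the factor `2 * 2 ^ d`; the transport of `u` itself is
  -- controlled by the first order estimate.
  have hzn : ∀ᶠ t in 𝓝[>] (0 : ℝ), ‖cls Ω (z t)‖ ≤ 2 * 2 ^ d * M + M' := by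
    filter_upwards [hut, hpull, hV.eventually_displacement] with t ⟨h1, h2⟩ h3 ⟨ht, hW⟩
    have a1 := hW.inH_pull ho hb (h1.sub hu)
    have a2 := (hW.inH_pull ho hb hu).sub hu
    have e : z t = t⁻¹ • (pull (t • V) (ut t - u) + (pull (t • V) u - u)) := by
      simp only [z]; rw [pull_sub, sub_add_sub_cancel]
    have b1 := hW.hNorm_pull_le (h1.sub hu).memLp
    have b2 : 2 * 2 ^ d * hNorm Ω (ut t - u) ≤ 2 * 2 ^ d * (M * t) := by gcongr
    have b3 := hNorm_add_le a1 a2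
    rw [e, norm_cls ((a1.add a2).smul _), hNorm_smul _ (a1.add a2), abs_of_pos (inv_pos.2 ht),
      inv_mul_le_iff₀ ht]
    linarith
  -- Boundedness in `H¹` and weak convergence in `L²` give weak convergence in `H¹`, since the
  -- embedding is injective. In particular the limit lies in `H¹`.
  obtain ⟨j, hj, hjc⟩ := exists_embedding ho
  have hζ : MemLp (fun x => u'.1 x + inner ℝ (u.2 x) (V x)) 2 (volume.restrict Ω) :=
    (memLp_fst hu'.memLp).add (hV.memLp_inner (memLp_snd hu.memLp))
  obtain ⟨z₀, h1, h2⟩ := exists_weak_limit_of_injective j hj hzn (ζ := hζ.toLp _) fun y => by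
    have hy : (Lp.memLp y).toLp y = y := Lp.toLp_coeFn y (Lp.memLp y)
    have hlimy := hV.tendsto_integral_material hb hu hu' hut hlim (Lp.memLp y)
    rw [← hy, inner_toLp]
    refine hlimy.congr' ?_
    filter_upwards [hz] with t ht
    rw [hjc _ ht, inner_toLp]
    exact integral_congr_ae (Eventually.of_forall fun x => by simp only [hz1]; rfl)
  obtain ⟨udot, hd, rfl⟩ := exists_cls_eq z₀
  rw [hjc _ hd, MemLp.toLp_eq_toLp_iff] at h1
  refine ⟨udot, hd, h1, z, hz.mono fun t ht => ⟨ht, hz1 t⟩, fun v hv => ?_⟩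
  rw [← inner_cls hd hv]
  refine (h2 (cls Ω v)).congr' ?_
  filter_upwards [hz] with t ht
  rw [inner_cls ht hv]

end Material

theorem SymPSD.homogeneous_unique {H : Type*} [NormedAddCommGroup H] [InnerProductSpace ℝ H]
    {B C : H →L[ℝ] H} (hB : SymPSD B) (hC : SymPSD C) {w u p u₂ p₂ : H} (a1 : u + C p + w = 0)
    (b1 : p = B u) (a2 : u₂ + C p₂ + w = 0) (b2 : p₂ = B u₂) : u₂ = u ∧ p₂ = p :=
  hB.system_unique (g := 0) hC (eq_neg_of_add_eq_zero_left a1) (by rw [sub_zero, b1])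
    (eq_neg_of_add_eq_zero_left a2) (by rw [sub_zero, b2])

theorem inner_add_add_left {H : Type*} [NormedAddCommGroup H] [InnerProductSpace ℝ H]
    (a b c x : H) : inner ℝ (a + b + c) x = inner ℝ a x + inner ℝ b x + inner ℝ c x := by
  rw [inner_add_left, inner_add_left]

/-! ### The transmission problem as an operator equation -/

section Transmission

variable {m : ℕ} {Ω ω : Set (Eucl (m + 1))} {C K : ℝ≥0} {α : ℝ} {f ud un : Eucl (m + 1) → ℝ}
  {V W : Eucl (m + 1) → Eucl (m + 1)} {B D : HSpace Ω →L[ℝ] HSpace Ω}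
  {S : Set (Eucl (m + 1)) → HSpace Ω →L[ℝ] HSpace Ω} {F g : HSpace Ω} {p y z : SobPair (m + 1)}

-- The integral over `∂ω` is the divergence form by `IsC2Domain.divForm_eq`, so the weak
-- transmission problem is exactly the equation of the weak derivative of the state.
set_option maxHeartbeats 1000000 in
theorem StateOperators.isTransmissionSolution_iff (h : StateOperators α f ud un Ω B S F g)
    (hD : TraceDomain Ω C) (hω : IsC2Domain ω) (hsub : ω ⊆ Ω) (hW : IsField Ω W K)
    (hWV : ∀ x ∈ closure Ω, W x = V x)
    (hDiv : ∀ u v, InH Ω u → InH Ω v →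
      inner ℝ (D (cls Ω u)) (cls Ω v) = 1 / α * divForm ω W u v) (hp : InH Ω p) :
    IsTransmissionSolution α Ω ω V p y z ↔ InH Ω y ∧ InH Ω z ∧
      cls Ω y + S ω (cls Ω z) + D (cls Ω p) = 0 ∧ cls Ω z = B (cls Ω y) := by
  have hT : ∀ v, InH Ω v → 1 / α * (∫ x, traceOn ω p x * traceOn ω v x
      * inner ℝ (V x) (outerNormal ω x) ∂(surf (frontier ω)))
      = inner ℝ (D (cls Ω p)) (cls Ω v) := fun v hv => by
    rw [hDiv p v hp hv, hω.divForm_eq (hD.isBounded.subset hsub) hW hsub hp hv, traceForm]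
    refine congrArg _ (setIntegral_congr_fun isClosed_frontier.measurableSet fun x hx => ?_)
    simp only [hWV x (closure_mono hsub (frontier_subset_closure hx))]
  constructor
  · rintro ⟨hy, hz, e1, e2⟩
    have hy := (isH1_iff hD).1 hy
    have hz := (isH1_iff hD).1 hz
    refine ⟨hy, hz, eq_of_inner_cls fun v hv => ?_, eq_of_inner_cls fun v hv => ?_⟩
    · have := e1 v ((isH1_iff hD).2 hv)
      rw [hT v hv, ← massForm_one, ← inner_cls hy hv, ← h.inner_S ω hsub z v hz hv] at this
      exact (inner_add_add_left _ _ _ _).trans (this.trans (inner_zero_left _).symm)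
    · have := e2 v ((isH1_iff hD).2 hv)
      rw [← traceForm_one, ← h.inner_B y v hy hv, ← inner_cls hz hv] at this
      exact sub_eq_zero.1 this
  · rintro ⟨hy, hz, e1, e2⟩
    refine ⟨(isH1_iff hD).2 hy, (isH1_iff hD).2 hz, fun v hv => ?_, fun v hv => ?_⟩
    · have hv := (isH1_iff hD).1 hv
      rw [hT v hv, ← massForm_one, ← inner_cls hy hv, ← h.inner_S ω hsub z v hz hv]
      exact (inner_add_add_left _ _ _ _).symm.trans
        ((congrArg (fun x => inner ℝ x (cls Ω v)) e1).trans (inner_zero_left _))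
    · have hv := (isH1_iff hD).1 hv
      rw [← traceForm_one, ← h.inner_B y v hy hv, ← inner_cls hz hv, e2, sub_self]

end Transmission

end

/-! ### Extension of the field by zero -/

section
variable {d : ℕ}

section Extension

variable {Ω : Set (Eucl d)} {V W : Eucl d → Eucl d} {K : ℝ≥0}

/-- Extension by zero of a Lipschitz field that vanishes on the boundary. -/
theorem exists_isField (ho : IsOpen Ω) (hb : Bornology.IsBounded Ω)
    (hV : LipschitzOnWith K V (closure Ω)) (hVΓ : ∀ x ∈ frontier Ω, V x = 0) :
    ∃ W K', IsField Ω W K' ∧ ∀ x ∈ closure Ω, W x = V x := by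
  obtain ⟨M, hM⟩ := hb.isCompact_closure.exists_bound_of_continuousOn hV.continuousOn
  have hW : ∀ x ∈ closure Ω, Ω.indicator V x = V x := fun x hx => by
    by_cases h : x ∈ Ω
    · exact indicator_of_mem h V
    · rw [indicator_of_notMem h, hVΓ x (by rw [ho.frontier_eq]; exact ⟨hx, h⟩)]
  -- The segment from a point inside to a point outside meets `∂Ω`, where the field vanishes; the
  -- Lipschitz bound up to that point is enough.
  have hmix : ∀ x ∈ Ω, ∀ y ∉ Ω, dist (V x) 0 ≤ K * dist x y := fun x hx y hy => by
    obtain ⟨z, hz, hzf⟩ : ∃ z ∈ segment ℝ x y, z ∈ frontier Ω := by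
      by_contra! hcon
      have hy' : y ∉ closure Ω := fun h =>
        hcon y (right_mem_segment ℝ x y) (by rw [ho.frontier_eq]; exact ⟨h, hy⟩)
      obtain ⟨z, -, h1, h2⟩ := (convex_segment x y).isPreconnected Ω (closure Ω)ᶜ ho
        isClosed_closure.isOpen_compl (fun z hz => by
          by_contra h
          simp only [mem_union, mem_compl_iff, not_or, not_not] at h
          exact hcon z hz (by rw [ho.frontier_eq]; exact ⟨h.2, h.1⟩))
        ⟨x, left_mem_segment ℝ x y, hx⟩ ⟨y, right_mem_segment ℝ x y, hy'⟩
      exact h2 (subset_closure h1)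
    have h1 := hV.dist_le_mul x (subset_closure hx) z (frontier_subset_closure hzf)
    have h2 := dist_add_dist_of_mem_segment hz
    rw [hVΓ z hzf] at h1
    refine h1.trans (mul_le_mul_of_nonneg_left ?_ K.coe_nonneg)
    linarith [dist_nonneg (x := z) (y := y)]
  have hlip : LipschitzWith K (Ω.indicator V) := LipschitzWith.of_dist_le_mul fun x y => by
    by_cases hx : x ∈ Ω <;> by_cases hy : y ∈ Ω
    · rw [indicator_of_mem hx, indicator_of_mem hy]
      exact hV.dist_le_mul x (subset_closure hx) y (subset_closure hy)
    · rw [indicator_of_mem hx, indicator_of_notMem hy]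
      exact hmix x hx y hy
    · rw [indicator_of_notMem hx, indicator_of_mem hy, dist_comm, dist_comm x]
      exact hmix y hy x hx
    · rw [indicator_of_notMem hx, indicator_of_notMem hy, dist_self]
      positivity
  refine ⟨Ω.indicator V, max K M.toNNReal, ⟨hlip.weaken (le_max_left _ _), fun x => ?_,
    fun x hx => indicator_of_notMem hx V⟩, hW⟩
  by_cases hx : x ∈ Ω
  · rw [indicator_of_mem hx]
    exact (hM x (subset_closure hx)).trans ((Real.le_coe_toNNReal M).trans
      (NNReal.coe_le_coe.2 (le_max_right _ _)))
  · rw [indicator_of_notMem hx, norm_zero]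
    positivity

theorem nonempty_compl_of_isBounded {m : ℕ} {Ω : Set (Eucl (m + 1))} (hb : Bornology.IsBounded Ω) :
    Ωᶜ.Nonempty := by
  have : NoncompactSpace (Eucl (m + 1)) := NormedSpace.noncompactSpace ℝ _
  rw [nonempty_compl]
  rintro rfl
  exact noncompact_univ _ (Metric.isCompact_of_isClosed_isBounded isClosed_univ hb)

theorem fderiv_eq_of_eqOn_closure (ho : IsOpen Ω) (h : ∀ x ∈ closure Ω, W x = V x) {x : Eucl d}
    (hx : x ∈ Ω) : fderiv ℝ W x = fderiv ℝ V x :=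
  Filter.EventuallyEq.fderiv_eq (by
    filter_upwards [ho.mem_nhds hx] with y hy using h y (subset_closure hy))

end Extension

/-! ### The surface form and the distributed form -/

section Forms

variable {m : ℕ} {Ω ω : Set (Eucl (m + 1))} {C K : ℝ≥0} {α : ℝ} {f ud un : Eucl (m + 1) → ℝ}
  {V W : Eucl (m + 1) → Eucl (m + 1)} {u p v w : SobPair (m + 1)}

theorem IsC2Domain.integral_divergence_eq (h : IsC2Domain ω) (hb : Bornology.IsBounded ω)
    (hW : IsField Ω W K) :
    ∫ x in ω, divergence W x = ∫ x, inner ℝ (W x) (outerNormal ω x) ∂(surf (frontier ω)) := by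
  obtain ⟨g, hg, he⟩ := exists_isCore_eqOn (φ := fun _ => (1 : ℝ)) contDiff_const hb
  refine Eq.trans ?_ ((h.integral_divergence hb hW hg).trans ?_)
  · refine setIntegral_congr_fun h.isOpen.measurableSet fun x hx => ?_
    rw [(he x (subset_closure hx)).1, (he x (subset_closure hx)).2, gradient_fun_const, inner_zero_left, zero_add, one_mul]
  · refine setIntegral_congr_fun isClosed_frontier.measurableSet fun x hx => ?_
    simp only [(he x (frontier_subset_closure hx)).1, one_mul]

/-- With `v = -p` the factor `p² + 2pv` is `-p²`, and the divergence theorem applies. -/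
theorem surface_form_eq (hω : IsC2Domain ω) (hb : Bornology.IsBounded ω) (hsub : ω ⊆ Ω)
    (hW : IsField Ω W K) (hWV : ∀ x ∈ closure Ω, W x = V x) (hp : InH Ω p) (hv : InH Ω v)
    (hvp : cls Ω v = cls Ω (-p)) :
    1 / (2 * α) * (∫ x, ((traceOn ω p x) ^ 2 + 2 * traceOn ω p x * traceOn ω v x)
      * inner ℝ (V x) (outerNormal ω x) ∂(surf (frontier ω)))
      = -(1 / (2 * α)) * divForm ω W p p := by
  obtain ⟨C, hD⟩ := hω.exists_traceDomain hb
  have hj := (cls_eq_iff hv hp.neg).1 hvp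
  have htr := traceOn_congr hD (hv.mono hsub) (hp.neg.mono hsub)
    (ae_restrict_of_ae_restrict_of_subset hsub hj)
  rw [hω.divForm_eq hb hW hsub hp hp, traceForm, neg_mul, ← mul_neg, ← integral_neg]
  refine congrArg _ (integral_congr_ae ?_)
  filter_upwards [htr, traceOn_neg hD (hp.mono hsub),
    ae_restrict_mem isClosed_frontier.measurableSet] with x h1 h2 hx
  rw [h1, h2, hWV x (closure_mono hsub (frontier_subset_closure hx))]
  simp only [Pi.neg_apply]
  ring

/-- For `v = -p`, `w = 0` the terms with `w` vanish and `A'`, `u v` combine to `-energyForm`. The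
identity for this form along solutions contains `∫ f ∇p · V`, which the weak gradient of `f`
converts into the remaining terms. -/
theorem IsState.volume_form_eq (hD : TraceDomain Ω C) (hω : IsOpen ω) (hsub : ω ⊆ Ω)
    (hf : MemLp f 2 (volume.restrict Ω)) (hs : IsState α f ud un Ω ω u p) (hW : IsField Ω W K)
    (hWV : ∀ x ∈ closure Ω, W x = V x) {Df : Eucl (m + 1) → Eucl (m + 1)}
    (hDf : MemLp Df 2 (volume.restrict Ω)) (hw : HasWeakGradient Ω f Df) (hv : InH Ω v)
    (hiw : InH Ω w) (hvp : cls Ω v = cls Ω (-p)) (hw0 : cls Ω w = 0) :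
    1 / (2 * α) * (∫ x in ω, divergence V x * (p.1 x) ^ 2)
      + (∫ x in Ω, aPrime V x (u.2 x) (v.2 x))
      + (∫ x in Ω, divergence V x * (u.1 x * v.1 x - v.1 x * f x))
      - (∫ x in Ω, v.1 x * inner ℝ (Df x) (V x))
      + 1 / α * (∫ x in ω, divergence V x * (p.1 x * v.1 x))
      + (∫ x in Ω, aPrime V x (p.2 x) (w.2 x))
      + (∫ x in Ω, divergence V x * (p.1 x * w.1 x)) = -(1 / (2 * α)) * divForm ω W p p := by
  have hu := (isH1_iff hD).1 hs.memU
  have hp := (isH1_iff hD).1 hs.memP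
  have hΩ := hD.isOpen.measurableSet
  have hpω := hp.mono hsub
  have hjv := (cls_eq_iff hv hp.neg).1 hvp
  have hjw : jet w =ᵐ[volume.restrict Ω] jet 0 := (cls_eq_iff hiw InH.zero).1 (by
    rw [hw0]
    exact (norm_eq_zero.1 (by rw [norm_cls InH.zero, hNorm_eq_zero (ae_eq_refl _)])).symm)
  have hdiv : ∀ x ∈ Ω, divergence V x = divergence W x := fun x hx => by
    rw [divergence, divergence, fderiv_eq_of_eqOn_closure hD.isOpen hWV hx]
  have i1 : ∀ {h : Eucl (m + 1) → ℝ}, MemLp h 2 (volume.restrict Ω) →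
      Integrable (fun x => divergence W x * (p.1 x * h x)) (volume.restrict Ω) := fun hh =>
    (integrable_mul_of_memLp (hW.memLp_mul_divergence hh) (memLp_fst hp.memLp)).congr
      (Eventually.of_forall fun x => by simp only; ring)
  have i2 := i1 (memLp_fst hu.memLp)
  have i3 := i1 hf
  have i4 : Integrable (fun x => aPrime W x (u.2 x) (p.2 x)) (volume.restrict Ω) :=
    ((integrable_energyIntegrand hW.lip hu hp).sub i2).congr (Eventually.of_forall fun x => by
      simp only [Pi.sub_apply]; ring)
  have i5 : Integrable (fun x => divergence W x * (p.1 x) ^ 2) (volume.restrict ω) :=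
    (integrable_mul_of_memLp (hW.memLp_mul_divergence (memLp_fst hpω.memLp))
      (memLp_fst hpω.memLp)).congr (Eventually.of_forall fun x => by simp only; ring)
  have i6 : Integrable (fun x => p.1 x * inner ℝ (p.2 x) (W x)) (volume.restrict ω) :=
    integrable_mul_of_memLp (memLp_fst hpω.memLp) (hW.memLp_inner (memLp_snd hpω.memLp))
  have e1 : ∫ x in ω, divergence V x * (p.1 x) ^ 2 = ∫ x in ω, divergence W x * (p.1 x) ^ 2 :=
    setIntegral_congr_fun hω.measurableSet fun x hx => by simp only [hdiv x (hsub hx)]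
  have e2 : ∫ x in Ω, aPrime V x (u.2 x) (v.2 x) = - ∫ x in Ω, aPrime W x (u.2 x) (p.2 x) := by
    rw [← integral_neg]
    refine integral_congr_ae ?_
    filter_upwards [hjv, ae_restrict_mem hΩ] with x hx hxΩ
    rw [aPrime, aPrime, (jet_eq_iff.1 hx).2, hdiv x hxΩ,
      fderiv_eq_of_eqOn_closure hD.isOpen hWV hxΩ]
    simp only [Prod.snd_neg, Pi.neg_apply, inner_neg_right, map_neg]
    ring
  have e3 : ∫ x in Ω, divergence V x * (u.1 x * v.1 x - v.1 x * f x)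
      = - (∫ x in Ω, divergence W x * (p.1 x * u.1 x)) + ∫ x in Ω, divergence W x * (p.1 x * f x) := by
    rw [← sub_eq_neg_add, ← integral_sub i3 i2]
    refine integral_congr_ae ?_
    filter_upwards [hjv, ae_restrict_mem hΩ] with x hx hxΩ
    rw [(jet_eq_iff.1 hx).1, hdiv x hxΩ]
    simp only [Prod.fst_neg, Pi.neg_apply]
    ring
  have e4 : ∫ x in Ω, v.1 x * inner ℝ (Df x) (V x) = - ∫ x in Ω, p.1 x * inner ℝ (Df x) (W x) := by
    rw [← integral_neg]
    refine integral_congr_ae ?_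
    filter_upwards [hjv, ae_restrict_mem hΩ] with x hx hxΩ
    rw [(jet_eq_iff.1 hx).1, hWV x (subset_closure hxΩ)]
    simp only [Prod.fst_neg, Pi.neg_apply]
    ring
  have e5 : ∫ x in ω, divergence V x * (p.1 x * v.1 x) = - ∫ x in ω, divergence W x * (p.1 x) ^ 2 := by
    rw [← integral_neg]
    refine integral_congr_ae ?_
    filter_upwards [ae_restrict_of_ae_restrict_of_subset hsub hjv,
      ae_restrict_mem hω.measurableSet] with x hx hxΩ
    rw [(jet_eq_iff.1 hx).1, hdiv x (hsub hxΩ)]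
    simp only [Prod.fst_neg, Pi.neg_apply]
    ring
  have e6 : ∫ x in Ω, aPrime V x (p.2 x) (w.2 x) = 0 := integral_eq_zero_of_ae (by
    filter_upwards [hjw] with x hx
    rw [aPrime, (jet_eq_iff.1 hx).2]
    simp)
  have e7 : ∫ x in Ω, divergence V x * (p.1 x * w.1 x) = 0 := integral_eq_zero_of_ae (by
    filter_upwards [hjw] with x hx
    rw [(jet_eq_iff.1 hx).1]
    simp)
  have e8 : energyForm Ω W u p = (∫ x in Ω, aPrime W x (u.2 x) (p.2 x))
      + ∫ x in Ω, divergence W x * (p.1 x * u.1 x) := by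
    rw [← integral_add i4 i2, energyForm]
    exact integral_congr_ae (Eventually.of_forall fun x => by simp only; ring)
  have e9 : divForm ω W p p = 2 * (∫ x in ω, p.1 x * inner ℝ (p.2 x) (W x))
      + ∫ x in ω, divergence W x * (p.1 x) ^ 2 := by
    rw [← integral_const_mul, ← integral_add (i6.const_mul 2) i5, divForm]
    refine integral_congr_ae (Eventually.of_forall fun x => ?_)
    simp only [inner_add_left, real_inner_smul_left]
    ring
  have e10 := hs.energyForm_eq hD hω.measurableSet hsub hf hW
  have e11 := hw.integral_inner hW hD.isOpen hD.isBounded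
    (nonempty_compl_of_isBounded hD.isBounded) hf hDf hp
  rw [e1, e2, e3, e4, e5, e6, e7, e9]
  -- Here `e10` is the transported pair of equations and `e11` the vanishing of `∫_Ω div (f p W)`.
  linear_combination e8 + e11 - e10

end Forms

end

end ShapeSource

end

/-! ### The theorem -/

theorem mainTheorem3 {d : ℕ} (hd : 1 ≤ d)
    (Ω ω : Set (Eucl d))
    (hΩ : IsLipschitzDomain Ω) (hω : IsC2Domain ω) (hsub : ω ⊆ Ω)
    (α lam β γ₀ : ℝ) (hα : 0 < α)
    (f ud un : Eucl d → ℝ)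
    (hf : MemLp f 2 (volume.restrict Ω))
    (hud : MemLp ud 2 (surf (frontier Ω)))
    (hun : MemLp un 2 (surf (frontier Ω)))
    (V : Eucl d → Eucl d) (K : ℝ≥0)
    (hV : LipschitzOnWith K V (closure Ω))
    (hVΓ : ∀ x ∈ frontier Ω, V x = 0)
    (U : Set (Eucl d)) (hU : IsOpen U) (hωU : frontier ω ⊆ U)
    (hVC : ContDiffOn ℝ 1 V U) :
    -- the state system has exactly one solution for every measurable source support
    (∀ A : Set (Eucl d), MeasurableSet A → A ⊆ Ω →
      (∃ u p, IsState α f ud un Ω A u p) ∧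
      ∀ u p u₂ p₂, IsState α f ud un Ω A u p →
        IsState α f ud un Ω A u₂ p₂ →
        u₂.1 =ᵐ[volume.restrict Ω] u.1 ∧ p₂.1 =ᵐ[volume.restrict Ω] p.1) ∧
    ∀ u p, IsState α f ud un Ω ω u p →
      -- the adjoint system has exactly one solution, `v = -p`, `w = 0`
      IsAdjoint α ud Ω ω u p (-p) 0 ∧
      (∀ v w, IsAdjoint α ud Ω ω u p v w →
        v.1 =ᵐ[volume.restrict Ω] (-p).1 ∧ w.1 =ᵐ[volume.restrict Ω] 0) ∧
      -- the surface form of the Eulerian derivative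
      (∀ v w, IsAdjoint α ud Ω ω u p v w →
        HasTrace ω p (traceOn ω p) ∧
        HasTrace ω v (traceOn ω v) ∧
        HasEulerianDerivative
          (shapeFunctional α lam β γ₀ f ud un) Ω ω V
          (1 / (2 * α) *
              (∫ x, ((traceOn ω p x) ^ 2
                  + 2 * traceOn ω p x * traceOn ω v x)
                * inner ℝ (V x) (outerNormal ω x)
                ∂(surf (frontier ω)))
            + lam * tangentialDivIntegral ω V
            + β * ∫ x, inner ℝ (V x) (outerNormal ω x)
                ∂(surf (frontier ω)))) ∧
      -- the volume form of the Eulerian derivative, for `f ∈ H¹(Ω)`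
      (∀ Df : Eucl d → Eucl d,
        MemLp Df 2 (volume.restrict Ω) → HasWeakGradient Ω f Df →
        ∀ v w, IsAdjoint α ud Ω ω u p v w →
        HasEulerianDerivative
          (shapeFunctional α lam β γ₀ f ud un) Ω ω V
          (1 / (2 * α) * (∫ x in ω, divergence V x * (p.1 x) ^ 2)
            + (∫ x in Ω, aPrime V x (u.2 x) (v.2 x))
            + (∫ x in Ω, divergence V x * (u.1 x * v.1 x - v.1 x * f x))
            - (∫ x in Ω, v.1 x * inner ℝ (Df x) (V x))
            + 1 / α * (∫ x in ω, divergence V x * (p.1 x * v.1 x))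
            + (∫ x in Ω, aPrime V x (p.2 x) (w.2 x))
            + (∫ x in Ω, divergence V x * (p.1 x * w.1 x))
            + lam * tangentialDivIntegral ω V
            + β * ∫ x in ω, divergence V x)) ∧
      -- the shape derivatives exist in `H¹(Ω)` and solve the transmission problem
      (∀ ut pt : ℝ → SobPair d,
        (∀ᶠ t in 𝓝[>] (0 : ℝ), IsState α f ud un
          (flow V t '' Ω) (flow V t '' ω) (ut t) (pt t)) →
        ∃ udot pdot u' p' : SobPair d,
          IsWeakMaterialDerivative Ω V ut u udot ∧
          IsWeakMaterialDerivative Ω V pt p pdot ∧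
          (∀ᵐ x ∂(volume.restrict Ω), u'.1 x = udot.1 x - inner ℝ (u.2 x) (V x)) ∧
          (∀ᵐ x ∂(volume.restrict Ω), p'.1 x = pdot.1 x - inner ℝ (p.2 x) (V x)) ∧
          IsTransmissionSolution α Ω ω V p u' p' ∧
          ∀ y z, IsTransmissionSolution α Ω ω V p y z →
            y.1 =ᵐ[volume.restrict Ω] u'.1 ∧ z.1 =ᵐ[volume.restrict Ω] p'.1) := by
  -- With `d = m + 1` the surface measure is the `m`-dimensional one and hyperplanes are
  -- parametrised by `Eucl m`.
  obtain ⟨m, rfl⟩ : ∃ m, d = m + 1 := ⟨d - 1, by omega⟩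
  obtain ⟨C, hD⟩ := hΩ.exists_traceDomain
  obtain ⟨B, S, F, g, h⟩ := hD.exists_stateOperators hα hf hud hun
  obtain ⟨W, K', hW, hWV⟩ := exists_isField hΩ.isOpen hΩ.isBounded hV hVΓ
  have hωm := hω.isOpen.measurableSet
  have hωb := hΩ.isBounded.subset hsub
  obtain ⟨C', hD'⟩ := hω.exists_traceDomain hωb
  refine ⟨fun A _ hA => ⟨h.exists_isState hD hud hA, fun u p u₂ p₂ h1 h2 => ?_⟩, fun u p hs => ?_⟩
  · obtain ⟨e1, e2⟩ := h.cls_unique hD hud hA h1 h2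
    exact ⟨fst_ae_eq_of_cls_eq ((isH1_iff hD).1 h2.memU) ((isH1_iff hD).1 h1.memU) e1,
      fst_ae_eq_of_cls_eq ((isH1_iff hD).1 h2.memP) ((isH1_iff hD).1 h1.memP) e2⟩
  have hu := (isH1_iff hD).1 hs.memU
  have hp := (isH1_iff hD).1 hs.memP
  have hE := h.hasEulerianDerivative hD hud hα hω hsub hW hWV hU hωU hVC hs lam β γ₀
  refine ⟨hs.isAdjoint hD, fun v w ha => ?_, fun v w ha => ?_, fun Df hDf hwf v w ha => ?_,
    fun ut pt ht => ?_⟩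
  · obtain ⟨e1, e2⟩ := h.isAdjoint_cls hD hud hsub hs ha
    have e3 : cls Ω w = cls Ω 0 := e2.trans
      (norm_eq_zero.1 (by rw [norm_cls InH.zero, hNorm_eq_zero (ae_eq_refl _)])).symm
    exact ⟨fst_ae_eq_of_cls_eq ((isH1_iff hD).1 ha.memV) hp.neg e1,
      fst_ae_eq_of_cls_eq ((isH1_iff hD).1 ha.memW) InH.zero e3⟩
  · have hv := (isH1_iff hD).1 ha.memV
    refine ⟨(hp.mono hsub).hasTrace_traceOn hD', (hv.mono hsub).hasTrace_traceOn hD', ?_⟩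
    rw [surface_form_eq hω hωb hsub hW hWV hp hv (h.isAdjoint_cls hD hud hsub hs ha).1]
    have e : ∫ x, inner ℝ (W x) (outerNormal ω x) ∂(surf (frontier ω))
        = ∫ x, inner ℝ (V x) (outerNormal ω x) ∂(surf (frontier ω)) :=
      setIntegral_congr_fun isClosed_frontier.measurableSet fun x hx => by
        simp only [hWV x (closure_mono hsub (frontier_subset_closure hx))]
    rwa [hω.integral_divergence_eq hωb hW, e] at hE
  · obtain ⟨e1, e2⟩ := h.isAdjoint_cls hD hud hsub hs ha
    rw [hs.volume_form_eq hD hω.isOpen hsub hf hW hWV hDf hwf ((isH1_iff hD).1 ha.memV)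
      ((isH1_iff hD).1 ha.memW) e1 e2]
    rw [setIntegral_congr_fun hωm fun x hx => show divergence W x = divergence V x by
      rw [divergence, divergence, fderiv_eq_of_eqOn_closure hΩ.isOpen hWV (hsub hx)]] at hE
    exact hE
  · have himg : ∀ t A, A ⊆ Ω → flow V t '' A = flow W t '' A := fun t A hA =>
      image_congr fun x hx => by rw [flow, flow, hWV x (subset_closure (hA hx))]
    have ht' : ∀ᶠ t in 𝓝[>] (0 : ℝ), IsState α f ud un Ω (flow W t '' ω) (ut t) (pt t) := by
      filter_upwards [ht, hW.eventually_displacement] with t h1 h2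
      have h3 : flow W t '' Ω = Ω := by rw [← shift_smul]; exact h2.2.image_shift
      rwa [himg t Ω subset_rfl, himg t ω hsub, h3] at h1
    obtain ⟨D, hDiv⟩ := hW.exists_divOp (ω := ω) hα hsub
    obtain ⟨u', p', hd, hlu, hlp, -, M, hM, hMt⟩ :=
      h.exists_stateDerivative hD hud hα hW hωm hsub hs hDiv ht'
    obtain ⟨M₁, -, hM₁⟩ := (hs.solvesInside_fst hD hωm hsub hf).exists_hNorm_pull_sub_le hD
      (hf.sub ((memLp_indicator_fst hωm hp).const_mul _)) hu hW
    obtain ⟨M₂, -, hM₂⟩ := (hs.solvesInside_snd hD).exists_hNorm_pull_sub_le hD MemLp.zero' hp hW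
    -- The same argument serves `u` and `p`: the weak derivative `q'` on the fixed domain is the
    -- shape derivative, and the material derivative exceeds it by `∇q · V`.
    have key : ∀ {q q' : SobPair (m + 1)} {qt : ℝ → SobPair (m + 1)} {M' : ℝ}, InH Ω q → InH Ω q' →
        (∀ᶠ t in 𝓝[>] (0 : ℝ), InH Ω (qt t) ∧ hNorm Ω (qt t - q) ≤ M * t) →
        (∀ᶠ t in 𝓝[>] (0 : ℝ), hNorm Ω (pull (t • W) q - q) ≤ M' * t) →
        (∀ v, InH Ω v → Tendsto (fun t => (aForm Ω (qt t) v - aForm Ω q v) / t) (𝓝[>] 0)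
          (𝓝 (aForm Ω q' v))) →
        ∃ qdot, IsWeakMaterialDerivative Ω V qt q qdot ∧
          ∀ᵐ x ∂(volume.restrict Ω), q'.1 x = qdot.1 x - inner ℝ (q.2 x) (V x) := by
      intro q q' qt M' hq hq' h1 h2 h3
      obtain ⟨qdot, a1, a2, z, a3, a4⟩ :=
        hW.exists_materialDerivative hΩ.isOpen hΩ.isBounded hq hq' h1 h2 h3
      refine ⟨qdot, ⟨(isH1_iff hD).2 a1, z, a3.mono fun t hz => ⟨(isH1_iff hD).2 hz.1, ?_⟩,
        fun v hv => a4 v ((isH1_iff hD).1 hv)⟩, ?_⟩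
      · filter_upwards [ae_restrict_mem hΩ.isOpen.measurableSet] with x hx
        rw [hz.2 x, flow, flow, hWV x (subset_closure hx)]
      · filter_upwards [a2, ae_restrict_mem hΩ.isOpen.measurableSet] with x hx hxΩ
        rw [hx, hWV x (subset_closure hxΩ), add_sub_cancel_right]
    obtain ⟨udot, hu1, hu2⟩ := key hu hd.inH_u (by
      filter_upwards [ht', hMt] with t h1 h2 using ⟨(isH1_iff hD).1 h1.memU, h2.1⟩) hM₁ hlu
    obtain ⟨pdot, hp1, hp2⟩ := key hp hd.inH_p (by
      filter_upwards [ht', hMt] with t h1 h2 using ⟨(isH1_iff hD).1 h1.memP, h2.2⟩) hM₂ hlp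
    have hT := fun y z => h.isTransmissionSolution_iff (y := y) (z := z) hD hω hsub hW hWV hDiv hp
    refine ⟨udot, pdot, u', p', hu1, hp1, hu2, hp2,
      (hT u' p').2 ⟨hd.inH_u, hd.inH_p, hd.eq_u, hd.eq_p⟩, fun y z hyz => ?_⟩
    obtain ⟨hy, hz, e1, e2⟩ := (hT y z).1 hyz
    obtain ⟨e3, e4⟩ := h.symPSD_B.homogeneous_unique (h.symPSD_S ω hsub) hd.eq_u hd.eq_p e1 e2
    exact ⟨fst_ae_eq_of_cls_eq hy hd.inH_u e3, fst_ae_eq_of_cls_eq hz hd.inH_p e4⟩
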